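/- \textbf{Conventions.} Time is the number of bit operations of a deterministic program (a random access machine with logarithmic cost); a program is fixed once and for all, and $C$ denotes an absolute constant. A finite field $\mathbb F_q$, $q=p^a$, and its extension $\mathbb F_{q^m}$ are given to the programs by arbitrary bases over $\mathbb F_p$ and over $\mathbb F_q$, together with the multiplication tables of these bases; elements are written in coordinates. Integer parameters, evaluation points and bases of subspaces are part of the input; a real $\varepsilon$ enters only through the integer $\lfloor\varepsilon m\rfloor$ (in (a)) or $\lceil 1/\varepsilon\rceil$ (in 2), and $R$ only through $\lceil Rmn\rceil$. For distinct $\alpha_1,\dots,\alpha_n\in\mathbb F_q$ the Reed--Solomon code $\mathrm{RS}^{(q,m)}[n,k]$ is the set of words $(f(\alpha_1),\dots,f(\alpha_n))$ with $f=\sum_{j<k}f_jX^j\in\mathbb F_{q^m}[X]$. Subspaces $H_1,\dots,H_k$ of $\mathbb F_q^m$ form an $(r,d)$-subspace design if $\sum_j\dim(W\cap H_j)\le d$ for every $r$-dimensional subspace $W\subseteq\mathbb F_q^m$. Put $V=H_1\times\cdots\times H_k$, and let $\widehat{\mathrm{RS}}$ be the $\mathbb F_q$-linear subcode of $\mathrm{RS}^{(q,m)}[n,k]$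 of the encodings of those $f$ whose coefficients, written as vectors in $\mathbb F_q^m$, satisfy $(f_0,\dots,f_{k-1})\in V$. \textbf{Theorem.} 1. Let $0<\varepsilon<1$, $1\le k<n\le q$ and $1\le s\le\varepsilon m/12$. (a) There is an $(s-1,\,2(s-1)/\varepsilon)$-subspace design $H_1,\dots,H_k$ in $\mathbb F_q^m$ with $\dim H_j\ge(1-\varepsilon)m$ for all $j$, so that $\dim_{\mathbb F_q}\widehat{\mathrm{RS}}\ge(1-\varepsilon)mk$, for which a basis of $V$ can be computed in time $q^{O(m^2)}$, and in time $q^{O(1)}$ if $m<q$. (b) For every $(s-1,\,2(s-1)/\varepsilon)$-subspace design $H_1,\dots,H_k$ in $\mathbb F_q^m$, given a basis of $V$ and a word $y\in\mathbb F_{q^m}^n$, one can compute in time $(n+m+\log q)^{O(1)}$ a point and a basis of the direction of an affine $\mathbb F_q$-subspace of $\mathbb F_{q^m}^n$ of dimension at most $2(s-1)/\varepsilon=O(s/\varepsilon)$ that contains every codeword of $\widehat{\mathrm{RS}}$ within Hamming distance $\frac{s}{s+1}(n-k)$ from $y$. 2. For all $R,\varepsilon\in(0,1)$ there are integers $1\le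 m\le C/((1-R)\varepsilon^2)$ and $n_0$ such that for every prime power $q$, every $n$ with $n_0\le n<q$ and all distinct $\alpha_1,\dots,\alpha_n\in\mathbb F_q$ there are $1\le k<n$ and an $\mathbb F_q$-linear subcode of $\mathrm{RS}^{(q,m)}[n,k]$ of $\mathbb F_q$-dimension exactly $\lceil Rmn\rceil$ (that is, of rate $R$ up to rounding), described by $k$ and a basis of its space of message polynomials, such that this description can be computed in time $q^{O(1)}$ and, given the description, (i) the code can be encoded in time $(n\log q/\varepsilon)^{O(1)}$, and (ii) given $y\in\mathbb F_{q^m}^n$, a point and a basis of the direction of an affine $\mathbb F_q$-subspace of dimension at most $C/((1-R)\varepsilon^2)$ (so $O(1/\varepsilon^2)$ for fixed $R$) that contains every codeword within Hamming distance $(1-\varepsilon)(1-R)n$ from $y$ can be computed in time $(n\log q/\varepsilon)^{O(1)}$. All exponents are absolute. -/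

import Mathlib

open Module

/-! ### The machine model

Deterministic programs over finitely many unbounded arrays of natural numbers, with logarithmic
(bit) cost: every access is charged the lengths of the binary numbers involved, every arithmetic
operation the square of the total length of its operands. -/

namespace BitRAM

/-- The memory: the content of cell `i` of array `a` is `σ a i`. -/
abbrev Store := ℕ → ℕ → ℕ

/-- Arithmetic operations (truncated subtraction, integer division and remainder). -/
inductive Op
  | add | sub | mul | div | mod

def Op.eval : Op → ℕ → ℕ → ℕ
  | .add, x, y => x + y
  | .sub, x, y => x - y
  | .mul, x, y => x * y
  | .div, x, y => x / y
  | .mod, x, y => x % y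

/-- Expressions; `read a i` is the content of the cell of array `a` whose index is the value of the
expression `i`. The array name `a` is fixed in the program text. -/
inductive Expr
  | const (c : ℕ)
  | read (a : ℕ) (i : Expr)
  | bin (o : Op) (e₁ e₂ : Expr)

def Expr.eval (σ : Store) : Expr → ℕ
  | .const c => c
  | .read a i => σ a (i.eval σ)
  | .bin o e₁ e₂ => o.eval (e₁.eval σ) (e₂.eval σ)

/-- The number of bit operations charged for evaluating an expression. -/
def Expr.cost (σ : Store) : Expr → ℕ
  | .const c => 1 + c.size
  | .read a i => i.cost σ + (1 + (i.eval σ).size + (σ a (i.eval σ)).size)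
  | .bin _ e₁ e₂ => e₁.cost σ + e₂.cost σ + (1 + (e₁.eval σ).size + (e₂.eval σ).size) ^ 2

/-- Programs. A condition holds if its value is nonzero. -/
inductive Prog
  | skip
  | write (a : ℕ) (i e : Expr)
  | seq (c₁ c₂ : Prog)
  | ite (e : Expr) (c₁ c₂ : Prog)
  | while (e : Expr) (c : Prog)

/-- `Exec c σ τ t`: started in memory `σ`, the program `c` halts in memory `τ` at total cost `t`. -/
inductive Exec : Prog → Store → Store → ℕ → Prop
  | skip (σ : Store) : Exec .skip σ σ 1
  | write (a : ℕ) (i e : Expr) (σ : Store) :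
      Exec (.write a i e) σ (Function.update σ a (Function.update (σ a) (i.eval σ) (e.eval σ)))
        (i.cost σ + e.cost σ + (1 + (i.eval σ).size + (e.eval σ).size))
  | seq {c₁ c₂ : Prog} {σ τ ρ : Store} {t₁ t₂ : ℕ} :
      Exec c₁ σ τ t₁ → Exec c₂ τ ρ t₂ → Exec (.seq c₁ c₂) σ ρ (t₁ + t₂)
  | ite_true {e : Expr} {c₁ c₂ : Prog} {σ τ : Store} {t : ℕ} :
      e.eval σ ≠ 0 → Exec c₁ σ τ t → Exec (.ite e c₁ c₂) σ τ (e.cost σ + t)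
  | ite_false {e : Expr} {c₁ c₂ : Prog} {σ τ : Store} {t : ℕ} :
      e.eval σ = 0 → Exec c₂ σ τ t → Exec (.ite e c₁ c₂) σ τ (e.cost σ + t)
  | while_true {e : Expr} {c : Prog} {σ τ ρ : Store} {t₁ t₂ : ℕ} :
      e.eval σ ≠ 0 → Exec c σ τ t₁ → Exec (.while e c) τ ρ t₂ →
        Exec (.while e c) σ ρ (e.cost σ + t₁ + t₂)
  | while_false {e : Expr} {c : Prog} {σ : Store} :
      e.eval σ = 0 → Exec (.while e c) σ σ (e.cost σ)

/-- Execution is deterministic, in its result and in its cost. -/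
theorem Exec.det {c : Prog} {σ τ τ' : Store} {t t' : ℕ} (h : Exec c σ τ t)
    (h' : Exec c σ τ' t') : τ = τ' ∧ t = t' := by
  induction h generalizing τ' t' with
  | skip => cases h'; simp
  | write => cases h'; simp
  | seq _ _ ih₁ ih₂ =>
    cases h' with
    | seq k₁ k₂ =>
      obtain ⟨rfl, rfl⟩ := ih₁ k₁
      obtain ⟨rfl, rfl⟩ := ih₂ k₂
      simp
  | ite_true he _ ih =>
    cases h' with
    | ite_true _ k => obtain ⟨rfl, rfl⟩ := ih k; simp
    | ite_false k => exact absurd k he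
  | ite_false he _ ih =>
    cases h' with
    | ite_true k => exact absurd he k
    | ite_false _ k => obtain ⟨rfl, rfl⟩ := ih k; simp
  | while_true he _ _ ih₁ ih₂ =>
    cases h' with
    | while_true _ k₁ k₂ =>
      obtain ⟨rfl, rfl⟩ := ih₁ k₁
      obtain ⟨rfl, rfl⟩ := ih₂ k₂
      simp
    | while_false k => exact absurd k he
  | while_false he =>
    cases h' with
    | while_true k => exact absurd he k
    | while_false => simp

/-- The content of an array that holds the list `l`, preceded by its length. -/
def listArray (l : List ℕ) (i : ℕ) : ℕ := (l.length :: l).getD i 0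

/-- The initial memory: the input is in array `0`, all other cells are `0`. -/
def load (input : List ℕ) : Store := fun a => if a = 0 then listArray input else fun _ => 0

/-- On the given input the program halts after at most `T` bit operations with the given output in
array `1`. -/
def RunsIn (c : Prog) (input output : List ℕ) (T : ℕ) : Prop :=
  ∃ (τ : Store) (t : ℕ), Exec c (load input) τ t ∧ t ≤ T ∧
    ∀ i ≤ output.length, τ 1 i = listArray output i

end BitRAM

/-! ### Explicit data for finite fields

`F` is a field with `q = p ^ a` elements given by a basis `bF` over `ZMod p`, and `K` is an extension
of `F` of degree `m` given by a basis `bK` over `F`. Elements are written down through their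
coordinates and the fields through the products of the basis elements. -/

section Encodings

variable {p a m : ℕ} {F K : Type*} [Field F] [Field K] [Algebra (ZMod p) F] [Algebra F K]

/-- Concatenation of the lists `g 0, …, g (n - 1)`. -/
def concatFin {n : ℕ} (g : Fin n → List ℕ) : List ℕ := (List.ofFn g).flatten

/-- The `a` coordinates of `x : F`, as numbers below `p`. -/
noncomputable def encF (bF : Basis (Fin a) (ZMod p) F) (x : F) : List ℕ :=
  List.ofFn fun i => (bF.repr x i).val

/-- A vector over `F`. -/
noncomputable def encFVec (bF : Basis (Fin a) (ZMod p) F) {n : ℕ} (x : Fin n → F) : List ℕ :=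
  concatFin fun i => encF bF (x i)

/-- An element of `K`, through its coordinate vector over `F`. -/
noncomputable def encK (bF : Basis (Fin a) (ZMod p) F) (bK : Basis (Fin m) F K) (y : K) : List ℕ :=
  encFVec bF fun j => bK.repr y j

/-- A vector over `K`. -/
noncomputable def encKVec (bF : Basis (Fin a) (ZMod p) F) (bK : Basis (Fin m) F K) {n : ℕ}
    (y : Fin n → K) : List ℕ :=
  concatFin fun i => encK bF bK (y i)

/-- A tuple of vectors over `K`. -/
noncomputable def encKMat (bF : Basis (Fin a) (ZMod p) F) (bK : Basis (Fin m) F K) {t n : ℕ}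
    (v : Fin t → Fin n → K) : List ℕ :=
  concatFin fun l => encKVec bF bK (v l)

/-- The multiplication table of the basis of `F`. -/
noncomputable def tableF (bF : Basis (Fin a) (ZMod p) F) : List ℕ :=
  concatFin fun i => concatFin fun j => encF bF (bF i * bF j)

/-- The multiplication table of the basis of `K` over `F`. -/
noncomputable def tableK (bF : Basis (Fin a) (ZMod p) F) (bK : Basis (Fin m) F K) : List ℕ :=
  concatFin fun i => concatFin fun j => encK bF bK (bK i * bK j)

end Encodings

/-! ### Reed–Solomon codes with evaluation points in a subfield, and their subcodes -/

section Codes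

variable {F K : Type*} [Field F] [Field K] [Algebra F K]

/-- The Reed–Solomon encoding of the polynomial `f₀ + f₁ X + ⋯ + f_{k-1} X ^ (k-1)` over `K` at the
points `α₁, …, αₙ` of `F`. -/
noncomputable def rsEncode {n : ℕ} (α : Fin n → F) (k : ℕ) :
    (Fin k → K) →ₗ[F] (Fin n → K) where
  toFun f i := (∑ j : Fin k, Polynomial.monomial (j : ℕ) (f j)).eval (algebraMap F K (α i))
  map_add' f g := by
    funext i
    simp [Finset.sum_add_distrib]
  map_smul' c f := by
    funext i
    simp [Polynomial.eval_finsetSum, Finset.smul_sum]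

/-- The subcode of the encodings of the polynomials with coefficient vector in `V`, an `F`-linear
code of length `n` over the alphabet `K`. -/
noncomputable def rsSubcode {n k : ℕ} (α : Fin n → F) (V : Submodule F (Fin k → K)) :
    Submodule F (Fin n → K) :=
  V.map (rsEncode α k)

/-- The words of `rsSubcode α ⊤` are the evaluations of the polynomials of degree less than `k`. -/
theorem mem_rsSubcode_top {n k : ℕ} (α : Fin n → F) (c : Fin n → K) :
    c ∈ rsSubcode α (⊤ : Submodule F (Fin k → K)) ↔
      ∃ P : Polynomial K, P.degree < (k : WithBot ℕ) ∧
        ∀ i, c i = P.eval (algebraMap F K (α i)) := by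
  constructor
  · rintro ⟨f, -, rfl⟩
    refine ⟨∑ j : Fin k, Polynomial.monomial (j : ℕ) (f j), ?_, fun i => rfl⟩
    rw [← Polynomial.mem_degreeLT]
    refine Submodule.sum_mem _ fun j _ => ?_
    rw [Polynomial.mem_degreeLT]
    exact (Polynomial.degree_monomial_le _ _).trans_lt (by exact_mod_cast j.2)
  · rintro ⟨P, hP, hc⟩
    refine ⟨fun j => P.coeff j, trivial, ?_⟩
    funext i
    have h : ∑ j : Fin k, Polynomial.monomial (j : ℕ) (P.coeff j) = P := by
      rw [Fin.sum_univ_eq_sum_range (fun j => Polynomial.monomial j (P.coeff j)) k]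
      ext i
      simp only [Polynomial.finsetSum_coeff, Polynomial.coeff_monomial, Finset.sum_ite_eq',
        Finset.mem_range]
      split_ifs with hi
      · rfl
      · exact (Polynomial.coeff_eq_zero_of_degree_lt
          (hP.trans_le (by exact_mod_cast not_lt.1 hi))).symm
    show Polynomial.eval _ (∑ j : Fin k, Polynomial.monomial (j : ℕ) (P.coeff j)) = c i
    rw [h, hc]

/-- The subspaces `H₁, …, H_b` of `F ^ L` form an `(r, d)`-subspace design. -/
def IsSubspaceDesign {b L : ℕ} (r : ℕ) (d : ℝ) (H : Fin b → Submodule F (Fin L → F)) : Prop :=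
  ∀ W : Submodule F (Fin L → F), finrank F W = r →
    ((∑ j, finrank F (W ⊓ H j : Submodule F (Fin L → F)) : ℕ) : ℝ) ≤ d

/-- The space `V = H₁ × ⋯ × H_k` of coefficient vectors `(f₀, …, f_{k-1})` over `K` such that the
coordinate vector of each `f_j` with respect to the basis `bK` lies in the corresponding `H j`. -/
noncomputable def designSpace {m k : ℕ} (bK : Basis (Fin m) F K)
    (H : Fin k → Submodule F (Fin m → F)) : Submodule F (Fin k → K) :=
  ⨅ j, (H j).comap (bK.equivFun.toLinearMap ∘ₗ LinearMap.proj j)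

theorem mem_designSpace {m k : ℕ} (bK : Basis (Fin m) F K)
    (H : Fin k → Submodule F (Fin m → F)) (f : Fin k → K) :
    f ∈ designSpace bK H ↔ ∀ j, bK.equivFun (f j) ∈ H j := by
  simp [designSpace]

/-- On the given input the program outputs, within `T` bit operations, a point `c₀` and an `F`-basis
`u₁, …, u_d` (preceded by its length `d ≤ D`) of the direction of an affine `F`-subspace of `K ^ n`
that contains every word of `C` within Hamming distance `e` from `y`. -/
def ListDecodesIn [DecidableEq K] {p a m n : ℕ} [Algebra (ZMod p) F]
    (bF : Basis (Fin a) (ZMod p) F) (bK : Basis (Fin m) F K) (dec : BitRAM.Prog)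
    (input : List ℕ) (C : Submodule F (Fin n → K)) (y : Fin n → K) (e D : ℝ) (T : ℕ) : Prop :=
  ∃ (d : ℕ) (c₀ : Fin n → K) (u : Fin d → Fin n → K),
    (d : ℝ) ≤ D ∧ LinearIndependent F u ∧
    BitRAM.RunsIn dec input (d :: (encKVec bF bK c₀ ++ encKMat bF bK u)) T ∧
    ∀ c ∈ C, (hammingDist y c : ℝ) ≤ e →
      c ∈ AffineSubspace.mk' c₀ (Submodule.span F (Set.range u))

end Codes

/-! Decoding. Let q be the order of F and D = ⌊(n - k + 1)/(s + 1)⌋. Polynomials `A₀` of degree < D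
+ k and `A j` (j < s) of degree ≤ D have together D + k + s(D + 1) > n coefficients in K, so some
nonzero choice satisfies A₀(αᵢ) + Σⱼ Aⱼ(αᵢ) yᵢ^(q^j) = 0 for every i. The points αᵢ lie in F, hence
raising f(αᵢ) to the power q^j amounts to raising the coefficients of f, giving a polynomial
f^(σ^j). If f agrees with y in D + k places, then A₀ + Σⱼ Aⱼ f^(σ^j) has degree < D + k and D + k
zeros, so it vanishes identically (`relation_of_agree`). This is an F-affine system for the
coefficients of f.

For the homogeneous system, let w₀ be the lowest exponent at which some Aⱼ has a nonzero
coefficient. If the coefficients of a solution below fᵢ vanish, the coefficient of X^(w₀+i) says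
that fᵢ is a zero of the linearized polynomial Σⱼ A_{j,w₀} z^(q^j). Its kernel W has dimension at
most s - 1 and does not depend on i. Filtering the solutions by the position of the first nonzero
coefficient bounds their dimension by Σ dim(W ∩ Hᵢ), which is what a subspace design controls
(`finrank_le_of_relation`, `decode_correct`).

Designs. Put t = ⌊εm⌋. Both constructions give spaces of codimension at most t with (t + 1) Σ dim(W
∩ Hⱼ) ≤ 2(s - 1)m, and t + 1 > εm.

For m < q, the space Hⱼ consists of the polynomials of degree < m divisible by a product of u
irreducible quadratics X² + bX + b²c, where b runs through a block of consecutive powers of an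
element γ whose first m powers are distinct. Each c for which Y² + Y + c has no root serves two
blocks, which is enough for q - 1 spaces. Scaling X by powers of γ permutes these quadratics.
Therefore the folded Wronskian det(fᵢ(γ^(-j) X)) of a basis of an r-dimensional W is divisible by
the dim(W ∩ Hⱼ)-th powers of u - r + 1 of them, for every j. It is nonzero, by a Vandermonde
determinant of leading coefficients, and has degree at most r(m - 1) (`det_foldMat_ne_zero`,
`sum_finrank_le_of_dvd`).

For m ≥ q, time q^(O(m²)) permits exhaustive search. The spaces are graphs of linear maps F^(m-t) →
F^t. Averaged over all maps, |W ∩ H|^e is at most 2 as soon as e + dim W + 1 ≤ t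
(`sum_card_graphSpace_le`). So the maps can be chosen one after another such that Σ_W Πⱼ |W ∩ Hⱼ|^e
at most doubles in each step (`exists_pot_le`), and each single summand of the final sum yields the
design property for its W (`pow_sum_finrank_le`).

Rate. The second part uses the explicit design with s = 4⌈1/ε⌉ and codimension 48⌈1/ε⌉, and keeps
only the first ⌈Rmn⌉ vectors of the product basis; the parameters are balanced in `rate_bounds`.

Running time. The algorithms are written in a language of bounded loops in which every number is
written modulo `M` and every iteration count is taken modulo `L`. Such programs run in time
polynomial in `L` and the lengths of the numbers, with an exponent that depends only on the program
text (`Cmd.compile_runs`); operations in F are compiled to loops over digits. What remains is to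
choose `M` and `L` so large that the reductions never act, and to verify the meaning `Cmd.den` of
each program. -/

namespace BitRAM

/-! ### Stores, expressions -/

/-- The store `σ` with cell `i` of array `a` set to `v`. -/
def put (σ : Store) (a i v : ℕ) : Store := Function.update σ a (Function.update (σ a) i v)

theorem put_apply (σ : Store) (a i v b j : ℕ) :
    put σ a i v b j = if b = a ∧ j = i then v else σ b j := by
  unfold put
  by_cases h : b = a
  · subst h
    by_cases h' : j = i <;> simp [h']
  · simp [h]

@[simp] theorem put_same (σ : Store) (a i v : ℕ) : put σ a i v a i = v := by simp [put_apply]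

@[simp] theorem put_of_ne (σ : Store) (a i v : ℕ) {b : ℕ} (h : b ≠ a) :
    put σ a i v b = σ b := by
  unfold put; simp [h]

theorem put_cell_ne (σ : Store) (a i v b : ℕ) {j : ℕ} (h : j ≠ i) :
    put σ a i v b j = σ b j := by simp [put_apply, h]

instance : Add Expr := ⟨.bin .add⟩
instance : Sub Expr := ⟨.bin .sub⟩
instance : Mul Expr := ⟨.bin .mul⟩
instance : Div Expr := ⟨.bin .div⟩
instance : Mod Expr := ⟨.bin .mod⟩
instance (n : ℕ) : OfNat Expr n := ⟨.const (OfNat.ofNat n)⟩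

/-- The scalar variable held in cell `0` of array `x`. -/
abbrev V (x : ℕ) : Expr := .read x (.const 0)

/-- Cell `i` of array `a`. -/
abbrev rd (a : ℕ) (i : Expr) : Expr := .read a i

/-- The `i`-th input number. -/
abbrev inp (i : ℕ) : Expr := .read 0 (.const i)

section
variable (σ : Store) (x y : Expr)
@[simp] theorem eval_add : (x + y).eval σ = x.eval σ + y.eval σ := rfl
@[simp] theorem eval_sub : (x - y).eval σ = x.eval σ - y.eval σ := rfl
@[simp] theorem eval_mul : (x * y).eval σ = x.eval σ * y.eval σ := rfl
@[simp] theorem eval_div : (x / y).eval σ = x.eval σ / y.eval σ := rfl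
@[simp] theorem eval_mod : (x % y).eval σ = x.eval σ % y.eval σ := rfl
@[simp] theorem eval_const (c : ℕ) : (Expr.const c).eval σ = c := rfl
@[simp] theorem eval_ofNat (c : ℕ) : (no_index (OfNat.ofNat c : Expr)).eval σ = OfNat.ofNat c := rfl
@[simp] theorem eval_read (a : ℕ) : (Expr.read a x).eval σ = σ a (x.eval σ) := rfl
end

/-- The syntactic conditions on the array names read by an expression. -/
def Expr.Reads (P : ℕ → Bool) : Expr → Bool
  | .const _ => true
  | .read a i => P a && i.Reads P
  | .bin _ e₁ e₂ => e₁.Reads P && e₂.Reads P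

theorem Expr.eval_congr {P : ℕ → Bool} {σ τ : Store} (h : ∀ a, P a = true → σ a = τ a) :
    ∀ e : Expr, e.Reads P = true → e.eval σ = e.eval τ
  | .const _, _ => rfl
  | .read a i, he => by
    simp only [Expr.Reads, Bool.and_eq_true] at he
    simp only [Expr.eval, Expr.eval_congr h i he.2, h a he.1]
  | .bin o e₁ e₂, he => by
    simp only [Expr.Reads, Bool.and_eq_true] at he
    simp only [Expr.eval, Expr.eval_congr h e₁ he.1, Expr.eval_congr h e₂ he.2]

/-- All cells have binary length at most `β`. -/
def Bd (β : ℕ) (σ : Store) : Prop := ∀ a i, (σ a i).size ≤ β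

theorem Bd.put {β : ℕ} {σ : Store} (h : Bd β σ) {a i v : ℕ} (hv : v.size ≤ β) :
    Bd β (put σ a i v) := by
  intro b j
  rw [put_apply]
  split_ifs
  · exact hv
  · exact h b j

/-! ### Bounds by powers of a common base -/

section Powers

variable {Z x y a b : ℕ}

theorem le_pow_add (hZ : 2 ≤ Z) (hx : x ≤ Z ^ a) (hy : y ≤ Z ^ b) : x + y ≤ Z ^ (a + b + 1) := by
  have h1 : Z ^ a ≤ Z ^ (a + b) := Nat.pow_le_pow_right (by omega) (by omega)
  have h2 : Z ^ b ≤ Z ^ (a + b) := Nat.pow_le_pow_right (by omega) (by omega)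
  calc x + y ≤ Z ^ (a + b) * 2 := by omega
    _ ≤ Z ^ (a + b) * Z := Nat.mul_le_mul_left _ hZ
    _ = _ := by ring

theorem le_pow_mul (hx : x ≤ Z ^ a) (hy : y ≤ Z ^ b) : x * y ≤ Z ^ (a + b) := by
  rw [pow_add]; exact Nat.mul_le_mul hx hy

theorem le_pow_const (hZ : 2 ≤ Z) (c : ℕ) : c ≤ Z ^ c :=
  (Nat.lt_two_pow_self).le.trans (Nat.pow_le_pow_left hZ c)

theorem le_pow_mono (hZ : 2 ≤ Z) (hx : x ≤ Z ^ a) (h : a ≤ b) : x ≤ Z ^ b :=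
  hx.trans (Nat.pow_le_pow_right (by omega) h)

end Powers

theorem Op.size_eval (o : Op) (x y : ℕ) : (o.eval x y).size ≤ x.size + y.size + 1 := by
  have hx := Nat.lt_size_self x
  have hy := Nat.lt_size_self y
  rw [Nat.size_le]
  have key : x + y < 2 ^ (x.size + y.size + 1) ∧ x * y < 2 ^ (x.size + y.size + 1) := by
    have h1 : 2 ^ (x.size + y.size + 1) = 2 ^ x.size * 2 ^ y.size * 2 := by ring
    have p1 : 1 ≤ 2 ^ x.size := Nat.one_le_two_pow
    have p2 : 1 ≤ 2 ^ y.size := Nat.one_le_two_pow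
    rw [h1]
    constructor <;> nlinarith
  cases o with
  | add => exact key.1
  | sub => exact lt_of_le_of_lt (Nat.sub_le _ _) (by omega)
  | mul => exact key.2
  | div => exact lt_of_le_of_lt (Nat.div_le_self _ _) (by omega)
  | mod => exact lt_of_le_of_lt (Nat.mod_le _ _) (by omega)

/-- The exponent depends on the expression alone: by structural induction every constituent of the
cost is at most a power of Z, and sums, products and squares of such powers are again at most powers
of Z. The same device yields all later time bounds. -/
theorem Expr.cost_le (e : Expr) : ∃ K, ∀ (σ : Store) (β Z : ℕ), Bd β σ → β + 2 ≤ Z →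
    e.cost σ ≤ Z ^ K ∧ (e.eval σ).size ≤ Z ^ K := by
  induction e with
  | const c =>
    refine ⟨1 + c.size, fun σ β Z _ hZ => ⟨le_pow_const (by omega) _, ?_⟩⟩
    exact le_pow_mono (by omega) (le_pow_const (by omega) _) (by simp [Expr.eval])
  | read a i ih =>
    obtain ⟨K, hK⟩ := ih
    refine ⟨K + ((1 + K + 1) + 1 + 1) + 1, fun σ β Z hσ hZ => ?_⟩
    obtain ⟨h1, h2⟩ := hK σ β Z hσ hZ
    have h3 : (σ a (i.eval σ)).size ≤ Z ^ 1 := by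
      have := hσ a (i.eval σ)
      rw [pow_one]; omega
    have hZ2 : 2 ≤ Z := by omega
    have h4 : 1 ≤ Z ^ 1 := by rw [pow_one]; omega
    simp only [Expr.cost, Expr.eval]
    have h5 := le_pow_add hZ2 (le_pow_add hZ2 h4 h2) h3
    exact ⟨le_pow_add hZ2 h1 h5,
      le_pow_mono hZ2 h3 (by omega)⟩
  | bin o e₁ e₂ ih₁ ih₂ =>
    obtain ⟨K₁, hK₁⟩ := ih₁
    obtain ⟨K₂, hK₂⟩ := ih₂
    refine ⟨(K₁ + K₂ + 1) + ((1 + K₁ + 1) + K₂ + 1) * 2 + 1, fun σ β Z hσ hZ => ?_⟩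
    obtain ⟨h1, h2⟩ := hK₁ σ β Z hσ hZ
    obtain ⟨h3, h4⟩ := hK₂ σ β Z hσ hZ
    have hZ2 : 2 ≤ Z := by omega
    have h5 : 1 ≤ Z ^ 1 := by simp; omega
    have h6 := le_pow_add hZ2 (le_pow_add hZ2 h5 h2) h4
    refine ⟨le_pow_add hZ2 (le_pow_add hZ2 h1 h3) ?_, ?_⟩
    · rw [pow_mul]; exact Nat.pow_le_pow_left h6 2
    · refine le_pow_mono hZ2 ?_ (Nat.le_add_right ((1 + K₁ + 1) + K₂ + 1) (K₁ + K₂ + 1 + 1 + K₁ + K₂ + 2 + 1) |>.trans (by omega))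
      have := Op.size_eval o (e₁.eval σ) (e₂.eval σ)
      simp only [Expr.eval]
      omega

theorem Exec.write' (a : ℕ) (i e : Expr) (σ : Store) :
    Exec (.write a i e) σ (put σ a (i.eval σ) (e.eval σ))
      (i.cost σ + e.cost σ + (1 + (i.eval σ).size + (e.eval σ).size)) :=
  Exec.write a i e σ

theorem write_cost_le (a : ℕ) (i e : Expr) : ∃ K, ∀ (σ : Store) (β Z : ℕ), Bd β σ → β + 2 ≤ Z →
    ∃ t ≤ Z ^ K, Exec (.write a i e) σ (put σ a (i.eval σ) (e.eval σ)) t := by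
  obtain ⟨K₁, h₁⟩ := i.cost_le
  obtain ⟨K₂, h₂⟩ := e.cost_le
  refine ⟨(K₁ + K₂ + 1) + ((1 + K₁ + 1) + K₂ + 1) + 1, fun σ β Z hσ hZ =>
    ⟨_, ?_, Exec.write' a i e σ⟩⟩
  have hZ2 : 2 ≤ Z := by omega
  have h5 : 1 ≤ Z ^ 1 := by simp; omega
  obtain ⟨a1, a2⟩ := h₁ σ β Z hσ hZ
  obtain ⟨b1, b2⟩ := h₂ σ β Z hσ hZ
  exact le_pow_add hZ2 (le_pow_add hZ2 a1 b1) (le_pow_add hZ2 (le_pow_add hZ2 h5 a2) b2)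

/-- A `while` loop whose successive memories are `S 0, …, S N`. -/
theorem exec_while {e : Expr} {c : Prog} (S : ℕ → Store) (N T : ℕ)
    (hb : ∀ i < N, e.eval (S i) ≠ 0 ∧ ∃ t ≤ T, Exec c (S i) (S (i + 1)) t)
    (hN : e.eval (S N) = 0) (hc : ∀ i ≤ N, e.cost (S i) ≤ T) :
    ∃ t ≤ (N + 1) * (2 * T), Exec (.while e c) (S 0) (S N) t := by
  induction N generalizing S with
  | zero => exact ⟨_, by have := hc 0 le_rfl; omega, Exec.while_false hN⟩
  | succ n ih =>
    obtain ⟨h0, t, ht, hx⟩ := hb 0 (by omega)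
    obtain ⟨t', ht', hx'⟩ := ih (fun i => S (i + 1)) (fun i hi => hb (i + 1) (by omega)) hN
      (fun i hi => hc (i + 1) (by omega))
    refine ⟨_, ?_, Exec.while_true h0 hx hx'⟩
    have := hc 0 (by omega)
    have e1 : (n + 1 + 1) * (2 * T) = (n + 1) * (2 * T) + 2 * T := by ring
    omega

/-! ### A language of bounded loops over a finite field -/

/-- An enumeration `el 0, …, el (q - 1)` of a finite field, a modulus `M` for the numbers written by
programs and a modulus `L` for the numbers of iterations. -/
structure Ctx (F : Type*) [Field F] where
  M : ℕ
  L : ℕ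
  q : ℕ
  el : ℕ → F
  code : F → ℕ
  el_code : ∀ x, el (code x) = x
  code_el : ∀ n, code (el n) = n % q
  code_lt : ∀ x, code x < q
  code_zero : code 0 = 0
  q_le : q ≤ M
  L_pos : 0 < L

/-- Field valued expressions; `sum x e f` is the sum over the values of the variable `x` below the
value of `e`. -/
inductive FE
  | nat (e : Expr)
  | add (f g : FE)
  | sub (f g : FE)
  | mul (f g : FE)
  | ite (e : Expr) (f g : FE)
  | sum (x : ℕ) (e : Expr) (f : FE)

/-- Commands; `set` writes a number, `setF` the number of a field element, `loop x e c` executes `c`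
for the values of the variable `x` below the value of `e`. -/
inductive Cmd
  | skip
  | set (a : ℕ) (i e : Expr)
  | setF (a : ℕ) (i : Expr) (f : FE)
  | seq (c d : Cmd)
  | ite (e : Expr) (c d : Cmd)
  | loop (x : ℕ) (e : Expr) (c : Cmd)

section

variable {F : Type*} [Field F] (X : Ctx F)

/-- The number of terms of a sum is reduced modulo `L`, as is the iteration count of the loop to
which the sum is compiled. -/
def FE.eval : FE → Store → F
  | .nat e, σ => X.el (e.eval σ)
  | .add f g, σ => f.eval σ + g.eval σ
  | .sub f g, σ => f.eval σ - g.eval σ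
  | .mul f g, σ => f.eval σ * g.eval σ
  | .ite e f g, σ => if e.eval σ ≠ 0 then f.eval σ else g.eval σ
  | .sum x e f, σ => ∑ i ∈ Finset.range (e.eval σ % X.L), f.eval (put σ x 0 i)

/-- The memories of a loop over the variable `x` with `N` iterations of `g`. -/
def iter (g : Store → Store) (x N : ℕ) (σ : Store) : ℕ → Store
  | 0 => put (put σ x 1 N) x 0 0
  | i + 1 => put (g (iter g x N σ i)) x 0 (i + 1)

/-- Reducing numbers modulo `M` and iteration counts modulo `L` makes the meaning total and bounded
without any invariant. Each specification has to show that the reductions are trivial on the numbers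
that actually occur. -/
def Cmd.den : Cmd → Store → Store
  | .skip, σ => σ
  | .set a i e, σ => put σ a (i.eval σ) (e.eval σ % X.M)
  | .setF a i f, σ => put σ a (i.eval σ) (X.code (f.eval X σ))
  | .seq c d, σ => d.den (c.den σ)
  | .ite e c d, σ => if e.eval σ ≠ 0 then c.den σ else d.den σ
  | .loop x e c, σ => iter (fun τ => c.den τ) x (e.eval σ % X.L) σ (e.eval σ % X.L)

theorem Cmd.den_seq (c d : Cmd) (σ : Store) : (Cmd.seq c d).den X σ = d.den X (c.den X σ) := rfl

theorem Cmd.den_set (a : ℕ) (i e : Expr) (σ : Store) :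
    (Cmd.set a i e).den X σ = put σ a (i.eval σ) (e.eval σ % X.M) := rfl

theorem Cmd.den_setF (a : ℕ) (i : Expr) (f : FE) (σ : Store) :
    (Cmd.setF a i f).den X σ = put σ a (i.eval σ) (X.code (f.eval X σ)) := rfl

theorem Cmd.den_skip (σ : Store) : Cmd.skip.den X σ = σ := rfl

theorem Cmd.den_ite {e : Expr} {c d : Cmd} {σ : Store} (n : ℕ) (h : e.eval σ = n) :
    (Cmd.ite e c d).den X σ = if n = 0 then d.den X σ else c.den X σ := by
  subst h
  simp only [den]
  split_ifs <;> first | rfl | contradiction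

theorem FE.eval_ite {e : Expr} {f g : FE} {σ : Store} (n : ℕ) (h : e.eval σ = n) :
    (FE.ite e f g).eval X σ = if n = 0 then g.eval X σ else f.eval X σ := by
  subst h
  simp only [FE.eval]
  split_ifs <;> first | rfl | contradiction

/-- The arrays a command may change. -/
def Cmd.mods : Cmd → List ℕ
  | .skip => []
  | .set a _ _ => [a]
  | .setF a _ _ => [a]
  | .seq c d => c.mods ++ d.mods
  | .ite _ c d => c.mods ++ d.mods
  | .loop x _ c => x :: c.mods

theorem Cmd.den_frame (c : Cmd) : ∀ (σ : Store) (b : ℕ), b ∉ c.mods → c.den X σ b = σ b := by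
  induction c with
  | skip => intros; rfl
  | set | setF => intro σ b hb; exact put_of_ne _ _ _ _ (by simpa [mods] using hb)
  | seq c d h₁ h₂ => simp +contextual [mods, den, h₁, h₂]
  | ite e c d h₁ h₂ =>
    intro σ b hb
    simp only [den]
    split_ifs <;> simp_all [mods]
  | loop x e c ih =>
    intro σ b hb
    simp only [mods, List.mem_cons, not_or] at hb
    simp only [den]
    generalize e.eval σ % X.L = N
    suffices ∀ n, iter (fun τ => c.den X τ) x N σ n b = σ b from this N
    intro n
    induction n with
    | zero => simp [iter, hb.1]
    | succ n ihn => simp [iter, hb.1, ih _ _ hb.2, ihn]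

variable {X} {b x : ℕ} {c d : Cmd} {e : Expr} {σ ρ : Store}

theorem Cmd.den_seq_iff :
    (Cmd.seq c d).den X σ = ρ ↔ ∃ τ, c.den X σ = τ ∧ d.den X τ = ρ := by simp [den]

/-- The frame rule in the form used throughout: for a concrete command the default argument computes
the list of written arrays. -/
theorem fr (h : c.den X σ = ρ) (b : ℕ) (hb : c.mods.contains b = false := by rfl) : ρ b = σ b :=
  h ▸ c.den_frame X σ b (by simpa using hb)

/-- The command does not write the arrays in the list. -/
def Cmd.keeps (c : Cmd) (l : List ℕ) : Bool := c.mods.all fun b => !l.contains b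

theorem frs (h : c.den X σ = ρ) (l : List ℕ) (hl : c.keeps l = true := by rfl) :
    ∀ b ∈ l, ρ b = σ b :=
  fun b hb => fr h b (by simp [Cmd.keeps] at hl ⊢; exact fun h => hl b h hb)

theorem set_val {j v : ℕ} (h : (Cmd.set b (.const j) e).den X σ = ρ) (hv : e.eval σ = v)
    (hM : v < X.M) : ρ b j = v := by
  rw [← h, Cmd.den_set, hv, Nat.mod_eq_of_lt hM]
  exact put_same _ _ _ _

/-- The rule for loops. -/
theorem Cmd.loop_inv (hρ : (Cmd.loop x e c).den X σ = ρ) (N : ℕ) (I : ℕ → Store → Prop)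
    (hN : e.eval σ = N) (hNL : N < X.L)
    (h0 : I 0 (put (put σ x 1 N) x 0 0))
    (hs : ∀ i < N, ∀ τ, (∀ (b : ℕ) (_ : b ∉ (Cmd.loop x e c).mods := by
      exact of_decide_eq_true rfl), τ b = σ b) → τ x 0 = i → I i τ →
      ∀ τ', c.den X τ = τ' → I (i + 1) (put τ' x 0 (i + 1))) : I N ρ := by
  simp only [← hρ, den, hN, Nat.mod_eq_of_lt hNL]
  suffices ∀ n ≤ N, I n (iter (fun τ => c.den X τ) x N σ n) ∧
      iter (fun τ => c.den X τ) x N σ n x 0 = n ∧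
      ∀ b, b ∉ (Cmd.loop x e c).mods → iter (fun τ => c.den X τ) x N σ n b = σ b from
    (this N le_rfl).1
  intro n
  induction n with
  | zero =>
    refine fun _ => ⟨h0, put_same _ _ _ _, fun b hb => ?_⟩
    simp only [mods, List.mem_cons, not_or] at hb
    simp [iter, hb.1]
  | succ n ih =>
    intro hn
    obtain ⟨h1, h2, h3⟩ := ih (by omega)
    refine ⟨hs n (by omega) _ (fun b hb => h3 b hb) h2 h1 _ rfl, put_same _ _ _ _, fun b hb => ?_⟩
    have hb' := hb
    simp only [mods, List.mem_cons, not_or] at hb'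
    simp [iter, hb'.1, den_frame X c _ _ hb'.2, h3 b hb]

/-! ### Programs without field operations run on the machine -/

/-- Array `2` holds the moduli and must survive. A loop keeps its counter and its bound in cells `0`
and `1` of its own array, so the body must not write that array. -/
def Cmd.NoF : Cmd → Bool
  | .skip => true
  | .set a _ _ => a != 2
  | .setF _ _ _ => false
  | .seq c d => c.NoF && d.NoF
  | .ite _ c d => c.NoF && d.NoF
  | .loop x _ c => c.NoF && (x != 2) && !(c.mods.contains x)

/-- The machine program of a command without field operations. The moduli are in the cells `0` and
`1` of array `2`. -/
def Cmd.prog : Cmd → Prog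
  | .skip => .skip
  | .set a i e => .write a i (e % rd 2 0)
  | .setF _ _ _ => .skip
  | .seq c d => .seq c.prog d.prog
  | .ite e c d => .ite e c.prog d.prog
  | .loop x e c => .seq (.write x 1 (e % rd 2 1)) (.seq (.write x 0 0)
      (.while (rd x 1 - rd x 0) (.seq c.prog (.write x 0 (rd x 0 + 1)))))

theorem Cmd.mods_of_noF (c : Cmd) (h : c.NoF = true) : 2 ∉ c.mods := by
  induction c <;> simp_all [mods, NoF] <;> omega

/-- Neither termination nor the size of numbers needs an argument specific to the program: a loop
makes fewer than `L` rounds, each of cost at most a power of Z by induction, and the reductions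
modulo `M` and `L` keep all cells of length at most β. Hence `K` can be chosen before the context
and the memory. -/
theorem Cmd.prog_runs (c : Cmd) (hc : c.NoF = true) : ∃ K, ∀ {F : Type*} [Field F] (X : Ctx F)
    (β Z : ℕ) (σ : Store), Bd β σ → X.M.size ≤ β → X.L.size ≤ β → X.L + β + 2 ≤ Z →
    σ 2 0 = X.M → σ 2 1 = X.L →
    (∃ t ≤ Z ^ K, Exec c.prog σ (c.den X σ) t) ∧ Bd β (c.den X σ) := by
  induction c with
  | skip =>
    refine ⟨1, fun {F} _ X β Z σ hσ _ _ hZ _ _ => ⟨⟨1, by simp; omega, Exec.skip σ⟩, hσ⟩⟩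
  | set a i e =>
    obtain ⟨K, hK⟩ := write_cost_le a i (e % rd 2 0)
    refine ⟨K, fun {F} _ X β Z σ hσ hM hL hZ h0 h1 => ?_⟩
    have hM0 : 0 < X.M := lt_of_le_of_lt (Nat.zero_le _) (lt_of_lt_of_le (X.code_lt 0) X.q_le)
    have he : (e % rd 2 0).eval σ = e.eval σ % X.M := by simp [h0]
    refine ⟨?_, hσ.put ((Nat.size_le_size (Nat.mod_lt _ hM0).le).trans hM)⟩
    have := hK σ β Z hσ (by omega)
    rwa [he] at this
  | setF a i f => simp [NoF] at hc
  | seq c d ih₁ ih₂ =>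
    simp only [NoF, Bool.and_eq_true] at hc
    obtain ⟨K₁, h₁⟩ := ih₁ hc.1
    obtain ⟨K₂, h₂⟩ := ih₂ hc.2
    refine ⟨K₁ + K₂ + 1, fun {F} _ X β Z σ hσ hM hL hZ h0 h1 => ?_⟩
    obtain ⟨⟨t, ht, hx⟩, hB⟩ := h₁ X β Z σ hσ hM hL hZ h0 h1
    have hf := c.den_frame X σ 2 (c.mods_of_noF hc.1)
    obtain ⟨⟨t', ht', hx'⟩, hB'⟩ := h₂ X β Z _ hB hM hL hZ (by rw [hf, h0]) (by rw [hf, h1])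
    exact ⟨⟨_, le_pow_add (by omega) ht ht', Exec.seq hx hx'⟩, hB'⟩
  | ite e c d ih₁ ih₂ =>
    simp only [NoF, Bool.and_eq_true] at hc
    obtain ⟨K₁, h₁⟩ := ih₁ hc.1
    obtain ⟨K₂, h₂⟩ := ih₂ hc.2
    obtain ⟨K, hK⟩ := e.cost_le
    refine ⟨K + (K₁ + K₂) + 1, fun {F} _ X β Z σ hσ hM hL hZ h0 h1 => ?_⟩
    have hk := (hK σ β Z hσ (by omega)).1
    by_cases he : e.eval σ = 0
    · obtain ⟨⟨t, ht, hx⟩, hB⟩ := h₂ X β Z σ hσ hM hL hZ h0 h1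
      simp only [den, he, ne_eq, not_true_eq_false, if_false]
      exact ⟨⟨_, le_pow_add (by omega) hk (le_pow_mono (by omega) ht (by omega)),
        Exec.ite_false he hx⟩, hB⟩
    · obtain ⟨⟨t, ht, hx⟩, hB⟩ := h₁ X β Z σ hσ hM hL hZ h0 h1
      simp only [den, he, ne_eq, not_false_eq_true, if_true]
      exact ⟨⟨_, le_pow_add (by omega) hk (le_pow_mono (by omega) ht (by omega)),
        Exec.ite_true he hx⟩, hB⟩
  | loop x e c ih =>
    simp only [NoF, Bool.and_eq_true, bne_iff_ne, Bool.not_eq_true', List.contains_eq_mem,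
      decide_eq_false_iff_not] at hc
    obtain ⟨⟨hc, hx2⟩, hxc⟩ := hc
    obtain ⟨K, hK⟩ := ih hc
    obtain ⟨K₁, h₁⟩ := write_cost_le x 1 (e % rd 2 1)
    obtain ⟨K₂, h₂⟩ := write_cost_le x 0 0
    obtain ⟨K₃, h₃⟩ := write_cost_le x 0 (rd x 0 + 1)
    obtain ⟨K₄, h₄⟩ := Expr.cost_le (rd x 1 - rd x 0)
    refine ⟨K₁ + (K₂ + (1 + (1 + (K + K₃ + 1 + K₄))) + 1) + 1,
      fun {F} _ X β Z σ hσ hM hL hZ h0 h1 => ?_⟩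
    have hZ2 : 2 ≤ Z := by omega
    set N := e.eval σ % X.L with hN
    have hNL : N < X.L := Nat.mod_lt _ X.L_pos
    have hNs : ∀ i ≤ N, i.size ≤ β := fun i hi => (Nat.size_le_size (by omega)).trans hL
    set S := iter (fun τ => c.den X τ) x N σ with hS0
    have hS : ∀ i ≤ N, (Bd β (S i) ∧ S i 2 = σ 2 ∧ S i x 0 = i ∧ S i x 1 = N) ∧
        (i < N → ∃ t ≤ Z ^ (K + K₃ + 1), Exec (.seq c.prog (.write x 0 (rd x 0 + 1)))
          (S i) (S (i + 1)) t) := by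
      have step : ∀ i < N, Bd β (S i) ∧ S i 2 = σ 2 ∧ S i x 0 = i ∧ S i x 1 = N →
          (∃ t ≤ Z ^ (K + K₃ + 1), Exec (.seq c.prog (.write x 0 (rd x 0 + 1)))
          (S i) (S (i + 1)) t) ∧ Bd β (S (i + 1)) := by
        rintro i hi ⟨hB, h2, hxi, -⟩
        obtain ⟨⟨t, ht, hx⟩, hB'⟩ := hK X β Z (S i) hB hM hL hZ (by rw [h2, h0]) (by rw [h2, h1])
        obtain ⟨t', ht', hx'⟩ := h₃ _ β Z hB' (by omega)
        have e1 : (rd x 0 + 1).eval (c.den X (S i)) = i + 1 := by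
          simp only [eval_add, eval_read, eval_ofNat, c.den_frame X _ x hxc, hxi]
        rw [e1] at hx'
        exact ⟨⟨_, le_pow_add hZ2 ht ht', Exec.seq hx hx'⟩, hB'.put (hNs _ hi)⟩
      intro i
      induction i with
      | zero =>
        refine fun _ => (fun h => ⟨h, fun hi => (step 0 hi h).1⟩)
          ⟨(hσ.put (hNs N le_rfl)).put (by simp), ?_, put_same _ _ _ _, ?_⟩ <;>
        simp [hS0, iter, hx2.symm, put_cell_ne]
      | succ i ihi =>
        intro hi
        have hi' := (ihi (by omega)).1
        refine (fun h => ⟨h, fun hi => (step _ hi h).1⟩)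
          ⟨(step i hi hi').2, ?_, put_same _ _ _ _, ?_⟩ <;>
        simp [show S (i + 1) = put (c.den X (S i)) x 0 (i + 1) from rfl, hx2.symm, put_cell_ne,
          c.den_frame X _ 2 (c.mods_of_noF hc), c.den_frame X _ x hxc, hi']
    have hcost : ∀ i ≤ N, (rd x 1 - rd x 0).cost (S i) ≤ Z ^ K₄ := fun i hi =>
      (h₄ _ β Z (hS i hi).1.1 (by omega)).1
    obtain ⟨t, ht, hx⟩ := exec_while (e := rd x 1 - rd x 0)
      (c := .seq c.prog (.write x 0 (rd x 0 + 1))) S N (Z ^ (K + K₃ + 1 + K₄))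
      (fun i hi => ⟨by simp [(hS i hi.le).1]; omega, by
        obtain ⟨t, ht, h⟩ := (hS i hi.le).2 hi
        exact ⟨t, le_pow_mono hZ2 ht (by omega), h⟩⟩)
      (by simp [(hS N le_rfl).1])
      (fun i hi => le_pow_mono hZ2 (hcost i hi) (by omega))
    obtain ⟨t₁, ht₁, hx₁⟩ := h₁ σ β Z hσ (by omega)
    have e1 : (e % rd 2 1).eval σ = N := by simp [h1, hN]
    rw [e1] at hx₁
    obtain ⟨t₂, ht₂, hx₂⟩ := h₂ (put σ x 1 N) β Z (hσ.put (hNs N le_rfl)) (by omega)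
    refine ⟨⟨_, ?_, Exec.seq hx₁ (Exec.seq hx₂ hx)⟩, (hS N le_rfl).1.1⟩
    refine le_pow_add hZ2 ht₁ (le_pow_add hZ2 ht₂ (ht.trans ?_))
    refine le_pow_mul (a := 1) (by simp; omega) (le_pow_mul (a := 1) (by simpa using hZ2) le_rfl)

end

/-! ### Numbers for the elements of a finite field -/

theorem sum_digits_lt {p : ℕ} (d : ℕ → ℕ) (hd : ∀ i, d i < p) (a : ℕ) :
    ∑ i ∈ Finset.range a, d i * p ^ i < p ^ a := by
  induction a with
  | zero => simp
  | succ n ih =>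
    rw [Finset.sum_range_succ, pow_succ]
    have h1 : (d n + 1) * p ^ n ≤ p * p ^ n := Nat.mul_le_mul_right _ (hd n)
    nlinarith

theorem sum_digits_div_mod {p : ℕ} (hp : 0 < p) (d : ℕ → ℕ) (hd : ∀ i, d i < p) (a j : ℕ)
    (hj : j < a) : (∑ i ∈ Finset.range a, d i * p ^ i) / p ^ j % p = d j := by
  obtain ⟨c, rfl⟩ : ∃ c, a = j + 1 + c := ⟨a - (j + 1), by omega⟩
  rw [Finset.sum_range_add, Finset.sum_range_succ]
  have h1 : ∑ x ∈ Finset.range c, d (j + 1 + x) * p ^ (j + 1 + x)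
      = p ^ j * (p * ∑ x ∈ Finset.range c, d (j + 1 + x) * p ^ x) := by
    rw [Finset.mul_sum, Finset.mul_sum]
    exact Finset.sum_congr rfl fun x _ => by ring
  have h2 : ∑ i ∈ Finset.range j, d i * p ^ i + d j * p ^ j +
      p ^ j * (p * ∑ x ∈ Finset.range c, d (j + 1 + x) * p ^ x)
      = ∑ i ∈ Finset.range j, d i * p ^ i +
        p ^ j * (d j + p * ∑ x ∈ Finset.range c, d (j + 1 + x) * p ^ x) := by ring
  rw [h1, h2, Nat.add_mul_div_left _ _ (pow_pos hp j),
    Nat.div_eq_of_lt (sum_digits_lt d hd j), zero_add, Nat.add_mul_mod_self_left,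
    Nat.mod_eq_of_lt (hd j)]

theorem sum_div_mod_pow (p n a : ℕ) :
    ∑ i ∈ Finset.range a, n / p ^ i % p * p ^ i = n % p ^ a := by
  induction a with
  | zero => simp [Nat.mod_one]
  | succ a ih => rw [Finset.sum_range_succ, ih, Nat.mod_pow_succ, mul_comm (p ^ a)]

theorem sum_range_mul_eq {A : Type*} [AddCommMonoid A] (f : ℕ → ℕ → A) (a b : ℕ) (hb : 0 < b) :
    ∑ k ∈ Finset.range (a * b), f (k / b) (k % b) =
      ∑ i ∈ Finset.range a, ∑ j ∈ Finset.range b, f i j := by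
  induction a with
  | zero => simp
  | succ a ih =>
    rw [add_mul, one_mul, Finset.sum_range_add, ih, Finset.sum_range_succ]
    congr 1
    refine Finset.sum_congr rfl fun j hj => ?_
    rw [Finset.mem_range] at hj
    rw [Nat.mul_comm a b, Nat.mul_add_div hb, Nat.div_eq_of_lt hj, Nat.mul_add_mod,
      Nat.mod_eq_of_lt hj, add_zero]

section

variable {p a : ℕ} {F : Type*} [Field F] [hp : Fact p.Prime] [Algebra (ZMod p) F]
  (bF : Basis (Fin a) (ZMod p) F)

/-- The digits of the number of `x`. -/
noncomputable def dig (x : F) (i : ℕ) : ℕ := if h : i < a then (bF.repr x ⟨i, h⟩).val else 0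

theorem dig_lt (x : F) (i : ℕ) : dig bF x i < p := by
  unfold dig
  split_ifs
  · exact ZMod.val_lt _
  · exact hp.out.pos

noncomputable def codeF (x : F) : ℕ := ∑ i ∈ Finset.range a, dig bF x i * p ^ i

/-- Only the first `a` digits of `n` matter, so every natural number names an element, and numbers
congruent modulo p^a name the same one. -/
noncomputable def elF (n : ℕ) : F := ∑ i : Fin a, ((n / p ^ (i : ℕ) % p : ℕ) : ZMod p) • bF i

theorem codeF_lt (x : F) : codeF bF x < p ^ a :=
  sum_digits_lt _ (dig_lt bF x) a

theorem codeF_digit (x : F) {j : ℕ} (hj : j < a) : codeF bF x / p ^ j % p = dig bF x j :=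
  sum_digits_div_mod hp.out.pos _ (dig_lt bF x) a j hj

theorem dig_elF (n j : ℕ) (hj : j < a) : dig bF (elF bF n) j = n / p ^ j % p := by
  simp only [dig, hj, dif_pos, elF]
  rw [show bF.repr (∑ i : Fin a, ((n / p ^ (i : ℕ) % p : ℕ) : ZMod p) • bF i) ⟨j, hj⟩
    = ((n / p ^ j % p : ℕ) : ZMod p) by
      rw [Basis.repr_sum_self bF (fun i : Fin a => ((n / p ^ (i : ℕ) % p : ℕ) : ZMod p))]]
  rw [ZMod.val_natCast, Nat.mod_mod]

theorem elF_codeF (x : F) : elF bF (codeF bF x) = x := by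
  unfold elF
  conv_rhs => rw [← bF.sum_repr x]
  refine Finset.sum_congr rfl fun i _ => ?_
  rw [codeF_digit bF x i.2]
  simp [dig]

theorem codeF_elF (n : ℕ) : codeF bF (elF bF n) = n % p ^ a := by
  rw [← sum_div_mod_pow, codeF]
  exact Finset.sum_congr rfl fun i hi => by rw [dig_elF bF n i (Finset.mem_range.1 hi)]

theorem elF_digit {d l : ℕ} (hd : d < p) (hl : l < a) :
    elF bF (d * p ^ l) = (d : ZMod p) • bF ⟨l, hl⟩ := by
  unfold elF
  rw [Finset.sum_eq_single ⟨l, hl⟩]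
  · simp [Nat.mul_div_cancel _ (pow_pos hp.out.pos l), Nat.mod_eq_of_lt hd]
  · rintro ⟨i, hi⟩ - hne
    have hil : i ≠ l := fun h => hne (Fin.ext h)
    suffices d * p ^ l / p ^ i % p = 0 by simp [this]
    rcases lt_or_gt_of_ne hil with h | h
    · obtain ⟨c, rfl⟩ : ∃ c, l = i + 1 + c := ⟨l - (i + 1), by omega⟩
      rw [show d * p ^ (i + 1 + c) = (d * p ^ c * p) * p ^ i by ring,
        Nat.mul_div_cancel _ (pow_pos hp.out.pos i), Nat.mul_mod_left]
    · rw [Nat.div_eq_of_lt, Nat.zero_mod]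
      calc d * p ^ l < p * p ^ l := Nat.mul_lt_mul_of_pos_right hd (pow_pos hp.out.pos l)
        _ = p ^ (l + 1) := by ring
        _ ≤ p ^ i := Nat.pow_le_pow_right hp.out.pos h
  · simp

/-- The context given by a basis of `F` over the prime field. -/
noncomputable def fieldCtx (M L : ℕ) (hM : p ^ a ≤ M) (hL : 0 < L) : Ctx F where
  M := M
  L := L
  q := p ^ a
  el := elF bF
  code := codeF bF
  el_code := elF_codeF bF
  code_el := codeF_elF bF
  code_lt := codeF_lt bF
  code_zero := by simp [codeF, dig]
  q_le := hM
  L_pos := hL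

/-- Digits are computed with natural numbers modulo `p`; it is enough to recognize the residue class
as the coordinate. -/
theorem dig_eq_of_cast {x : F} {i n : ℕ} (hi : i < a) (h : (n : ZMod p) = bF.repr x ⟨i, hi⟩) :
    n % p = dig bF x i := by
  simp only [dig, hi, dif_pos, ← h, ZMod.val_natCast]

theorem cast_dig (x : F) {i : ℕ} (hi : i < a) : (dig bF x i : ZMod p) = bF.repr x ⟨i, hi⟩ := by
  simp [dig, hi]

/-! ### Field operations as loops -/

/-- The memory holds the moduli, the powers of `p` and the multiplication table of the field. -/
structure Env (X : Ctx F) (σ : Store) : Prop where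
  code : X.code = codeF bF
  el : X.el = elF bF
  hXq : X.q = p ^ a
  hM : σ 2 0 = X.M
  hL : σ 2 1 = X.L
  hq : σ 2 2 = X.q
  hp : σ 0 1 = p
  ha : σ 0 2 = a
  hpow : ∀ i < a, σ 3 i = p ^ i
  htab : ∀ i j l : Fin a, σ 0 (σ 2 3 + (((i : ℕ) * a + j) * a + l)) = (bF.repr (bF i * bF j) l).val
  haL : a * a < X.L

theorem Env.congr {X : Ctx F} {σ τ : Store} (h : Env bF X σ) (h0 : τ 0 = σ 0) (h2 : τ 2 = σ 2)
    (h3 : τ 3 = σ 3) : Env bF X τ := by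
  cases h; constructor <;> simp_all

/-- Assembles a number from the digits computed by `c`. -/
def digC (d : ℕ) (c : Cmd) : Cmd :=
  .seq (.set 6 0 0) (.seq (.loop 7 (inp 2) (.seq c (.set 6 0 (V 6 + V 8 * rd 3 (V 7)))))
    (.set 5 (.const d) (V 6)))

/-- The digit with index `l` of the number in cell `d` of array `5`. -/
def dg (d : ℕ) (l : Expr) : Expr := rd 5 (.const d) / rd 3 l % inp 1

def addC (d : ℕ) : Cmd := digC d (.set 8 0 ((dg d (V 7) + dg (d + 1) (V 7)) % inp 1))

/-- `inp 1` is `p`: the digit is subtracted from `p` and then added, since subtraction of natural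
numbers truncates. -/
def subC (d : ℕ) : Cmd := digC d (.set 8 0 ((dg d (V 7) + (inp 1 - dg (d + 1) (V 7))) % inp 1))

/-- The variable `9` runs through the pairs (i, j) in the form i * a + j. A digit of the product is
Σ xᵢ yⱼ times the tabulated coordinate of bᵢ bⱼ, reduced modulo `p` after every step. -/
def mulC (d : ℕ) : Cmd := digC d (.seq (.set 8 0 0) (.loop 9 (inp 2 * inp 2) (.set 8 0
  ((V 8 + dg d (V 9 / inp 2) * dg (d + 1) (V 9 % inp 2) *
    rd 0 (rd 2 3 + (V 9 * inp 2 + V 7))) % inp 1))))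

theorem a_pos (bF : Basis (Fin a) (ZMod p) F) : 0 < a := by
  rcases Nat.eq_zero_or_pos a with rfl | h
  · exact absurd (by rw [← bF.sum_repr 1]; simp) (one_ne_zero (α := F))
  · exact h

/-- The arrays visible to expressions in the scope of sums over the variables `n`; the arrays `5`
to `9` hold intermediate values. -/
abbrev vis (n : List ℕ) (b : ℕ) : Prop := b < 5 ∨ 10 ≤ b ∧ (b < 50 ∨ b ∈ n)

/-- The memory `τ` holds the number of `z` in cell `d` of array `5`, and agrees with `σ` on earlier
cells and on visible arrays. -/
structure Res (X : Ctx F) (n : List ℕ) (d : ℕ) (z : F) (σ τ : Store) : Prop where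
  val : τ 5 d = X.code z
  lt : ∀ j < d, τ 5 j = σ 5 j
  vis : ∀ b, vis n b → τ b = σ b

variable {X : Ctx F} {n : List ℕ} {d e : ℕ} {x y z : F} {σ τ ρ : Store}

section
omit [Algebra (ZMod p) F] hp

theorem Res.trans (h : Res X n d x σ τ) (h' : Res X n e y τ ρ) (hde : e ≤ d) :
    Res X n e y σ ρ :=
  ⟨h'.val, fun j hj => by rw [h'.lt j hj, h.lt j (by omega)], fun b hb => by
    rw [h'.vis b hb, h.vis b hb]⟩

theorem Ctx.code_mod (X : Ctx F) (x : F) : X.code x % X.M = X.code x :=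
  Nat.mod_eq_of_lt ((X.code_lt _).trans_le X.q_le)

end

theorem Env.res (h : Env bF X σ) (h' : Res X n d z σ τ) : Env bF X τ :=
  h.congr bF (h'.vis 0 (by omega)) (h'.vis 2 (by omega)) (h'.vis 3 (by omega))

theorem Env.lt_M (h : Env bF X σ) {j : ℕ} (hj : j < p) : j < X.M :=
  hj.trans_le ((Nat.le_self_pow (a_pos bF).ne' p).trans (h.hXq ▸ X.q_le))

theorem a_lt_L (hσ : Env bF X σ) : a < X.L :=
  lt_of_le_of_lt (Nat.le_mul_of_pos_left a (a_pos bF)) hσ.haL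

theorem digC_spec (hσ : Env bF X σ) (c : Cmd) (hm : ∀ b ∈ c.mods, b = 8 ∨ b = 9)
    (hc : ∀ τ l, l < a → (∀ b, b < 6 ∨ 9 < b → τ b = σ b) → τ 7 0 = l →
      c.den X τ 8 0 = dig bF z l) : Res X n d z σ ((digC d c).den X σ) := by
  have h := Cmd.loop_inv (rfl : (Cmd.loop 7 (inp 2)
      (.seq c (.set 6 0 (V 6 + V 8 * rd 3 (V 7))))).den X (put σ 6 0 0) = _) a
    (fun n τ => τ 6 0 = ∑ i ∈ Finset.range n, dig bF z i * p ^ i ∧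
      ∀ b, b < 6 ∨ 9 < b → τ b = σ b)
    (by simp [hσ.ha]) (a_lt_L bF hσ)
    ⟨by simp, fun b hb => by simp (disch := omega) only [put_of_ne]⟩ (by
      rintro n hn τ - h7 ⟨h6, hb⟩ _ rfl
      have hf : ∀ b, b ≠ 8 → b ≠ 9 → c.den X τ b = τ b := fun b h8 h9 =>
        c.den_frame X τ b fun h => by rcases hm b h with h | h <;> contradiction
      refine ⟨?_, fun b hb' => ?_⟩
      · simp [Cmd.den, hf, h6, h7, hc τ n hn hb h7, hb, hσ.hpow n hn, ← Finset.sum_range_succ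
          fun i => dig bF z i * p ^ i]
        exact Nat.mod_eq_of_lt ((sum_digits_lt _ (dig_lt bF z) _).trans_le
          ((Nat.pow_le_pow_right hp.out.pos hn).trans (hσ.hXq ▸ X.q_le)))
      · simp (disch := omega) only [Cmd.den, put_of_ne, hf, hb])
  have e1 : (digC d c).den X σ = put ((Cmd.loop 7 (inp 2)
      (.seq c (.set 6 0 (V 6 + V 8 * rd 3 (V 7))))).den X (put σ 6 0 0)) 5 d (X.code z) := by
    conv_rhs => rw [← X.code_mod, hσ.code, codeF, ← h.1]
    simp only [digC, Cmd.den, eval_ofNat, eval_read, eval_const, Nat.zero_mod]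
  rw [e1]
  exact ⟨put_same _ _ _ _, fun j hj => by rw [put_cell_ne _ _ _ _ _ hj.ne, h.2 5 (by omega)],
    fun b hb => by rw [put_of_ne _ _ _ _ (by omega), h.2 b (by omega)]⟩

theorem dg_eval (hσ : Env bF X σ) (h : ∀ b, b < 6 ∨ 9 < b → τ b = σ b) (hx : σ 5 d = X.code x)
    {e : Expr} {i : ℕ} (he : e.eval τ = i) (hi : i < a) : (dg d e).eval τ = dig bF x i := by
  simp [dg, h, hx, hσ.code, he, hσ.hpow _ hi, hσ.hp, codeF_digit bF x hi]

section

variable (hσ : Env bF X σ) (hx : σ 5 d = X.code x) (hy : σ 5 (d + 1) = X.code y)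
include hσ hx hy

theorem addC_spec : Res X n d (x + y) σ ((addC d).den X σ) := by
  refine digC_spec bF hσ _ (by simp [Cmd.mods]) fun τ l hl hτ h7 => ?_
  have e7 : (V 7).eval τ = l := by simp [h7]
  simp only [Cmd.den, eval_mod, eval_add, dg_eval bF hσ hτ hx e7 hl, dg_eval bF hσ hτ hy e7 hl,
    eval_ofNat, put_same, eval_read, eval_const, hτ 0 (by simp), hσ.hp]
  rw [dig_eq_of_cast bF (x := x + y) hl (by push_cast [cast_dig bF _ hl]; simp)]
  exact Nat.mod_eq_of_lt (hσ.lt_M bF (dig_lt bF _ _))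

theorem subC_spec : Res X n d (x - y) σ ((subC d).den X σ) := by
  refine digC_spec bF hσ _ (by simp [Cmd.mods]) fun τ l hl hτ h7 => ?_
  have e7 : (V 7).eval τ = l := by simp [h7]
  simp only [Cmd.den, eval_mod, eval_add, eval_sub, dg_eval bF hσ hτ hx e7 hl,
    dg_eval bF hσ hτ hy e7 hl, eval_ofNat, put_same, eval_read, eval_const, hτ 0 (by simp), hσ.hp]
  rw [dig_eq_of_cast bF (x := x - y) hl (by
    rw [Nat.cast_add, Nat.cast_sub (dig_lt bF y l).le, cast_dig bF _ hl, cast_dig bF _ hl]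
    simp [sub_eq_add_neg])]
  exact Nat.mod_eq_of_lt (hσ.lt_M bF (dig_lt bF _ _))

theorem mulC_spec : Res X n d (x * y) σ ((mulC d).den X σ) := by
  refine digC_spec bF hσ _ (by simp [Cmd.mods]) fun τ l hl hτ h7 => ?_
  have ha := a_pos bF
  let t : ℕ → ℕ := fun k => dig bF x (k / a) * dig bF y (k % a) * σ 0 (σ 2 3 + (k * a + l))
  have hl' := Cmd.loop_inv (rfl : (Cmd.loop 9 (inp 2 * inp 2)
    (.set 8 0 ((V 8 + dg d (V 9 / inp 2) * dg (d + 1) (V 9 % inp 2) *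
      rd 0 (rd 2 3 + (V 9 * inp 2 + V 7))) % inp 1))).den X (put τ 8 0 0) = _) (a * a)
    (fun n ρ => ρ 8 0 = (∑ k ∈ Finset.range n, t k) % p)
    (by simp [hτ 0, hσ.ha]) hσ.haL (by simp) (by
      rintro n hn ρ hρ h9 h8 _ rfl
      have hρτ : ∀ b, b ≠ 8 → b ≠ 9 → ρ b = τ b := fun b h8 h9 => by
        rw [hρ b (by simp [Cmd.mods, h8, h9]), put_of_ne _ _ _ _ h8]
      have hρσ : ∀ b, b < 6 ∨ 9 < b → ρ b = σ b := fun b hb => by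
        rw [hρτ b (by omega) (by omega), hτ b hb]
      rw [put_of_ne _ _ _ _ (by omega)]
      simp only [Cmd.den, eval_mod, eval_add, eval_mul]
      rw [dg_eval bF hσ hρσ hx (i := n / a) (by simp [h9, hρσ 0, hσ.ha])
          (Nat.div_lt_of_lt_mul hn),
        dg_eval bF hσ hρσ hy (i := n % a) (by simp [h9, hρσ 0, hσ.ha]) (Nat.mod_lt _ ha)]
      simp only [eval_ofNat, put_same, eval_read, eval_const, eval_add, eval_mul, h9, h8,
        hρτ 7 (by omega) (by omega), h7, hρσ 0 (by simp), hρσ 2 (by simp), hσ.ha, hσ.hp]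
      rw [Nat.mod_eq_of_lt (hσ.lt_M bF (Nat.mod_lt _ hp.out.pos)), Nat.mod_add_mod,
        Finset.sum_range_succ])
  simp only [Cmd.den, eval_ofNat, Nat.zero_mod] at hl' ⊢
  rw [hl']
  refine dig_eq_of_cast bF hl ?_
  have h1 : ∑ k ∈ Finset.range (a * a), t k = ∑ i ∈ Finset.range a, ∑ j ∈ Finset.range a,
      dig bF x i * dig bF y j * σ 0 (σ 2 3 + ((i * a + j) * a + l)) := by
    rw [← sum_range_mul_eq _ _ _ ha]
    exact Finset.sum_congr rfl fun k _ => by simp only [t]; rw [Nat.div_add_mod']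
  have h2 : x * y = ∑ i : Fin a, ∑ j : Fin a, (bF.repr x i * bF.repr y j) • (bF i * bF j) := by
    conv_lhs => rw [← bF.sum_repr x, ← bF.sum_repr y, Finset.sum_mul_sum]
    simp only [smul_mul_smul_comm]
  rw [h1, h2]
  simp only [Finset.sum_range, map_sum, map_smul, Finsupp.coe_finsetSum, Finset.sum_apply,
    Finsupp.smul_apply, Nat.cast_sum, Nat.cast_mul, smul_eq_mul]
  refine Finset.sum_congr rfl fun i _ => Finset.sum_congr rfl fun j _ => ?_
  rw [cast_dig bF x i.2, cast_dig bF y j.2, hσ.htab i j ⟨l, hl⟩, ZMod.natCast_val, ZMod.cast_id]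

end

/-! ### Elimination of the field operations -/

/-- The arrays programs may write. -/
abbrev usr (b : ℕ) : Prop := b = 1 ∨ 10 ≤ b ∧ b < 50

/-- Only visible arrays are read, of the arrays from `50` on only cell `0`. -/
def Expr.ok (n : List ℕ) : Expr → Bool
  | .const _ => true
  | .read b i => i.ok n && vis n b && (b < 50 || match i with | .const 0 => true | _ => false)
  | .bin _ e₁ e₂ => e₁.ok n && e₂.ok n

def FE.ok : List ℕ → FE → Bool
  | n, .nat e => e.ok n
  | n, .add f g => f.ok n && g.ok n
  | n, .sub f g => f.ok n && g.ok n
  | n, .mul f g => f.ok n && g.ok n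
  | n, .ite e f g => e.ok n && f.ok n && g.ok n
  | n, .sum x e f => 50 ≤ x && !n.contains x && e.ok n && f.ok (x :: n)

/-- The memories agree as far as expressions can see. -/
def Agree (n : List ℕ) (σ τ : Store) : Prop := ∀ b j, vis n b → b < 50 ∨ j = 0 → σ b j = τ b j

theorem Expr.eval_agree (h : Agree n σ τ) : ∀ e : Expr, e.ok n = true → e.eval σ = e.eval τ
  | .const _, _ => rfl
  | .read b i, he => by
    simp only [Expr.ok, Bool.and_eq_true, Bool.or_eq_true, decide_eq_true_eq] at he
    simp only [Expr.eval, Expr.eval_agree h i he.1.1]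
    refine h _ _ he.1.2 (he.2.imp_right fun h2 => ?_)
    match i, h2 with
    | .const 0, _ => rfl
  | .bin o e₁ e₂, he => by
    simp only [Expr.ok, Bool.and_eq_true] at he
    simp only [Expr.eval, Expr.eval_agree h e₁ he.1, Expr.eval_agree h e₂ he.2]

omit [Algebra (ZMod p) F] hp in
theorem FE.eval_agree (f : FE) : ∀ {n : List ℕ} {σ τ : Store}, Agree n σ τ → f.ok n = true →
    f.eval X σ = f.eval X τ := by
  induction f with
  | nat e => exact fun h hf => by simp only [FE.eval, Expr.eval_agree h e hf]
  | add f g ihf ihg | sub f g ihf ihg | mul f g ihf ihg =>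
    intro n σ τ h hf
    simp only [FE.ok, Bool.and_eq_true] at hf
    simp only [FE.eval, ihf h hf.1, ihg h hf.2]
  | ite e f g ihf ihg =>
    intro n σ τ h hf
    simp only [FE.ok, Bool.and_eq_true] at hf
    simp only [FE.eval, Expr.eval_agree h e hf.1.1, ihf h hf.1.2, ihg h hf.2]
  | sum x e f ih =>
    intro n σ τ h hf
    simp only [FE.ok, Bool.and_eq_true, decide_eq_true_eq, Bool.not_eq_true',
      List.contains_eq_mem, decide_eq_false_iff_not] at hf
    simp only [FE.eval, Expr.eval_agree h e hf.1.2]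
    refine Finset.sum_congr rfl fun i _ => ih (fun b j hb hj => ?_) hf.2
    rw [put_apply, put_apply]
    split_ifs with h'
    · rfl
    · exact h b j (by grind) hj

/-- Evaluates a field expression into cell `d` of array `5`. -/
def FE.lower : FE → ℕ → Cmd
  | .nat e, d => .set 5 (.const d) (e % rd 2 2)
  | .add f g, d => .seq (f.lower d) (.seq (g.lower (d + 1)) (addC d))
  | .sub f g, d => .seq (f.lower d) (.seq (g.lower (d + 1)) (subC d))
  | .mul f g, d => .seq (f.lower d) (.seq (g.lower (d + 1)) (mulC d))
  | .ite e f g, d => .ite e (f.lower d) (g.lower d)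
  | .sum x e f, d => .seq (.set 5 (.const d) 0) (.loop x e (.seq (f.lower (d + 1)) (addC d)))

/-- Array `5` is used as a stack: the value in cell `d` survives the evaluation of the next operand,
which only touches cells from `d + 1` on. -/
theorem FE.lower_spec (f : FE) : ∀ (n : List ℕ) (d : ℕ) (σ : Store), f.ok n = true → Env bF X σ →
    Res X n d (f.eval X σ) σ ((f.lower d).den X σ) := by
  have binop : ∀ {f g : FE} {op : F → F → F} {c : Cmd} {n : List ℕ} {d : ℕ} {σ : Store},
      (∀ {σ : Store} {x y : F}, Env bF X σ → σ 5 d = X.code x → σ 5 (d + 1) = X.code y →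
        Res X n d (op x y) σ (c.den X σ)) →
      (∀ (n : List ℕ) (d : ℕ) (σ : Store), f.ok n = true → Env bF X σ →
        Res X n d (f.eval X σ) σ ((f.lower d).den X σ)) →
      (∀ (n : List ℕ) (d : ℕ) (σ : Store), g.ok n = true → Env bF X σ →
        Res X n d (g.eval X σ) σ ((g.lower d).den X σ)) →
      (f.ok n && g.ok n) = true → Env bF X σ → Res X n d (op (f.eval X σ) (g.eval X σ)) σ
        (c.den X ((g.lower (d + 1)).den X ((f.lower d).den X σ))) := by
    intro f g op c n d σ hop hf hg hok hσ
    rw [Bool.and_eq_true] at hok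
    have h1 := hf n d σ hok.1 hσ
    have h2 := hg n (d + 1) _ hok.2 (hσ.res bF h1)
    rw [← FE.eval_agree g (fun b j hb _ => by rw [h1.vis b hb]) hok.2] at h2
    have h3 := hop ((hσ.res bF h1).res bF h2) (by rw [h2.lt d (by omega), h1.val]) h2.val
    exact h1.trans ⟨h3.val, fun j hj => by rw [h3.lt j hj, h2.lt j (by omega)], fun b hb => by
      rw [h3.vis b hb, h2.vis b hb]⟩ le_rfl
  induction f with
  | nat e =>
    intro n d σ hf hσ
    have e1 : e.eval σ % X.q % X.M = X.code (X.el (e.eval σ)) := by rw [← X.code_el, X.code_mod]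
    simp only [FE.lower, Cmd.den, eval_const, FE.eval, eval_mod, eval_read, eval_ofNat, hσ.hq, e1]
    exact ⟨put_same _ _ _ _, fun j hj => put_cell_ne _ _ _ _ _ hj.ne,
      fun b hb => put_of_ne _ _ _ _ (by omega)⟩
  | add f g ihf ihg => exact fun n d σ => binop (addC_spec bF) ihf ihg
  | sub f g ihf ihg => exact fun n d σ => binop (subC_spec bF) ihf ihg
  | mul f g ihf ihg => exact fun n d σ => binop (mulC_spec bF) ihf ihg
  | ite e f g ihf ihg =>
    intro n d σ hf hσ
    simp only [FE.ok, Bool.and_eq_true] at hf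
    simp only [FE.lower, Cmd.den, FE.eval]
    split_ifs
    exacts [ihf n d σ hf.1.2 hσ, ihg n d σ hf.2 hσ]
  | sum x e f ih =>
    intro n d σ hf hσ
    simp only [FE.ok, Bool.and_eq_true, decide_eq_true_eq, Bool.not_eq_true',
      List.contains_eq_mem, decide_eq_false_iff_not] at hf
    simp only [FE.lower, Cmd.den, FE.eval, eval_const, eval_ofNat, Nat.zero_mod]
    rw [Expr.eval_agree (σ := put σ 5 d 0) (fun b j hb _ => by rw [put_of_ne _ _ _ _ (by omega)])
      e hf.1.2]
    generalize e.eval σ % X.L = N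
    have hx : ∀ b, vis n b → b ≠ x := by grind
    suffices ∀ k, Res X n d (∑ i ∈ Finset.range k, f.eval X (put σ x 0 i)) σ
        (iter (fun τ => (addC d).den X ((f.lower (d + 1)).den X τ)) x N (put σ 5 d 0) k) ∧
        iter (fun τ => (addC d).den X ((f.lower (d + 1)).den X τ)) x N (put σ 5 d 0) k x 0 = k from
      (this N).1
    intro k
    induction k with
    | zero =>
      refine ⟨⟨?_, fun j hj => ?_, fun b hb => ?_⟩, put_same _ _ _ _⟩
      · simp (disch := omega) [iter, X.code_zero]
      · simp (disch := omega) only [iter, put_of_ne, put_cell_ne]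
      · have := hx b hb
        simp (disch := omega) only [iter, put_of_ne]
    | succ k ihk =>
      obtain ⟨h1, h2⟩ := ihk
      have h3 := ih (x :: n) (d + 1) _ hf.2 (hσ.res bF h1)
      -- The compiled loop has also written its bound to cell `1` of array `x`, which the meaning of
      -- the sum does not do. This is harmless because expressions read only cell `0` of arrays from
      -- `50` on.
      rw [FE.eval_agree (τ := put σ x 0 k) f (fun b j hb hj => by
        rw [put_apply]
        split_ifs with h
        · rw [h.1, h.2, h2]
        · rw [h1.vis b (by grind)]) hf.2] at h3
      have h4 := addC_spec bF (n := n) ((hσ.res bF h1).res bF h3)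
        (by rw [h3.lt d (by omega), h1.val]) h3.val
      refine ⟨⟨?_, fun j hj => ?_, fun b hb => ?_⟩, put_same _ _ _ _⟩
      · rw [iter, put_of_ne _ _ _ _ (by omega), h4.val, Finset.sum_range_succ]
      · rw [iter, put_of_ne _ _ _ _ (by omega), h4.lt j hj, h3.lt j (by omega), h1.lt j hj]
      · rw [iter, put_of_ne _ _ _ _ (hx b hb), h4.vis b hb, h3.vis b (by grind), h1.vis b hb]

def Cmd.lower : Cmd → Cmd
  | .skip => .skip
  | .set b i e => .set b i e
  | .setF b i f => .seq (f.lower 0) (.set b i (rd 5 (.const 0)))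
  | .seq c d => .seq c.lower d.lower
  | .ite e c d => .ite e c.lower d.lower
  | .loop x e c => .loop x e c.lower

/-- The expressions of the command read visible arrays, and it writes arrays a program may write. -/
def Cmd.wf : Cmd → Bool
  | .skip => true
  | .set b i e => usr b && i.ok [] && e.ok []
  | .setF b i f => usr b && i.ok [] && f.ok []
  | .seq c d => c.wf && d.wf
  | .ite e c d => e.ok [] && c.wf && d.wf
  | .loop x e c => usr x && e.ok [] && c.wf

def Cmd.ok (c : Cmd) : Bool := c.wf && c.lower.NoF

omit [Algebra (ZMod p) F] hp in
theorem Cmd.usr_mods (c : Cmd) (hc : c.wf = true) : ∀ b ∈ c.mods, usr b := by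
  induction c <;> simp_all [wf, mods, or_imp]

/-- The intermediate arrays are invisible to the expressions of the command, so the command and its
lowered version stay in step on visible arrays; the environment persists because arrays `0`, `2` and
`3` are never written. -/
theorem Cmd.lower_den (c : Cmd) (hc : c.wf = true) : ∀ σ τ : Store, (∀ b, vis [] b → σ b = τ b) →
    Env bF X σ → ∀ b, vis [] b → c.lower.den X σ b = c.den X τ b := by
  have hput : ∀ {σ τ : Store} (x i v : ℕ), (∀ b, vis [] b → σ b = τ b) →
      ∀ b, vis [] b → put σ x i v b = put τ x i v b := by
    intro σ τ x i v h b hb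
    funext j
    rw [put_apply, put_apply, h b hb]
  have ag : ∀ {σ τ : Store} {e : Expr}, e.ok [] = true → (∀ b, vis [] b → σ b = τ b) →
      e.eval σ = e.eval τ := fun he h => Expr.eval_agree (fun b j hb _ => by rw [h b hb]) _ he
  have env : ∀ {c : Cmd} {σ τ : Store}, (∀ b ∈ c.mods, usr b) → (∀ b, vis [] b → σ b = τ b) →
      (∀ b, vis [] b → c.lower.den X σ b = c.den X τ b) → Env bF X σ →
      Env bF X (c.lower.den X σ) := by
    intro c σ τ hc h h' hσ
    have : ∀ b, vis [] b → ¬usr b → c.lower.den X σ b = σ b := fun b hb hu => by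
      rw [h' b hb, c.den_frame X τ b fun hm => hu (hc b hm), h b hb]
    exact hσ.congr bF (this 0 (by omega) (by omega)) (this 2 (by omega) (by omega))
      (this 3 (by omega) (by omega))
  induction c with
  | skip => intro σ τ h _ b hb; exact h b hb
  | set a i e =>
    intro σ τ h hσ b hb
    simp only [wf, Bool.and_eq_true] at hc
    simp only [lower, den, ag hc.1.2 h, ag hc.2 h]
    exact hput _ _ _ h b hb
  | setF a i f =>
    intro σ τ h hσ b hb
    simp only [wf, Bool.and_eq_true] at hc
    have h1 := FE.lower_spec bF f [] 0 σ hc.2 hσ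
    have h' : ∀ b, vis [] b → (f.lower 0).den X σ b = τ b := fun b hb => by
      rw [h1.vis b hb, h b hb]
    simp only [lower, den, eval_read, eval_const, h1.val, X.code_mod, ag hc.1.2 h',
      FE.eval_agree f (σ := σ) (τ := τ) (fun b j hb _ => by rw [h b hb]) hc.2]
    exact hput _ _ _ h' b hb
  | seq c d ih₁ ih₂ =>
    intro σ τ h hσ b hb
    simp only [wf, Bool.and_eq_true] at hc
    have h1 := ih₁ hc.1 _ _ h hσ
    exact ih₂ hc.2 _ _ h1 (env (c.usr_mods hc.1) h h1 hσ) b hb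
  | ite e c d ih₁ ih₂ =>
    intro σ τ h hσ b hb
    simp only [wf, Bool.and_eq_true] at hc
    simp only [lower, den, ag hc.1.1 h]
    split_ifs
    exacts [ih₁ hc.1.2 _ _ h hσ b hb, ih₂ hc.2 _ _ h hσ b hb]
  | loop x e c ih =>
    intro σ τ h hσ b hb
    simp only [wf, Bool.and_eq_true, decide_eq_true_eq] at hc
    simp only [lower, den, ag hc.1.2 h]
    generalize e.eval τ % X.L = N
    have envput : ∀ {σ : Store} (i v : ℕ), Env bF X σ → Env bF X (put σ x i v) := fun i v h =>
      h.congr bF (put_of_ne _ _ _ _ (by omega)) (put_of_ne _ _ _ _ (by omega))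
        (put_of_ne _ _ _ _ (by omega))
    suffices ∀ n, (∀ b, vis [] b → iter (fun τ => c.lower.den X τ) x N σ n b =
        iter (fun τ => c.den X τ) x N τ n b) ∧
        Env bF X (iter (fun τ => c.lower.den X τ) x N σ n) from (this N).1 b hb
    intro n
    induction n with
    | zero => exact ⟨hput _ _ _ (hput _ _ _ h), envput _ _ (envput _ _ hσ)⟩
    | succ n ihn =>
      have h1 := ih hc.2 _ _ ihn.1 ihn.2
      exact ⟨hput _ _ _ h1, envput _ _ (env (c.usr_mods hc.2) ihn.1 h1 ihn.2)⟩

/-- The machine program of a command. -/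
def Cmd.compile (c : Cmd) : Prog := c.lower.prog

end

/-- Commands run in time polynomial in the number of iterations allowed for loops and the length of
the numbers in the memory, and the result is the one given by `den`. -/
theorem Cmd.compile_runs (c : Cmd) (hc : c.ok = true) : ∃ K, ∀ {p a : ℕ} {F : Type*} [Field F]
    [Fact p.Prime] [Algebra (ZMod p) F] (bF : Basis (Fin a) (ZMod p) F) (X : Ctx F) (β Z : ℕ)
    (σ : Store), Bd β σ → X.M.size ≤ β → X.L.size ≤ β → X.L + β + 2 ≤ Z → Env bF X σ →
    ∃ τ, (∃ t ≤ Z ^ K, Exec c.compile σ τ t) ∧ ∀ b, vis [] b → τ b = c.den X σ b := by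
  rw [ok, Bool.and_eq_true] at hc
  obtain ⟨K, hK⟩ := c.lower.prog_runs hc.2
  exact ⟨K, fun bF X β Z σ hσ h1 h2 h3 hE => ⟨_, (hK X β Z σ hσ h1 h2 h3 hE.hM hE.hL).1,
    c.lower_den bF hc.1 σ σ (fun _ _ => rfl) hE⟩⟩

/-! ### Preparation of the memory -/

/-- Writes the length of the `1`-st input number to cell `0` of array `7`. -/
def sizeProg : Prog :=
  .seq (.write 7 0 0) (.seq (.write 6 0 (inp 1))
    (.while (V 6) (.seq (.write 6 0 (V 6 / 2)) (.write 7 0 (V 7 + 1)))))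

/-- Writes the powers of `b` with exponents up to `e` to array `a`. -/
def powProg (a x : ℕ) (b e : Expr) : Prog :=
  .seq (.write a 0 1) (.seq (.write x 0 0)
    (.while (e - V x) (.seq (.write a (V x + 1) (rd a (V x) * b)) (.write x 0 (V x + 1)))))

/-- `S` lists the memories before the rounds and `M` those between the two writes of a round. Giving
both explicitly reduces the preparatory loops to checking equations between memories. -/
theorem exec_while_writes (e i₁ v₁ i₂ v₂ : Expr) (a₁ a₂ : ℕ) : ∃ K, ∀ (S M : ℕ → Store)
    (N β Z : ℕ), N + β + 2 ≤ Z → (∀ i ≤ N, Bd β (S i)) →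
    (∀ i < N, e.eval (S i) ≠ 0 ∧ Bd β (M i) ∧
      put (S i) a₁ (i₁.eval (S i)) (v₁.eval (S i)) = M i ∧
      put (M i) a₂ (i₂.eval (M i)) (v₂.eval (M i)) = S (i + 1)) → e.eval (S N) = 0 →
    ∃ t ≤ Z ^ K, Exec (.while e (.seq (.write a₁ i₁ v₁) (.write a₂ i₂ v₂))) (S 0) (S N) t := by
  obtain ⟨K₁, h₁⟩ := write_cost_le a₁ i₁ v₁
  obtain ⟨K₂, h₂⟩ := write_cost_le a₂ i₂ v₂
  obtain ⟨K₃, h₃⟩ := e.cost_le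
  refine ⟨1 + (1 + (K₁ + K₂ + 1 + K₃)), fun S M N β Z hZ hS hs hN => ?_⟩
  have hZ2 : 2 ≤ Z := by omega
  obtain ⟨t, ht, hx⟩ := exec_while (c := .seq (.write a₁ i₁ v₁) (.write a₂ i₂ v₂)) S N
    (Z ^ (K₁ + K₂ + 1 + K₃)) (fun i hi => ⟨(hs i hi).1, by
      obtain ⟨-, hB, e1, e2⟩ := hs i hi
      obtain ⟨t, ht, hx⟩ := h₁ _ β Z (hS i hi.le) (by omega)
      obtain ⟨t', ht', hx'⟩ := h₂ _ β Z hB (by omega)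
      rw [e1] at hx
      rw [e2] at hx'
      exact ⟨_, le_pow_mono hZ2 (le_pow_add hZ2 ht ht') (by omega), Exec.seq hx hx'⟩⟩) hN
    (fun i hi => le_pow_mono hZ2 (h₃ _ β Z (hS i hi) (by omega)).1 (by omega))
  exact ⟨t, ht.trans (le_pow_mul (a := 1) (by simp; omega) (le_pow_mul (a := 1)
    (by simpa using hZ2) le_rfl)), hx⟩

theorem sizeProg_runs : ∃ K, ∀ (σ : Store) (β Z : ℕ), Bd β σ → 2 * β + 2 ≤ Z →
    ∃ τ, (∃ t ≤ Z ^ K, Exec sizeProg σ τ t) ∧ Bd β τ ∧ τ 7 0 = (σ 0 1).size ∧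
      ∀ b, b ≠ 6 → b ≠ 7 → τ b = σ b := by
  obtain ⟨K₁, h₁⟩ := write_cost_le 7 0 0
  obtain ⟨K₂, h₂⟩ := write_cost_le 6 0 (inp 1)
  obtain ⟨K₃, h₃⟩ := exec_while_writes (V 6) 0 (V 6 / 2) 0 (V 7 + 1) 6 7
  refine ⟨K₁ + (K₂ + K₃ + 1) + 1, fun σ β Z hσ hZ => ?_⟩
  have hZ2 : 2 ≤ Z := by omega
  obtain ⟨x, hx⟩ : ∃ x, σ 0 1 = x := ⟨_, rfl⟩
  have hxβ : x.size ≤ β := hx ▸ hσ 0 1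
  have hB : ∀ i ≤ x.size, ∀ j, Bd β (put (put σ 7 0 i) 6 0 (x / 2 ^ j)) := fun i hi j =>
    (hσ.put ((Nat.size_le.2 Nat.lt_two_pow_self).trans (hi.trans hxβ))).put
      ((Nat.size_le_size (Nat.div_le_self _ _)).trans hxβ)
  obtain ⟨t, ht, hxt⟩ := h₃ (fun i => put (put σ 7 0 i) 6 0 (x / 2 ^ i))
    (fun i => put (put σ 7 0 i) 6 0 (x / 2 ^ (i + 1))) x.size β Z (by omega)
    (fun i hi => hB i hi i) (fun i hi => by
      refine ⟨?_, hB i hi.le _, ?_, ?_⟩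
      · simpa using (Nat.div_pos (Nat.lt_size.1 hi) (by positivity)).ne'
      · funext b j
        simp only [put_apply, eval_ofNat, eval_div, eval_read, eval_const, pow_succ,
          ← Nat.div_div_eq_div_mul]
        grind
      · funext b j
        simp only [put_apply, eval_ofNat, eval_add, eval_read, eval_const]
        grind) (by simp [Nat.div_eq_of_lt (Nat.lt_size_self x)])
  obtain ⟨t₁, ht₁, hx₁⟩ := h₁ σ β Z hσ (by omega)
  obtain ⟨t₂, ht₂, hx₂⟩ := h₂ (put σ 7 0 0) β Z (hσ.put (by simp)) (by omega)
  simp only [eval_ofNat, eval_read, eval_const] at hx₁ hx₂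
  rw [put_of_ne _ _ _ _ (by omega), hx] at hx₂
  exact ⟨_, ⟨_, le_pow_add hZ2 ht₁ (le_pow_add hZ2 ht₂ ht), Exec.seq hx₁ (Exec.seq hx₂ (by
    simpa using hxt))⟩, hB _ le_rfl _, by simp [hx], fun b h6 h7 => by simp [h6, h7]⟩

theorem powProg_runs (a x : ℕ) (b e : Expr) (hax : a ≠ x)
    (hb : b.Reads (fun c => c != a && c != x) = true)
    (he : e.Reads (fun c => c != a && c != x) = true) : ∃ K, ∀ (σ : Store) (β Z : ℕ), Bd β σ →
    e.eval σ + β + 2 ≤ Z → 0 < b.eval σ → (b.eval σ ^ e.eval σ).size ≤ β → (e.eval σ).size ≤ β →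
    ∃ τ, (∃ t ≤ Z ^ K, Exec (powProg a x b e) σ τ t) ∧ Bd β τ ∧
      (∀ i ≤ e.eval σ, τ a i = b.eval σ ^ i) ∧ ∀ c, c ≠ a → c ≠ x → τ c = σ c := by
  obtain ⟨K₁, h₁⟩ := write_cost_le a 0 1
  obtain ⟨K₂, h₂⟩ := write_cost_le x 0 0
  obtain ⟨K₃, h₃⟩ := exec_while_writes (e - V x) (V x + 1) (rd a (V x) * b) 0 (V x + 1) a x
  refine ⟨K₁ + (K₂ + K₃ + 1) + 1, fun σ β Z hσ hZ hB0 hBs hEs => ?_⟩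
  have hZ2 : 2 ≤ Z := by omega
  have hcong : ∀ τ : Store, (∀ c, c ≠ a → c ≠ x → τ c = σ c) →
      b.eval τ = b.eval σ ∧ e.eval τ = e.eval σ := by
    intro τ hτ
    have : ∀ c, (fun c => c != a && c != x) c = true → τ c = σ c := fun c hc => by
      simp only [Bool.and_eq_true, bne_iff_ne] at hc
      exact hτ c hc.1 hc.2
    exact ⟨Expr.eval_congr this b hb, Expr.eval_congr this e he⟩
  generalize b.eval σ = B at *
  generalize e.eval σ = E at *
  have hpow : ∀ i ≤ E, (B ^ i).size ≤ β := fun i hi =>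
    (Nat.size_le_size (Nat.pow_le_pow_right hB0 hi)).trans hBs
  let S : ℕ → Store := fun n => Nat.rec (put (put σ a 0 1) x 0 0)
    (fun i τ => put (put τ a (i + 1) (B ^ (i + 1))) x 0 (i + 1)) n
  have hS1 : ∀ i, S (i + 1) = put (put (S i) a (i + 1) (B ^ (i + 1))) x 0 (i + 1) := fun i => rfl
  have hS : ∀ i ≤ E, Bd β (S i) ∧ S i x 0 = i ∧ (∀ j ≤ i, S i a j = B ^ j) ∧
      ∀ c, c ≠ a → c ≠ x → S i c = σ c := by
    intro i
    induction i with
    | zero =>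
      refine fun _ => ⟨(hσ.put (by simpa using hpow 0)).put (by simp), put_same _ _ _ _,
        fun j hj => ?_, fun c h h' => by simp [S, h, h']⟩
      obtain rfl : j = 0 := by omega
      simp [S, hax]
    | succ i ih =>
      intro hi
      obtain ⟨i1, i2, i3, i4⟩ := ih (by omega)
      refine ⟨(i1.put (hpow _ hi)).put ((Nat.size_le_size hi).trans hEs), put_same _ _ _ _,
        fun j hj => ?_, fun c h h' => by rw [hS1]; simp [h, h', i4]⟩
      rw [hS1, put_of_ne _ _ _ _ hax, put_apply]
      split_ifs with h
      · rw [h.2]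
      · exact i3 j (by grind)
  obtain ⟨t, ht, hxt⟩ := h₃ S (fun i => put (S i) a (i + 1) (B ^ (i + 1))) E β Z (by omega)
    (fun i hi => (hS i hi).1) (fun i hi => by
      obtain ⟨i1, i2, i3, i4⟩ := hS i hi.le
      refine ⟨?_, i1.put (hpow _ hi), ?_, ?_⟩
      · simp only [eval_sub, eval_read, eval_const, i2, (hcong _ i4).2]
        omega
      · simp only [eval_add, eval_mul, eval_read, eval_const, eval_ofNat, i2, (hcong _ i4).1,
          i3 i le_rfl, pow_succ]
      · simp [hax.symm, i2, hS1])
    (by simp [(hS E le_rfl).2.1, (hcong _ (hS E le_rfl).2.2.2).2])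
  have hEnd := hS E le_rfl
  obtain ⟨t₁, ht₁, hx₁⟩ := h₁ σ β Z hσ (by omega)
  obtain ⟨t₂, ht₂, hx₂⟩ := h₂ (put σ a 0 1) β Z (hσ.put (by simpa using hpow 0)) (by omega)
  exact ⟨S E, ⟨_, le_pow_add hZ2 ht₁ (le_pow_add hZ2 ht₂ ht), Exec.seq hx₁ (Exec.seq hx₂ hxt)⟩,
    hEnd.1, hEnd.2.2.1, hEnd.2.2.2⟩

/-- Prepares the memory for the machine program of a command: the powers of `p` in array `3`, the
powers of `q` with exponents up to `ee` in array `4`, the constants in array `2`. -/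
def prelude (h : ℕ) (ee le me : Expr) : Prog :=
  .seq sizeProg (.seq (powProg 3 6 (inp 1) (inp 2)) (.seq (.write 2 2 (rd 3 (inp 2)))
    (.seq (powProg 4 6 (rd 2 2) ee) (.seq (.write 2 3 (.const (h + 1)))
      (.seq (.write 2 1 le) (.write 2 0 me))))))

/-- What the expressions for the moduli may rely on. -/
structure Prep (p a E : ℕ) (input : List ℕ) (τ : Store) : Prop where
  h0 : τ 0 = listArray input
  h3 : ∀ i ≤ a, τ 3 i = p ^ i
  h4 : ∀ i ≤ E, τ 4 i = (p ^ a) ^ i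
  h22 : τ 2 2 = p ^ a
  h7 : τ 7 0 = p.size

/-- The expression for `L` may use the tables of powers and the length of `p`; the one for `M` may
in addition use `L`, which is therefore stored first. -/
theorem prelude_runs (h : ℕ) (ee le me : Expr)
    (hee : ee.Reads (fun c => c != 4 && c != 6) = true) :
    ∃ K, ∀ (p a M L E : ℕ) (input : List ℕ) (β Z : ℕ) (σ : Store), 0 < p →
      σ 0 = listArray input → Bd β σ → listArray input 1 = p → listArray input 2 = a →
      M.size ≤ β → L.size ≤ β → ((p ^ a) ^ E).size ≤ β → p ^ a ≤ M → a ≤ L → E ≤ L → h + 1 ≤ M →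
      L + 2 * β + 2 ≤ Z →
      (∀ τ : Store, τ 0 = listArray input → τ 2 2 = p ^ a → ee.eval τ = E) →
      (∀ τ, Prep p a E input τ → le.eval τ = L) →
      (∀ τ, Prep p a E input τ → τ 2 1 = L → me.eval τ = M) →
      ∃ τ, (∃ t ≤ Z ^ K, Exec (prelude h ee le me) σ τ t) ∧ Bd β τ ∧ Prep p a E input τ ∧
        τ 2 0 = M ∧ τ 2 1 = L ∧ τ 2 3 = h + 1 := by
  obtain ⟨K₁, h₁⟩ := sizeProg_runs
  obtain ⟨K₂, h₂⟩ := powProg_runs 3 6 (inp 1) (inp 2) (by decide) (by decide) (by decide)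
  obtain ⟨K₃, h₃⟩ := write_cost_le 2 2 (rd 3 (inp 2))
  obtain ⟨K₄, h₄⟩ := powProg_runs 4 6 (rd 2 2) ee (by decide) (by decide) hee
  obtain ⟨K₅, h₅⟩ := write_cost_le 2 3 (.const (h + 1))
  obtain ⟨K₆, h₆⟩ := write_cost_le 2 1 le
  obtain ⟨K₇, h₇⟩ := write_cost_le 2 0 me
  refine ⟨K₁ + (K₂ + (K₃ + (K₄ + (K₅ + (K₆ + K₇ + 1) + 1) + 1) + 1) + 1) + 1,
    fun p a M L E input β Z σ hp hσ0 hσ hip hia hM hL hE hpM haL hEL hhM hZ hee' hle hme =>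
    ?_⟩
  have hZ2 : 2 ≤ Z := by omega
  obtain ⟨σ₁, ⟨t₁, ht₁, x₁⟩, b₁, r₁, f₁⟩ := h₁ σ β Z hσ (by omega)
  have e10 : σ₁ 0 = listArray input := by rw [f₁ 0 (by omega) (by omega), hσ0]
  have ep : (inp 1).eval σ₁ = p := by simp [e10, hip]
  have ea : (inp 2).eval σ₁ = a := by simp [e10, hia]
  have hpa : (p ^ a).size ≤ β := (Nat.size_le_size hpM).trans hM
  have haβ : a.size ≤ β := (Nat.size_le_size haL).trans hL
  have hEβ : E.size ≤ β := (Nat.size_le_size hEL).trans hL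
  obtain ⟨σ₂, ⟨t₂, ht₂, x₂⟩, b₂, r₂, f₂⟩ := h₂ σ₁ β Z b₁ (by rw [ea]; omega) (by rwa [ep])
    (by rwa [ep, ea]) (by rwa [ea])
  rw [ep, ea] at r₂
  have e20 : σ₂ 0 = listArray input := by rw [f₂ 0 (by omega) (by omega), e10]
  obtain ⟨t₃, ht₃, x₃⟩ := h₃ σ₂ β Z b₂ (by omega)
  have eq3 : put σ₂ 2 ((2 : Expr).eval σ₂) ((rd 3 (inp 2)).eval σ₂) = put σ₂ 2 2 (p ^ a) := by
    simp [e20, hia, r₂ a le_rfl]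
  rw [eq3] at x₃
  have b₃ : Bd β (put σ₂ 2 2 (p ^ a)) := b₂.put hpa
  have e30 : put σ₂ 2 2 (p ^ a) 0 = listArray input := by rw [put_of_ne _ _ _ _ (by omega), e20]
  have eE := hee' _ e30 (put_same _ _ _ _)
  have eq : (rd 2 2).eval (put σ₂ 2 2 (p ^ a)) = p ^ a := by simp
  obtain ⟨σ₄, ⟨t₄, ht₄, x₄⟩, b₄, r₄, f₄⟩ := h₄ (put σ₂ 2 2 (p ^ a)) β Z b₃ (by rw [eE]; omega)
    (by rw [eq]; positivity) (by rwa [eq, eE]) (by rwa [eE])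
  rw [eq, eE] at r₄
  have P₄ : Prep p a E input σ₄ := by
    refine ⟨?_, fun i hi => ?_, r₄, ?_, ?_⟩ <;> simp [f₄, e20, r₂, f₂, r₁, hσ0, hip, *]
  have Pput : ∀ {τ : Store} (i v : ℕ), i ≠ 2 → Prep p a E input τ →
      Prep p a E input (put τ 2 i v) := fun i v hi P => by
    refine ⟨?_, fun j hj => ?_, fun j hj => ?_, ?_, ?_⟩ <;>
    simp [P.h0, P.h3, P.h4, P.h22, P.h7, put_cell_ne, hi.symm, *]
  obtain ⟨t₅, ht₅, x₅⟩ := h₅ σ₄ β Z b₄ (by omega)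
  simp only [eval_const, eval_ofNat] at x₅
  have P₅ := Pput 3 (h + 1) (by omega) P₄
  have b₅ : Bd β (put σ₄ 2 3 (h + 1)) := b₄.put ((Nat.size_le_size hhM).trans hM)
  obtain ⟨t₆, ht₆, x₆⟩ := h₆ _ β Z b₅ (by omega)
  rw [hle _ P₅, eval_ofNat] at x₆
  have P₆ := Pput 1 L (by omega) P₅
  have b₆ : Bd β (put (put σ₄ 2 3 (h + 1)) 2 1 L) := b₅.put hL
  obtain ⟨t₇, ht₇, x₇⟩ := h₇ _ β Z b₆ (by omega)
  rw [hme _ P₆ (put_same _ _ _ _), eval_ofNat] at x₇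
  have P₇ := Pput 0 M (by omega) P₆
  refine ⟨_, ⟨_, ?_, Exec.seq x₁ (Exec.seq x₂ (Exec.seq x₃ (Exec.seq x₄ (Exec.seq x₅
    (Exec.seq x₆ x₇)))))⟩, b₆.put hM, P₇, put_same _ _ _ _, ?_, ?_⟩
  · exact le_pow_add hZ2 ht₁ (le_pow_add hZ2 ht₂ (le_pow_add hZ2 ht₃ (le_pow_add hZ2 ht₄
      (le_pow_add hZ2 ht₅ (le_pow_add hZ2 ht₆ ht₇)))))
  · rw [put_cell_ne _ _ _ _ _ (by omega), put_same]
  · rw [put_cell_ne _ _ _ _ _ (by omega), put_cell_ne _ _ _ _ _ (by omega), put_same]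

@[simp] theorem listArray_zero (l : List ℕ) : listArray l 0 = l.length := rfl
@[simp] theorem listArray_succ (l : List ℕ) (i : ℕ) : listArray l (i + 1) = l.getD i 0 := rfl

/-! ### Encodings -/

theorem concatFin_succ {n : ℕ} (g : Fin (n + 1) → List ℕ) :
    concatFin g = g 0 ++ concatFin fun i => g i.succ := by
  simp [concatFin, List.ofFn_succ]

theorem length_concatFin {n ℓ : ℕ} (g : Fin n → List ℕ) (hg : ∀ i, (g i).length = ℓ) :
    (concatFin g).length = n * ℓ := by
  induction n with
  | zero => simp [concatFin]
  | succ n ih =>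
    rw [concatFin_succ, List.length_append, hg, ih _ fun i => hg _]
    ring

theorem getD_concatFin {n ℓ : ℕ} (g : Fin n → List ℕ) (hg : ∀ i, (g i).length = ℓ) (i : Fin n)
    {j : ℕ} (hj : j < ℓ) : (concatFin g).getD (i * ℓ + j) 0 = (g i).getD j 0 := by
  induction n with
  | zero => exact i.elim0
  | succ n ih =>
    rw [concatFin_succ]
    refine Fin.cases ?_ (fun i => ?_) i
    · rw [List.getD_append _ _ _ _ (by rw [hg]; simpa using hj)]
      simp
    · have e : ((i.succ : Fin (n + 1)) : ℕ) * ℓ + j = ℓ + (i * ℓ + j) := by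
        rw [Fin.val_succ]; ring
      rw [List.getD_append_right _ _ _ _ (by rw [hg, e]; omega), hg, e, Nat.add_sub_cancel_left]
      exact ih (fun i => g i.succ) (fun i => hg _) i

/-- Extension of a finite family by zero. -/
def ext {A : Type*} [Zero A] {n : ℕ} (x : Fin n → A) (i : ℕ) : A := if h : i < n then x ⟨i, h⟩ else 0

@[simp] theorem ext_val {A : Type*} [Zero A] {n : ℕ} (x : Fin n → A) (i : Fin n) :
    ext x i = x i := by simp [ext]

theorem ext_of_lt {A : Type*} [Zero A] {n : ℕ} (x : Fin n → A) {i : ℕ} (h : i < n) :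
    ext x i = x ⟨i, h⟩ := by simp [ext, h]

section

variable {p a m : ℕ} {F K : Type*} [Field F] [Field K] [hp : Fact p.Prime] [Algebra (ZMod p) F]
  [Algebra F K] (bF : Basis (Fin a) (ZMod p) F) (bK : Basis (Fin m) F K)

/-- The list holds the digits of the elements `z 0, …, z (N - 1)`. -/
def Enc (l : List ℕ) (N : ℕ) (z : ℕ → F) : Prop :=
  l.length = N * a ∧ ∀ i < N, ∀ d < a, l.getD (i * a + d) 0 = dig bF (z i) d

theorem mul_add_lt {i d N a : ℕ} (hi : i < N) (hd : d < a) : i * a + d < N * a := by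
  have : (i + 1) * a ≤ N * a := Nat.mul_le_mul_right _ hi
  nlinarith

theorem enc_encF (x : F) : Enc bF (encF bF x) 1 fun _ => x := by
  refine ⟨by simp [encF], fun i hi d hd => ?_⟩
  obtain rfl : i = 0 := by omega
  rw [zero_mul, zero_add, encF, List.getD_eq_getElem _ _ (by simpa using hd)]
  simp [dig, hd]

theorem Enc.congr {l : List ℕ} {N : ℕ} {z z' : ℕ → F} (h : Enc bF l N z)
    (hz : ∀ i < N, z i = z' i) : Enc bF l N z' :=
  ⟨h.1, fun i hi d hd => by rw [h.2 i hi d hd, hz i hi]⟩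

theorem Enc.concat {n ℓ : ℕ} {g : Fin n → List ℕ} {z : ℕ → ℕ → F}
    (hg : ∀ i : Fin n, Enc bF (g i) ℓ (z i)) :
    Enc bF (concatFin g) (n * ℓ) fun j => z (j / ℓ) (j % ℓ) := by
  refine ⟨by rw [length_concatFin g fun i => (hg i).1]; ring, fun j hj d hd => ?_⟩
  have hℓ : 0 < ℓ := Nat.pos_of_ne_zero (by rintro rfl; simp at hj)
  have hi : j / ℓ < n := Nat.div_lt_of_lt_mul (by rwa [mul_comm])
  have hm := Nat.mod_lt j hℓ
  have e : j * a + d = ((⟨j / ℓ, hi⟩ : Fin n) : ℕ) * (ℓ * a) + (j % ℓ * a + d) := by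
    conv_lhs => rw [← Nat.div_add_mod j ℓ]
    simp only
    ring
  rw [e, getD_concatFin g (fun i => (hg i).1) _ (mul_add_lt hm hd)]
  exact (hg ⟨j / ℓ, hi⟩).2 _ hm d hd

theorem Enc.append {l₁ l₂ : List ℕ} {N₁ N₂ : ℕ} {z₁ z₂ : ℕ → F} (h₁ : Enc bF l₁ N₁ z₁)
    (h₂ : Enc bF l₂ N₂ z₂) :
    Enc bF (l₁ ++ l₂) (N₁ + N₂) fun i => if i < N₁ then z₁ i else z₂ (i - N₁) := by
  refine ⟨by rw [List.length_append, h₁.1, h₂.1]; ring, fun i hi d hd => ?_⟩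
  dsimp only
  split_ifs with h
  · rw [List.getD_append _ _ _ _ (by rw [h₁.1]; exact mul_add_lt h hd), h₁.2 i h d hd]
  · have h' : N₁ * a ≤ i * a := Nat.mul_le_mul_right _ (not_lt.1 h)
    rw [List.getD_append_right _ _ _ _ (by rw [h₁.1]; omega), h₁.1,
      ← h₂.2 (i - N₁) (by omega) d hd, Nat.sub_mul]
    congr 1
    omega

theorem enc_encFVec {n : ℕ} (x : Fin n → F) : Enc bF (encFVec bF x) n (ext x) := by
  have := Enc.concat bF (g := fun i => encF bF (x i)) (ℓ := 1) (z := fun i _ => ext x i)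
    fun i => by simpa using enc_encF bF (x i)
  simpa [encFVec] using this

/-- The coordinates of `y`. -/
noncomputable def kc (y : K) (c : ℕ) : F := ext (fun i => bK.repr y i) c

theorem enc_encK (y : K) : Enc bF (encK bF bK y) m (kc bK y) := enc_encFVec bF _

theorem enc_encKVec {n : ℕ} (y : Fin n → K) :
    Enc bF (encKVec bF bK y) (n * m) fun j => kc bK (ext y (j / m)) (j % m) :=
  Enc.concat bF (z := fun i j => kc bK (ext y i) j) fun i => by
    simpa using enc_encK bF bK (y i)

theorem enc_encKMat {t n : ℕ} (v : Fin t → Fin n → K) :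
    Enc bF (encKMat bF bK v) (t * (n * m))
      fun j => kc bK (ext (ext v (j / (n * m))) (j % (n * m) / m)) (j % (n * m) % m) :=
  Enc.concat bF (z := fun i j => kc bK (ext (ext v i) (j / m)) (j % m)) fun i => by
    simpa using enc_encKVec bF bK (v i)

theorem enc_tableF : Enc bF (tableF bF) (a * (a * 1))
    fun j => ext bF (j / (a * 1)) * ext bF (j % (a * 1) / 1) :=
  Enc.concat bF (z := fun i j => ext bF i * ext bF (j / 1)) fun i =>
    Enc.concat bF (z := fun j _ => ext bF i * ext bF j) fun j => by
      simpa using enc_encF bF (bF i * bF j)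

theorem enc_tableK : Enc bF (tableK bF bK) (m * (m * m))
    fun j => kc bK (ext bK (j / (m * m)) * ext bK (j % (m * m) / m)) (j % (m * m) % m) :=
  Enc.concat bF (z := fun i j => kc bK (ext bK i * ext bK (j / m)) (j % m)) fun i =>
    Enc.concat bF (z := fun j c => kc bK (ext bK i * ext bK j) c) fun j => by
      simpa using enc_encK bF bK (bK i * bK j)

/-! ### Input and output -/

variable {X : Ctx F} {σ : Store}

/-- Writes the numbers of the field elements whose digits start at position `o` of the input to
array `10`. -/
def inC (o N : Expr) : Cmd :=
  .loop 42 N (.setF 10 (V 42) (.sum 50 (inp 2)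
    (.nat (rd 0 (o + (V 42 * inp 2 + V 50)) * rd 3 (V 50)))))

/-- Writes the digits of the field elements in array `44`, preceded by the length and space for `h`
numbers. -/
def outC (h N : Expr) : Cmd :=
  .seq (.set 1 0 (h + N * inp 2)) (.loop 43 (N * inp 2) (.set 1 (1 + h + V 43)
    (rd 44 (V 43 / inp 2) / rd 3 (V 43 % inp 2) % inp 1)))

theorem mul_add_div_self {i c w : ℕ} (hc : c < w) : (i * w + c) / w = i := by
  rw [Nat.mul_comm, Nat.mul_add_div (by omega), Nat.div_eq_of_lt hc, add_zero]

theorem mul_add_mod_self {i c w : ℕ} (hc : c < w) : (i * w + c) % w = c := by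
  rw [Nat.mul_comm, Nat.mul_add_mod, Nat.mod_eq_of_lt hc]

section

variable {x b : ℕ} {e : Expr} {f : FE} {ρ : Store}
  (hρ : (Cmd.loop x e (.setF b (V x) f)).den X σ = ρ) (N : ℕ)
include hρ

/-- The command `for x < N: b[x] := f`, if `f` depends only on earlier cells of array `b`. -/
theorem tab_rec (g : ℕ → F) (hN : e.eval σ = N) (hNL : N < X.L)
    (hf : ∀ τ i, i < N → (∀ (c : ℕ) (_ : c ≠ b := by decide) (_ : c ≠ x := by decide),
      τ c = σ c) → τ x 0 = i → (∀ j < i, τ b j = X.code (g j)) → f.eval X τ = g i)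
    (hxb : x ≠ b := by decide) : ∀ i < N, ρ b i = X.code (g i) := by
  refine Cmd.loop_inv hρ N (fun n τ => ∀ i < n, τ b i = X.code (g i)) hN hNL (by simp) ?_
  rintro n hn τ hτ hx h _ rfl i hi
  rw [put_of_ne _ _ _ _ hxb.symm]
  simp only [Cmd.den, eval_read, eval_const, hx,
    hf τ n hn (fun c hc hc' => hτ c (by simp [Cmd.mods, hc, hc'])) hx h]
  by_cases hin : i = n
  · rw [hin, put_same]
  · rw [put_cell_ne _ _ _ _ _ hin, h i (by omega)]

/-- The command `for x < N: b[x] := f`, if `f` does not depend on array `b`. -/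
theorem tab_spec (g : ℕ → F) (hN : e.eval σ = N) (hNL : N < X.L)
    (hf : ∀ τ i, i < N → (∀ (c : ℕ) (_ : c ≠ b := by decide) (_ : c ≠ x := by decide),
      τ c = σ c) → τ x 0 = i → f.eval X τ = g i)
    (hxb : x ≠ b := by decide) : ∀ i < N, ρ b i = X.code (g i) :=
  tab_rec hρ N g hN hNL (fun τ i hi h h' _ => hf τ i hi @h h') hxb

/-- A table with rows of length `w`. -/
theorem tab2_rec (w : ℕ) (g : ℕ → ℕ → F) (hN : e.eval σ = N * w) (hNL : N * w < X.L)
    (hf : ∀ τ i j, i < N → j < w → (∀ (c : ℕ) (_ : c ≠ b := by decide) (_ : c ≠ x := by decide),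
      τ c = σ c) → τ x 0 = i * w + j → (∀ i' j', i' * w + j' < i * w + j → j' < w →
      τ b (i' * w + j') = X.code (g i' j')) → f.eval X τ = g i j) (hxb : x ≠ b := by decide) :
    ∀ i < N, ∀ j < w, ρ b (i * w + j) = X.code (g i j) := by
  intro i hi j hj
  rw [tab_rec hρ (N * w) (fun z => g (z / w) (z % w)) hN hNL (fun τ z hz hτ hx hr => ?_) hxb _
    (mul_add_lt hi hj), mul_add_div_self hj, mul_add_mod_self hj]
  have hw : 0 < w := Nat.pos_of_ne_zero (by rintro rfl; simp at hz)
  refine hf τ _ _ (Nat.div_lt_of_lt_mul (by rwa [mul_comm])) (Nat.mod_lt _ hw) @hτ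
    (by rw [hx, Nat.div_add_mod' z w]) fun i' j' h hj' => ?_
  rw [hr _ (by rwa [Nat.div_add_mod' z w] at h), mul_add_div_self hj', mul_add_mod_self hj']

theorem tab2_spec (w : ℕ) (g : ℕ → ℕ → F) (hN : e.eval σ = N * w) (hNL : N * w < X.L)
    (hf : ∀ τ i j, i < N → j < w → (∀ (c : ℕ) (_ : c ≠ b := by decide) (_ : c ≠ x := by decide),
      τ c = σ c) → τ x 0 = i * w + j → f.eval X τ = g i j) (hxb : x ≠ b := by decide) :
    ∀ i < N, ∀ j < w, ρ b (i * w + j) = X.code (g i j) :=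
  tab2_rec hρ N w g hN hNL (fun τ i j hi hj h h' _ => hf τ i j hi hj @h h') hxb

end

theorem Env.step {ρ : Store} {c : Cmd} (h : Env bF X σ) (hρ : c.den X σ = ρ)
    (hc : c.keeps [0, 2, 3] = true := by rfl) : Env bF X ρ :=
  have e := frs hρ _ hc
  h.congr bF (e 0 (by simp)) (e 2 (by simp)) (e 3 (by simp))

theorem elF_input (x : F) :
    ∑ d ∈ Finset.range a, elF bF (dig bF x d * p ^ d) = x := by
  rw [Finset.sum_range]
  conv_rhs => rw [← bF.sum_repr x]
  refine Finset.sum_congr rfl fun i _ => ?_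
  rw [elF_digit bF (dig_lt bF x i) i.2, cast_dig bF x i.2]

theorem inC_spec (hσ : Env bF X σ) {o Ne : Expr} {ρ : Store} (hρ : (inC o Ne).den X σ = ρ) (N : ℕ)
    (z : ℕ → F) (hN : Ne.eval σ = N) (hNL : N < X.L)
    (ho : ∀ τ : Store, τ 0 = σ 0 → o.eval τ = o.eval σ)
    (hz : ∀ i < N, ∀ d < a, σ 0 (o.eval σ + (i * a + d)) = dig bF (z i) d) :
    ∀ i < N, ρ 10 i = X.code (z i) := by
  refine tab_spec hρ N z hN hNL fun τ i hi hτ h42 => ?_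
  have h0 : τ 0 = σ 0 := hτ 0
  simp only [FE.eval, eval_read, eval_const, h0, hσ.ha, Nat.mod_eq_of_lt (a_lt_L bF hσ), hσ.el]
  refine (Finset.sum_congr rfl fun d hd => ?_).trans (elF_input bF (z i))
  rw [Finset.mem_range] at hd
  simp [ho (put τ 50 0 d) (by simp [h0]), h0, h42, hσ.ha, hz i hi d hd, hσ.hpow d hd, hτ 3]

theorem outC_spec (hσ : Env bF X σ) {he Ne : Expr} {ρ : Store} (hρ : (outC he Ne).den X σ = ρ)
    (h N : ℕ) (z : ℕ → F) (hN : ∀ τ : Store, (∀ b, b ≠ 1 → b ≠ 43 → τ b = σ b) → Ne.eval τ = N)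
    (hh : ∀ τ : Store, (∀ b, b ≠ 1 → b ≠ 43 → τ b = σ b) → he.eval τ = h)
    (hNL : N * a < X.L) (hNM : h + N * a < X.M) (hz : ∀ i < N, σ 44 i = X.code (z i)) :
    ρ 1 0 = h + N * a ∧ (∀ i < N, ∀ d < a, ρ 1 (1 + h + (i * a + d)) = dig bF (z i) d) ∧
    ∀ i, 0 < i → i ≤ h → ρ 1 i = σ 1 i := by
  have ha := a_pos bF
  rw [outC, Cmd.den_seq, Cmd.den_set] at hρ
  simp only [eval_add, eval_mul, hN σ (fun _ _ _ => rfl), hh σ (fun _ _ _ => rfl), eval_read,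
    eval_const, eval_ofNat, hσ.ha, Nat.mod_eq_of_lt hNM] at hρ
  have hl := Cmd.loop_inv hρ (N * a)
    (fun n τ => τ 1 0 = h + N * a ∧ (∀ i < n, τ 1 (1 + h + i) = dig bF (z (i / a)) (i % a)) ∧
      ∀ i, 0 < i → i ≤ h → τ 1 i = σ 1 i)
    (by simp [hN _ fun b hb _ => put_of_ne σ _ _ _ hb, hσ.ha]) hNL
    ⟨by simp, by simp, fun i hi _ => by simp [put_cell_ne, hi.ne']⟩ (by
    rintro n hn τ hτ h43 ⟨h1, h2, h3⟩ _ rfl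
    have hτσ : ∀ b, b ≠ 1 → b ≠ 43 → τ b = σ b := fun b hb hb' => by
      rw [hτ b (by simp [Cmd.mods, hb, hb']), put_of_ne _ _ _ _ hb]
    have hm := Nat.mod_lt n ha
    have hna : n / a < N := Nat.div_lt_of_lt_mul (by rwa [mul_comm])
    have e1 : σ 44 (n / a) / p ^ (n % a) % p % X.M = dig bF (z (n / a)) (n % a) := by
      rw [hz _ hna, hσ.code, codeF_digit bF _ hm, Nat.mod_eq_of_lt (hσ.lt_M bF (dig_lt bF _ _))]
    simp only [Cmd.den, eval_add, eval_div, eval_mod, eval_ofNat, eval_read, eval_const, hh τ hτσ,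
      h43, hτσ 44 (by omega) (by omega), hτσ 0 (by omega) (by omega), hτσ 3 (by omega) (by omega),
      hσ.ha, hσ.hp, hσ.hpow _ hm, e1]
    rw [put_of_ne _ _ _ _ (by omega)]
    refine ⟨by rw [put_cell_ne _ _ _ _ _ (by omega), h1], fun i hi => ?_, fun i hi hi' => by
      rw [put_cell_ne _ _ _ _ _ (by omega), h3 i hi hi']⟩
    by_cases hin : i = n
    · rw [hin, put_same]
    · rw [put_cell_ne _ _ _ _ _ (by omega), h2 i (by omega)])
  refine ⟨hl.1, fun i hi d hd => ?_, hl.2.2⟩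
  rw [hl.2.1 _ (mul_add_lt hi hd), mul_add_div_self hd, mul_add_mod_self hd]

/-- The output of `outC` is the encoding of a list of field elements. -/
theorem listArray_of_enc {hd l : List ℕ} {N : ℕ} {z : ℕ → F} {A : ℕ → ℕ} (hl : Enc bF l N z)
    (h0 : A 0 = hd.length + N * a)
    (h1 : ∀ i, 0 < i → i ≤ hd.length → A i = listArray (hd ++ l) i)
    (h2 : ∀ i < N, ∀ d < a, A (1 + hd.length + (i * a + d)) = dig bF (z i) d) :
    ∀ i ≤ (hd ++ l).length, A i = listArray (hd ++ l) i := by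
  intro i hi
  rcases Nat.eq_zero_or_pos i with rfl | hi0
  · rw [h0, listArray_zero, List.length_append, hl.1]
  rcases le_or_gt i hd.length with h | h
  · exact h1 i hi0 h
  · obtain ⟨j, rfl⟩ : ∃ j, i = 1 + hd.length + j := ⟨i - (1 + hd.length), by omega⟩
    have ha := a_pos bF
    rw [List.length_append, hl.1] at hi
    have hj : j < N * a := by omega
    have hja : j / a < N := Nat.div_lt_of_lt_mul (by rwa [mul_comm])
    have e := h2 (j / a) hja (j % a) (Nat.mod_lt _ ha)
    have e2 := hl.2 (j / a) hja (j % a) (Nat.mod_lt _ ha)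
    rw [Nat.div_add_mod' j a] at e e2
    rw [e, show 1 + hd.length + j = (hd.length + j) + 1 by ring, listArray_succ,
      List.getD_append_right _ _ _ _ (by omega), Nat.add_sub_cancel_left, e2]

end

/-! ### Complete programs -/

/-- A program that prepares the memory and executes a command. -/
def Cmd.full (c : Cmd) (h : ℕ) (ee le me : Expr) : Prog := .seq (prelude h ee le me) c.compile

/-- The initial memory has to hold the input in array `0` and short numbers elsewhere, nothing more.
Thus the program can also be started on the leftovers of another one. -/
theorem Cmd.full_runs (c : Cmd) (hc : c.ok = true) (h : ℕ) (ee le me : Expr)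
    (hee : ee.Reads (fun c => c != 4 && c != 6) = true) :
    ∃ K, ∀ {p a : ℕ} {F : Type*} [Field F] [Fact p.Prime] [Algebra (ZMod p) F]
      (bF : Basis (Fin a) (ZMod p) F) {M L : ℕ} (_ : p ^ a ≤ M) (_ : 0 < L) (E : ℕ)
      (input : List ℕ) (β Z : ℕ) (σ : Store),
      σ 0 = listArray input → Bd β σ → listArray input 1 = p → listArray input 2 = a →
      (∀ i < a * (a * 1), ∀ d < a, listArray input (h + 1 + (i * a + d)) =
        dig bF (ext bF (i / (a * 1)) * ext bF (i % (a * 1) / 1)) d) →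
      M.size ≤ β → L.size ≤ β → ((p ^ a) ^ E).size ≤ β → a * a < L → E ≤ L → h + 1 ≤ M →
      L + 2 * β + 2 ≤ Z →
      (∀ τ : Store, τ 0 = listArray input → τ 2 2 = p ^ a → ee.eval τ = E) →
      (∀ τ, Prep p a E input τ → le.eval τ = L) →
      (∀ τ, Prep p a E input τ → τ 2 1 = L → me.eval τ = M) →
      ∃ X : Ctx F, X.M = M ∧ X.L = L ∧ ∃ τ₀, Env bF X τ₀ ∧ Prep p a E input τ₀ ∧
        ∃ τ, (∃ t ≤ Z ^ K, Exec (c.full h ee le me) σ τ t) ∧ τ 1 = c.den X τ₀ 1 := by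
  obtain ⟨K₁, h₁⟩ := prelude_runs h ee le me hee
  obtain ⟨K₂, h₂⟩ := c.compile_runs hc
  refine ⟨K₁ + K₂ + 1, fun {p a F} _ hp _ bF {M L} hM hL E input β Z σ hσ0 hσ hip hia htab
    hMβ hLβ hEβ haL hEL hhM hZ hee' hle hme => ⟨fieldCtx bF M L hM hL, rfl, rfl, ?_⟩⟩
  have ha := a_pos bF
  obtain ⟨σ₁, ⟨t₁, ht₁, x₁⟩, b₁, P, e0, e1, e3⟩ := h₁ p a M L E input β Z σ hp.out.pos hσ0 hσ hip
    hia hMβ hLβ hEβ hM ((Nat.le_mul_of_pos_left a ha).trans haL.le) hEL hhM hZ hee' hle hme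
  have env : Env bF (fieldCtx bF M L hM hL) σ₁ := by
    refine ⟨rfl, rfl, rfl, e0, e1, P.h22, by rw [P.h0, hip], by rw [P.h0, hia],
      fun i hi => P.h3 i hi.le, fun i j l => ?_, haL⟩
    rw [P.h0, e3, htab _ (by simpa using mul_add_lt i.2 j.2) l l.2, Nat.mul_comm i]
    simp [dig, Nat.mul_add_div ha, Nat.div_eq_of_lt j.2, Nat.mod_eq_of_lt j.2]
  obtain ⟨τ, ⟨t₂, ht₂, x₂⟩, hτ⟩ := h₂ bF _ β Z σ₁ b₁ hMβ hLβ (by exact (by omega : L + β + 2 ≤ Z)) env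
  exact ⟨σ₁, env, P, τ, ⟨_, le_pow_add (by omega) ht₁ ht₂, Exec.seq x₁ x₂⟩, hτ 1 (by omega)⟩

/-! ### Intersection of a subspace with hyperplanes -/

section

variable {F E : Type*} [Field F] [AddCommGroup E] [Module F E]

/-- The vectors obtained from a basis of a space and the values of a linear form on it by
eliminating the vector with index `i₀`. -/
def cutFamily {d : ℕ} (b : Fin (d + 1) → E) (φ : E →ₗ[F] F) (i₀ : Fin (d + 1)) (i : Fin d) : E :=
  φ (b i₀) • b (i₀.succAbove i) - φ (b (i₀.succAbove i)) • b i₀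

/-- A relation with coefficients `g` among the new vectors is a relation among the old ones in which
`b (i₀.succAbove i)` has coefficient `g i * φ (b i₀)`, and the last factor is nonzero. Multiplying
by the pivot value instead of dividing keeps the elimination free of inverses. -/
theorem linearIndependent_cutFamily {d : ℕ} {b : Fin (d + 1) → E} (hb : LinearIndependent F b)
    (φ : E →ₗ[F] F) {i₀ : Fin (d + 1)} (h : φ (b i₀) ≠ 0) :
    LinearIndependent F (cutFamily b φ i₀) := by
  rw [Fintype.linearIndependent_iff] at hb ⊢
  intro g hg i
  have h1 : ∑ j, (i₀.insertNth (-∑ i, g i * φ (b (i₀.succAbove i)))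
      (fun i => g i * φ (b i₀)) : Fin (d + 1) → F) j • b j = 0 := by
    rw [Fin.sum_univ_succAbove _ i₀]
    simp only [Fin.insertNth_apply_same, Fin.insertNth_apply_succAbove]
    rw [← hg]
    simp only [cutFamily, smul_sub, smul_smul, Finset.sum_sub_distrib, neg_smul,
      Finset.sum_smul]
    abel
  have := hb _ h1 (i₀.succAbove i)
  rw [Fin.insertNth_apply_succAbove] at this
  exact (mul_eq_zero.1 this).resolve_right h

/-- On the kernel of `φ` the coefficient of `b i₀` is forced by the others, and the vector is the
combination of the new vectors with the remaining coefficients divided by `φ (b i₀)`. -/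
theorem mem_span_cutFamily {d : ℕ} (b : Fin (d + 1) → E) (φ : E →ₗ[F] F) {i₀ : Fin (d + 1)}
    (h : φ (b i₀) ≠ 0) (x : E) :
    x ∈ Submodule.span F (Set.range (cutFamily b φ i₀)) ↔
      x ∈ Submodule.span F (Set.range b) ∧ φ x = 0 := by
  constructor
  · intro hx
    have hle : Submodule.span F (Set.range (cutFamily b φ i₀)) ≤
        Submodule.span F (Set.range b) ⊓ LinearMap.ker φ := by
      rw [Submodule.span_le]
      rintro _ ⟨i, rfl⟩
      refine ⟨?_, ?_⟩
      · exact Submodule.sub_mem _ (Submodule.smul_mem _ _ (Submodule.subset_span ⟨_, rfl⟩))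
          (Submodule.smul_mem _ _ (Submodule.subset_span ⟨_, rfl⟩))
      · simp only [SetLike.mem_coe, LinearMap.mem_ker, cutFamily, map_sub, map_smul, smul_eq_mul]
        ring
    exact ⟨(hle hx).1, (hle hx).2⟩
  · rintro ⟨hx, hφ⟩
    obtain ⟨g, rfl⟩ := (Submodule.mem_span_range_iff_exists_fun F).1 hx
    rw [map_sum, Fin.sum_univ_succAbove _ i₀] at hφ
    simp only [map_smul, smul_eq_mul] at hφ
    have e : ∑ i, g i • b i = ∑ i, ((φ (b i₀))⁻¹ * g (i₀.succAbove i)) • cutFamily b φ i₀ i := by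
      rw [Fin.sum_univ_succAbove _ i₀]
      simp only [cutFamily, smul_sub, smul_smul, Finset.sum_sub_distrib]
      rw [← Finset.sum_smul]
      have h2 : ∑ i, (φ (b i₀))⁻¹ * g (i₀.succAbove i) * φ (b (i₀.succAbove i)) = - g i₀ := by
        simp_rw [mul_assoc]
        rw [← Finset.mul_sum, eq_neg_of_add_eq_zero_right hφ]
        field_simp
      have h3 : ∀ i, (φ (b i₀))⁻¹ * g (i₀.succAbove i) * φ (b i₀) = g (i₀.succAbove i) := by
        intro i
        field_simp
      rw [h2]
      simp_rw [h3]
      rw [neg_smul]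
      abel
    rw [e]
    exact Submodule.sum_mem _ fun i _ => Submodule.smul_mem _ _ (Submodule.subset_span ⟨i, rfl⟩)

end

/-! ### Elimination on rows held in the memory -/

section

variable {F : Type*} [Field F] (X : Ctx F)

/-- The rows of length `σ 20 0` in array `11`. -/
def rowv (σ : Store) (i j : ℕ) : F := if j < σ 20 0 then X.el (σ 11 (i * σ 20 0 + j)) else 0

/-- The first `σ 12 0` rows are a basis of the subspace described by `P`. -/
def RowBasis (σ : Store) (P : (ℕ → F) → Prop) : Prop :=
  LinearIndependent F (fun i : Fin (σ 12 0) => rowv X σ i) ∧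
    ∀ x, x ∈ Submodule.span F (Set.range fun i : Fin (σ 12 0) => rowv X σ i) ↔ P x

theorem rowBasis_iff {σ : Store} {P : (ℕ → F) → Prop} {n : ℕ} (h : σ 12 0 = n)
    {g : ℕ → ℕ → F} (hg : ∀ i < n, rowv X σ i = g i) :
    RowBasis X σ P ↔ LinearIndependent F (fun i : Fin n => g i) ∧
      ∀ x, x ∈ Submodule.span F (Set.range fun i : Fin n => g i) ↔ P x := by
  subst h
  have : (fun i : Fin (σ 12 0) => rowv X σ i) = fun i : Fin (σ 12 0) => g i :=
    funext fun i => hg i i.2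
  rw [RowBasis, this]

variable {X}

theorem rowv_congr {σ τ : Store} (h20 : τ 20 = σ 20) (h11 : τ 11 = σ 11) :
    rowv X τ = rowv X σ := by
  funext i j
  simp only [rowv, h20, h11]

theorem rowv_eq {σ : Store} {i j : ℕ} (h : j < σ 20 0) :
    X.el (σ 11 (i * σ 20 0 + j)) = rowv X σ i j := by
  rw [rowv, if_pos h]

theorem RowBasis.congr {σ τ : Store} {P : (ℕ → F) → Prop} (hB : RowBasis X σ P)
    (h : τ 12 0 = σ 12 0) (hg : rowv X τ = rowv X σ) : RowBasis X τ P :=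
  (rowBasis_iff X h fun _ _ => by rw [hg]).2 hB

theorem RowBasis.imp {σ : Store} {P Q : (ℕ → F) → Prop} (hB : RowBasis X σ P)
    (h : ∀ x, P x ↔ Q x) : RowBasis X σ Q :=
  ⟨hB.1, fun x => (hB.2 x).trans (h x)⟩

/-- Searches the last row on which the form with the values in array `13` does not vanish. -/
def pivC : Cmd :=
  .seq (.set 14 0 (V 12)) (.loop 16 (V 12) (.ite (rd 13 (V 16)) (.set 14 0 (V 16)) .skip))

/-- The index of the row used for row `i` after the elimination. -/
def srcE (i : Expr) : Expr := i + (1 - (V 14 - i))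

def elimRowsC : Cmd :=
  .seq (.loop 17 ((V 12 - 1) * V 20) (.setF 15 (V 17)
    (.sub (.mul (.nat (rd 13 (V 14)))
        (.nat (rd 11 (srcE (V 17 / V 20) * V 20 + V 17 % V 20))))
      (.mul (.nat (rd 13 (srcE (V 17 / V 20)))) (.nat (rd 11 (V 14 * V 20 + V 17 % V 20)))))))
  (.seq (.loop 19 ((V 12 - 1) * V 20) (.setF 11 (V 19) (.nat (rd 15 (V 19)))))
    (.set 12 0 (V 12 - 1)))

/-- Replaces the rows by a basis of the kernel of the form with the values in array `13`. -/
def cutC : Cmd := .seq pivC (.ite (V 12 - V 14) elimRowsC .skip)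

/-- The value `σ 12 0`, one past the last row index, signals that the form vanishes on all rows. -/
theorem pivC_spec {σ ρ : Store} (hρ : pivC.den X σ = ρ) (hL : σ 12 0 < X.L) (hM : σ 12 0 < X.M) :
    (ρ 14 0 < σ 12 0 ∧ σ 13 (ρ 14 0) ≠ 0) ∨ (ρ 14 0 = σ 12 0 ∧ ∀ i < σ 12 0, σ 13 i = 0) := by
  obtain ⟨σ', h, hρ⟩ := Cmd.den_seq_iff.1 hρ
  have h14 : σ' 14 0 = σ 12 0 := set_val h (by simp) hM
  refine Cmd.loop_inv hρ _ (fun n τ => (τ 14 0 < σ 12 0 ∧ σ 13 (τ 14 0) ≠ 0) ∨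
    (τ 14 0 = σ 12 0 ∧ ∀ i < n, σ 13 i = 0)) (by simp [fr h 12]) hL (by simp [h14]) ?_
  intro n hn τ hτ h16 ih ρ' h'
  rw [Cmd.den_ite X (σ 13 n) (by simp [h16, hτ 13, fr h 13])] at h'
  rw [put_of_ne _ _ _ _ (by omega)]
  split_ifs at h' with hne <;> subst h'
  · rw [Cmd.den_skip]
    refine ih.imp_right fun ih => ⟨ih.1, fun i hi => ?_⟩
    rcases Nat.lt_succ_iff_lt_or_eq.1 hi with hi | rfl
    exacts [ih.2 i hi, hne]
  · left
    simpa [Cmd.den_set, h16, Nat.mod_eq_of_lt (hn.trans hM), hn] using hne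

theorem elimRowsC_spec {σ ρ : Store} (hρ : elimRowsC.den X σ = ρ) {d : ℕ} (hd : σ 12 0 = d + 1)
    (hL : d * σ 20 0 < X.L) (hM : d < X.M) (hp : σ 14 0 < d + 1) (φ : (ℕ → F) →ₗ[F] F)
    (hφ : ∀ i < d + 1, σ 13 i = X.code (φ (rowv X σ i))) :
    ρ 12 0 = d ∧ ∀ i : Fin d, rowv X ρ i =
      cutFamily (fun i : Fin (d + 1) => rowv X σ i) φ ⟨σ 14 0, hp⟩ i := by
  set w := σ 20 0 with hw
  have h20 := fr hρ 20
  simp only [elimRowsC, Cmd.den_seq_iff] at hρ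
  obtain ⟨σ₁, h₁, σ₂, h₂, h₃⟩ := hρ
  -- By truncation the added term is 0 for indices below the pivot and 1 from the pivot on, so this
  -- is `Fin.succAbove`.
  let src : ℕ → ℕ := fun i => i + (1 - (σ 14 0 - i))
  have hsrc : ∀ i : Fin d, ((⟨σ 14 0, hp⟩ : Fin (d + 1)).succAbove i : ℕ) = src i := by
    intro i
    simp only [Fin.succAbove, Fin.lt_def, src, Fin.val_castSucc]
    split_ifs with h
    · simp only [Fin.val_castSucc]; omega
    · simp only [Fin.val_succ]; omega
  let g : ℕ → ℕ → F := fun i j => φ (rowv X σ (σ 14 0)) * X.el (σ 11 (src i * w + j)) -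
    φ (rowv X σ (src i)) * X.el (σ 11 (σ 14 0 * w + j))
  have a1 := tab2_spec h₁ d w g (by simp [hd, hw]) hL (by
    intro τ i j hi hj hτ h17
    have hs : i + (1 - (σ 14 0 - i)) < d + 1 := by omega
    simp [FE.eval, srcE, hτ 13, hτ 14, hτ 11, hτ 20, h17, ← hw, hφ _ hp, hφ _ hs, X.el_code, g,
      src, mul_add_div_self hj, mul_add_mod_self hj])
  have b1 := tab2_spec h₂ d w g (by simp [fr h₁ 12, fr h₁ 20, hd, hw]) hL (by
    intro τ i j hi hj hτ h19
    simp [FE.eval, h19, hτ 15, a1 i hi j hj, X.el_code])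
  refine ⟨set_val h₃ (by simp [fr h₂ 12, fr h₁ 12, hd]) hM, fun i => funext fun j => ?_⟩
  simp only [rowv, h20, cutFamily, Pi.sub_apply, Pi.smul_apply, smul_eq_mul, ← hw]
  split_ifs with hj
  · rw [fr h₃ 11, b1 _ i.2 _ hj, X.el_code]
    simp only [g, ← hsrc]
  · simp

/-- Besides the new basis, the last clause keeps track of the pivot: it is later used to find a
particular solution of an affine system. -/
theorem cutC_spec {σ ρ : Store} (hρ : cutC.den X σ = ρ) {P : (ℕ → F) → Prop}
    (hB : RowBasis X σ P) (hL : σ 12 0 * (σ 20 0 + 1) < X.L) (hM : σ 12 0 < X.M)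
    (φ : (ℕ → F) →ₗ[F] F) (hφ : ∀ i < σ 12 0, σ 13 i = X.code (φ (rowv X σ i))) :
    RowBasis X ρ (fun x => P x ∧ φ x = 0) ∧ ρ 12 0 ≤ σ 12 0 ∧ σ 12 0 ≤ ρ 12 0 + 1 ∧
    ((ρ 14 0 < σ 12 0 ∧ φ (rowv X σ (ρ 14 0)) ≠ 0) ∨
      (ρ 14 0 = σ 12 0 ∧ ∀ i < σ 12 0, φ (rowv X σ i) = 0)) := by
  obtain ⟨ρ₁, h₁, h₂⟩ := Cmd.den_seq_iff.1 hρ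
  have h12 := fr h₁ 12
  have hrow : rowv X ρ₁ = rowv X σ := rowv_congr (fr h₁ 20) (fr h₁ 11)
  rw [Cmd.den_ite X (σ 12 0 - ρ₁ 14 0) (by simp [h12])] at h₂
  rcases pivC_spec h₁ (by nlinarith) hM with ⟨hlt, hne⟩ | ⟨heq, hz⟩
  · rw [if_neg (by omega)] at h₂
    obtain ⟨d, hd⟩ : ∃ d, σ 12 0 = d + 1 := ⟨σ 12 0 - 1, by omega⟩
    rw [hd] at hlt hL hM
    have hφne : φ (rowv X σ (ρ₁ 14 0)) ≠ 0 := fun h => hne (by rw [hφ _ (by omega), h, X.code_zero])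
    obtain ⟨e1, e2⟩ := elimRowsC_spec h₂ (by rw [h12, hd]) (by rw [fr h₁ 20]; nlinarith) (by omega)
      hlt φ (fun i hi => by rw [fr h₁ 13, hφ i (by omega), hrow])
    refine ⟨?_, by omega, by omega, Or.inl ?_⟩
    · obtain ⟨hB1, hB2⟩ := (rowBasis_iff X hd (g := fun i => rowv X σ i) fun i _ => rfl).1 hB
      rw [rowBasis_iff X e1 (g := fun i => rowv X ρ i) fun i _ => rfl, funext e2, hrow]
      refine ⟨linearIndependent_cutFamily hB1 φ hφne, fun x => ?_⟩
      rw [mem_span_cutFamily _ φ (by exact hφne), hB2]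
    · rw [fr h₂ 14]
      exact ⟨by omega, hφne⟩
  · rw [if_pos (by omega), Cmd.den_skip] at h₂
    subst h₂
    have hφ0 : ∀ i < σ 12 0, φ (rowv X σ i) = 0 := fun i hi => by
      rw [← X.el_code (φ _), ← hφ i hi, hz i hi, ← X.code_zero, X.el_code]
    refine ⟨(hB.imp fun x => ⟨fun hx => ⟨hx, ?_⟩, fun hx => hx.1⟩).congr (by rw [h12]) hrow,
      by rw [h12], by rw [h12]; omega, Or.inr ⟨heq, hφ0⟩⟩
    have hle : Submodule.span F (Set.range fun i : Fin (σ 12 0) => rowv X σ i) ≤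
        LinearMap.ker φ := by
      rw [Submodule.span_le]
      rintro _ ⟨i, rfl⟩
      exact hφ0 i i.2
    exact hle ((hB.2 x).2 hx)

/-- Intersects the span of the rows with the kernels of `N` linear forms; `f` is the value of the
form with number `V 18` on the row with number `V 22`. -/
def elimC (N : Expr) (f : FE) : Cmd :=
  .loop 18 N (.seq (.loop 22 (V 12) (.setF 13 (V 22) f)) cutC)

/-- Each form removes at most one row. The resulting lower bound for the number of remaining rows is
what guarantees a nonzero solution when there are more unknowns than equations. -/
theorem elimC_spec {Ne : Expr} {f : FE} {σ ρ : Store} (hρ : (elimC Ne f).den X σ = ρ)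
    {P : (ℕ → F) → Prop} (hB : RowBasis X σ P) (N : ℕ) (hN : Ne.eval σ = N) (hNL : N < X.L)
    (hL : σ 12 0 * (σ 20 0 + 1) < X.L) (hM : σ 12 0 < X.M) (φ : ℕ → (ℕ → F) →ₗ[F] F)
    (hf : ∀ n < N, ∀ τ r, (∀ (b : ℕ) (_ : b ∉ (elimC 0 (.nat 0)).mods := by decide), τ b = σ b) →
      τ 18 0 = n → τ 22 0 = r → τ 12 0 ≤ σ 12 0 → r < τ 12 0 → f.eval X τ = φ n (rowv X τ r)) :
    RowBasis X ρ (fun x => P x ∧ ∀ n < N, φ n x = 0) ∧ ρ 12 0 ≤ σ 12 0 ∧ σ 12 0 ≤ ρ 12 0 + N := by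
  refine Cmd.loop_inv hρ N (fun n τ => RowBasis X τ (fun x => P x ∧ ∀ i < n, φ i x = 0) ∧
    τ 12 0 ≤ σ 12 0 ∧ σ 12 0 ≤ τ 12 0 + n) hN hNL ⟨(hB.imp fun x => by simp).congr (by simp)
      (rowv_congr (by simp) (by simp)), by simp⟩ ?_
  rintro n hn τ hτ h18 ⟨i1, i2, i3⟩ τ' h'
  obtain ⟨ρ, h₁, h₂⟩ := Cmd.den_seq_iff.1 h'
  have hrow : rowv X ρ = rowv X τ := rowv_congr (fr h₁ 20) (fr h₁ 11)
  have r12 : ρ 12 = τ 12 := fr h₁ 12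
  have t1 := tab_spec h₁ (τ 12 0) (fun r => φ n (rowv X τ r)) rfl (by nlinarith) (by
    intro τ' r hr hτ' h22
    rw [hf n hn τ' r (fun b hb => ?_) (by rw [hτ' 18, h18]) h22 (by rw [hτ' 12]; exact i2)
      (by rw [hτ' 12]; exact hr), rowv_congr (hτ' 20) (hτ' 11)]
    rw [hτ' b (by rintro rfl; revert hb; decide) (by rintro rfl; revert hb; decide), hτ b hb])
  obtain ⟨c1, c2, c3, -⟩ := cutC_spec h₂ (i1.congr (by rw [r12]) hrow)
    (by rw [r12, fr h₁ 20, hτ 20]; nlinarith) (by rw [r12]; omega) (φ n)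
    (fun i hi => by rw [t1 i (by rwa [← r12]), hrow])
  rw [put_of_ne _ _ _ _ (by omega)]
  refine ⟨(c1.imp fun x => ?_).congr (by simp) (rowv_congr (by simp) (by simp)),
    by rw [r12] at c2; omega, by rw [r12] at c3; omega⟩
  rw [and_assoc]
  refine and_congr_right fun _ => ⟨fun h i hi => ?_, fun h => ⟨fun i hi => h i (by omega),
    h n (by omega)⟩⟩
  rcases Nat.lt_succ_iff_lt_or_eq.1 hi with hi | rfl
  exacts [h.1 i hi, h.2]

end

/-! ### The interpolation step of linear algebraic list decoding -/

section

variable {F E : Type*} [Field F] [AddCommGroup E] [Module F E]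

/-- Rank and nullity of the restriction of `φ` to `S`, whose range lies in `N`. -/
theorem finrank_le_inf_ker_add [FiniteDimensional F E] {E' : Type*} [AddCommGroup E'] [Module F E']
    [FiniteDimensional F E'] (S : Submodule F E) (φ : E →ₗ[F] E') (N : Submodule F E')
    (h : ∀ x ∈ S, φ x ∈ N) :
    finrank F S ≤ finrank F (S ⊓ LinearMap.ker φ : Submodule F E) + finrank F N := by
  rw [← LinearMap.finrank_range_add_finrank_ker (φ.domRestrict S), add_comm]
  refine Nat.add_le_add ?_ ?_
  · have e : Submodule.map S.subtype (LinearMap.ker (φ.domRestrict S)) ≤ S ⊓ LinearMap.ker φ := by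
      rintro _ ⟨x, hx, rfl⟩
      exact ⟨x.2, by simpa using hx⟩
    rw [← Submodule.finrank_map_subtype_eq]
    exact Submodule.finrank_mono e
  · refine Submodule.finrank_mono ?_
    rintro _ ⟨x, rfl⟩
    exact h x x.2

/-- The dimension of a space of tuples is bounded by the dimensions of spaces containing the first
nonzero entries. -/
theorem finrank_le_sum_of_first [FiniteDimensional F E] {k : ℕ} (S : Submodule F (Fin k → E))
    (N : Fin k → Submodule F E) (h : ∀ f ∈ S, ∀ i, (∀ j < i, f j = 0) → f i ∈ N i) :
    finrank F S ≤ ∑ i, finrank F (N i) := by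
  -- The tuples of `S` whose first `l` entries vanish. Passing from `l` to `l + 1` intersects with
  -- the kernel of one coordinate, which on `Z l` takes values in `N l`.
  let Z : ℕ → Submodule F (Fin k → E) := fun l =>
    S ⊓ ⨅ j : Fin k, ⨅ _ : (j : ℕ) < l, LinearMap.ker (LinearMap.proj (R := F) (φ := fun _ => E) j)
  have hZ : ∀ l f, f ∈ Z l ↔ f ∈ S ∧ ∀ j : Fin k, (j : ℕ) < l → f j = 0 := fun l f => by
    simp [Z]
  have step : ∀ l ≤ k, finrank F (Z 0) ≤
      finrank F (Z l) + ∑ i ∈ Finset.range l, ext (fun i => finrank F (N i)) i := by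
    intro l
    induction l with
    | zero => simp
    | succ l ih =>
      intro hl
      refine (ih (by omega)).trans ?_
      rw [Finset.sum_range_succ, ext_of_lt _ (by omega : l < k)]
      have h1 := finrank_le_inf_ker_add (Z l) (LinearMap.proj (R := F) (φ := fun _ => E) ⟨l, hl⟩)
        (N ⟨l, hl⟩) (fun f hf => h f ((hZ l f).1 hf).1 _ fun j hj => ((hZ l f).1 hf).2 j hj)
      have h2 : finrank F (Z l ⊓ LinearMap.ker (LinearMap.proj (R := F) (φ := fun _ => E) ⟨l, hl⟩) :
          Submodule F (Fin k → E)) ≤ finrank F (Z (l + 1)) := by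
        refine Submodule.finrank_mono fun f hf => (hZ _ _).2 ⟨((hZ l f).1 hf.1).1, fun j hj => ?_⟩
        rcases Nat.lt_succ_iff_lt_or_eq.1 hj with hj | hj
        · exact ((hZ l f).1 hf.1).2 j hj
        · obtain rfl : j = ⟨l, hl⟩ := Fin.ext hj
          exact hf.2
      omega
  have h0 : S ≤ Z 0 := fun f hf => (hZ _ _).2 ⟨hf, by simp⟩
  have hk : Z k = ⊥ := by
    rw [eq_bot_iff]
    exact fun f hf => funext fun j => ((hZ k f).1 hf).2 j j.2
  have := step k le_rfl
  rw [hk, finrank_bot, zero_add, Finset.sum_range] at this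
  exact (Submodule.finrank_mono h0).trans (this.trans (by simp))

/-- A design is tested on subspaces of one exact dimension, whereas the kernel met in decoding has
only a dimension bound and has to be enlarged. -/
theorem exists_le_finrank_eq [FiniteDimensional F E] (W : Submodule F E) {r : ℕ}
    (h : finrank F W ≤ r) (hr : r ≤ finrank F E) : ∃ W', W ≤ W' ∧ finrank F W' = r := by
  induction r, h using Nat.le_induction with
  | base => exact ⟨W, le_rfl, rfl⟩
  | succ r hr' ih =>
    obtain ⟨W', h1, h2⟩ := ih (by omega)
    obtain ⟨x, hx⟩ : ∃ x, x ∉ W' := by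
      by_contra! hx
      rw [(eq_top_iff.2 fun x _ => hx x : W' = ⊤), finrank_top] at h2
      omega
    exact ⟨W' ⊔ Submodule.span F {x}, h1.trans le_sup_left, by
      rw [Submodule.finrank_sup_span_singleton hx, h2]⟩

end

/-! ### Powers of Frobenius and linearized polynomials -/

section

variable (F K : Type*) [Field F] [Finite F] [Field K] [Algebra F K]

/-- The `j`-th power of the Frobenius endomorphism of `K` over `F`. -/
noncomputable def frob (j : ℕ) : K →ₐ[F] K :=
  letI := Fintype.ofFinite F
  FiniteField.frobeniusAlgHom F K ^ j

variable {F K}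

theorem frob_apply (j : ℕ) (x : K) : frob F K j x = x ^ (Nat.card F ^ j) := by
  let := Fintype.ofFinite F
  rw [frob, AlgHom.coe_pow, FiniteField.coe_frobeniusAlgHom, pow_iterate, Nat.card_eq_fintype_card]

/-- The linearized polynomial with coefficients `c 0, …, c (s - 1)` as a linear map. -/
noncomputable def linPoly (s : ℕ) (c : ℕ → K) : K →ₗ[F] K :=
  ∑ j ∈ Finset.range s, LinearMap.mulLeft F (c j) ∘ₗ (frob F K j).toLinearMap

theorem linPoly_apply (s : ℕ) (c : ℕ → K) (z : K) :
    linPoly (F := F) s c z = ∑ j ∈ Finset.range s, c j * frob F K j z := by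
  simp [linPoly]

/-- The kernel consists of roots of Σ cⱼ X^(q^j), a nonzero polynomial of degree at most q^(s-1); so
q^dim ≤ q^(s-1). -/
theorem finrank_ker_linPoly [FiniteDimensional F K] {s : ℕ} {c : ℕ → K}
    (h : ∃ j < s, c j ≠ 0) : finrank F (LinearMap.ker (linPoly (F := F) s c)) ≤ s - 1 := by
  have hq : 1 < Nat.card F := Finite.one_lt_card
  have : Finite K := Module.finite_of_finite F
  set P : Polynomial K := ∑ j ∈ Finset.range s, Polynomial.monomial (Nat.card F ^ j) (c j) with hP
  obtain ⟨j₀, hj₀, hc⟩ := h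
  have hP0 : P ≠ 0 := by
    intro h0
    have := congrArg (fun Q => Polynomial.coeff Q (Nat.card F ^ j₀)) h0
    simp only [hP, Polynomial.finsetSum_coeff, Polynomial.coeff_monomial, Polynomial.coeff_zero]
      at this
    rw [Finset.sum_eq_single j₀ (fun j _ hj => if_neg fun h => hj (Nat.pow_right_injective hq h))
      (fun h => absurd (Finset.mem_range.2 hj₀) h), if_pos rfl] at this
    exact hc this
  have hdeg : P.natDegree ≤ Nat.card F ^ (s - 1) := by
    refine Polynomial.natDegree_sum_le_of_forall_le _ _ fun j hj => ?_
    rw [Finset.mem_range] at hj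
    exact (Polynomial.natDegree_monomial_le _).trans (Nat.pow_le_pow_right (by omega) (by omega))
  have hroot : ∀ z ∈ LinearMap.ker (linPoly (F := F) s c), P.IsRoot z := by
    intro z hz
    rw [LinearMap.mem_ker, linPoly_apply] at hz
    rw [Polynomial.IsRoot, hP, Polynomial.eval_finsetSum]
    simpa [frob_apply, Polynomial.eval_monomial] using hz
  have hcard : Nat.card (LinearMap.ker (linPoly (F := F) s c)) ≤ Nat.card F ^ (s - 1) := by
    refine le_trans ?_ hdeg
    have hsub : (LinearMap.ker (linPoly (F := F) s c) : Set K) ⊆ P.rootSet K := fun z hz => by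
      rw [Polynomial.mem_rootSet]
      exact ⟨hP0, by simpa [Polynomial.IsRoot] using hroot z hz⟩
    calc Nat.card (LinearMap.ker (linPoly (F := F) s c))
        = Set.ncard (LinearMap.ker (linPoly (F := F) s c) : Set K) := Nat.card_coe_set_eq _
      _ ≤ Set.ncard (P.rootSet K) := Set.ncard_le_ncard hsub (Set.toFinite _)
      _ ≤ P.natDegree := Polynomial.ncard_rootSet_le P K
  rw [Module.natCard_eq_pow_finrank (K := F)] at hcard
  exact (Nat.pow_le_pow_iff_right hq).1 hcard

end

/-! ### The relation satisfied by close codewords, and its solutions -/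

section

open Polynomial

theorem rsEncode_apply {F K : Type*} [Field F] [Field K] [Algebra F K] {n k : ℕ} (α : Fin n → F) (f : Fin k → K) (i : Fin n) :
    rsEncode α k f i = ∑ j : Fin k, f j * algebraMap F K (α i) ^ (j : ℕ) := by
  show eval _ (∑ j : Fin k, monomial (j : ℕ) (f j)) = _
  simp [eval_finsetSum]

variable {F K : Type*} [Field F] [Finite F] [Field K] [Algebra F K]

/-- The coefficients of `A₀ + A₁ f + A₂ f^σ + ⋯` without its term `A₀`. -/
noncomputable def relCoeff {k : ℕ} (s D : ℕ) (A : ℕ → ℕ → K) (w : ℕ) :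
    (Fin k → K) →ₗ[F] K :=
  ∑ i : Fin k, ∑ j ∈ Finset.range s, if (i : ℕ) ≤ w ∧ w ≤ D + i then
    LinearMap.mulLeft F (A j (w - i)) ∘ₗ (frob F K j).toLinearMap ∘ₗ LinearMap.proj i else 0

theorem relCoeff_apply {k : ℕ} (s D : ℕ) (A : ℕ → ℕ → K) (w : ℕ) (f : Fin k → K) :
    relCoeff (F := F) s D A w f = ∑ i : Fin k, ∑ j ∈ Finset.range s,
      if (i : ℕ) ≤ w ∧ w ≤ D + i then A j (w - i) * frob F K j (f i) else 0 := by
  simp only [relCoeff, LinearMap.sum_apply]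
  refine Finset.sum_congr rfl fun i _ => Finset.sum_congr rfl fun j _ => ?_
  split_ifs <;> simp

theorem frob_algebraMap_pow (j w : ℕ) (x : F) :
    frob F K j (algebraMap F K x ^ w) = algebraMap F K x ^ w := by
  rw [map_pow, AlgHom.commutes]

theorem sum_range_window {A : Type*} [AddCommMonoid A] (g : ℕ → A) {N D i : ℕ} (h : D + i < N) :
    ∑ w ∈ Finset.range N, (if i ≤ w ∧ w ≤ D + i then g w else 0) =
      ∑ d ∈ Finset.range (D + 1), g (d + i) := by
  rw [← Finset.sum_filter]
  refine Finset.sum_nbij' (· - i) (· + i) ?_ ?_ ?_ ?_ ?_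
  · intro w hw
    simp only [Finset.mem_filter, Finset.mem_range] at hw ⊢
    omega
  · intro w hw
    simp only [Finset.mem_filter, Finset.mem_range] at hw ⊢
    omega
  · intro w hw
    simp only [Finset.mem_filter, Finset.mem_range] at hw ⊢
    omega
  · intro w _
    simp
  · intro w hw
    simp only [Finset.mem_filter, Finset.mem_range] at hw
    congr 1
    omega

/-- A codeword close to `y` satisfies the relation interpolating `y`. -/
theorem relation_of_agree {n k s D : ℕ} {α : Fin n → F} (hα : Function.Injective α)
    {y : Fin n → K} {A₀ : ℕ → K} {A : ℕ → ℕ → K}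
    (hA : ∀ i, ∑ w ∈ Finset.range (D + k), algebraMap F K (α i) ^ w * A₀ w +
      ∑ j ∈ Finset.range s, ∑ w ∈ Finset.range (D + 1), algebraMap F K (α i) ^ w *
        (A j w * frob F K j (y i)) = 0) (f : Fin k → K) (T : Finset (Fin n))
    (hT : ∀ i ∈ T, rsEncode α k f i = y i) (hcard : D + k ≤ T.card) {w : ℕ} (hw : w < D + k) :
    A₀ w + relCoeff (F := F) s D A w f = 0 := by
  -- P is A₀ + Σⱼ Aⱼ f^(σ^j); the claim is that its coefficients vanish.
  set P : K[X] := ∑ w ∈ Finset.range (D + k), monomial w (A₀ w + relCoeff (F := F) s D A w f)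
    with hP
  have hdeg : P.degree < (D + k : ℕ) := by
    rw [← mem_degreeLT]
    refine Submodule.sum_mem _ fun w hw => ?_
    rw [mem_degreeLT]
    exact (degree_monomial_le _ _).trans_lt (by exact_mod_cast Finset.mem_range.1 hw)
  have hroot : ∀ i ∈ T, P.eval (algebraMap F K (α i)) = 0 := by
    intro i hi
    rw [hP, eval_finsetSum, ← hA i]
    simp only [eval_monomial, add_mul, Finset.sum_add_distrib]
    congr 1
    · exact Finset.sum_congr rfl fun w _ => mul_comm _ _
    simp only [relCoeff_apply, Finset.sum_mul]
    rw [← hT i hi, rsEncode_apply]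
    -- Frobenius over F fixes the powers of the evaluation point, so it acts on the value of f only
    -- through the coefficients.
    simp_rw [map_sum, map_mul, frob_algebraMap_pow, Finset.mul_sum]
    set x := algebraMap F K (α i)
    have h1 : ∀ (j : ℕ) (i' : Fin k), ∑ w ∈ Finset.range (D + k), (if (i' : ℕ) ≤ w ∧ w ≤ D + i' then
        A j (w - i') * frob F K j (f i') else 0) * x ^ w =
        ∑ d ∈ Finset.range (D + 1), x ^ d * (A j d * (frob F K j (f i') * x ^ (i' : ℕ))) := by
      intro j i'
      simp_rw [ite_mul, zero_mul]
      rw [sum_range_window (fun w => A j (w - i') * frob F K j (f i') * x ^ w) (by omega)]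
      refine Finset.sum_congr rfl fun d _ => ?_
      rw [Nat.add_sub_cancel, pow_add]
      ring
    rw [Finset.sum_comm]
    refine (Finset.sum_congr rfl fun i' _ => Finset.sum_comm).trans ?_
    refine (Finset.sum_congr rfl fun i' _ => Finset.sum_congr rfl fun j _ => h1 j i').trans ?_
    rw [Finset.sum_comm]
    exact Finset.sum_congr rfl fun j _ => Finset.sum_comm
  -- The points of `T` give at least D + k distinct roots, against degree less than D + k.
  have hP0 : P = 0 := by
    by_contra hne
    have h1 := card_le_degree_of_subset_roots (p := P)
      (Z := T.map ⟨_, (algebraMap F K).injective.comp hα⟩) (by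
        intro x hx
        rw [Finset.mem_val, Finset.mem_map] at hx
        obtain ⟨i, hi, rfl⟩ := hx
        exact (mem_roots hne).2 (hroot i hi))
    rw [Finset.card_map] at h1
    have := (natDegree_lt_iff_degree_lt hne).2 hdeg
    omega
  have := congrArg (fun Q => coeff Q w) hP0
  simp only [hP, finsetSum_coeff, coeff_monomial, Finset.sum_ite_eq', Finset.mem_range, hw,
    if_true, coeff_zero] at this
  exact this

/-- The relation involves more than its constant term. -/
theorem coeff_eq_zero_of_interpolation {n N : ℕ} {α : Fin n → F} (hα : Function.Injective α)
    {A₀ : ℕ → K} (hA : ∀ i, ∑ w ∈ Finset.range N, algebraMap F K (α i) ^ w * A₀ w = 0)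
    (hN : N ≤ n) {w : ℕ} (hw : w < N) : A₀ w = 0 := by
  -- The case without conjugates: with s = 0 and D = 0 the relation consists of `A₀` alone, and the
  -- zero message agrees everywhere with its own codeword.
  have h := relation_of_agree (s := 0) (D := 0) (k := N) (y := rsEncode α N (0 : Fin N → K)) hα
    (A₀ := A₀) (A := 0) (by simpa using hA) 0 Finset.univ (by simp) (by simpa using hN)
    (w := w) (by simpa using hw)
  simpa using h

/-- The solutions of the homogeneous relation in a space given by a subspace design. -/
theorem finrank_le_of_relation {m k s D : ℕ} (bK : Basis (Fin m) F K) {d : ℝ}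
    {H : Fin k → Submodule F (Fin m → F)} (hH : IsSubspaceDesign (s - 1) d H) (hs : s - 1 ≤ m)
    {A : ℕ → ℕ → K} (hA : ∃ j < s, ∃ w ≤ D, A j w ≠ 0) (S : Submodule F (Fin k → K))
    (hS : ∀ f ∈ S, f ∈ designSpace bK H ∧ ∀ w < D + k, relCoeff (F := F) s D A w f = 0) :
    (finrank F S : ℝ) ≤ d := by
  classical
  have : FiniteDimensional F K := bK.finiteDimensional_of_finite
  have hex : ∃ w, ∃ j < s, A j w ≠ 0 := by
    obtain ⟨j, hj, w, -, h⟩ := hA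
    exact ⟨w, j, hj, h⟩
  -- The lowest exponent at which some `A j` has a nonzero coefficient. The linearized polynomial
  -- `B` formed from the coefficients there is the same for all positions `i`.
  set w₀ := Nat.find hex with hw₀
  have hspec := Nat.find_spec hex
  have hmin : ∀ w < w₀, ∀ j < s, A j w = 0 := fun w hw j hj => by
    by_contra h
    exact Nat.find_min hex hw ⟨j, hj, h⟩
  have hw₀D : w₀ ≤ D := by
    obtain ⟨j, hj, w, hw, h⟩ := hA
    exact (Nat.find_min' hex ⟨j, hj, h⟩).trans hw
  set B := linPoly (F := F) s fun j => A j w₀ with hB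
  have hker : finrank F (LinearMap.ker B) ≤ s - 1 := finrank_ker_linPoly hspec
  have hmF : finrank F (Fin m → F) = m := by simp
  obtain ⟨W, hW, hWr⟩ := exists_le_finrank_eq
    ((LinearMap.ker B).map bK.equivFun.toLinearMap) (r := s - 1)
    ((Submodule.finrank_map_le _ _).trans hker) (by rw [hmF]; exact hs)
  refine le_trans ?_ (hH W hWr)
  norm_cast
  have hfirst : ∀ f ∈ S, ∀ i, (∀ j < i, f j = 0) → B (f i) = 0 := by
    intro f hf i hi
    -- In the coefficient of X^(w₀+i), the terms with an index below `i` vanish because those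
    -- entries of `f` do, and the terms above `i` because they involve coefficients of the `A j`
    -- below `w₀`. Only `B (f i)` is left.
    have h := (hS f hf).2 (w₀ + i) (by omega)
    rw [relCoeff_apply, Finset.sum_eq_single i] at h
    · rw [hB, linPoly_apply, ← h]
      refine Finset.sum_congr rfl fun j _ => ?_
      rw [if_pos (by omega), Nat.add_sub_cancel]
    · intro i' _ hne
      refine Finset.sum_eq_zero fun j hj => ?_
      split_ifs with hc
      · rcases lt_or_gt_of_ne hne with hlt | hgt
        · rw [hi i' hlt, map_zero, mul_zero]
        · rw [hmin _ (by have : (i : ℕ) < i' := hgt; omega) j (Finset.mem_range.1 hj), zero_mul]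
      · rfl
    · simp
  refine (finrank_le_sum_of_first S (fun i => (LinearMap.ker B) ⊓
    (H i).comap bK.equivFun.toLinearMap) fun f hf i hi =>
    ⟨hfirst f hf i hi, (mem_designSpace bK H f).1 (hS f hf).1 i⟩).trans ?_
  refine Finset.sum_le_sum fun i _ => ?_
  rw [← LinearEquiv.finrank_map_eq bK.equivFun]
  refine Submodule.finrank_mono ?_
  rintro _ ⟨x, ⟨hx1, hx2⟩, rfl⟩
  exact ⟨hW ⟨x, hx1, rfl⟩, hx2⟩

theorem rsEncode_injective {n k : ℕ} {α : Fin n → F} (hα : Function.Injective α) (hk : k ≤ n) :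
    Function.Injective (rsEncode (K := K) α k) := by
  rw [← LinearMap.ker_eq_bot, LinearMap.ker_eq_bot']
  intro f hf
  funext i
  have := coeff_eq_zero_of_interpolation hα (A₀ := ext f) (N := k) (fun j => by
    have h := congrFun hf j
    rw [rsEncode_apply] at h
    rw [Finset.sum_range]
    simpa [mul_comm] using h) hk i.2
  simpa using this

end

/-! ### Coordinates -/

section

variable {m : ℕ} {F K : Type*} [Field F] [Field K] [Algebra F K] (bK : Basis (Fin m) F K)

/-- The coordinate with index `c` as a linear form. -/
noncomputable def kcL (c : ℕ) : K →ₗ[F] F := if h : c < m then bK.coord ⟨c, h⟩ else 0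

theorem kcL_apply (c : ℕ) (y : K) : kcL bK c y = kc bK y c := by
  unfold kcL kc ext
  split_ifs <;> rfl

theorem kc_injective {x y : K} (h : ∀ c < m, kc bK x c = kc bK y c) : x = y :=
  bK.ext_elem fun i => by simpa [kc] using h i i.2

theorem kc_sum {ι : Type*} (s : Finset ι) (f : ι → K) (c : ℕ) :
    kc bK (∑ i ∈ s, f i) c = ∑ i ∈ s, kc bK (f i) c := by
  simp only [← kcL_apply, map_sum]

theorem kc_smul (x : F) (y : K) (c : ℕ) : kc bK (x • y) c = x * kc bK y c := by
  simp only [← kcL_apply, map_smul, smul_eq_mul]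

theorem kc_add (x y : K) (c : ℕ) : kc bK (x + y) c = kc bK x c + kc bK y c := by
  simp only [← kcL_apply, map_add]

theorem kc_zero (c : ℕ) : kc bK 0 c = 0 := by
  simp only [← kcL_apply, map_zero]

theorem kc_basis {l c : ℕ} (hl : l < m) (hc : c < m) :
    kc bK (ext bK l) c = if l = c then 1 else 0 := by
  simp [kc, ext_of_lt, hl, hc, Finsupp.single_apply]

theorem sum_kc (y : K) : ∑ l ∈ Finset.range m, kc bK y l • ext bK l = y := by
  rw [Finset.sum_range]
  conv_rhs => rw [← bK.sum_repr y]
  exact Finset.sum_congr rfl fun i _ => by simp [kc]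

theorem kc_map (φ : K →ₗ[F] K) (y : K) (c : ℕ) :
    kc bK (φ y) c = ∑ l ∈ Finset.range m, kc bK y l * kc bK (φ (ext bK l)) c := by
  conv_lhs => rw [← sum_kc bK y]
  simp only [map_sum, map_smul, kc_sum, kc_smul]

theorem kc_mul (x y : K) (c : ℕ) : kc bK (x * y) c = ∑ l ∈ Finset.range m,
    ∑ l' ∈ Finset.range m, kc bK x l * (kc bK y l' * kc bK (ext bK l * ext bK l') c) := by
  conv_lhs => rw [← sum_kc bK x, ← sum_kc bK y]
  simp only [Finset.sum_mul, Finset.mul_sum, smul_mul_assoc, mul_smul_comm, kc_sum, kc_smul]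
  rw [Finset.sum_comm]
  exact Finset.sum_congr rfl fun l _ => Finset.sum_congr rfl fun l' _ => by ring

/-- The element with the coordinates `x (b * m), …, x (b * m + m - 1)`. -/
noncomputable def blk (b : ℕ) : (ℕ → F) →ₗ[F] K :=
  ∑ c : Fin m, (LinearMap.proj (R := F) (φ := fun _ : ℕ => F) (b * m + c)).smulRight (bK c)

theorem kc_blk (b : ℕ) (x : ℕ → F) {c : ℕ} (hc : c < m) : kc bK (blk bK b x) c = x (b * m + c) := by
  simp only [blk, LinearMap.sum_apply, LinearMap.smulRight_apply, LinearMap.proj_apply, kc_sum,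
    kc_smul]
  rw [Finset.sum_eq_single ⟨c, hc⟩]
  · simp [kc, ext_of_lt _ hc]
  · intro i _ hi
    have : (i : ℕ) ≠ c := fun h => hi (Fin.ext h)
    simp [kc, ext_of_lt _ hc, Finsupp.single_apply, Fin.ext_iff, this]
  · simp

end

/-! ### Sums of field expressions and multiplication in the extension field -/

section

variable {F : Type*} [Field F] (X : Ctx F)

theorem FE.eval_sum {x : ℕ} {e : Expr} {f : FE} {σ : Store} {N : ℕ} (g : ℕ → F)
    (h : e.eval σ = N) (hN : N < X.L) (hf : ∀ i < N, f.eval X (put σ x 0 i) = g i) :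
    (FE.sum x e f).eval X σ = ∑ i ∈ Finset.range N, g i := by
  simp only [FE.eval, h, Nat.mod_eq_of_lt hN]
  exact Finset.sum_congr rfl fun i hi => hf i (Finset.mem_range.1 hi)

@[simp] theorem FE.eval_nat (e : Expr) (σ : Store) : (FE.nat e).eval X σ = X.el (e.eval σ) := rfl
@[simp] theorem FE.eval_add' (f g : FE) (σ : Store) :
    (FE.add f g).eval X σ = f.eval X σ + g.eval X σ := rfl
@[simp] theorem FE.eval_sub' (f g : FE) (σ : Store) :
    (FE.sub f g).eval X σ = f.eval X σ - g.eval X σ := rfl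
@[simp] theorem FE.eval_mul' (f g : FE) (σ : Store) :
    (FE.mul f g).eval X σ = f.eval X σ * g.eval X σ := rfl

/-- Coordinate `c` of the product of the elements with the coordinates `f` (in terms of the variable
`50`) and `g` (in terms of the variable `51`); the multiplication table is in array `10` and the
degree in cell `0` of array `21`. -/
def mulFE (f g c : Expr) : FE :=
  .sum 50 (V 21) (.sum 51 (V 21) (.mul (.nat f) (.mul (.nat g)
    (.nat (rd 10 ((V 50 * V 21 + V 51) * V 21 + c))))))

variable {m : ℕ} {K : Type*} [Field K] [Algebra F K] (bK : Basis (Fin m) F K)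

/-- Array `10` starts with the multiplication table. -/
structure TabK (σ : Store) : Prop where
  h21 : σ 21 0 = m
  hL : m < X.L
  h10 : ∀ l l' c, l < m → l' < m → c < m →
    σ 10 ((l * m + l') * m + c) = X.code (kc bK (ext bK l * ext bK l') c)

variable {X bK}

theorem TabK.congr {σ τ : Store} (h : TabK X bK σ) (h10 : τ 10 = σ 10) (h21 : τ 21 = σ 21) :
    TabK X bK τ := ⟨by rw [h21, h.h21], h.hL, by rw [h10]; exact h.h10⟩

theorem TabK.step {σ ρ : Store} {c : Cmd} (h : TabK X bK σ) (hρ : c.den X σ = ρ)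
    (hc : c.keeps [10, 21] = true := by rfl) : TabK X bK ρ :=
  h.congr (frs hρ _ hc 10 (by simp)) (frs hρ _ hc 21 (by simp))

theorem mulFE_eval {σ : Store} (h : TabK X bK σ) {f g c : Expr} (x y : K) (cn : ℕ) (hcn : cn < m)
    (hf : ∀ i < m, ∀ j, X.el (f.eval (put (put σ 50 0 i) 51 0 j)) = kc bK x i)
    (hg : ∀ i, ∀ j < m, X.el (g.eval (put (put σ 50 0 i) 51 0 j)) = kc bK y j)
    (hc : ∀ i j, c.eval (put (put σ 50 0 i) 51 0 j) = cn) :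
    (mulFE f g c).eval X σ = kc bK (x * y) cn := by
  rw [kc_mul]
  refine FE.eval_sum X _ (by simp [h.h21]) h.hL fun i hi => ?_
  refine FE.eval_sum X _ (by simp [h.h21]) h.hL fun j hj => ?_
  simp only [FE.eval_mul', FE.eval_nat, hf i hi j, hg i j hj, eval_read, eval_add, eval_mul,
    eval_const, hc, put_same, ne_eq, Nat.reduceEqDiff, not_false_eq_true,
    put_of_ne, h.h21, h.h10 i j cn hi hj hcn, X.el_code]

end

/-! ### Powers by repeated squaring -/

section

variable {F : Type*} [Field F] {X : Ctx F}

theorem pow_step {A : Type*} [CommMonoid A] (acc b : A) (e : ℕ) :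
    (if e % 2 = 0 then acc else acc * b) * (b * b) ^ (e / 2) = acc * b ^ e := by
  rw [← pow_two, ← pow_mul]
  conv_rhs => rw [← Nat.div_add_mod e 2, pow_add]
  split_ifs with h
  · rw [h, pow_zero, mul_one]
  · rw [show e % 2 = 1 by omega, pow_one, mul_assoc, mul_comm b]

/-- Repeated squaring; `d` squares and `c` multiplies the accumulator, and cell `0` of array `30` is
the exponent. -/
def sqC (c d : Cmd) : Cmd :=
  .loop 37 (rd 2 1 - 1) (.seq (.ite (V 30 % 2) c .skip) (.seq d (.set 30 0 (V 30 / 2))))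

/-- The accumulator times the base to the remaining exponent is invariant (`pow_step`), and L - 1
halvings exhaust an exponent below 2^(L-1). The predicate `P` hides the representation, so that the
same loop serves for elements of F and for whole tables of elements of K, multiplied entrywise. -/
theorem sqC_spec {c d : Cmd} {σ ρ : Store} (hρ : (sqC c d).den X σ = ρ) {A : Type*} [CommMonoid A]
    (P : Store → A → A → Prop) {E : ℕ} {z w : A} (hL : σ 2 1 = X.L) (h30 : σ 30 0 = E)
    (hEM : E < X.M) (hEL : E < 2 ^ (X.L - 1)) (h0 : P σ z w)
    (hP : ∀ {τ τ' x y}, P τ x y → (∀ b, b ≠ 30 → b ≠ 37 → τ' b = τ b) → P τ' x y)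
    (hc : ∀ {τ τ' x y}, P τ x y → c.den X τ = τ' → P τ' (x * y) y)
    (hd : ∀ {τ τ' x y}, P τ x y → d.den X τ = τ' → P τ' x (y * y))
    (hc' : c.mods.contains 30 = false := by rfl) (hd' : d.mods.contains 30 = false := by rfl) :
    ∃ y, P ρ (z * w ^ E) y := by
  have hLp := X.L_pos
  obtain ⟨x, y, h, h', h3⟩ := Cmd.loop_inv hρ (X.L - 1) (fun t τ => ∃ x y, P τ x y ∧
    τ 30 0 = E / 2 ^ t ∧ x * y ^ (τ 30 0) = z * w ^ E) (by simp [hL]) (by omega)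
    ⟨z, w, hP h0 (fun b _ h => by simp [h]), by simp [h30], by simp [h30]⟩ (by
    rintro t ht τ - h37 ⟨x, y, i1, i2, i3⟩ τ' h
    simp only [Cmd.den_seq_iff] at h
    obtain ⟨τ₁, e₁, τ₂, e₂, e₃⟩ := h
    rw [Cmd.den_ite X (τ 30 0 % 2) (by simp)] at e₁
    have j1 : P τ₁ (if τ 30 0 % 2 = 0 then x else x * y) y := by
      split_ifs at e₁ ⊢
      exacts [e₁ ▸ i1, hc i1 e₁]
    have f1 : τ₁ 30 = τ 30 := by
      split_ifs at e₁
      exacts [e₁ ▸ rfl, fr e₁ 30 hc']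
    have f3 : τ' 30 0 = τ 30 0 / 2 := set_val e₃ (by simp [fr e₂ 30 hd', f1]) (by
      rw [i2]
      exact ((Nat.div_le_self _ _).trans (Nat.div_le_self _ _)).trans_lt hEM)
    refine ⟨_, _, hP (hd j1 e₂) fun b h h' => ?_, ?_, ?_⟩
    · rw [put_of_ne _ _ _ _ h', fr e₃ b (by simpa [Cmd.mods])]
    · simp [f3, i2, Nat.div_div_eq_div_mul, pow_succ]
    · rw [put_of_ne _ _ _ _ (by omega), f3, pow_step, i3])
  rw [h', Nat.div_eq_of_lt hEL, pow_zero, mul_one] at h3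
  exact ⟨y, h3 ▸ h⟩

/-- Writes the power of `x` with exponent `e + 1` to cell `0` of array `33`. -/
def powS (x : FE) (e : Expr) : Cmd :=
  .seq (.setF 33 0 x) (.seq (.setF 33 1 (.nat (V 33))) (.seq (.set 30 0 e)
    (sqC (.setF 33 0 (.mul (.nat (rd 33 0)) (.nat (rd 33 1))))
      (.setF 33 1 (.mul (.nat (rd 33 1)) (.nat (rd 33 1)))))))

/-- The accumulator starts with `z` and not with 1, because the number of the unit of F is itself
computed by this command. Hence the exponent `E + 1`. -/
theorem powS_spec {x : FE} {e : Expr} {σ ρ : Store} (hρ : (powS x e).den X σ = ρ) (z : F) (E : ℕ)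
    (hx : x.eval X σ = z) (he : ∀ τ : Store, (∀ b, b ≠ 33 → τ b = σ b) → e.eval τ = E)
    (hEM : E < X.M) (hL : σ 2 1 = X.L) (hEL : E < 2 ^ (X.L - 1)) :
    ρ 33 0 = X.code (z ^ (E + 1)) := by
  simp only [powS, Cmd.den_seq_iff] at hρ
  obtain ⟨σ₁, h₁, σ₂, h₂, σ₃, h₃, h⟩ := hρ
  have e0 : σ₃ 33 0 = X.code z ∧ σ₃ 33 1 = X.code z := by
    rw [fr h₃ 33]
    simp [← h₂, ← h₁, Cmd.den_setF, put_cell_ne, hx, X.el_code]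
  obtain ⟨y, hy, -⟩ := sqC_spec h (fun τ x y => τ 33 0 = X.code x ∧ τ 33 1 = X.code y) (E := E)
    (by rw [fr h₃ 2, fr h₂ 2, fr h₁ 2, hL]) (set_val h₃ (he _ fun b hb => by
      rw [fr h₂ b (by simpa [Cmd.mods]), fr h₁ b (by simpa [Cmd.mods])]) hEM) hEM hEL e0
    (fun h e => by rwa [e 33 (by omega) (by omega)])
    (by rintro τ _ x y ⟨h, h'⟩ rfl; simp [Cmd.den_setF, put_cell_ne, h, h', X.el_code])
    (by rintro τ _ x y ⟨h, h'⟩ rfl; simp [Cmd.den_setF, put_cell_ne, h, h', X.el_code])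
  rwa [pow_succ']

theorem Ctx.el_zero : X.el 0 = 0 := by rw [← X.code_zero, X.el_code]

/-- With truncated subtraction, 1 - (i - j) - (j - i) is 1 if i = j and 0 otherwise; entries of unit
matrices are written in this way without a comparison. -/
theorem Ctx.el_diag {o : ℕ} (ho : o = X.code 1) (i j : ℕ) :
    X.el (o * (1 - (i - j) - (j - i))) = if i = j then 1 else 0 := by
  split_ifs with h
  · simp [h, ho, X.el_code]
  · rw [show 1 - (i - j) - (j - i) = 0 by omega, mul_zero, X.el_zero]

end

/-! ### Frobenius images of the basis of the extension field -/

section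

variable {m : ℕ} {F K : Type*} [Field F] [Field K] [Algebra F K] (X : Ctx F) (bK : Basis (Fin m) F K)

/-- Array `s` holds the coordinates of `u 0, …, u (N - 1)`. -/
def Rows (σ : Store) (s N : ℕ) (u : ℕ → K) : Prop :=
  ∀ l < N, ∀ c < m, σ s (l * m + c) = X.code (kc bK (u l) c)

variable {X bK} {σ ρ : Store}

theorem Rows.congr {τ : Store} {s N : ℕ} {u : ℕ → K} (h : Rows X bK σ s N u) (hs : τ s = σ s) :
    Rows X bK τ s N u := by
  rwa [Rows, hs]

/-- Multiplies the rows of the arrays `s` and `s'`. -/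
def mulRowsC (d s s' : ℕ) : Cmd :=
  .seq (.loop 38 (V 21 * V 21) (.setF 39 (V 38) (mulFE (rd s (V 38 / V 21 * V 21 + V 50))
      (rd s' (V 38 / V 21 * V 21 + V 51)) (V 38 % V 21))))
    (.loop 38 (V 21 * V 21) (.setF d (V 38) (.nat (rd 39 (V 38)))))

/-- The products are collected in array `39` before they are copied, since the target array may be
that of a factor. -/
theorem mulRowsC_spec {d s s' : ℕ} (hρ : (mulRowsC d s s').den X σ = ρ) (hσ : TabK X bK σ)
    (hL : m * m < X.L) {u u' : ℕ → K} (hs : Rows X bK σ s m u) (hs' : Rows X bK σ s' m u')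
    (h1 : s ∉ [39, 38, 50, 51] := by decide) (h2 : s' ∉ [39, 38, 50, 51] := by decide)
    (h3 : 38 ≠ d ∧ 39 ≠ d := by decide) : Rows X bK ρ d m (u * u') := by
  obtain ⟨σ₁, e₁, e₂⟩ := Cmd.den_seq_iff.1 hρ
  simp only [List.mem_cons, List.not_mem_nil, or_false, not_or] at h1 h2
  have a1 := tab2_spec e₁ m m (fun l => kc bK ((u * u') l)) (by simp [hσ.h21]) hL (by
    intro τ i c hi hc hτ h38
    refine mulFE_eval (hσ.congr (hτ 10) (hτ 21)) _ _ c hc ?_ ?_ ?_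
    · intro i' hi' j
      simp [h38, hτ 21, hσ.h21, h1, hτ s h1.1 h1.2.1, mul_add_div_self hc, hs i hi i' hi', X.el_code]
    · intro i' j hj
      simp [h38, hτ 21, hσ.h21, h2, hτ s' h2.1 h2.2.1, mul_add_div_self hc, hs' i hi j hj,
        X.el_code]
    · simp [h38, hτ 21, hσ.h21, mul_add_mod_self hc])
  refine tab2_spec e₂ m m _ (by simp [fr e₁ 21, hσ.h21]) hL (fun τ i c hi hc hτ h38 => ?_) h3.1
  simp [h38, hτ 39 h3.2, a1 i hi c hc, X.el_code]

/-- Writes the coordinates of the `q`-th powers of the basis to array `28`; the number of the field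
element `1` is in array `40`. -/
def frobC : Cmd :=
  .seq (.loop 38 (V 21 * V 21) (.setF 28 (V 38) (.nat (V 40 *
      (1 - (V 38 / V 21 - V 38 % V 21) - (V 38 % V 21 - V 38 / V 21))))))
  (.seq (.loop 38 (V 21 * V 21) (.setF 29 (V 38) (.nat (rd 28 (V 38)))))
  (.seq (.set 30 0 (rd 2 2 - 1)) (sqC (mulRowsC 28 28 29) (mulRowsC 29 29 29))))

/-- All basis elements are raised to the power q simultaneously by repeated squaring. The
accumulator starts with the basis itself, which leaves the exponent q - 1. -/
theorem frobC_spec [Finite F] (hρ : frobC.den X σ = ρ) (hσ : TabK X bK σ) (hL : m * m < X.L)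
    (hone : σ 40 0 = X.code 1) (hLc : σ 2 1 = X.L) (hq : σ 2 2 = Nat.card F)
    (hM : Nat.card F ≤ X.M) (hEL : Nat.card F ≤ 2 ^ (X.L - 1)) :
    Rows X bK ρ 28 m (fun l => frob F K 1 (ext bK l)) := by
  have hq1 : 0 < Nat.card F := Nat.card_pos
  simp only [frobC, Cmd.den_seq_iff] at hρ
  obtain ⟨σ₁, e₁, σ₂, e₂, σ₃, e₃, e₄⟩ := hρ
  have a1 : Rows X bK σ₁ 28 m (ext bK) := tab2_spec e₁ m m _ (by simp [hσ.h21]) hL (by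
    intro τ i c hi hc hτ h38
    rw [kc_basis bK hi hc, ← X.el_diag hone]
    simp [h38, hτ 21, hτ 40, hσ.h21, mul_add_div_self hc, mul_add_mod_self hc])
  have b1 : Rows X bK σ₂ 29 m (ext bK) := tab2_spec e₂ m m _ (by simp [fr e₁ 21, hσ.h21]) hL (by
    intro τ i c hi hc hτ h38
    simp [h38, hτ 28, a1 i hi c hc, X.el_code])
  obtain ⟨y, -, h, -⟩ := sqC_spec e₄ (fun τ x y => TabK X bK τ ∧ Rows X bK τ 28 m x ∧
    Rows X bK τ 29 m y) (E := Nat.card F - 1) (by rw [fr e₃ 2, fr e₂ 2, fr e₁ 2, hLc])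
    (set_val e₃ (by simp [fr e₂ 2, fr e₁ 2, hq]) (by omega)) (by omega) (by omega)
    ⟨((hσ.step e₁).step e₂).step e₃, (a1.congr (fr e₂ 28)).congr (fr e₃ 28), b1.congr (fr e₃ 29)⟩
    (fun h e => ⟨h.1.congr (e 10 (by omega) (by omega)) (e 21 (by omega) (by omega)),
      h.2.1.congr (e 28 (by omega) (by omega)), h.2.2.congr (e 29 (by omega) (by omega))⟩)
    (fun h e => ⟨h.1.step e, mulRowsC_spec e h.1 hL h.2.1 h.2.2, h.2.2.congr (fr e 29)⟩)
    (fun h e => ⟨h.1.step e, h.2.1.congr (fr e 28), mulRowsC_spec e h.1 hL h.2.2 h.2.2⟩)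
  rw [← pow_succ', Nat.sub_add_cancel hq1] at h
  intro l hl c hc
  simp [h l hl c hc, frob_apply]

end

/-! ### The list decoder -/

section

variable {F : Type*} [Field F] {X : Ctx F}

/-- The rows are the unit vectors of length `W`. -/
def unitRowsC (W : Expr) : Cmd :=
  .seq (.set 12 0 W) (.seq (.set 20 0 W) (.loop 38 (V 12 * V 12) (.setF 11 (V 38) (.nat (V 40 *
    (1 - (V 38 / V 12 - V 38 % V 12) - (V 38 % V 12 - V 38 / V 12)))))))

theorem unitRowsC_spec {We : Expr} {σ ρ : Store} (hρ : (unitRowsC We).den X σ = ρ) (W : ℕ)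
    (hW : ∀ τ : Store, (∀ b, b ≠ 12 → τ b = σ b) → We.eval τ = W) (hone : σ 40 0 = X.code 1)
    (hL : W * W < X.L) (hM : W < X.M) :
    RowBasis X ρ (fun x => ∀ j, W ≤ j → x j = 0) ∧ ρ 12 0 = W ∧ ρ 20 0 = W := by
  simp only [unitRowsC, Cmd.den_seq_iff] at hρ
  obtain ⟨σ₁, h₁, σ₂, h₂, h₃⟩ := hρ
  have e12 : σ₂ 12 0 = W := by
    rw [fr h₂ 12]
    exact set_val h₁ (hW σ fun _ _ => rfl) hM
  have h12 : ρ 12 0 = W := by rw [fr h₃ 12, e12]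
  have h20 : ρ 20 0 = W := by
    rw [fr h₃ 20]
    exact set_val h₂ (hW _ fun b hb => fr h₁ b (by simpa [Cmd.mods])) hM
  have a1 := tab2_spec h₃ W W (fun i j => if i = j then 1 else 0) (by simp [e12]) hL (by
    intro τ i c hi hc hτ h38
    rw [← X.el_diag hone]
    simp [h38, hτ 12, e12, hτ 40, fr h₂ 40, fr h₁ 40, mul_add_div_self hc, mul_add_mod_self hc])
  refine ⟨?_, h12, h20⟩
  have hrow : ∀ i < W, rowv X ρ i = Pi.single i 1 := by
    intro i hi
    funext j
    simp only [rowv, h20]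
    split_ifs with hj
    · rw [a1 i hi j hj, X.el_code, Pi.single_apply]
      simp only [eq_comm]
    · rw [Pi.single_apply, if_neg (by omega)]
  rw [rowBasis_iff X h12 hrow]
  constructor
  · exact (Pi.linearIndependent_single_one ℕ F).comp (fun i : Fin W => (i : ℕ)) Fin.val_injective
  · intro x
    constructor
    · intro hx j hj
      have hle : Submodule.span F (Set.range fun i : Fin W => (Pi.single (i : ℕ) 1 : ℕ → F)) ≤
          LinearMap.ker (LinearMap.proj (R := F) (φ := fun _ : ℕ => F) j) := by
        rw [Submodule.span_le]
        rintro _ ⟨i, rfl⟩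
        simp only [SetLike.mem_coe, LinearMap.mem_ker, LinearMap.proj_apply, Pi.single_apply]
        rw [if_neg (by omega)]
      exact hle hx
    · intro hx
      rw [Submodule.mem_span_range_iff_exists_fun]
      refine ⟨fun i => x i, funext fun j => ?_⟩
      simp only [Finset.sum_apply, Pi.smul_apply, Pi.single_apply, smul_eq_mul, mul_ite, mul_one,
        mul_zero]
      by_cases hj : j < W
      · rw [Finset.sum_eq_single ⟨j, hj⟩] <;> simp [Fin.ext_iff, eq_comm]
        exact fun a h h' => absurd h' h
      · rw [hx j (by omega), Finset.sum_eq_zero fun i _ => if_neg (by omega)]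

end

/-! ### Data of the decoder and powers of the evaluation points -/

section

variable {m : ℕ} {F K : Type*} [Field F] [Field K] [Algebra F K]

variable (X : Ctx F) (bK : Basis (Fin m) F K) {n k κ s D : ℕ}

/-- The data of the decoder in the memory. -/
structure DecIn (α : Fin n → F) (v : Fin κ → Fin k → K) (y : Fin n → K) (s D : ℕ) (σ : Store) :
    Prop where
  tab : TabK X bK σ
  par : σ 23 0 = n ∧ σ 24 0 = k ∧ σ 25 0 = κ ∧ σ 26 0 = s ∧ σ 27 0 = D
  hα : ∀ i < n, σ 10 (m * m * m + i) = X.code (ext α i)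
  hv : ∀ l < κ, ∀ j < k, ∀ c < m, σ 10 (m * m * m + n + (l * (k * m) + (j * m + c))) =
    X.code (kc bK (ext (ext v l) j) c)
  hy : ∀ i < n, ∀ c < m, σ 10 (m * m * m + n + κ * (k * m) + (i * m + c)) =
    X.code (kc bK (ext y i) c)
  h21 : σ 2 1 = X.L
  h22 : σ 2 2 = Nat.card F
  one : σ 40 0 = X.code 1

variable {X bK} {α : Fin n → F} {v : Fin κ → Fin k → K} {y : Fin n → K} {σ : Store}

theorem DecIn.vals (h : DecIn X bK α v y s D σ) : σ 21 0 = m ∧ σ 23 0 = n ∧ σ 24 0 = k ∧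
    σ 25 0 = κ ∧ σ 26 0 = s ∧ σ 27 0 = D :=
  ⟨h.tab.h21, h.par⟩

theorem DecIn.congr {τ : Store} (h : DecIn X bK α v y s D σ)
    (e : ∀ b ∈ [2, 10, 21, 23, 24, 25, 26, 27, 40], τ b = σ b) : DecIn X bK α v y s D τ := by
  have t := h.tab.congr (e 10 (by simp)) (e 21 (by simp))
  cases h
  constructor <;> simp_all

theorem DecIn.step {ρ : Store} {c : Cmd} (h : DecIn X bK α v y s D σ) (hρ : c.den X σ = ρ)
    (hc : c.keeps [2, 10, 21, 23, 24, 25, 26, 27, 40] = true := by rfl) :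
    DecIn X bK α v y s D ρ :=
  h.congr (frs hρ _ hc)

theorem DecIn.loop {τ : Store} {b x : ℕ} (h : DecIn X bK α v y s D σ)
    (e : ∀ c, c ≠ b → c ≠ x → τ c = σ c)
    (hc : ∀ c ∈ [2, 10, 21, 23, 24, 25, 26, 27, 40], c ≠ b ∧ c ≠ x := by decide) :
    DecIn X bK α v y s D τ :=
  h.congr fun c h => e c (hc c h).1 (hc c h).2

/-- The powers of the evaluation points. -/
def alphaPowC : Cmd :=
  .loop 38 (V 23 * (V 27 + V 24)) (.setF 32 (V 38) (.ite (V 38 % (V 27 + V 24))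
    (.mul (.nat (rd 32 (V 38 - 1))) (.nat (rd 10 (V 21 * V 21 * V 21 + V 38 / (V 27 + V 24)))))
    (.nat (V 40))))

theorem alphaPowC_spec {ρ : Store} (hρ : alphaPowC.den X σ = ρ) (h : DecIn X bK α v y s D σ)
    (hL : n * (D + k) < X.L) :
    ∀ i < n, ∀ w < D + k, ρ 32 (i * (D + k) + w) = X.code (ext α i ^ w) := by
  refine tab2_rec hρ n (D + k) (fun i w => ext α i ^ w) (by simp [h.vals]) hL ?_
  intro τ i w hi hw hτ h38 hrec
  have h' := h.loop @hτ
  rw [FE.eval_ite X w (by simp [h38, h'.vals, mul_add_mod_self hw])]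
  rcases w with - | w
  · simp [h'.one, X.el_code]
  · have := hrec i w (by omega) (by omega)
    simp [h38, h'.vals, mul_add_div_self hw, this, X.el_code, h'.hα _ hi, pow_succ]

end

/-! ### The linear forms of the interpolation system and of the message system -/

section

variable {m : ℕ} {F K : Type*} [Field F] [Finite F] [Field K] [Algebra F K]

/-- The elements of `K` whose conjugates are computed: the received word and the basis. -/
noncomputable def wordBasis (bK : Basis (Fin m) F K) {n : ℕ} (y : Fin n → K) (i : ℕ) : K :=
  if i < n then ext y i else ext bK (i - n)

/-- The conjugates of the received word and of the basis. -/
noncomputable def conjK (bK : Basis (Fin m) F K) {n : ℕ} (y : Fin n → K) (r : ℕ) : K :=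
  frob F K (r / (n + m)) (wordBasis bK y (r % (n + m)))

/-- The left-hand side of an interpolation condition. -/
noncomputable def interpForm (bK : Basis (Fin m) F K) (k s D : ℕ) (α : F) (y : K) :
    (ℕ → F) →ₗ[F] K :=
  ∑ w ∈ Finset.range (D + k), α ^ w • blk bK w + ∑ j ∈ Finset.range s, ∑ w ∈ Finset.range (D + 1),
    α ^ w • (LinearMap.mulRight F (frob F K j y) ∘ₗ blk bK (D + k + (j * (D + 1) + w)))

theorem kc_interpForm (bK : Basis (Fin m) F K) (k s D : ℕ) (α : F) (y : K) (x : ℕ → F) (c : ℕ) :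
    kc bK (interpForm bK k s D α y x) c = ∑ w ∈ Finset.range (D + k), α ^ w * kc bK (blk bK w x) c +
      ∑ j ∈ Finset.range s, ∑ w ∈ Finset.range (D + 1), α ^ w *
        kc bK (blk bK (D + k + (j * (D + 1) + w)) x * frob F K j y) c := by
  simp [interpForm, kc_add, kc_sum, kc_smul]

/-- The products of the interpolating coefficients with the conjugates of the basis. -/
noncomputable def coefK (bK : Basis (Fin m) F K) (k D : ℕ) (x : ℕ → F) (z : ℕ) : K :=
  blk bK (D + k + z / m) x * frob F K (z / m / (D + 1)) (ext bK (z % m))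

/-- The coefficients of the message polynomial. -/
noncomputable def fvec (bK : Basis (Fin m) F K) (k : ℕ) : (ℕ → F) →ₗ[F] (Fin k → K) :=
  LinearMap.pi fun i => blk bK i

/-- The left-hand side of a condition on a multiple of a message polynomial. -/
noncomputable def relForm (bK : Basis (Fin m) F K) (k s D : ℕ) (A₀ : ℕ → K) (A : ℕ → ℕ → K)
    (w : ℕ) : (ℕ → F) →ₗ[F] K :=
  (LinearMap.proj (R := F) (φ := fun _ : ℕ => F) (k * m)).smulRight (A₀ w) +
    relCoeff s D A w ∘ₗ fvec bK k

theorem kc_relForm (bK : Basis (Fin m) F K) (k s D : ℕ) (A₀ : ℕ → K) (A : ℕ → ℕ → K)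
    (w : ℕ) (x : ℕ → F) (c : ℕ) :
    kc bK (relForm bK k s D A₀ A w x) c = kc bK (A₀ w) c * x (k * m) +
      ∑ i ∈ Finset.range k, ∑ j ∈ Finset.range s, if i ≤ w ∧ w ≤ D + i then
        ∑ l ∈ Finset.range m, kc bK (blk bK i x) l * kc bK (A j (w - i) * frob F K j (ext bK l)) c
        else 0 := by
  rw [relForm, LinearMap.add_apply, kc_add, LinearMap.smulRight_apply, kc_smul, mul_comm,
    LinearMap.comp_apply, relCoeff_apply, kc_sum, Finset.sum_range]
  congr 1
  refine Finset.sum_congr rfl fun i _ => ?_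
  rw [kc_sum]
  refine Finset.sum_congr rfl fun j _ => ?_
  split_ifs
  · exact kc_map bK (LinearMap.mulLeft F (A j (w - i)) ∘ₗ (frob F K j).toLinearMap) _ c
  · exact kc_zero bK c

variable {X : Ctx F} {bK : Basis (Fin m) F K} {n k κ s D : ℕ} {α : Fin n → F}
  {v : Fin κ → Fin k → K} {y : Fin n → K} {σ : Store}

/-- Array `31` consists of blocks of n + m rows. The first block is the received word followed by
the basis of K; each further block arises from the preceding one by Frobenius, applied linearly
through the images of the basis in array `28`. -/
def conjC : Cmd :=
  .loop 38 (V 26 * (V 23 + V 21) * V 21) (.setF 31 (V 38) (.ite (V 23 + V 21 - V 38 / V 21)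
    (.ite (V 23 - V 38 / V 21)
      (.nat (rd 10 (V 21 * V 21 * V 21 + V 23 + V 25 * (V 24 * V 21) + V 38)))
      (.nat (V 40 * (1 - (V 38 / V 21 - V 23 - V 38 % V 21) -
        (V 38 % V 21 - (V 38 / V 21 - V 23))))))
    (.sum 50 (V 21) (.mul (.nat (rd 31 ((V 38 / V 21 - (V 23 + V 21)) * V 21 + V 50)))
      (.nat (rd 28 (V 50 * V 21 + V 38 % V 21)))))))

theorem conjC_spec {ρ : Store} (hρ : conjC.den X σ = ρ) (h : DecIn X bK α v y s D σ)
    (hL : s * (n + m) * m < X.L) (h28 : Rows X bK σ 28 m (fun l => frob F K 1 (ext bK l))) :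
    Rows X bK ρ 31 (s * (n + m)) (conjK bK y) := by
  refine tab2_rec hρ _ m (fun r => kc bK (conjK bK y r)) (by simp [h.vals]) hL ?_
  intro τ r c hr hc hτ h38 hrec
  have h' := h.loop @hτ
  rw [FE.eval_ite X (n + m - r) (by simp [h38, h'.vals, mul_add_div_self hc])]
  split_ifs with h0
  · obtain ⟨r, rfl⟩ := Nat.exists_eq_add_of_le (show n + m ≤ r by omega)
    have e1 : conjK bK y (n + m + r) = (frob F K 1).toLinearMap (conjK bK y r) := by
      simp only [conjK, AlgHom.toLinearMap_apply, Nat.add_mod_left,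
        Nat.add_div_left r (show 0 < n + m by omega), frob_apply, ← pow_mul, pow_one, ← pow_succ]
    rw [e1, kc_map bK (frob F K 1).toLinearMap]
    refine FE.eval_sum X _ (by simp [h'.vals]) h.tab.hL fun i hi => ?_
    have r1 := hrec r i (by nlinarith) hi
    simp [h38, h'.vals, mul_add_div_self hc, mul_add_mod_self hc, r1, X.el_code, hτ 28,
      h28 i hi _ hc]
  · rw [FE.eval_ite X (n - r) (by simp [h38, h'.vals, mul_add_div_self hc]), conjK,
      Nat.div_eq_of_lt (by omega), Nat.mod_eq_of_lt (by omega), frob_apply, pow_zero, pow_one,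
      wordBasis]
    split_ifs with h1 h2 h2
    · omega
    · rw [kc_basis bK (by omega) hc, ← X.el_diag h'.one]
      simp [h38, h'.vals, mul_add_div_self hc, mul_add_mod_self hc]
    · simp [h38, h'.vals, h'.hy _ h2 _ hc, X.el_code]
    · omega

/-- The value of an interpolation condition on a row. -/
def interpFE : FE :=
  .add (.sum 52 (V 27 + V 24) (.mul (.nat (rd 32 (V 18 / V 21 * (V 27 + V 24) + V 52)))
      (.nat (rd 11 (V 22 * V 20 + (V 52 * V 21 + V 18 % V 21))))))
    (.sum 52 (V 26) (.sum 53 (V 27 + 1) (.mul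
      (.nat (rd 32 (V 18 / V 21 * (V 27 + V 24) + V 53)))
      (mulFE (rd 11 (V 22 * V 20 + ((V 27 + V 24 + (V 52 * (V 27 + 1) + V 53)) * V 21 + V 50)))
        (rd 31 ((V 52 * (V 23 + V 21) + V 18 / V 21) * V 21 + V 51)) (V 18 % V 21)))))

theorem interpFE_eval (h : DecIn X bK α v y s D σ) (hk : 0 < k) (hL1 : D + k < X.L) (hL2 : s < X.L)
    (h32 : ∀ i < n, ∀ w < D + k, σ 32 (i * (D + k) + w) = X.code (ext α i ^ w))
    (h31 : Rows X bK σ 31 (s * (n + m)) (conjK bK y))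
    (h20 : σ 20 0 = (D + k + s * (D + 1)) * m) {z r : ℕ} (hz : z < n * m) (h18 : σ 18 0 = z)
    (h22 : σ 22 0 = r) :
    interpFE.eval X σ =
      kcL bK (z % m) (interpForm bK k s D (ext α (z / m)) (ext y (z / m)) (rowv X σ r)) := by
  have hm : 0 < m := Nat.pos_of_ne_zero (by rintro rfl; simp at hz)
  have hc := Nat.mod_lt z hm
  have hi : z / m < n := Nat.div_lt_of_lt_mul (by rwa [mul_comm])
  rw [kcL_apply, kc_interpForm, interpFE, FE.eval_add']
  congr 1
  · refine FE.eval_sum X _ (by simp [h.vals]) hL1 fun w hw => ?_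
    have hlt : w * m + z % m < σ 20 0 := by
      rw [h20]; exact mul_add_lt (by omega) hc
    have := rowv_eq (X := X) (i := r) hlt
    rw [kc_blk bK _ _ hc, ← this]
    simp [h.vals, h18, h22, h32 _ hi w hw, X.el_code]
  · refine FE.eval_sum X _ (by simp [h.vals]) hL2 fun j hj => ?_
    refine FE.eval_sum X _ (by simp [h.vals]) (by omega) fun w hw => ?_
    rw [FE.eval_mul']
    congr 1
    · simp [h.vals, h18, h32 _ hi w (by omega), X.el_code]
    · refine mulFE_eval (h.tab.congr (by simp) (by simp)) _ _ _ hc ?_ ?_ ?_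
      · intro i' hi' j'
        have hlt : (D + k + (j * (D + 1) + w)) * m + i' < σ 20 0 := by
          rw [h20]
          exact mul_add_lt (by have := mul_add_lt hj hw; omega) hi'
        rw [kc_blk bK _ _ hi', ← rowv_eq (i := r) hlt]
        simp [h.vals, h22]
      · intro i' j' hj'
        have hlt : z / m < n + m := by omega
        have := h31 _ (mul_add_lt hj hlt) j' hj'
        rw [conjK, mul_add_div_self hlt, mul_add_mod_self hlt, wordBasis, if_pos hi] at this
        simp [h.vals, h18, this, X.el_code]
      · simp [h.vals, h18]

/-- In the message system the unknowns are the coordinates of the message coefficients. By linearity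
it suffices to know the products of the interpolating coefficients with the conjugates of the basis
elements; they are tabulated once. -/
def coefC : Cmd :=
  .loop 38 (V 26 * (V 27 + 1) * V 21 * V 21) (.setF 35 (V 38) (mulFE
    (rd 34 ((V 27 + V 24 + V 38 / V 21 / V 21) * V 21 + V 50))
    (rd 31 ((V 38 / V 21 / V 21 / (V 27 + 1) * (V 23 + V 21) + (V 23 + V 38 / V 21 % V 21)) *
      V 21 + V 51)) (V 38 % V 21)))

theorem coefC_spec {ρ : Store} (hρ : coefC.den X σ = ρ) (h : DecIn X bK α v y s D σ)
    (hL : s * (D + 1) * m * m < X.L) (h31 : Rows X bK σ 31 (s * (n + m)) (conjK bK y)) {x : ℕ → F}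
    (h34 : ∀ j < (D + k + s * (D + 1)) * m, σ 34 j = X.code (x j)) :
    Rows X bK ρ 35 (s * (D + 1) * m) (coefK bK k D x) := by
  refine tab2_spec hρ _ m _ (by simp [h.vals]) hL fun τ z c hz hc hτ h38 => ?_
  have hm : 0 < m := by omega
  have h' := h.loop @hτ
  have hl := Nat.mod_lt z hm
  have hb : z / m < s * (D + 1) := Nat.div_lt_of_lt_mul (by rwa [mul_comm])
  have hj : z / m / (D + 1) < s := Nat.div_lt_of_lt_mul (by rwa [mul_comm])
  refine mulFE_eval h'.tab _ _ _ hc ?_ ?_ ?_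
  · intro i hi j
    have := h34 _ (mul_add_lt (show D + k + z / m < D + k + s * (D + 1) by omega) hi)
    rw [kc_blk bK _ _ hi]
    simp [h38, h'.vals, mul_add_div_self hc, hτ 34, this, X.el_code]
  · intro i j hj'
    have hlt : n + z % m < n + m := by omega
    have := h31 _ (mul_add_lt hj hlt) j hj'
    rw [conjK, mul_add_div_self hlt, mul_add_mod_self hlt, wordBasis, if_neg (by omega),
      Nat.add_sub_cancel_left] at this
    simp [h38, h'.vals, mul_add_div_self hc, hτ 31, this, X.el_code]
  · simp [h38, h'.vals, mul_add_mod_self hc]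

/-- The value of a condition on a multiple of a message polynomial on a row. -/
def relFE : FE :=
  .add (.mul (.nat (rd 34 (V 18))) (.nat (rd 11 (V 22 * V 20 + V 24 * V 21))))
    (.sum 50 (V 24) (.sum 51 (V 26) (.ite
      ((1 - (V 50 - V 18 / V 21)) * (1 - (V 18 / V 21 - (V 27 + V 50))))
      (.sum 52 (V 21) (.mul (.nat (rd 11 (V 22 * V 20 + (V 50 * V 21 + V 52))))
        (.nat (rd 35 (((V 51 * (V 27 + 1) + (V 18 / V 21 - V 50)) * V 21 + V 52) * V 21 +
          V 18 % V 21)))))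
      (.nat 0))))

theorem relFE_eval (h : DecIn X bK α v y s D σ) (hL1 : k < X.L) (hL2 : s < X.L) {x : ℕ → F}
    (h34 : ∀ j < (D + k + s * (D + 1)) * m, σ 34 j = X.code (x j))
    (h35 : Rows X bK σ 35 (s * (D + 1) * m) (coefK bK k D x))
    (h20 : σ 20 0 = k * m + 1) {z r : ℕ} (hz : z < (D + k) * m) (h18 : σ 18 0 = z)
    (h22 : σ 22 0 = r) :
    relFE.eval X σ = kcL bK (z % m) (relForm bK k s D (fun w => blk bK w x)
      (fun j d => blk bK (D + k + (j * (D + 1) + d)) x) (z / m) (rowv X σ r)) := by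
  have hm : 0 < m := Nat.pos_of_ne_zero (by rintro rfl; simp at hz)
  have hc := Nat.mod_lt z hm
  have hi : z / m < D + k := Nat.div_lt_of_lt_mul (by rwa [mul_comm])
  rw [kcL_apply, kc_relForm, relFE, FE.eval_add']
  congr 1
  · have e1 : kc bK (blk bK (z / m) x) (z % m) = x z := by
      rw [kc_blk bK _ _ hc, Nat.div_add_mod']
    have e2 := h34 z (hz.trans_le (Nat.mul_le_mul_right _ (by omega)))
    rw [e1, ← rowv_eq (i := r) (show k * m < σ 20 0 by omega)]
    simp [h18, h22, h.vals, e2, X.el_code]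
  · refine FE.eval_sum X _ (by simp [h.vals]) hL1 fun i hi' => ?_
    refine FE.eval_sum X _ (by simp [h.vals]) hL2 fun j hj => ?_
    -- By truncation the two factors are nonzero exactly under the two inequalities that delimit the
    -- contribution of the i-th coefficient to the given power of X.
    rw [FE.eval_ite X ((1 - (i - z / m)) * (1 - (z / m - (D + i))))
      (by simp [h18, h.vals])]
    by_cases hcond : i ≤ z / m ∧ z / m ≤ D + i
    · rw [if_pos hcond, if_neg (by
        rw [show i - z / m = 0 by omega, show z / m - (D + i) = 0 by omega]; simp)]
      refine FE.eval_sum X _ (by simp [h.vals]) h.tab.hL fun l hl => ?_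
      have hlt : i * m + l < σ 20 0 := by
        rw [h20]; exact (mul_add_lt hi' hl).trans (by omega)
      have hd : z / m - i < D + 1 := by omega
      have := h35 _ (mul_add_lt (mul_add_lt hj hd) hl) _ hc
      rw [coefK, mul_add_div_self hl, mul_add_mod_self hl, mul_add_div_self hd] at this
      rw [kc_blk bK _ _ hl, ← rowv_eq (i := r) hlt]
      simp [h18, h22, h.vals, this, X.el_code]
    · rw [if_neg hcond, if_pos]
      · simp [← X.code_zero, X.el_code]
      · rw [not_and_or, not_le, not_le] at hcond
        rcases hcond with h5 | h5
        · rw [show 1 - (i - z / m) = 0 by omega, zero_mul]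
        · rw [show 1 - (z / m - (D + i)) = 0 by omega, mul_zero]

end

/-! ### Message rows with a homogenizing coordinate -/

section

variable {m : ℕ} {F K : Type*} [Field F] [Field K] [Algebra F K] (bK : Basis (Fin m) F K) {k : ℕ}

/-- The coordinates of a tuple of elements of `K`. -/
noncomputable def toRow (f : Fin k → K) (j : ℕ) : F :=
  if j < k * m then kc bK (ext f (j / m)) (j % m) else 0

variable {bK}

theorem fvec_eq {x : ℕ → F} {f : Fin k → K} (h : ∀ j < k * m, x j = kc bK (ext f (j / m)) (j % m)) :
    fvec bK k x = f := by
  funext i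
  refine kc_injective bK fun c hc => ?_
  show kc bK (blk bK i x) c = _
  rw [kc_blk bK _ _ hc, h _ (mul_add_lt i.2 hc), mul_add_div_self hc, mul_add_mod_self hc, ext_val]

theorem kc_fvec (x : ℕ → F) {j : ℕ} (hj : j < k * m) :
    kc bK (ext (fvec bK k x) (j / m)) (j % m) = x j := by
  have hm : 0 < m := Nat.pos_of_ne_zero (by rintro rfl; simp at hj)
  rw [ext_of_lt _ (Nat.div_lt_of_lt_mul (by rwa [mul_comm]))]
  show kc bK (blk bK (j / m) x) _ = _
  rw [kc_blk bK _ _ (Nat.mod_lt _ hm), Nat.div_add_mod']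

theorem fvec_toRow (f : Fin k → K) : fvec bK k (toRow bK f) = f :=
  fvec_eq fun j hj => by rw [toRow, if_pos hj]

theorem fvec_single : fvec bK k (Pi.single (k * m) 1 : ℕ → F) = 0 :=
  fvec_eq fun j hj => by
    rw [Pi.single_apply, if_neg (by omega)]
    simp [ext, kc_zero]

theorem eq_of_fvec {x x' : ℕ → F} (h : ∀ j, k * m + 1 ≤ j → x j = x' j) (h' : x (k * m) = x' (k * m))
    (hf : fvec bK k x = fvec bK k x') : x = x' := by
  funext j
  rcases lt_trichotomy j (k * m) with hj | rfl | hj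
  · rw [← kc_fvec (bK := bK) x hj, hf, kc_fvec x' hj]
  · exact h'
  · exact h j hj

variable {X : Ctx F} {n κ s D : ℕ} {α : Fin n → F} {v : Fin κ → Fin k → K} {y : Fin n → K}
  {σ : Store}

/-- The rows are the basis of the space of message polynomials, extended by a zero, and a unit
vector. -/
def msgRowsC : Cmd :=
  .seq (.set 12 0 (V 25 + 1)) (.seq (.set 20 0 (V 24 * V 21 + 1)) (.loop 38 (V 12 * V 20)
    (.setF 11 (V 38) (.ite (V 25 - V 38 / V 20)
      (.ite (V 24 * V 21 - V 38 % V 20) (.nat (rd 10 (V 21 * V 21 * V 21 + V 23 +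
        (V 38 / V 20 * (V 24 * V 21) + V 38 % V 20)))) (.nat 0))
      (.ite (V 24 * V 21 - V 38 % V 20) (.nat 0) (.nat (V 40)))))))

/-- Coordinate `k * m` is a homogenizing variable: a row encodes a message together with a multiple
of `A₀`, which turns the affine system for messages into a linear one. Value 1 of this coordinate
selects its solutions, value 0 those of the homogeneous system. -/
theorem msgRowsC_spec {ρ : Store} (hρ : msgRowsC.den X σ = ρ) (h : DecIn X bK α v y s D σ)
    (hv : LinearIndependent F v) (hL : (κ + 1) * (k * m + 1) < X.L) (hM : κ + 1 < X.M)
    (hM' : k * m + 1 < X.M) :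
    RowBasis X ρ (fun x => (∀ j, k * m + 1 ≤ j → x j = 0) ∧
      fvec bK k x ∈ Submodule.span F (Set.range v)) ∧ ρ 12 0 = κ + 1 ∧ ρ 20 0 = k * m + 1 := by
  simp only [msgRowsC, Cmd.den_seq_iff] at hρ
  obtain ⟨σ₁, h₁, σ₂, h₂, h₃⟩ := hρ
  have i1 := h.step h₁
  have e12 : σ₂ 12 0 = κ + 1 := by
    rw [fr h₂ 12]
    exact set_val h₁ (by simp [h.vals]) hM
  have e20 : σ₂ 20 0 = k * m + 1 := set_val h₂ (by simp [i1.vals]) hM'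
  set row : ℕ → ℕ → F := fun i => if i < κ then toRow bK (ext v i) else Pi.single (k * m) 1
    with hrowdef
  have a1 := tab2_spec h₃ (κ + 1) (k * m + 1) row (by simp [e12, e20]) hL (by
    intro τ i c hi hc hτ h38
    have ht := (i1.step h₂).loop @hτ
    have q := And.intro (mul_add_mod_self (i := i) hc) (mul_add_div_self (i := i) hc)
    have e1 : (V 24 * V 21 - V 38 % V 20).eval τ = k * m - c := by
      simp [h38, hτ 20, e20, ht.vals, q]
    rw [FE.eval_ite X (κ - i) (by simp [h38, hτ 20, e20, ht.vals, q]), FE.eval_ite X _ e1,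
      FE.eval_ite X _ e1]
    simp only [hrowdef]
    by_cases hiκ : i < κ
    · rw [if_neg (by omega), if_pos hiκ, toRow]
      by_cases hck : c < k * m
      · rw [if_neg (by omega), if_pos hck]
        have hm : 0 < m := Nat.pos_of_ne_zero (by rintro rfl; simp at hck)
        have := ht.hv i hiκ (c / m) (Nat.div_lt_of_lt_mul (by rwa [mul_comm])) (c % m)
          (Nat.mod_lt _ hm)
        rw [Nat.div_add_mod'] at this
        simp [h38, hτ 20, e20, ht.vals, q, this, X.el_code]
      · rw [if_pos (by omega), if_neg hck]
        simp [X.el_zero]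
    · rw [if_pos (by omega), if_neg hiκ, Pi.single_apply]
      by_cases hck : c < k * m
      · rw [if_neg (by omega), if_neg (by omega)]
        simp [X.el_zero]
      · rw [if_pos (by omega), if_pos (by omega)]
        simp [ht.one, X.el_code])
  have h12 : ρ 12 0 = κ + 1 := by rw [fr h₃ 12, e12]
  have h20 : ρ 20 0 = k * m + 1 := by rw [fr h₃ 20, e20]
  refine ⟨?_, h12, h20⟩
  have hsupp : ∀ i j, k * m + 1 ≤ j → row i j = 0 := by
    intro i j hj
    simp only [hrowdef]
    split_ifs
    · rw [toRow, if_neg (by omega)]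
    · rw [Pi.single_apply, if_neg (by omega)]
  have hrow : ∀ i < κ + 1, rowv X ρ i = row i := by
    intro i hi
    funext j
    simp only [rowv, h20]
    split_ifs with hj
    · rw [a1 i hi j hj, X.el_code]
    · rw [hsupp i j (by omega)]
  rw [rowBasis_iff X h12 hrow]
  have r1 : ∀ i : Fin κ, row (i.castSucc : Fin (κ + 1)) = toRow bK (v i) := fun i => by
    simp [hrowdef]
  have r2 : row (Fin.last κ) = Pi.single (k * m) 1 := by simp [hrowdef]
  have hsum : ∀ (g : Fin (κ + 1) → F), ∑ i, g i • row i =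
      ∑ i : Fin κ, g i.castSucc • toRow bK (v i) + g (Fin.last κ) • Pi.single (k * m) 1 := by
    intro g
    rw [Fin.sum_univ_castSucc, r2]
    simp only [r1]
  constructor
  · rw [Fintype.linearIndependent_iff]
    intro g hg
    rw [hsum] at hg
    have g1 := congrFun hg (k * m)
    have g2 := congrArg (fvec bK k) hg
    simp only [map_add, map_sum, map_smul, fvec_toRow, fvec_single, smul_zero, add_zero,
      map_zero] at g2
    have g3 := Fintype.linearIndependent_iff.1 hv _ g2
    have g4 : g (Fin.last κ) = 0 := by simpa [toRow] using g1
    exact fun i => Fin.lastCases g4 g3 i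
  · intro x
    constructor
    · intro hx
      obtain ⟨g, rfl⟩ := (Submodule.mem_span_range_iff_exists_fun F).1 hx
      refine ⟨fun j hj => ?_, ?_⟩
      · simp only [Finset.sum_apply, Pi.smul_apply, hsupp _ j hj, smul_zero, Finset.sum_const_zero]
      · rw [hsum]
        simp only [map_add, map_sum, map_smul, fvec_toRow, fvec_single, smul_zero, add_zero]
        exact Submodule.sum_mem _ fun i _ => Submodule.smul_mem _ _ (Submodule.subset_span ⟨i, rfl⟩)
    · rintro ⟨hx1, hx2⟩
      obtain ⟨g, hg⟩ := (Submodule.mem_span_range_iff_exists_fun F).1 hx2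
      rw [Submodule.mem_span_range_iff_exists_fun]
      refine ⟨Fin.snoc g (x (k * m)), ?_⟩
      rw [hsum]
      simp only [Fin.snoc_castSucc, Fin.snoc_last]
      refine eq_of_fvec (bK := bK) (k := k) (fun j hj => ?_) ?_ ?_
      · rw [hx1 j hj]
        simp [toRow, show j ≠ k * m by omega, show ¬ j < k * m by omega]
      · simp [toRow]
      · simp only [map_add, map_sum, map_smul, fvec_toRow, fvec_single, smul_zero, add_zero, hg]

end

/-! ### The interpolation step and the solution of the message system -/

section

variable {m : ℕ} {F K : Type*} [Field F] [Field K] [Algebra F K]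

/-- An equation in K amounts to m equations in F; the number z stands for coordinate z % m of
equation z / m. -/
theorem forall_kcL_iff {bK : Basis (Fin m) F K} (φ : ℕ → (ℕ → F) →ₗ[F] K) (N : ℕ) (x : ℕ → F) :
    (∀ z < N * m, (kcL bK (z % m) ∘ₗ φ (z / m)) x = 0) ↔ ∀ i < N, φ i x = 0 := by
  constructor
  · intro h i hi
    refine kc_injective bK fun c hc => ?_
    have := h _ (mul_add_lt hi hc)
    rw [mul_add_div_self hc, mul_add_mod_self hc, LinearMap.comp_apply, kcL_apply] at this
    rw [this, kc_zero]
  · intro h z hz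
    rw [LinearMap.comp_apply, h _ (Nat.div_lt_of_lt_mul (by rwa [mul_comm])), map_zero]

variable [Finite F]

/-- Bounds for the loops and numbers of the decoder. -/
structure DecBd (X : Ctx F) (m n k κ s D a : ℕ) : Prop where
  mm : m * m < X.L
  conj : s * (n + m) * m < X.L
  pow : n * (D + k) < X.L
  row : (D + k + s * (D + 1)) * m * ((D + k + s * (D + 1)) * m + 1) < X.L
  nm : n * m < X.L
  coef : s * (D + 1) * m * m < X.L
  msg : (κ + 1) * (k * m + 1 + 1) < X.L
  rel : (D + k) * m < X.L
  out : (κ + 2) * (n * m) * a < X.L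
  Dk : D + k < X.L
  s : s < X.L
  apos : 0 < a
  q : 4 * Nat.card F ≤ 2 ^ (X.L - 1)
  M : 4 * (Nat.card F * X.L) ≤ X.M

variable {X : Ctx F} {bK : Basis (Fin m) F K} {n k κ s D a : ℕ} {α : Fin n → F}
  {v : Fin κ → Fin k → K} {y : Fin n → K} {σ : Store}

theorem DecBd.lt_M (h : DecBd X m n k κ s D a) {z : ℕ} (hz : z ≤ 3 * X.L) : z < X.M := by
  have h1 : 0 < Nat.card F := Nat.card_pos
  have h2 := X.L_pos
  have h3 := h.M
  have h4 : X.L ≤ Nat.card F * X.L := Nat.le_mul_of_pos_left _ h1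
  omega

theorem DecBd.q_lt_M (h : DecBd X m n k κ s D a) : 2 * Nat.card F < X.M := by
  have h1 : 0 < Nat.card F := Nat.card_pos
  have h2 := X.L_pos
  have h3 := h.M
  have h4 : Nat.card F ≤ Nat.card F * X.L := Nat.le_mul_of_pos_right _ h2
  omega

/-- The interpolation step of the decoder. -/
def interpC : Cmd :=
  .seq frobC (.seq conjC (.seq alphaPowC (.seq
    (unitRowsC ((V 27 + V 24 + V 26 * (V 27 + 1)) * V 21)) (.seq (elimC (V 23 * V 21) interpFE)
      (.seq (.loop 38 (V 20) (.setF 34 (V 38) (.nat (rd 11 (V 38))))) coefC)))))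

/-- The result of the interpolation step. -/
structure InterpOut (X : Ctx F) (bK : Basis (Fin m) F K) (α : Fin n → F)
    (v : Fin κ → Fin k → K) (y : Fin n → K) (s D : ℕ) (x : ℕ → F) (σ : Store) : Prop where
  inp : DecIn X bK α v y s D σ
  h32 : ∀ i < n, ∀ w < D + k, σ 32 (i * (D + k) + w) = X.code (ext α i ^ w)
  h34 : ∀ j < (D + k + s * (D + 1)) * m, σ 34 j = X.code (x j)
  h35 : Rows X bK σ 35 (s * (D + 1) * m) (coefK bK k D x)
  ne : x ≠ 0
  supp : ∀ j, (D + k + s * (D + 1)) * m ≤ j → x j = 0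
  form : ∀ i : Fin n, interpForm bK k s D (α i) (y i) x = 0

theorem InterpOut.step {x : ℕ → F} {ρ : Store} {c : Cmd} (h : InterpOut X bK α v y s D x σ)
    (hρ : c.den X σ = ρ)
    (hc : c.keeps [2, 10, 21, 23, 24, 25, 26, 27, 40, 32, 34, 35] = true := by rfl) :
    InterpOut X bK α v y s D x ρ := by
  have e := frs hρ _ hc
  have i := h.inp.congr fun b hb => e b (by revert b hb; decide)
  cases h
  constructor <;> simp_all [Rows]

/-- More than n blocks of m unknowns face n * m equations, and each equation removes at most one
row. So a row remains, and it is nonzero because the rows are independent. -/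
theorem interpC_spec {ρ : Store} (hρ : interpC.den X σ = ρ) (h : DecIn X bK α v y s D σ)
    (hb : DecBd X m n k κ s D a) (hm : 0 < m) (hk : 0 < k) (hcount : n < D + k + s * (D + 1)) :
    ∃ x, InterpOut X bK α v y s D x ρ := by
  have hq1 : 0 < Nat.card F := Nat.card_pos
  have hqM := hb.q_lt_M
  set W := (D + k + s * (D + 1)) * m with hW
  have hWL : W * (W + 1) < X.L := hb.row
  have hW1 : n * m + m ≤ W := by
    rw [hW, ← Nat.succ_mul]
    exact Nat.mul_le_mul_right _ hcount
  simp only [interpC, Cmd.den_seq_iff] at hρ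
  obtain ⟨σ₁, h₁, σ₂, h₂, σ₃, h₃, σ₄, h₄, σ₅, h₅, σ₆, h₆, h₇⟩ := hρ
  have i1 := h.step h₁
  have i2 := i1.step h₂
  have i3 := i2.step h₃
  have i4 := i3.step h₄
  have i6 := (i4.step h₅).step h₆
  have b1 := conjC_spec h₂ i1 hb.conj
    (frobC_spec h₁ h.tab hb.mm h.one h.h21 h.h22 (by omega) (by have := hb.q; omega))
  have c1 := alphaPowC_spec h₃ i2 hb.pow
  obtain ⟨d1, d2, d3⟩ := unitRowsC_spec h₄ W (fun τ hτ => by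
      simp [hτ 27, hτ 24, hτ 26, hτ 21, i3.vals, hW])
    i3.one (by nlinarith) (hb.lt_M (by nlinarith))
  have h31 : Rows X bK σ₄ 31 (s * (n + m)) (conjK bK y) := (b1.congr (fr h₃ 31)).congr (fr h₄ 31)
  have h32 : ∀ i < n, ∀ w < D + k, σ₄ 32 (i * (D + k) + w) = X.code (ext α i ^ w) := by
    rwa [fr h₄ 32]
  obtain ⟨e1, e2, e3⟩ := elimC_spec h₅ d1 (n * m) (by simp [i4.vals]) hb.nm
    (by rw [d2, d3]; exact hWL) (by rw [d2]; exact hb.lt_M (by nlinarith))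
    (fun z => kcL bK (z % m) ∘ₗ interpForm bK k s D (ext α (z / m)) (ext y (z / m))) (by
      intro z hz τ r hτ h18 h22 _ _
      have iτ : DecIn X bK α v y s D τ := i4.congr fun b hb => hτ b (by revert b hb; decide)
      exact interpFE_eval iτ hk hb.Dk hb.s (by rwa [hτ 32]) (h31.congr (hτ 31))
        (by rw [hτ 20, d3]) hz h18 h22)
  have h20 : σ₅ 20 0 = W := by rw [fr h₅ 20, d3]
  have hpos : 0 < σ₅ 12 0 := by omega
  have hxs := (e1.2 (rowv X σ₅ 0)).1 (Submodule.subset_span ⟨⟨0, hpos⟩, rfl⟩)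
  have f1 := tab_spec h₆ W (rowv X σ₅ 0) (by simp [h20]) (by nlinarith) (by
    intro τ j hj hτ h38
    rw [rowv, if_pos (by omega)]
    simp [h38, hτ 11])
  refine ⟨rowv X σ₅ 0, i6.step h₇, ?_, ?_, coefC_spec h₇ i6 hb.coef
    ((h31.congr (fr h₅ 31)).congr (fr h₆ 31)) f1, LinearIndependent.ne_zero (⟨0, hpos⟩ : Fin (σ₅ 12 0)) e1.1,
    hxs.1, fun i => ?_⟩
  · rwa [fr h₇ 32, fr h₆ 32, fr h₅ 32]
  · rwa [fr h₇ 34]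
  · simpa using (forall_kcL_iff (bK := bK)
      (fun i => interpForm bK k s D (ext α i) (ext y i)) n _).1 hxs.2 i i.2

/-- The computation of the space of multiples of message polynomials. -/
def solveC : Cmd :=
  .seq msgRowsC (.seq (elimC ((V 27 + V 24) * V 21) relFE)
    (.seq (.loop 38 (V 12 * V 20) (.setF 36 (V 38) (.nat (rd 11 (V 38)))))
      (.seq (.seq (.loop 22 (V 12) (.setF 13 (V 22) (.nat (rd 11 (V 22 * V 20 + V 24 * V 21)))))
        cutC) (powS (.nat (rd 36 (V 14 * V 20 + V 24 * V 21))) (2 * rd 2 2 - 4)))))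

/-- The solutions of the homogeneous conditions. -/
def IsSol (bK : Basis (Fin m) F K) (v : Fin κ → Fin k → K) (s D : ℕ) (x z : ℕ → F) : Prop :=
  (∀ j, k * m + 1 ≤ j → z j = 0) ∧ fvec bK k z ∈ Submodule.span F (Set.range v) ∧
    ∀ w < D + k, relForm bK k s D (fun w => blk bK w x)
      (fun j d => blk bK (D + k + (j * (D + 1) + d)) x) w z = 0

/-- Eliminating the conditions leaves rows spanning the homogenized solutions. Cutting once more
with the homogenizing coordinate gives the homogeneous solutions, and the pivot row divided by its
value there is a particular solution `g`. Without a pivot no solution has homogenizing coordinate 1,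
so any `g` is admissible. -/
theorem solveC_spec {ρ : Store} (hρ : solveC.den X σ = ρ) {x : ℕ → F}
    (h : InterpOut X bK α v y s D x σ) (hb : DecBd X m n k κ s D a) (hv : LinearIndependent F v) :
    ∃ g : ℕ → F, RowBasis X ρ (fun z => IsSol bK v s D x z ∧ z (k * m) = 0) ∧
    (∀ z, IsSol bK v s D x z → z (k * m) = 1 →
      IsSol bK v s D x (z - g) ∧ (z - g) (k * m) = 0) ∧
    (∀ j < k * m + 1, X.el (ρ 36 (ρ 14 0 * (k * m + 1) + j)) * X.el (ρ 33 0) = g j) ∧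
    ρ 12 0 ≤ κ + 1 ∧ ρ 20 0 = k * m + 1 := by
  have hq1 : 1 < Nat.card F := Finite.one_lt_card
  have hqM := hb.q_lt_M
  have hL2 := hb.msg
  have hκ : κ + 1 < X.L := lt_of_le_of_lt (Nat.le_mul_of_pos_right _ (by omega)) hL2
  simp only [solveC, Cmd.den_seq_iff] at hρ
  obtain ⟨σ₁, h₁, σ₂, h₂, σ₃, h₃, σ₅, ⟨σ₄, h₄, h₅⟩, h₆⟩ := hρ
  have i1 := h.step h₁
  have i3 := (i1.step h₂).step h₃
  have i5 := (i3.step h₄).step h₅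
  obtain ⟨a1, a2, a3⟩ := msgRowsC_spec h₁ h.inp hv (by nlinarith) (hb.lt_M (by omega))
    (hb.lt_M (by nlinarith))
  set A₀ : ℕ → K := fun w => blk bK w x
  set A : ℕ → ℕ → K := fun j d => blk bK (D + k + (j * (D + 1) + d)) x
  obtain ⟨b1, b2, b3⟩ := elimC_spec h₂ a1 ((D + k) * m) (by simp [i1.inp.vals]) hb.rel
    (by rw [a2, a3]; exact hL2) (by rw [a2]; exact hb.lt_M (by omega))
    (fun z => kcL bK (z % m) ∘ₗ relForm bK k s D A₀ A (z / m)) (by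
      intro z hz τ r hτ h18 h22 _ _
      have iτ : DecIn X bK α v y s D τ := i1.inp.congr fun b hb => hτ b (by revert b hb; decide)
      exact relFE_eval iτ (by have := hb.Dk; omega) hb.s (by rw [hτ 34]; exact i1.h34)
        (i1.h35.congr (hτ 35)) (by rw [hτ 20, a3]) hz h18 h22)
  have h20 : σ₂ 20 0 = k * m + 1 := by rw [fr h₂ 20, a3]
  have hB2 : RowBasis X σ₂ (IsSol bK v s D x) := by
    refine b1.imp fun z => ?_
    rw [forall_kcL_iff (bK := bK) (fun w => relForm bK k s D A₀ A w), and_assoc]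
    rfl
  rw [a2] at b2
  have c1 := tab2_spec h₃ (σ₂ 12 0) (k * m + 1) (rowv X σ₂) (by simp [h20]) (by nlinarith) (by
    intro τ i j hi hj hτ h38
    rw [rowv, if_pos (by omega), h20]
    simp [h38, hτ 11])
  have e312 : σ₃ 12 = σ₂ 12 := fr h₃ 12
  set φ : (ℕ → F) →ₗ[F] F := LinearMap.proj (R := F) (φ := fun _ : ℕ => F) (k * m)
  have d1 := tab_spec h₄ (σ₂ 12 0) (fun r => φ (rowv X σ₂ r)) (by simp [e312]) (by nlinarith) (by
    intro τ r hr hτ h22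
    have : rowv X σ₂ r (k * m) = X.el (σ₂ 11 (r * σ₂ 20 0 + k * m)) := (rowv_eq (by omega)).symm
    simp [h22, hτ 11, hτ 20, hτ 24, hτ 21, fr h₃ 11, fr h₃ 20, i3.inp.vals, φ, this])
  have e412 : σ₄ 12 0 = σ₂ 12 0 := by rw [fr h₄ 12, e312]
  have e420 : σ₄ 20 0 = k * m + 1 := by rw [fr h₄ 20, fr h₃ 20, h20]
  have e4row : rowv X σ₄ = rowv X σ₂ :=
    (rowv_congr (fr h₄ 20) (fr h₄ 11)).trans (rowv_congr (fr h₃ 20) (fr h₃ 11))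
  have hB4 := hB2.congr e412 e4row
  obtain ⟨f1, f2, f3, f5⟩ := cutC_spec h₅ hB4 (by rw [e412, e420]; nlinarith)
    (by rw [e412]; exact hb.lt_M (by omega)) φ (fun i hi => by rw [d1 i (by omega), e4row])
  have e536 : σ₅ 36 = σ₃ 36 := by rw [fr h₅ 36, fr h₄ 36]
  have e520 : σ₅ 20 0 = k * m + 1 := by rw [fr h₅ 20, e420]
  set z₀ : F := X.el (σ₅ 36 (σ₅ 14 0 * (k * m + 1) + k * m)) with hz₀
  -- The exponent 2q - 4 + 1 is congruent to -1 modulo q - 1, so the power is the inverse of a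
  -- nonzero `z₀`. Writing the exponent q - 2 as (q - 3) + 1 would meet the truncation at q = 2.
  have g1 := powS_spec h₆ z₀ (2 * Nat.card F - 4) (by simp [e520, i5.inp.vals, hz₀])
    (fun τ hτ => by simp [hτ 2, i5.inp.h22]) (by omega) i5.inp.h21 (by have := hb.q; omega)
  set g : ℕ → F := fun j => if j < k * m + 1 then
    X.el (σ₅ 36 (σ₅ 14 0 * (k * m + 1) + j)) * z₀ ^ (2 * Nat.card F - 4 + 1) else 0 with hg
  refine ⟨g, f1.congr (by rw [fr h₆ 12]) (rowv_congr (fr h₆ 20) (fr h₆ 11)), fun z hz hz1 => ?_,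
    fun j hj => by rw [fr h₆ 36, fr h₆ 14, g1, X.el_code]; exact (if_pos hj).symm, by rw [fr h₆ 12]; omega,
    by rw [fr h₆ 20, e520]⟩
  have hzmem := (hB4.2 z).2 hz
  rcases f5 with ⟨hlt, hne⟩ | ⟨-, hz0⟩
  · have hgrow : g = z₀ ^ (2 * Nat.card F - 4 + 1) • rowv X σ₄ (σ₅ 14 0) := by
      funext j
      rw [e4row]
      simp only [hg, Pi.smul_apply, smul_eq_mul]
      split_ifs with hj
      · rw [e536, c1 _ (by omega) j hj, X.el_code, mul_comm]
      · rw [rowv, if_neg (by omega), mul_zero]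
    have hφz : φ (rowv X σ₄ (σ₅ 14 0)) = z₀ := by
      rw [hz₀, e536, c1 _ (by omega) _ (by omega), X.el_code, e4row]
      rfl
    rw [hφz] at hne
    have hpow : z₀ ^ (2 * Nat.card F - 4 + 1) * z₀ = 1 := by
      let := Fintype.ofFinite F
      rw [← pow_succ, Nat.card_eq_fintype_card]
      rw [Nat.card_eq_fintype_card] at hq1
      rw [show 2 * Fintype.card F - 4 + 1 + 1 = (Fintype.card F - 1) * 2 by omega, pow_mul,
        FiniteField.pow_card_sub_one_eq_one _ hne, one_pow]
    refine ⟨(hB4.2 _).1 (Submodule.sub_mem _ hzmem ?_), ?_⟩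
    · rw [hgrow]
      exact Submodule.smul_mem _ _ (Submodule.subset_span ⟨⟨σ₅ 14 0, hlt⟩, rfl⟩)
    · have : φ (z - g) = 0 := by
        rw [map_sub, hgrow, map_smul, hφz, smul_eq_mul, hpow]
        exact sub_eq_zero.2 hz1
      exact this
  · have hle : Submodule.span F (Set.range fun i : Fin (σ₄ 12 0) => rowv X σ₄ i) ≤
        LinearMap.ker φ := by
      rw [Submodule.span_le]
      rintro _ ⟨i, rfl⟩
      exact hz0 i i.2
    have h1 : z (k * m) = 0 := hle hzmem
    exact absurd (hz1.symm.trans h1) one_ne_zero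

end

/-! ### Codewords of the solutions and nontriviality of the relation -/

section

variable {m : ℕ} {F K : Type*} [Field F] [Field K] [Algebra F K] {bK : Basis (Fin m) F K}
  {X : Ctx F} {n k κ s D a : ℕ} {α : Fin n → F} {v : Fin κ → Fin k → K} {y : Fin n → K} {σ : Store}

theorem kc_rsEncode (bK : Basis (Fin m) F K) (f : Fin k → K) (i : Fin n) (c : ℕ) :
    kc bK (rsEncode α k f i) c = ∑ j ∈ Finset.range k, α i ^ j * kc bK (ext f j) c := by
  rw [rsEncode_apply, kc_sum, Finset.sum_range]
  refine Finset.sum_congr rfl fun j _ => ?_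
  rw [← map_pow, mul_comm, ← Algebra.smul_def, kc_smul, ext_val]

/-- Writes the codewords of the rows (the first one is the row with number `V 14` of array `36`
times the element in array `33`). -/
def codewordsC : Cmd :=
  .loop 38 ((V 12 + 1) * (V 23 * V 21)) (.setF 44 (V 38) (.sum 50 (V 24) (.mul
    (.nat (rd 32 (V 38 % (V 23 * V 21) / V 21 * (V 27 + V 24) + V 50)))
    (.ite (V 38 / (V 23 * V 21))
      (.nat (rd 11 ((V 38 / (V 23 * V 21) - 1) * V 20 + (V 50 * V 21 + V 38 % (V 23 * V 21) % V 21))))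
      (.mul (.nat (rd 36 (V 14 * V 20 + (V 50 * V 21 + V 38 % (V 23 * V 21) % V 21))))
        (.nat (V 33)))))))

theorem codewordsC_spec {ρ : Store} (hρ : codewordsC.den X σ = ρ) (h : DecIn X bK α v y s D σ)
    (hk : k < X.L) (hL : (σ 12 0 + 1) * (n * m) < X.L)
    (h32 : ∀ i < n, ∀ w < D + k, σ 32 (i * (D + k) + w) = X.code (ext α i ^ w))
    (h20 : σ 20 0 = k * m + 1) {g : ℕ → F}
    (hg : ∀ j < k * m + 1, X.el (σ 36 (σ 14 0 * (k * m + 1) + j)) * X.el (σ 33 0) = g j) :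
    ∀ r < σ 12 0 + 1, ∀ j < n * m, ρ 44 (r * (n * m) + j) = X.code (kc bK
      (ext (rsEncode α k (fvec bK k (if r = 0 then g else rowv X σ (r - 1)))) (j / m)) (j % m)) := by
  refine tab2_spec hρ _ _ _ (by simp [h.vals]) hL fun τ r j hr hj hτ h38 => ?_
  have hm : 0 < m := Nat.pos_of_ne_zero (by rintro rfl; simp at hj)
  have hi : j / m < n := Nat.div_lt_of_lt_mul (by rwa [mul_comm])
  have hc := Nat.mod_lt j hm
  have h' := h.loop @hτ
  have e20 : τ 20 0 = k * m + 1 := by rw [hτ 20, h20]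
  rw [ext_of_lt _ hi, kc_rsEncode]
  refine FE.eval_sum X _ (by simp [h'.vals]) hk fun w hw => ?_
  rw [FE.eval_mul']
  have hidx : w * m + j % m < k * m := mul_add_lt hw hc
  have h3 := kc_fvec (bK := bK) (k := k) (if r = 0 then g else rowv X σ (r - 1)) hidx
  rw [mul_add_div_self hc, mul_add_mod_self hc] at h3
  rw [h3]
  congr 1
  · have := h32 (j / m) hi w (by omega)
    rw [ext_of_lt _ hi] at this
    simp [h38, h'.vals, mul_add_mod_self hj, hτ 32, this, X.el_code]
  · rw [FE.eval_ite X r (by simp [h38, h'.vals, mul_add_div_self hj])]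
    split_ifs with h0
    · rw [← hg _ (by omega)]
      simp [h38, h'.vals, mul_add_mod_self hj, e20, hτ 36, hτ 14, hτ 33]
    · have := rowv_eq (X := X) (σ := σ) (i := r - 1) (j := w * m + j % m) (by omega)
      rw [← this, h20]
      simp [h38, h'.vals, mul_add_mod_self hj, mul_add_div_self hj, e20, hτ 11]

theorem interpForm_apply [Finite F] (α : F) (y : K) (x : ℕ → F) : interpForm bK k s D α y x =
    ∑ w ∈ Finset.range (D + k), algebraMap F K α ^ w * blk bK w x +
      ∑ j ∈ Finset.range s, ∑ w ∈ Finset.range (D + 1), algebraMap F K α ^ w *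
        (blk bK (D + k + (j * (D + 1) + w)) x * frob F K j y) := by
  simp [interpForm, Algebra.smul_def]

/-- The interpolating relation involves the conjugates of the codeword. -/
theorem InterpOut.exists_ne [Finite F] {x : ℕ → F} (h : InterpOut X bK α v y s D x σ)
    (hα : Function.Injective α) (hD : D + k ≤ n) :
    ∃ j < s, ∃ w ≤ D, blk bK (D + k + (j * (D + 1) + w)) x ≠ 0 := by
  by_contra! hA
  refine h.ne (funext fun t => ?_)
  rcases le_or_gt ((D + k + s * (D + 1)) * m) t with ht | ht
  · exact h.supp t ht
  have hm : 0 < m := Nat.pos_of_ne_zero (by rintro rfl; simp at ht)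
  have hb : t / m < D + k + s * (D + 1) := Nat.div_lt_of_lt_mul (by rwa [mul_comm])
  -- If all `A j` were zero, then `A₀`, of degree less than D + k ≤ n, would vanish at all n points,
  -- and the whole interpolating vector would be zero.
  have hA0 : ∀ w < D + k, blk bK w x = 0 := fun w hw => by
    refine coeff_eq_zero_of_interpolation (A₀ := fun w => blk bK w x) hα (fun i => ?_) hD hw
    rw [← h.form i, interpForm_apply, left_eq_add]
    refine Finset.sum_eq_zero fun j hj => Finset.sum_eq_zero fun w hw => ?_
    rw [Finset.mem_range] at hj hw
    rw [hA j hj w (by omega), zero_mul, mul_zero]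
  have hblk : blk bK (t / m) x = 0 := by
    rcases lt_or_ge (t / m) (D + k) with h1 | h1
    · exact hA0 _ h1
    · obtain ⟨r, hr⟩ := Nat.exists_eq_add_of_le h1
      rw [hr, ← Nat.div_add_mod' r (D + 1)]
      exact hA _ (Nat.div_lt_of_lt_mul (by rw [mul_comm]; omega)) _
        (Nat.le_of_lt_succ (Nat.mod_lt _ (by omega)))
  have := kc_blk bK (t / m) x (Nat.mod_lt t hm)
  rw [hblk, kc_zero, Nat.div_add_mod'] at this
  exact this.symm

end

/-! ### Correctness of the decoder -/

section

variable {m : ℕ} {F K : Type*} [Field F] [Finite F] [Field K] [Algebra F K]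
  {n k κ s D : ℕ} {α : Fin n → F} {v : Fin κ → Fin k → K} {y : Fin n → K} {σ : Store}

/-- The computed point and basis describe a space that contains all close codewords. -/
theorem decode_correct {X : Ctx F} {bK : Basis (Fin m) F K} {d : ℕ} {x g : ℕ → F} {ρ : ℕ → ℕ → F}
    (h : InterpOut X bK α v y s D x σ) (hs : s - 1 ≤ m) (hD : D + k ≤ n)
    (hα : Function.Injective α) (hρ : LinearIndependent F fun i : Fin d => ρ i)
    (hRmem : ∀ z, z ∈ Submodule.span F (Set.range fun i : Fin d => ρ i) ↔
      IsSol bK v s D x z ∧ z (k * m) = 0)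
    (hg : ∀ z, IsSol bK v s D x z → z (k * m) = 1 →
      IsSol bK v s D x (z - g) ∧ (z - g) (k * m) = 0) {δ : ℝ} {H : Fin k → Submodule F (Fin m → F)}
    (hH : IsSubspaceDesign (s - 1) δ H) (hV : Submodule.span F (Set.range v) ≤ designSpace bK H) :
    (d : ℝ) ≤ δ ∧ (LinearIndependent F fun l : Fin d => rsEncode α k (fvec bK k (ρ l))) ∧
      ∀ c ∈ rsSubcode α (Submodule.span F (Set.range v)), ∀ T : Finset (Fin n),
        (∀ i ∈ T, c i = y i) → D + k ≤ T.card →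
        c ∈ AffineSubspace.mk' (rsEncode α k (fvec bK k g))
          (Submodule.span F (Set.range fun l : Fin d => rsEncode α k (fvec bK k (ρ l)))) := by
  set A₀ : ℕ → K := fun w => blk bK w x with hA₀
  set A : ℕ → ℕ → K := fun j d => blk bK (D + k + (j * (D + 1) + d)) x with hA
  set R := Submodule.span F (Set.range fun i : Fin d => ρ i) with hR
  -- Rows of `R` vanish at the homogenizing coordinate and beyond it, hence are determined by their
  -- message. So the computed vectors stay independent as messages and, by injectivity of the
  -- encoding, as codewords.
  have hinj : ∀ z ∈ R, fvec bK k z = 0 → z = 0 := by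
    intro z hz hz0
    obtain ⟨⟨h1, -, -⟩, h2⟩ := (hRmem z).1 hz
    exact eq_of_fvec (bK := bK) (k := k) (fun j hj => h1 j hj) h2 (by rw [hz0, map_zero])
  have hli : LinearIndependent F fun l : Fin d => fvec bK k (ρ l) := by
    refine hρ.map (f := fvec bK k) ?_
    rw [Submodule.disjoint_def]
    exact fun z hz hz0 => hinj z hz hz0
  have hinjE := rsEncode_injective (K := K) hα (show k ≤ n by omega)
  have hliu : LinearIndependent F fun l : Fin d => rsEncode α k (fvec bK k (ρ l)) :=
    hli.map' (rsEncode α k) (LinearMap.ker_eq_bot.2 hinjE)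
  have hcoef : ∀ w z, relForm bK k s D A₀ A w z =
      z (k * m) • A₀ w + relCoeff s D A w (fvec bK k z) := fun w z => rfl
  refine ⟨?_, hliu, ?_⟩
  · have hS : finrank F (Submodule.span F (Set.range fun l : Fin d => fvec bK k (ρ l)))
        = d := by
      rw [finrank_span_eq_card hli, Fintype.card_fin]
    rw [← hS]
    refine finrank_le_of_relation bK hH hs (A := A) (D := D) (h.exists_ne hα hD) _ ?_
    intro f hf
    have hf' : f ∈ R.map (fvec bK k) := by
      rw [hR, Submodule.map_span, ← Set.range_comp]
      exact hf
    obtain ⟨z, hz, rfl⟩ := hf'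
    obtain ⟨⟨-, h1, h2⟩, h3⟩ := (hRmem z).1 hz
    refine ⟨hV h1, fun w hw => ?_⟩
    have := h2 w hw
    rw [hcoef, h3, zero_smul, zero_add] at this
    exact this
  · rintro c ⟨f, hf, rfl⟩ T hT hcard
    have hrel : ∀ w < D + k, A₀ w + relCoeff (F := F) s D A w f = 0 := fun w hw =>
      relation_of_agree hα (y := y) (fun i => by rw [← h.form i, interpForm_apply]) f T hT hcard hw
    -- The message of a close codeword, with homogenizing coordinate 1, solves the linear system;
    -- its difference from `g` is a homogeneous solution.
    set z : ℕ → F := toRow bK f + Pi.single (k * m) 1 with hz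
    have hzf : fvec bK k z = f := by rw [hz, map_add, fvec_toRow, fvec_single, add_zero]
    have hz1 : z (k * m) = 1 := by simp [hz, toRow]
    have hzs : IsSol bK v s D x z := by
      refine ⟨fun j hj => ?_, by rw [hzf]; exact hf, fun w hw => ?_⟩
      · simp [hz, toRow, show j ≠ k * m by omega, show ¬ j < k * m by omega]
      · rw [hcoef, hz1, one_smul, hzf, hrel w hw]
    have hmem := (hRmem _).2 (hg z hzs hz1)
    rw [AffineSubspace.mem_mk', vsub_eq_sub]
    have e1 : rsEncode α k f - rsEncode α k (fvec bK k g) = rsEncode α k (fvec bK k (z - g)) := by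
      rw [map_sub (fvec bK k), hzf, map_sub]
    have e2 : Submodule.span F (Set.range fun l : Fin d => rsEncode α k (fvec bK k (ρ l))) =
        (R.map (fvec bK k)).map (rsEncode α k) := by
      rw [hR, Submodule.map_span, Submodule.map_span, ← Set.range_comp, ← Set.range_comp]
      rfl
    rw [e1, e2]
    exact ⟨_, ⟨_, hmem, rfl⟩, rfl⟩

end

/-! ### Output of the affine space -/

section

variable {p a m : ℕ} {F K : Type*} [Field F] [Field K] [hp : Fact p.Prime]
  [Algebra (ZMod p) F] [Algebra F K] (bF : Basis (Fin a) (ZMod p) F) (bK : Basis (Fin m) F K)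
  {X : Ctx F} {n : ℕ} {σ : Store}

theorem wordsOut_spec (hσ : Env bF X σ) {ρ : Store}
    (hρ : (outC 1 ((V 12 + 1) * (V 23 * V 21))).den X σ = ρ) {d : ℕ} {c₀ : Fin n → K}
    {u : Fin d → Fin n → K} (h12 : σ 12 0 = d) (h21 : σ 21 0 = m) (h23 : σ 23 0 = n)
    (h1 : σ 1 1 = d) (hL' : (d + 1) * (n * m) * a < X.L) (hM' : 1 + (d + 1) * (n * m) * a < X.M)
    (h44 : ∀ z < (d + 1) * (n * m), σ 44 z = X.code (kc bK
      (ext (if z / (n * m) = 0 then c₀ else ext u (z / (n * m) - 1))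
        (z % (n * m) / m)) (z % (n * m) % m))) :
    ∀ i ≤ (d :: (encKVec bF bK c₀ ++ encKMat bF bK u)).length,
      ρ 1 i = listArray (d :: (encKVec bF bK c₀ ++ encKMat bF bK u)) i := by
  obtain ⟨o1, o2, o3⟩ := outC_spec bF hσ hρ 1 _ _
    (by intro τ hτ; simp [hτ 12, hτ 23, hτ 21, h12, h21, h23]) (by intro τ _; rfl) hL' hM' h44
  have henc := (enc_encKVec bF bK c₀).append bF (enc_encKMat bF bK u)
  rw [show n * m + d * (n * m) = (d + 1) * (n * m) by ring] at henc
  refine listArray_of_enc bF (hd := [d]) (henc.congr bF ?_) (by simpa using o1) ?_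
    o2
  · intro z hz
    have hnm' : 0 < n * m := Nat.pos_of_ne_zero (by rintro h0; simp [h0] at hz)
    split_ifs with h1 h2 h2
    · rw [Nat.mod_eq_of_lt h1]
    · exact absurd (Nat.div_eq_of_lt h1) h2
    · exact absurd h2 (by
        have := (Nat.div_pos_iff).2 ⟨hnm', not_lt.1 h1⟩
        omega)
    · obtain ⟨r, rfl⟩ := Nat.exists_eq_add_of_le (not_lt.1 h1)
      rw [Nat.add_sub_cancel_left, Nat.add_mod_left, Nat.add_div_left _ hnm',
        Nat.succ_sub_one]
  · intro i hi0 hi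
    obtain rfl : i = 1 := by simp at hi; omega
    rw [o3 1 (by omega) (by omega), h1]
    rfl

end

/-! ### The complete decoder -/

section

variable {p a m : ℕ} {F K : Type*} [Field F] [Finite F] [Field K] [hp : Fact p.Prime]
  [Algebra (ZMod p) F] [Algebra F K] (bF : Basis (Fin a) (ZMod p) F) (bK : Basis (Fin m) F K)
  {X : Ctx F} {n k κ s D : ℕ} {α : Fin n → F} {v : Fin κ → Fin k → K} {y : Fin n → K} {σ : Store}

/-- The list decoder. -/
def decC : Cmd :=
  .seq interpC (.seq solveC (.seq codewordsC (.seq (.set 1 1 (V 12))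
    (outC 1 ((V 12 + 1) * (V 23 * V 21))))))

theorem decC_spec (hσ : Env bF X σ) {ρ : Store} (hρ : decC.den X σ = ρ)
    (h : DecIn X bK α v y s D σ) (hb : DecBd X m n k κ s D a) (hm : 0 < m) (hk : 0 < k)
    (hs : s - 1 ≤ m) (hD : D + k ≤ n) (hcount : n < D + k + s * (D + 1))
    (hα : Function.Injective α) (hv : LinearIndependent F v) {δ : ℝ}
    {H : Fin k → Submodule F (Fin m → F)} (hH : IsSubspaceDesign (s - 1) δ H)
    (hV : Submodule.span F (Set.range v) ≤ designSpace bK H) :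
    ∃ (d : ℕ) (c₀ : Fin n → K) (u : Fin d → Fin n → K), (d : ℝ) ≤ δ ∧ LinearIndependent F u ∧
      (∀ c ∈ rsSubcode α (Submodule.span F (Set.range v)), ∀ T : Finset (Fin n),
        (∀ i ∈ T, c i = y i) → D + k ≤ T.card →
        c ∈ AffineSubspace.mk' c₀ (Submodule.span F (Set.range u))) ∧
      ∀ i ≤ (d :: (encKVec bF bK c₀ ++ encKMat bF bK u)).length,
        ρ 1 i = listArray (d :: (encKVec bF bK c₀ ++ encKMat bF bK u)) i := by
  simp only [decC, Cmd.den_seq_iff] at hρ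
  obtain ⟨σ₁, h₁, σ₂, h₂, σ₃, h₃, σ₄, h₄, h₅⟩ := hρ
  obtain ⟨x, a1⟩ := interpC_spec h₁ h hb hm hk hcount
  obtain ⟨g, b1, b2, b3, b4, b5⟩ := solveC_spec h₂ a1 hb hv
  have i2 := a1.step h₂
  have i4 := (i2.step h₃).step h₄
  have hout := hb.out
  have ha := hb.apos
  have hdn : (σ₂ 12 0 + 1) * (n * m) * a < X.L :=
    lt_of_le_of_lt (Nat.mul_le_mul_right _ (Nat.mul_le_mul_right _ (by omega))) hout
  have c1 := codewordsC_spec h₃ i2.inp (by have := hb.Dk; omega)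
    (lt_of_le_of_lt (Nat.le_mul_of_pos_right _ ha) hdn) i2.h32 b5 b3
  have hdM : σ₂ 12 0 < X.M := by
    have := hb.msg
    exact hb.lt_M (by nlinarith)
  have f1 : σ₄ 1 1 = σ₂ 12 0 := set_val h₄ (by simp [fr h₃ 12]) hdM
  obtain ⟨m1, m2, m3⟩ := decode_correct i2 hs hD hα b1.1 b1.2 b2 hH hV
  refine ⟨σ₂ 12 0, rsEncode α k (fvec bK k g), fun l => rsEncode α k (fvec bK k (rowv X σ₂ l)),
    m1, m2, m3, ?_⟩
  refine wordsOut_spec bF bK ((((hσ.step bF h₁).step bF h₂).step bF h₃).step bF h₄) h₅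
    (by rw [fr h₄ 12, fr h₃ 12]) i4.inp.tab.h21 i4.inp.vals.2.1 f1 hdn (hb.lt_M (by omega))
    fun z hz => ?_
  have hnm' : 0 < n * m := Nat.pos_of_ne_zero (by rintro h0; simp [h0] at hz)
  have hr : z / (n * m) < σ₂ 12 0 + 1 := Nat.div_lt_of_lt_mul (by rwa [mul_comm])
  have := c1 _ hr _ (Nat.mod_lt z hnm')
  rw [Nat.div_add_mod'] at this
  rw [fr h₄ 44, this, apply_ite (fun x => rsEncode α k (fvec bK k x))]
  by_cases h0 : z / (n * m) = 0
  · rw [if_pos h0, if_pos h0]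
  · rw [if_neg h0, if_neg h0, ext_of_lt _ (show z / (n * m) - 1 < σ₂ 12 0 by
      generalize z / (n * m) = w at hr h0; omega)]

end

/-! ### Programs with number of iterations bounded by a polynomial -/

/-- The `c`-th power of an expression. -/
def powE (e : Expr) : ℕ → Expr
  | 0 => 1
  | c + 1 => powE e c * e

@[simp] theorem eval_powE (σ : Store) (e : Expr) (c : ℕ) :
    (powE e c).eval σ = e.eval σ ^ c := by
  induction c with
  | zero => rfl
  | succ c ih => rw [powE, eval_mul, ih, pow_succ]

theorem listArray_append (l l' : List ℕ) (j : ℕ) :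
    listArray (l ++ l') (l.length + 1 + j) = l'.getD j 0 := by
  rw [show l.length + 1 + j = l.length + j + 1 by ring, listArray_succ,
    List.getD_append_right _ _ _ _ (by omega), Nat.add_sub_cancel_left]

theorem listArray_append_left (l l' : List ℕ) {j : ℕ} (hj : j < l.length) :
    listArray (l ++ l') (j + 1) = l.getD j 0 := by
  rw [listArray_succ, List.getD_append _ _ _ _ hj]

theorem bd_load {l : List ℕ} {β : ℕ} (h0 : l.length.size ≤ β) (h : ∀ x ∈ l, x.size ≤ β) :
    Bd β (load l) := by
  intro a i
  unfold load
  split_ifs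
  · rcases i with - | i
    · rwa [listArray_zero]
    · rw [listArray_succ]
      by_cases hi : i < l.length
      · rw [List.getD_eq_getElem _ _ hi]
        exact h _ (List.getElem_mem hi)
      · rw [List.getD_eq_default _ _ (not_lt.1 hi)]
        simp
  · simp

theorem Enc.lt {p a : ℕ} {F : Type*} [Field F] [Fact p.Prime] [Algebra (ZMod p) F]
    (bF : Basis (Fin a) (ZMod p) F) {l : List ℕ} {N : ℕ} {z : ℕ → F} (h : Enc bF l N z) :
    ∀ x ∈ l, x < p := by
  intro x hx
  obtain ⟨j, hj, rfl⟩ := List.mem_iff_getElem.1 hx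
  rw [h.1] at hj
  have ha := a_pos bF
  have hja : j / a < N := Nat.div_lt_of_lt_mul (by rwa [mul_comm])
  have e := h.2 _ hja _ (Nat.mod_lt j ha)
  rw [Nat.div_add_mod', List.getD_eq_getElem _ _ (by rw [h.1]; exact hj)] at e
  rw [e]
  exact dig_lt bF _ _

/-- The program for the command `c`, with a header of `h` numbers and `le` iterations. -/
def Cmd.toProg (c : Cmd) (h : ℕ) (le : Expr) : Prog := c.full h 0 le (4 * (rd 2 2 * rd 2 1))

/-- With M = 4qL the numbers in the memory have length at most 2L, although q itself may be
exponential in `L`. This is what makes the running time polynomial in log q. -/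
theorem size_four_mul_mul_le {Q L : ℕ} (hQ : 0 < Q) (hL : 0 < L) (hq : 4 * Q ≤ 2 ^ (L - 1)) :
    (4 * (Q * L)).size ≤ 2 * L := by
  rw [Nat.size_le]
  calc 4 * (Q * L) = 4 * Q * L := by ring
    _ < 4 * Q * 2 ^ L := Nat.mul_lt_mul_of_pos_left Nat.lt_two_pow_self (by omega)
    _ ≤ 2 ^ (L - 1) * 2 ^ L := Nat.mul_le_mul_right _ hq
    _ = 2 ^ (L - 1 + L) := (pow_add _ _ _).symm
    _ ≤ _ := Nat.pow_le_pow_right (by omega) (by omega)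

/-- All bounds are expressed by the single number `L`: the modulus is 4qL, the cells have length at
most 2L, and L³ dominates L + 4L + 2. Hence the time is a power of `L`. -/
theorem Cmd.toProg_exec (c : Cmd) (hc : c.ok = true) (h : ℕ) (le : Expr) :
    ∃ K, ∀ {p a : ℕ} {F : Type*} [Field F] [Fact p.Prime] [Algebra (ZMod p) F]
      (bF : Basis (Fin a) (ZMod p) F) {L : ℕ} (_ : 0 < L)
      (hd l : List ℕ) (σ : Store), σ 0 = listArray (hd ++ tableF bF ++ l) → Bd (2 * L) σ →
      hd.length = h → 2 ≤ h → hd.getD 0 0 = p → hd.getD 1 0 = a →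
      a * a < L → h + 1 ≤ L → 4 * p ^ a ≤ 2 ^ (L - 1) →
      (∀ τ, Prep p a 0 (hd ++ tableF bF ++ l) τ → le.eval τ = L) →
      ∃ X : Ctx F, X.M = 4 * (p ^ a * L) ∧ X.L = L ∧ ∃ τ, Env bF X τ ∧
        τ 0 = listArray (hd ++ tableF bF ++ l) ∧
        ∃ ρ, (∃ t ≤ L ^ K, Exec (c.toProg h le) σ ρ t) ∧
          ρ 1 = c.den X τ 1 := by
  obtain ⟨K, hK⟩ := c.full_runs hc h 0 le (4 * (rd 2 2 * rd 2 1)) (by decide)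
  refine ⟨3 * K, fun {p a F} _ hp _ bF {L} hL hd l σ h00 hB hh h2 h0 h1 haL hhL hq hle => ?_⟩
  have hLM : L ≤ 4 * (p ^ a * L) := by
    have := Nat.le_mul_of_pos_left L (pow_pos hp.out.pos a)
    omega
  have hML := size_four_mul_mul_le (pow_pos hp.out.pos a) hL hq
  have htF := enc_tableF bF
  have hin : ∀ j < h, listArray (hd ++ tableF bF ++ l) (j + 1) = hd.getD j 0 := fun j hj => by
    rw [List.append_assoc, listArray_append_left _ _ (by omega)]
  have hM : p ^ a ≤ 4 * (p ^ a * L) := by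
    have := Nat.le_mul_of_pos_right (p ^ a) hL
    omega
  obtain ⟨X, hXM, hXL, τ₀, hE, P, τ, ⟨t, ht, hx⟩, hτ⟩ := hK bF hM hL 0 (hd ++ tableF bF ++ l) (2 * L) (L ^ 3)
    σ h00 hB ((hin 0 (by omega)).trans h0) ((hin 1 (by omega)).trans h1)
    (fun i hi d hd' => by
      rw [List.append_assoc, ← hh, listArray_append,
        List.getD_append _ _ _ _ (by rw [htF.1]; exact mul_add_lt hi hd')]
      exact htF.2 i hi d hd')
    hML ((Nat.size_le_size hLM).trans hML) (by simp; omega) haL (by omega) (by omega)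
    (by
      have : 3 ≤ L := by omega
      have h9 : 3 * 3 ≤ L * L := Nat.mul_le_mul this this
      calc L + 2 * (2 * L) + 2 ≤ 9 * L := by omega
        _ ≤ L * L * L := Nat.mul_le_mul_right _ h9
        _ = L ^ 3 := by ring)
    (fun τ _ _ => rfl) hle
    (fun τ P hτ => by simp [P.h22, hτ])
  exact ⟨X, hXM, hXL, τ₀, hE, P.h0, τ, ⟨t, by rwa [pow_mul], hx⟩, hτ⟩

theorem Cmd.toProg_runs (c : Cmd) (hc : c.ok = true) (h : ℕ) (le : Expr) :
    ∃ K, ∀ {p a : ℕ} {F : Type*} [Field F] [Fact p.Prime] [Algebra (ZMod p) F]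
      (bF : Basis (Fin a) (ZMod p) F) {L : ℕ} (_ : 0 < L)
      (hd l : List ℕ), hd.length = h → 2 ≤ h → hd.getD 0 0 = p → hd.getD 1 0 = a →
      (∀ x ∈ hd, x ≤ p ^ a * L) → (∀ x ∈ l, x < p) → (hd ++ tableF bF ++ l).length ≤ L →
      a * a < L → h + 1 ≤ L → 4 * p ^ a ≤ 2 ^ (L - 1) →
      (∀ τ, Prep p a 0 (hd ++ tableF bF ++ l) τ → le.eval τ = L) →
      ∃ X : Ctx F, X.M = 4 * (p ^ a * L) ∧ X.L = L ∧ ∃ τ, Env bF X τ ∧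
        τ 0 = listArray (hd ++ tableF bF ++ l) ∧
        ∀ output : List ℕ, (∀ i ≤ output.length, c.den X τ 1 i = listArray output i) →
        RunsIn (c.toProg h le) (hd ++ tableF bF ++ l) output (L ^ K) := by
  obtain ⟨K, hK⟩ := c.toProg_exec hc h le
  refine ⟨K, fun {p a F} _ hp _ bF {L} hL hd l hh h2 h0 h1 hhd hl hlen haL hhL hq hle => ?_⟩
  have hML := size_four_mul_mul_le (pow_pos hp.out.pos a) hL hq
  have hLM : L ≤ 4 * (p ^ a * L) := by
    have := Nat.le_mul_of_pos_left L (pow_pos hp.out.pos a)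
    omega
  have hsz : ∀ {x}, x ≤ 4 * (p ^ a * L) → x.size ≤ 2 * L := fun hx =>
    (Nat.size_le_size hx).trans hML
  have hpM : p ≤ 4 * (p ^ a * L) := (Nat.le_self_pow (a_pos bF).ne' p).trans
    ((Nat.le_mul_of_pos_right (p ^ a) hL).trans (by omega))
  obtain ⟨X, hXM, hXL, τ₀, hE, P, τ, ⟨t, ht, hx⟩, hτ⟩ := hK bF hL hd l (load (hd ++ tableF bF ++ l))
    (by simp [load]) (bd_load (hsz (hlen.trans hLM)) (fun x hx => by
      simp only [List.mem_append] at hx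
      rcases hx with (hx | hx) | hx
      · exact hsz ((hhd x hx).trans (by omega))
      · exact hsz (((enc_tableF bF).lt bF x hx).le.trans hpM)
      · exact hsz ((hl x hx).le.trans hpM))) hh h2 h0 h1 haL hhL hq hle
  exact ⟨X, hXM, hXL, τ₀, hE, P, fun output hout => ⟨τ, t, hx, ht, fun i hi => by
    rw [hτ, hout i hi]⟩⟩

/-! ### The input of the decoder -/

section

variable {p a m : ℕ} {F K : Type*} [Field F] [Field K] [hp : Fact p.Prime]
  [Algebra (ZMod p) F] [Algebra F K] (bF : Basis (Fin a) (ZMod p) F) (bK : Basis (Fin m) F K)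
  {X : Ctx F} {n k κ s D N : ℕ} {α : Fin n → F} {v : Fin κ → Fin k → K} {y : Fin n → K} {σ ρ : Store}

/-- Reads `N` field elements behind the table of the base field, which starts at position `o`. -/
def inRest (o : ℕ) (N : Expr) : Cmd := inC (.const o + inp 2 * inp 2 * inp 2) N

theorem inRest_spec (hσ : Env bF X σ) {Ne : Expr} {hd l : List ℕ}
    (hρ : (inRest (hd.length + 1) Ne).den X σ = ρ) (h0 : σ 0 = listArray (hd ++ tableF bF ++ l))
    (hN : Ne.eval σ = N) (hNL : N < X.L) {z : ℕ → F} (hz : Enc bF l N z) :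
    ∀ i < N, ρ 10 i = X.code (z i) := by
  refine inC_spec bF hσ hρ N z hN hNL (fun τ h => by simp [h]) fun i hi d hd' => ?_
  have e : (Expr.const (hd.length + 1) + inp 2 * inp 2 * inp 2).eval σ + (i * a + d) =
      (hd ++ tableF bF).length + 1 + (i * a + d) := by
    simp only [eval_add, eval_mul, eval_read, eval_const, hσ.ha, List.length_append,
      (enc_tableF bF).1]
    ring
  rw [e, h0, listArray_append]
  exact hz.2 i hi d hd'

/-- Writes the number of the element `1` to the variable `40`. -/
def oneC : Cmd := .seq (powS (.nat 1) (rd 2 2 - 2)) (.setF 40 0 (.nat (V 33)))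

/-- The coordinates of the unit of F are not part of the input. The element with number 1 need not
be the unit, but it is nonzero since 0 has number 0, so its power with exponent q - 1 is the unit.
-/
theorem oneC_spec [Finite F] (hρ : oneC.den X σ = ρ) (h21 : σ 2 1 = X.L)
    (h22 : σ 2 2 = Nat.card F) (hq : X.q = Nat.card F) (hqL : 4 * Nat.card F ≤ 2 ^ (X.L - 1)) :
    ρ 40 0 = X.code 1 := by
  obtain ⟨σ₁, h₁, rfl⟩ := Cmd.den_seq_iff.1 hρ
  have hq1 : 1 < Nat.card F := Finite.one_lt_card
  have hqM := X.q_le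
  have h1 : X.el 1 ≠ 0 := by
    intro h
    have := X.code_el 1
    rw [h, X.code_zero, Nat.mod_eq_of_lt (by omega)] at this
    omega
  have e1 := powS_spec h₁ (X.el 1) (Nat.card F - 2) rfl (fun τ hτ => by simp [hτ 2, h22]) (by omega)
    h21 (by omega)
  have e3 : X.el 1 ^ (Nat.card F - 2 + 1) = 1 := by
    rw [show Nat.card F - 2 + 1 = Nat.card F - 1 by omega]
    have := Fintype.ofFinite F
    rw [Nat.card_eq_fintype_card]
    exact FiniteField.pow_card_sub_one_eq_one _ h1
  rw [e3] at e1
  simp [Cmd.den_setF, e1, FE.eval, X.el_code]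

theorem enc_rest (α : Fin n → F) (v : Fin κ → Fin k → K) {l' : List ℕ} {w : ℕ → F}
    (hw : Enc bF l' N w) :
    ∃ z : ℕ → F, Enc bF (tableK bF bK ++ (encFVec bF α ++ (encKMat bF bK v ++ l')))
      (m * m * m + n + κ * (k * m) + N) z ∧
    (∀ l l' c, l < m → l' < m → c < m → z ((l * m + l') * m + c) =
      kc bK (ext bK l * ext bK l') c) ∧
    (∀ i < n, z (m * m * m + i) = ext α i) ∧
    (∀ l < κ, ∀ j < k, ∀ c < m, z (m * m * m + n + (l * (k * m) + (j * m + c))) =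
      kc bK (ext (ext v l) j) c) ∧
    ∀ i < N, z (m * m * m + n + κ * (k * m) + i) = w i := by
  have h := (enc_tableK bF bK).append bF ((enc_encFVec bF α).append bF
    ((enc_encKMat bF bK v).append bF hw))
  rw [show m * (m * m) + (n + (κ * (k * m) + N)) = m * m * m + n + κ * (k * m) + N by ring] at h
  refine ⟨_, h, ?_, ?_, ?_, ?_⟩
  · intro l l' c hl hl' hc
    have h1 : l' * m + c < m * m := mul_add_lt hl' hc
    have e : (l * m + l') * m + c = l * (m * m) + (l' * m + c) := by ring
    rw [e, if_pos (mul_add_lt hl h1), mul_add_div_self h1, mul_add_mod_self h1,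
      mul_add_div_self hc, mul_add_mod_self hc]
  · intro i hi
    rw [if_neg (by rw [mul_assoc]; omega), if_pos (by rw [mul_assoc]; omega), mul_assoc,
      Nat.add_sub_cancel_left]
  · intro l hl j hj c hc
    have h1 : j * m + c < k * m := mul_add_lt hj hc
    have h2 := mul_add_lt hl h1
    rw [show m * m * m + n + (l * (k * m) + (j * m + c)) =
      m * (m * m) + (n + (l * (k * m) + (j * m + c))) by ring, if_neg (by omega),
      Nat.add_sub_cancel_left, if_neg (by omega), Nat.add_sub_cancel_left, if_pos h2,
      mul_add_div_self h1, mul_add_mod_self h1, mul_add_div_self hc, mul_add_mod_self hc]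
  · intro i hi
    rw [show m * m * m + n + κ * (k * m) + i =
      m * (m * m) + (n + (κ * (k * m) + i)) by ring, if_neg (by omega),
      Nat.add_sub_cancel_left, if_neg (by omega), Nat.add_sub_cancel_left, if_neg (by omega),
      Nat.add_sub_cancel_left]

/-- Reads the input of the decoder; `es` and `eκ` are the positions of `s` and `κ`. -/
def decInC (es eκ : Expr) : Cmd :=
  .seq (.set 21 0 (inp 3)) (.seq (.set 23 0 (inp 4)) (.seq (.set 24 0 (inp 5))
    (.seq (.set 26 0 es) (.seq (.set 25 0 eκ) (.seq (.set 27 0 ((V 23 - V 24 + 1) / (V 26 + 1)))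
      (.seq (inRest 8 (V 21 * V 21 * V 21 + V 23 + V 25 * (V 24 * V 21) + V 23 * V 21)) oneC))))))

theorem decInC_spec [Finite F] (hσ : Env bF X σ) {hd : List ℕ} {es eκ : Expr}
    (hρ : (decInC es eκ).den X σ = ρ)
    (hlen : hd.length = 7) (h2 : hd.getD 2 0 = m) (h3 : hd.getD 3 0 = n) (h4 : hd.getD 4 0 = k)
    (hs : ∀ τ : Store, τ 0 = σ 0 → es.eval τ = s ∧ eκ.eval τ = κ) (hq : Nat.card F = p ^ a)
    (h0 : σ 0 = listArray (hd ++ tableF bF ++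
      (tableK bF bK ++ (encFVec bF α ++ (encKMat bF bK v ++ encKVec bF bK y)))))
    (hNL : m * m * m + n + κ * (k * m) + n * m < X.L) (hmL : m < X.L) (hkL : k < X.L)
    (hκL : κ < X.L) (hsL : s < X.L) (hLM : X.L < X.M) (hqL : 4 * Nat.card F ≤ 2 ^ (X.L - 1)) :
    DecIn X bK α v y s ((n - k + 1) / (s + 1)) ρ := by
  have hin : ∀ j < 7, σ 0 (j + 1) = hd.getD j 0 := fun j hj => by
    rw [h0, List.append_assoc, listArray_append_left _ _ (by omega)]
  have hDn : (n - k + 1) / (s + 1) ≤ n - k + 1 := Nat.div_le_self _ _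
  simp only [decInC, Cmd.den_seq_iff] at hρ
  obtain ⟨σ₁, h₁, σ₂, h₂, σ₃, h₃, σ₄, h₄, σ₅, h₅, σ₆, h₆, σ₇, h₇, h₈⟩ := hρ
  have f5 : σ₅ 0 = σ 0 := by rw [fr h₅ 0, fr h₄ 0, fr h₃ 0, fr h₂ 0, fr h₁ 0]
  have v21 : σ₅ 21 0 = m := by
    rw [fr h₅ 21, fr h₄ 21, fr h₃ 21, fr h₂ 21]
    exact set_val h₁ ((hin 2 (by omega)).trans h2) (by omega)
  have v23 : σ₅ 23 0 = n := by
    rw [fr h₅ 23, fr h₄ 23, fr h₃ 23]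
    exact set_val h₂ ((congrFun (fr h₁ 0) 4).trans ((hin 3 (by omega)).trans h3)) (by omega)
  have v24 : σ₅ 24 0 = k := by
    rw [fr h₅ 24, fr h₄ 24]
    exact set_val h₃ ((congrFun ((fr h₂ 0).trans (fr h₁ 0)) 5).trans ((hin 4 (by omega)).trans h4))
      (by omega)
  have v26 : σ₅ 26 0 = s := by
    rw [fr h₅ 26]
    exact set_val h₄ (hs _ (by rw [fr h₃ 0, fr h₂ 0, fr h₁ 0])).1 (by omega)
  have v25 : σ₅ 25 0 = κ :=
    set_val h₅ (hs _ (by rw [fr h₄ 0, fr h₃ 0, fr h₂ 0, fr h₁ 0])).2 (by omega)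
  have v27 : σ₆ 27 0 = (n - k + 1) / (s + 1) := set_val h₆ (by simp [v23, v24, v26]) (by omega)
  have env := (((((hσ.step bF h₁).step bF h₂).step bF h₃).step bF h₄).step bF h₅).step bF h₆
  obtain ⟨z, hz, z1, z2, z3, z4⟩ := enc_rest bF bK α v (enc_encKVec bF bK y)
  have r1 := inRest_spec (ρ := σ₇) bF env (hd := hd) (by rwa [hlen]) (by rw [fr h₆ 0, f5, h0])
    (by simp [fr h₆ 21, fr h₆ 23, fr h₆ 24, fr h₆ 25, v21, v23, v24, v25]) hNL hz
  have env := env.step bF h₇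
  have e22 : σ₇ 2 2 = Nat.card F := env.hq.trans (env.hXq.trans hq.symm)
  have h10 : ∀ i < m * m * m + n + κ * (k * m) + n * m, ρ 10 i = X.code (z i) := by
    rw [fr h₈ 10]; exact r1
  have hfr : ∀ b ∈ [21, 23, 24, 25, 26], ρ b = σ₅ b := fun b hb => by
    rw [frs h₈ [21, 23, 24, 25, 26] rfl b hb, frs h₇ [21, 23, 24, 25, 26] rfl b hb,
      frs h₆ [21, 23, 24, 25, 26] rfl b hb]
  refine ⟨⟨by rw [hfr 21 (by simp), v21], hmL, fun l l' c hl hl' hc => ?_⟩,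
    ⟨by rw [hfr 23 (by simp), v23], by rw [hfr 24 (by simp), v24], by rw [hfr 25 (by simp), v25],
    by rw [hfr 26 (by simp), v26], by rw [fr h₈ 27, fr h₇ 27, v27]⟩, fun i hi => ?_,
    fun l hl j hj c hc => ?_, fun i hi c hc => ?_, by rw [fr h₈ 2]; exact env.hL,
    by rw [fr h₈ 2, e22], oneC_spec h₈ env.hL e22 (env.hXq.trans hq.symm) hqL⟩
  · have := mul_add_lt (mul_add_lt hl hl') hc
    rw [h10 _ (by omega), z1 l l' c hl hl' hc]
  · rw [h10 _ (by omega), z2 i hi]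
  · have := mul_add_lt hl (mul_add_lt hj hc)
    rw [h10 _ (by omega), z3 l hl j hj c hc]
  · have := mul_add_lt hi hc
    rw [h10 _ (by omega), z4 _ this, mul_add_div_self hc, mul_add_mod_self hc]

end

theorem finite_of_basis {p a : ℕ} {F : Type*} [Field F] [Fact p.Prime] [Algebra (ZMod p) F]
    (bF : Basis (Fin a) (ZMod p) F) : Finite F :=
  Finite.of_equiv _ bF.equivFun.toEquiv.symm

theorem card_of_basis {p a : ℕ} {F : Type*} [Field F] [Fact p.Prime] [Algebra (ZMod p) F]
    (bF : Basis (Fin a) (ZMod p) F) : Nat.card F = p ^ a := by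
  rw [Nat.card_congr bF.equivFun.toEquiv, Nat.card_fun, Nat.card_zmod, Nat.card_eq_fintype_card,
    Fintype.card_fin]

theorem le_card_of_linearIndependent {m k κ : ℕ} {F K : Type*} [Field F] [Field K] [Algebra F K]
    (bK : Basis (Fin m) F K) {v : Fin κ → Fin k → K} (hv : LinearIndependent F v) :
    κ ≤ k * m := by
  have : Module.Finite F K := Module.Finite.of_basis bK
  have h := hv.fintype_card_le_finrank
  rwa [Fintype.card_fin, finrank_pi_fintype, Finset.sum_const, Finset.card_fin,
    finrank_eq_card_basis bK, Fintype.card_fin, smul_eq_mul] at h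

/-- The input of the decoder. -/
noncomputable abbrev decInput {p a m n k κ : ℕ} {F K : Type*} [Field F] [Field K]
    [Algebra (ZMod p) F] [Algebra F K] (bF : Basis (Fin a) (ZMod p) F) (bK : Basis (Fin m) F K)
    (x₁ x₂ : ℕ) (α : Fin n → F) (v : Fin κ → Fin k → K) (y : Fin n → K) : List ℕ :=
  [p, a, m, n, k, x₁, x₂] ++ tableF bF ++
    (tableK bF bK ++ (encFVec bF α ++ (encKMat bF bK v ++ encKVec bF bK y)))

theorem length_decInput {p a m n k κ : ℕ} {F K : Type*} [Field F] [Field K] [Fact p.Prime]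
    [Algebra (ZMod p) F] [Algebra F K] (bF : Basis (Fin a) (ZMod p) F) (bK : Basis (Fin m) F K)
    (x₁ x₂ : ℕ) (α : Fin n → F) (v : Fin κ → Fin k → K) (y : Fin n → K) :
    (decInput bF bK x₁ x₂ α v y).length =
      7 + a * a * a + (m * m * m + n + κ * (k * m) + n * m) * a := by
  simp only [decInput, List.length_append, (enc_tableF bF).1, (enc_tableK bF bK).1,
    (enc_encFVec bF α).1, (enc_encKMat bF bK v).1, (enc_encKVec bF bK y).1, List.length_cons,
    List.length_nil]
  ring

/-- A bound for all numbers that occur in the input of the decoder. -/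
structure InBd (B p a m n k κ s : ℕ) : Prop where
  hB : 10 ≤ B
  hp : p.size ≤ B
  ha : a ≤ B
  hm : m ≤ B
  hn : n ≤ B
  hk : k ≤ B
  hκ : κ ≤ B
  hs : s ≤ B

theorem InBd.mul_pow_le {B p a m n k κ s : ℕ} (h : InBd B p a m n k κ s) {c e : ℕ} (hc : c ≤ 10)
    (he : e < 10) : c * B ^ e < B ^ 12 := by
  have := h.hB
  calc c * B ^ e ≤ B * B ^ e := Nat.mul_le_mul_right _ (by omega)
    _ = B ^ (e + 1) := by ring
    _ < B ^ 12 := Nat.pow_lt_pow_right (by omega) (by omega)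

theorem InBd.four_mul_le {B p a m n k κ s : ℕ} (h : InBd B p a m n k κ s) :
    4 * p ^ a ≤ 2 ^ (B ^ 12 - 1) := by
  have h1 : p ^ a ≤ 2 ^ (B * B) := by
    calc p ^ a ≤ (2 ^ p.size) ^ a := Nat.pow_le_pow_left (Nat.lt_size_self p).le a
      _ = 2 ^ (p.size * a) := (pow_mul _ _ _).symm
      _ ≤ 2 ^ (B * B) := Nat.pow_le_pow_right (by omega) (Nat.mul_le_mul h.hp h.ha)
  have h2 := h.mul_pow_le (c := 2) (e := 2) (by omega) (by omega)
  have h3 := h.hB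
  calc 4 * p ^ a ≤ 2 ^ 2 * 2 ^ (B * B) := Nat.mul_le_mul_left _ h1
    _ = 2 ^ (2 + B * B) := (pow_add _ _ _).symm
    _ ≤ _ := Nat.pow_le_pow_right (by omega) (by
      have : 10 * 10 ≤ B * B := Nat.mul_le_mul h3 h3
      rw [pow_two] at h2
      omega)

/-- Each quantity is bounded by a polynomial with small coefficients in parameters that are at most
B, of degree well below 12; so L = B^12 exceeds them all. -/
theorem InBd.decBd {B p a m n k κ s D : ℕ} (h : InBd B p a m n k κ s) {F : Type*} [Field F]
    {X : Ctx F} (hq : Nat.card F = p ^ a) (hXL : X.L = B ^ 12)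
    (hXM : X.M = 4 * (p ^ a * B ^ 12)) (ha : 0 < a) (hk : 0 < k) (hD : D + k ≤ n) :
    DecBd X m n k κ s D a := by
  obtain ⟨hB, hp, ha', hm, hn, hk', hκ, hs⟩ := h
  have key : ∀ c e x, c ≤ 10 → e < 10 → x ≤ c * B ^ e → x < X.L := fun c e x hc he hx => by
    rw [hXL]; exact lt_of_le_of_lt hx (InBd.mul_pow_le ⟨hB, hp, ha', hm, hn, hk', hκ, hs⟩ hc he)
  have hDB : D + k ≤ B := hD.trans hn
  have hD1 : D + 1 ≤ B := by omega
  have h0 : 1 ≤ B := by omega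
  have hw : D + k + s * (D + 1) ≤ 2 * B ^ 2 := by
    calc D + k + s * (D + 1) ≤ B * B + B * B := by
          refine Nat.add_le_add (hDB.trans (Nat.le_mul_of_pos_left _ h0)) (Nat.mul_le_mul hs hD1)
      _ = _ := by ring
  have hkm : k * m + 1 + 1 ≤ 3 * B ^ 2 := by
    have : k * m ≤ B * B := Nat.mul_le_mul hk' hm
    nlinarith
  refine ⟨key 1 2 _ (by omega) (by omega) ?_, key 2 3 _ (by omega) (by omega) ?_,
    key 1 2 _ (by omega) (by omega) ?_, key 6 6 _ (by omega) (by omega) ?_,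
    key 1 2 _ (by omega) (by omega) ?_, key 1 4 _ (by omega) (by omega) ?_,
    key 6 3 _ (by omega) (by omega) ?_, key 1 2 _ (by omega) (by omega) ?_,
    key 3 4 _ (by omega) (by omega) ?_, key 1 1 _ (by omega) (by omega) (by rw [pow_one]; omega),
    key 1 1 _ (by omega) (by omega) (by rw [pow_one]; omega), ha, ?_, ?_⟩
  · calc m * m ≤ B * B := by gcongr
      _ = _ := by ring
  · calc s * (n + m) * m ≤ B * (B + B) * B := by gcongr
      _ = _ := by ring
  · calc n * (D + k) ≤ B * B := by gcongr
      _ = _ := by ring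
  · calc _ ≤ (2 * B ^ 2) * B * ((2 * B ^ 2) * B + B ^ 3) := by
          gcongr
          exact Nat.one_le_pow _ _ h0
      _ = _ := by ring
  · calc n * m ≤ B * B := by gcongr
      _ = _ := by ring
  · calc s * (D + 1) * m * m ≤ B * B * B * B := by gcongr
      _ = _ := by ring
  · calc (κ + 1) * (k * m + 1 + 1) ≤ (B + B) * (3 * B ^ 2) := by gcongr
      _ = _ := by ring
  · calc (D + k) * m ≤ B * B := by gcongr
      _ = _ := by ring
  · calc (κ + 2) * (n * m) * a ≤ (B + 2 * B) * (B * B) * B := by gcongr; omega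
      _ = _ := by ring
  · rw [hXL, hq]; exact InBd.four_mul_le ⟨hB, hp, ha', hm, hn, hk', hκ, hs⟩
  · rw [hXL, hq, hXM]

/-- A program can read off bounds for the parameters from the length of its input, because the
tables, points, basis vectors and the received word occupy space there; `s` is covered by `s ≤ m`.
-/
theorem inBd_of_length {p a m n k κ s l : ℕ} (hm : 0 < m) (ha : 0 < a) (hk : 0 < k) (hkn : k < n)
    (hs : s ≤ m) (hl : 7 + a * a * a + (m * m * m + n + κ * (k * m) + n * m) * a ≤ l) :
    InBd (l + p.size + 10) p a m n k κ s := by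
  have h1 : a ≤ a * a * a := by
    rw [mul_assoc]; exact Nat.le_mul_of_pos_right _ (Nat.mul_pos ha ha)
  have h2 : m ≤ m * m * m := by
    rw [mul_assoc]; exact Nat.le_mul_of_pos_right _ (Nat.mul_pos hm hm)
  have h3 : κ ≤ κ * (k * m) := Nat.le_mul_of_pos_right _ (Nat.mul_pos hk hm)
  have h4 := Nat.le_mul_of_pos_right (m * m * m + n + κ * (k * m) + n * m) ha
  constructor <;> omega

/-- The size of the input in terms of the parameters. -/
theorem length_le_pow {p a m n k κ W : ℕ} (hp : p.Prime) (ha : 0 < a) (hm : 0 < m) (hn : 2 ≤ n)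
    (hkn : k < n) (hκ : κ ≤ k * m) (hW : n + m + (p ^ a).size ≤ W) :
    7 + a * a * a + (m * m * m + n + κ * (k * m) + n * m) * a + p.size + 10 ≤ W ^ 7 := by
  have h1 : a < (p ^ a).size := Nat.lt_size.2 (Nat.pow_le_pow_left hp.two_le a)
  have h2 : p.size ≤ (p ^ a).size := Nat.size_le_size (Nat.le_self_pow ha.ne' p)
  have hW5 : 5 ≤ W := by omega
  have hκ' : κ ≤ W ^ 2 := hκ.trans (by
    calc k * m ≤ W * W := Nat.mul_le_mul (by omega) (by omega)
      _ = _ := by ring)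
  have key : ∀ e ≤ 5, W ^ e ≤ W ^ 5 := fun e he => Nat.pow_le_pow_right (by omega) he
  calc 7 + a * a * a + (m * m * m + n + κ * (k * m) + n * m) * a + p.size + 10
      ≤ 7 + W * W * W + (W * W * W + W + W ^ 2 * (W * W) + W * W) * W + W + 10 := by
        gcongr <;> omega
    _ = 17 + W ^ 1 + W ^ 2 + 2 * W ^ 3 + W ^ 4 + W ^ 5 := by ring
    _ ≤ 25 * W ^ 5 := by
      have := key 0 (by omega)
      have := key 1 (by omega)
      have := key 2 (by omega)
      have := key 3 (by omega)
      have := key 4 (by omega)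
      rw [pow_zero] at *
      omega
    _ ≤ W ^ 2 * W ^ 5 := Nat.mul_le_mul_right _ (by nlinarith)
    _ = _ := by ring

/-- The decoder; `es` and `eκ` are the positions of `s` and `κ` in the input. -/
def decProg (es eκ : Expr) : Prog :=
  (Cmd.seq (decInC es eκ) decC).toProg 7 (powE (inp 0 + V 7 + 10) 12)

/-- Let t be the number of agreements. The distance bound gives (s + 1)t ≥ n - k + (s + 1)k, while t
+ 1 ≤ D + k would give (s + 1)(t + 1) ≤ n - k + 1 + (s + 1)k. For s ≥ 1 these are incompatible. -/
theorem le_card_agree {K : Type*} [DecidableEq K] {n k s : ℕ} (hkn : k < n) (hs : 1 ≤ s)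
    {y c : Fin n → K}
    (h : (hammingDist y c : ℝ) ≤ (s : ℝ) / (s + 1) * (n - k)) :
    (n - k + 1) / (s + 1) + k ≤ (Finset.univ.filter fun i => c i = y i).card := by
  have h1 : hammingDist y c + (Finset.univ.filter fun i => c i = y i).card = n := by
    have := Finset.card_filter_add_card_filter_not (s := (Finset.univ : Finset (Fin n)))
      (fun i => c i = y i)
    rw [Finset.card_fin, add_comm] at this
    refine Eq.trans ?_ this
    rw [hammingDist]
    simp only [ne_eq, eq_comm]
  set t := (Finset.univ.filter fun i => c i = y i).card
  have h2 : (s + 1) * hammingDist y c ≤ s * (n - k) := by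
    have hc : ((n - k : ℕ) : ℝ) = n - k := Nat.cast_sub hkn.le
    rw [← hc, div_mul_eq_mul_div, le_div_iff₀ (by positivity)] at h
    have : ((hammingDist y c * (s + 1) : ℕ) : ℝ) ≤ ((s * (n - k) : ℕ) : ℝ) := by
      push_cast; exact h
    have := Nat.cast_le.1 this
    linarith
  have h3 : (s + 1) * ((n - k + 1) / (s + 1)) ≤ n - k + 1 := Nat.mul_div_le _ _
  obtain ⟨w, rfl⟩ := Nat.exists_eq_add_of_le hkn.le
  rw [Nat.add_sub_cancel_left] at *
  by_contra hlt
  have h4 : t + 1 ≤ (w + 1) / (s + 1) + k := by omega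
  have h5 : (s + 1) * (t + 1) ≤ (s + 1) * ((w + 1) / (s + 1)) + (s + 1) * k := by
    rw [← mul_add]; exact Nat.mul_le_mul_left _ h4
  have h6 : (s + 1) * hammingDist y c + (s + 1) * t = (s + 1) * (k + w) := by
    rw [← mul_add, h1]
  nlinarith

/-- The two decoders differ only in where the input stores `s` and the number of basis vectors, so
these two positions are left as expressions. The design parameter `δ` is arbitrary, and `v` need
only span a subspace of the product space, as required for codes of prescribed dimension. -/
theorem decProg_runs (es eκ : Expr) (hok : (Cmd.seq (decInC es eκ) decC).ok = true) :
    ∃ C, ∀ {p a m n k s κ : ℕ} {F K : Type*} [Field F] [Field K] [DecidableEq K] [Fact p.Prime]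
      [Algebra (ZMod p) F] [Algebra F K] (bF : Basis (Fin a) (ZMod p) F) (bK : Basis (Fin m) F K)
      (α : Fin n → F) (v : Fin κ → Fin k → K) (y : Fin n → K) (x₁ x₂ : ℕ)
      (H : Fin k → Submodule F (Fin m → F)) (δ : ℝ),
      (∀ τ : Store, τ 0 = listArray (decInput bF bK x₁ x₂ α v y) →
        es.eval τ = s ∧ eκ.eval τ = κ) →
      x₁ ≤ k * m + m → x₂ ≤ k * m + m → 1 ≤ s → s ≤ m → 1 ≤ k → k < n → Function.Injective α →
      LinearIndependent F v → IsSubspaceDesign (s - 1) δ H →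
      Submodule.span F (Set.range v) ≤ designSpace bK H →
      ListDecodesIn bF bK (decProg es eκ) (decInput bF bK x₁ x₂ α v y)
        (rsSubcode α (Submodule.span F (Set.range v))) y ((s : ℝ) / (s + 1) * (n - k)) δ
        ((n + m + (Nat.card F).size) ^ C) := by
  obtain ⟨K₀, hK₀⟩ := (Cmd.seq (decInC es eκ) decC).toProg_runs hok 7 (powE (inp 0 + V 7 + 10) 12)
  refine ⟨7 * 12 * K₀, fun {p a m n k s κ F K} _ _ _ hp _ _ bF bK α v y x₁ x₂ H δ hse hx₁ hx₂ hs hsm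
    hk hkn hα hv hH hV => ?_⟩
  have : Finite F := finite_of_basis bF
  have hq := card_of_basis bF
  have ha := a_pos bF
  have hm : 0 < m := by omega
  have hκ := le_card_of_linearIndependent bK hv
  have hlen := length_decInput bF bK x₁ x₂ α v y
  set l := (decInput bF bK x₁ x₂ α v y).length with hl
  obtain ⟨B, hB⟩ : ∃ B, l + p.size + 10 = B := ⟨_, rfl⟩
  have hin : InBd B p a m n k κ s := by
    rw [← hB]; exact inBd_of_length hm ha hk hkn hsm hlen.ge
  have hBW : B ≤ (n + m + (Nat.card F).size) ^ 7 := by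
    rw [← hB, hlen, hq]
    exact length_le_pow hp.out ha hm (by omega) hkn hκ le_rfl
  have hBL : ∀ c e, c ≤ 10 → e < 10 → c * B ^ e < B ^ 12 := fun c e hc he =>
    hin.mul_pow_le hc he
  have hBL1 : 10 * B < B ^ 12 := by simpa using hBL 10 1 (by omega) (by omega)
  have hB10 := hin.hB
  have hL : 0 < B ^ 12 := by omega
  have hqL : B ^ 12 ≤ p ^ a * B ^ 12 := Nat.le_mul_of_pos_left _ (pow_pos hp.out.pos a)
  have hD : (n - k + 1) / (s + 1) + k ≤ n := by
    have : (n - k + 1) / (s + 1) ≤ (n - k + 1) / 2 := Nat.div_le_div_left (by omega) (by omega)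
    omega
  -- With D the quotient, (s + 1)(D + 1) > n - k + 1, so there are at least n + 1 unknowns. The
  -- summand 1 in the numerator of D is what makes this inequality strict.
  have hcount : n < (n - k + 1) / (s + 1) + k + s * ((n - k + 1) / (s + 1) + 1) := by
    have := Nat.lt_mul_div_succ (n - k + 1) (show 0 < s + 1 by omega)
    have e : (s + 1) * ((n - k + 1) / (s + 1) + 1) =
      (n - k + 1) / (s + 1) + s * ((n - k + 1) / (s + 1) + 1) + 1 := by ring
    omega
  have hkmB : k * m ≤ B * B := Nat.mul_le_mul hin.hk hin.hm
  have hBB : 10 * B ^ 2 < B ^ 12 := hBL 10 2 (by omega) (by omega)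
  rw [pow_two] at hBB
  have hmB := hin.hm
  have hBB' : 10 * B ≤ B * B := Nat.mul_le_mul_right _ hB10
  have hfour : 4 * p ^ a ≤ 2 ^ (B ^ 12 - 1) := hin.four_mul_le
  have hbd := fun {X : Ctx F} (h1 : X.L = B ^ 12) (h2 : X.M = 4 * (p ^ a * B ^ 12)) =>
    hin.decBd (D := (n - k + 1) / (s + 1)) hq h1 h2 ha hk hD
  generalize hLB : B ^ 12 = L at *
  obtain ⟨X, hXM, hXL, τ, hE, h0, hrun⟩ := hK₀ bF hL [p, a, m, n, k, x₁, x₂]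
    (tableK bF bK ++ (encFVec bF α ++ (encKMat bF bK v ++ encKVec bF bK y))) rfl (by omega) rfl rfl
    (by
      have h1 : p ≤ p ^ a := Nat.le_self_pow ha.ne' p
      have h2 : p ^ a ≤ p ^ a * L := Nat.le_mul_of_pos_right _ hL
      have := hin.ha
      have := hin.hm
      have := hin.hn
      have := hin.hk
      simp only [List.forall_mem_cons, List.not_mem_nil, false_imp_iff, implies_true, and_true]
      refine ⟨?_, ?_, ?_, ?_, ?_, ?_, ?_⟩ <;> omega)
    (by
      obtain ⟨z, hz, -⟩ := enc_rest bF bK α v (enc_encKVec bF bK y)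
      exact hz.lt bF)
    (by rw [← hl]; omega)
    (by have : a * a ≤ B * B := Nat.mul_le_mul hin.ha hin.ha
        omega) (by omega) hfour
    (fun τ P => by
      have : τ 0 0 = l := by rw [P.h0, listArray_zero]
      simp [P.h7, this, hB, hLB])
  have hmn := Nat.le_mul_of_pos_right (m * m * m + n + κ * (k * m) + n * m) ha
  have hkB := hin.hk
  have hκB := hin.hκ
  have hsB := hin.hs
  obtain ⟨σ₁, h₁, h₂⟩ := Cmd.den_seq_iff.1 (rfl : (Cmd.seq (decInC es eκ) decC).den X τ = _)
  have d1 := decInC_spec bF bK (hd := [p, a, m, n, k, x₁, x₂]) (α := α) (v := v) (y := y)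
    hE h₁ rfl rfl rfl rfl (fun τ' h => hse τ' (h.trans h0)) hq h0 (by omega) (by omega) (by omega)
    (by omega) (by omega) (by omega) (by rwa [hq, hXL])
  obtain ⟨d, c₀, u, o1, o2, o3, o4⟩ := decC_spec bF bK (hE.step bF h₁) h₂ d1 (hbd hXL hXM) hm hk
    (by omega) hD hcount hα hv hH hV
  refine ⟨d, c₀, u, o1, o2, ?_, fun c hc hdist => o3 c hc _
    (fun i hi => (Finset.mem_filter.1 hi).2) (le_card_agree hkn hs hdist)⟩
  obtain ⟨ρ, t, r1, r2, r3⟩ := hrun _ o4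
  refine ⟨ρ, t, r1, r2.trans ?_, r3⟩
  rw [← hLB, ← pow_mul, mul_assoc 7, pow_mul (n + m + _)]
  exact Nat.pow_le_pow_left hBW _

theorem decInC_ok₁ : (Cmd.seq (decInC (inp 6) (inp 7)) decC).ok = true := by decide

/-- In the second part of the theorem the input lists the dimension and ⌈1/ε⌉, and `s` is four times
the latter. -/
theorem decInC_ok₂ : (Cmd.seq (decInC (4 * inp 7) (inp 6)) decC).ok = true := by decide

/-! ### The folded Wronskian -/

section

open Polynomial

variable {F : Type*} [Field F] {r : ℕ}

/-- The matrix with rows `f_i(X), f_i(δ X), …, f_i(δ ^ (r - 1) X)`. -/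
noncomputable def foldMat (δ : F) (f : Fin r → F[X]) : Matrix (Fin r) (Fin r) F[X] :=
  Matrix.of fun i j => (f i).comp (C (δ ^ (j : ℕ)) * X)

theorem natDegree_scale_le (a : F) (P : F[X]) : (P.comp (C a * X)).natDegree ≤ P.natDegree := by
  refine natDegree_comp_le.trans ?_
  calc P.natDegree * (C a * X).natDegree ≤ P.natDegree * 1 :=
        Nat.mul_le_mul_left _ ((natDegree_C_mul_le a X).trans natDegree_X_le)
    _ = _ := mul_one _

theorem coeff_scale (a : F) (P : F[X]) (n : ℕ) : (P.comp (C a * X)).coeff n = P.coeff n * a ^ n := by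
  rw [comp_C_mul_X_coeff]

theorem coeff_prod_of_natDegree_le' {ι : Type*} (s : Finset ι) (f : ι → F[X]) (e : ι → ℕ)
    (h : ∀ i ∈ s, (f i).natDegree ≤ e i) :
    (∏ i ∈ s, f i).natDegree ≤ ∑ i ∈ s, e i ∧
      (∏ i ∈ s, f i).coeff (∑ i ∈ s, e i) = ∏ i ∈ s, (f i).coeff (e i) := by
  classical
  induction s using Finset.induction_on with
  | empty => simp
  | insert i s hi ih =>
    obtain ⟨h1, h2⟩ := ih fun j hj => h j (Finset.mem_insert_of_mem hj)
    have h3 := h i (Finset.mem_insert_self _ _)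
    rw [Finset.prod_insert hi, Finset.sum_insert hi, Finset.prod_insert hi, ← h2]
    exact ⟨natDegree_mul_le.trans (Nat.add_le_add h3 h1), coeff_mul_add_eq_of_natDegree_le h3 h1⟩

/-- Every product in the expansion of the determinant takes exactly one entry from each row, so the
row bounds add up, and the coefficient at their sum is the determinant of the coefficients at the
row bounds. -/
theorem natDegree_det_le_and_coeff (M : Matrix (Fin r) (Fin r) F[X]) (e : Fin r → ℕ)
    (h : ∀ i j, (M i j).natDegree ≤ e i) :
    M.det.natDegree ≤ ∑ i, e i ∧
      M.det.coeff (∑ i, e i) = (Matrix.of fun i j => (M i j).coeff (e i)).det := by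
  have key : ∀ σ : Equiv.Perm (Fin r), (∏ i, M (σ i) i).natDegree ≤ ∑ i, e i ∧
      (∏ i, M (σ i) i).coeff (∑ i, e i) = ∏ i, (M (σ i) i).coeff (e (σ i)) := fun σ => by
    have := coeff_prod_of_natDegree_le' Finset.univ (fun i => M (σ i) i) (fun i => e (σ i))
      fun i _ => h _ _
    rwa [Equiv.sum_comp σ e] at this
  rw [Matrix.det_apply, Matrix.det_apply]
  refine ⟨natDegree_sum_le_of_forall_le _ _ fun σ _ => ?_, ?_⟩
  · refine le_trans ?_ (key σ).1
    rw [Units.smul_def, zsmul_eq_mul]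
    refine natDegree_mul_le.trans ?_
    simp
  · rw [finsetSum_coeff]
    refine Finset.sum_congr rfl fun σ _ => ?_
    rw [Units.smul_def, Units.smul_def, coeff_smul, (key σ).2]
    rfl

/-- The coefficient of the determinant at the sum of the degrees is the product of the leading
coefficients with a Vandermonde determinant in the powers δ^(deg fᵢ), which are distinct. -/
theorem det_foldMat_ne_zero_of_injective {δ : F} {m : ℕ} (hδ : ∀ i < m, ∀ j < m, δ ^ i = δ ^ j → i = j)
    (f : Fin r → F[X]) (hf : ∀ i, f i ≠ 0) (hm : ∀ i, (f i).natDegree < m)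
    (hinj : Function.Injective fun i => (f i).natDegree) : (foldMat δ f).det ≠ 0 := by
  intro h0
  have h := (natDegree_det_le_and_coeff (foldMat δ f) (fun i => (f i).natDegree)
    fun i j => natDegree_scale_le _ _).2
  have e : (Matrix.of fun i j => ((foldMat δ f) i j).coeff (f i).natDegree) =
      Matrix.of fun i j => (f i).leadingCoeff *
        Matrix.vandermonde (fun i => δ ^ (f i).natDegree) i j := by
    ext i j
    simp only [foldMat, Matrix.of_apply, coeff_scale, Matrix.vandermonde_apply, leadingCoeff]
    rw [← pow_mul, ← pow_mul, mul_comm (j : ℕ)]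
  rw [h0, coeff_zero, e, Matrix.det_mul_column] at h
  rcases mul_eq_zero.1 h.symm with h | h
  · obtain ⟨i, -, hi⟩ := Finset.prod_eq_zero_iff.1 h
    exact hf i (leadingCoeff_eq_zero.1 hi)
  · rw [Matrix.det_vandermonde_eq_zero_iff] at h
    obtain ⟨i, j, hij, hne⟩ := h
    exact hne (hinj (hδ _ (hm i) _ (hm j) hij))

theorem foldMat_update (δ a : F) (f : Fin r → F[X]) (i j : Fin r) :
    foldMat δ (Function.update f i (f i + a • f j)) =
      (foldMat δ f).updateRow i (foldMat δ f i + C a • foldMat δ f j) := by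
  ext l c
  by_cases h : l = i
  · subst h
    simp [foldMat, smul_eq_C_mul]
  · simp [foldMat, h]

theorem linearIndependent_update_add_smul {A : Type*} [AddCommGroup A] [Module F A] {f : Fin r → A}
    (hf : LinearIndependent F f) (a : F) {i j : Fin r} (hne : i ≠ j) :
    LinearIndependent F (Function.update f i (f i + a • f j)) := by
  have e : Function.update f i (f i + a • f j) = fun l => f l + (if l = i then a else 0) • f j := by
    ext l
    by_cases h : l = i
    · subst h; simp
    · simp [h]
  rw [Fintype.linearIndependent_iff] at hf ⊢
  intro c hc
  have h1 : ∑ l, (c + (Pi.single j (c i * a) : Fin r → F)) l • f l = 0 := by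
    rw [← hc, e]
    simp only [Pi.add_apply, add_smul, smul_add, Finset.sum_add_distrib, Pi.single_apply, ite_smul,
      zero_smul, smul_ite, smul_zero, Finset.sum_ite_eq', Finset.mem_univ, if_true, smul_smul]
  have h2 := hf _ h1
  have h3 : c i = 0 := by simpa [hne] using h2 i
  intro l
  have := h2 l
  rwa [h3, zero_mul, Pi.single_zero, add_zero] at this

/-- Polynomials that are linearly independent have a nonzero folded Wronskian. -/
theorem det_foldMat_ne_zero {δ : F} {m : ℕ} (hδ : ∀ i < m, ∀ j < m, δ ^ i = δ ^ j → i = j)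
    (f : Fin r → F[X]) (hf : LinearIndependent F f) (hm : ∀ i, (f i).natDegree < m) :
    (foldMat δ f).det ≠ 0 := by
  induction hN : ∑ i, (f i).natDegree using Nat.strong_induction_on generalizing f with
  | _ N ih =>
    by_cases hinj : Function.Injective fun i => (f i).natDegree
    · exact det_foldMat_ne_zero_of_injective hδ f (fun i => hf.ne_zero i) hm hinj
    obtain ⟨i, j, hij, hne⟩ : ∃ i j, (f i).natDegree = (f j).natDegree ∧ i ≠ j := by
      simpa [Function.Injective] using hinj
    -- Chosen to cancel the leading term of `f i` against `f j`. This is a row operation on the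
    -- matrix, so the determinant and independence are preserved while the sum of the degrees drops.
    set a : F := -((f i).leadingCoeff / (f j).leadingCoeff) with ha
    have hj0 : (f j).leadingCoeff ≠ 0 := leadingCoeff_ne_zero.2 (hf.ne_zero j)
    have hdet : (foldMat δ (Function.update f i (f i + a • f j))).det = (foldMat δ f).det := by
      rw [foldMat_update, Matrix.det_updateRow_add_smul_self _ hne]
    have hli := linearIndependent_update_add_smul hf a hne
    set g := Function.update f i (f i + a • f j) with hg
    have hgi : g i = f i + a • f j := by simp [hg]
    have hgl : ∀ l, l ≠ i → g l = f l := fun l hl => by simp [hg, hl]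
    have hgi0 : g i ≠ 0 := hli.ne_zero i
    have hle : (g i).natDegree ≤ (f i).natDegree := by
      rw [hgi]
      refine natDegree_add_le_of_degree_le le_rfl ((natDegree_smul_le _ _).trans hij.symm.le)
    have hcoef : (g i).coeff (f i).natDegree = 0 := by
      rw [hgi, coeff_add, coeff_smul, smul_eq_mul, hij, coeff_natDegree, ← hij, coeff_natDegree, ha]
      field_simp
      ring
    have hlt : (g i).natDegree < (f i).natDegree := by
      refine lt_of_le_of_ne hle fun h => ?_
      rw [← h, coeff_natDegree, leadingCoeff_eq_zero] at hcoef
      exact hgi0 hcoef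
    rw [← hdet]
    refine ih _ ?_ g hli (fun l => ?_) rfl
    · rw [← hN]
      refine Finset.sum_lt_sum (fun l _ => ?_) ⟨i, Finset.mem_univ _, hlt⟩
      by_cases h : l = i
      · rw [h]; exact hle
      · rw [hgl l h]
    · by_cases h : l = i
      · rw [h]; exact hlt.trans (hm i)
      · rw [hgl l h]; exact hm l

theorem pow_dvd_det_of_rows {M : Matrix (Fin r) (Fin r) F[X]} {Q : F[X]} (S : Finset (Fin r))
    (h : ∀ i ∈ S, ∀ j, Q ∣ M i j) : Q ^ S.card ∣ M.det := by
  choose! A hA using h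
  have e : M = Matrix.of fun i j => (if i ∈ S then Q else 1) *
      (Matrix.of fun i j => if i ∈ S then A i j else M i j) i j := by
    ext i j
    by_cases hi : i ∈ S
    · simp [hi, hA i hi j]
    · simp [hi]
  rw [e, Matrix.det_mul_column, Finset.prod_ite_mem, Finset.univ_inter, Finset.prod_const]
  exact Dvd.intro _ rfl

/-- If `g` is contained in the span of `f` then so do the Wronskians. -/
theorem det_foldMat_of_mem_span (δ : F) {f g : Fin r → F[X]}
    (h : ∀ i, g i ∈ Submodule.span F (Set.range f)) :
    ∃ c : F, (foldMat δ g).det = C c * (foldMat δ f).det := by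
  have h' : ∀ i, ∃ c : Fin r → F, ∑ l, c l • f l = g i := fun i =>
    (Submodule.mem_span_range_iff_exists_fun F).1 (h i)
  choose A hA using h'
  refine ⟨(Matrix.of A).det, ?_⟩
  have e : foldMat δ g = (Matrix.of A).map C * foldMat δ f := by
    ext1 i j
    simp only [foldMat, Matrix.of_apply, Matrix.mul_apply, Matrix.map_apply, ← hA]
    rw [sum_comp]
    exact Finset.sum_congr rfl fun l _ => by rw [smul_eq_C_mul, mul_comp, C_comp]
  rw [e, Matrix.det_mul, RingHom.map_det]
  rfl

/-- A basis of `W` that contains a basis of the subspace `U`. -/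
theorem exists_adapted {A : Type*} [AddCommGroup A] [Module F A] {W U : Submodule F A}
    [FiniteDimensional F W] (hU : U ≤ W) (hW : finrank F W = r) :
    ∃ (g : Fin r → A) (S : Finset (Fin r)), LinearIndependent F g ∧ (∀ i, g i ∈ W) ∧
      S.card = finrank F U ∧ ∀ i ∈ S, g i ∈ U := by
  classical
  obtain ⟨U', hU'⟩ : ∃ U' : Submodule F W, U' = U.comap W.subtype := ⟨_, rfl⟩
  have hd : finrank F U' = finrank F U := by
    rw [hU']
    exact (Submodule.comapSubtypeEquivOfLe hU).finrank_eq
  obtain ⟨Z, hZ⟩ := Submodule.exists_isCompl U'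
  set B := ((finBasis F U').prod (finBasis F Z)).map (U'.prodEquivOfIsCompl Z hZ) with hB
  have hcard : Fintype.card (Fin (finrank F U') ⊕ Fin (finrank F Z)) = Fintype.card (Fin r) := by
    rw [← finrank_eq_card_basis B, hW, Fintype.card_fin]
  set E := Fintype.equivOfCardEq hcard
  refine ⟨fun i => (B (E.symm i) : A), Finset.univ.image fun i => E (Sum.inl i), ?_,
    fun i => (B (E.symm i)).2, ?_, ?_⟩
  · exact ((B.linearIndependent.comp _ E.symm.injective).map' W.subtype W.ker_subtype)
  · rw [Finset.card_image_of_injective _ fun x y h => Sum.inl_injective (E.injective h),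
      Finset.card_univ, Fintype.card_fin, hd]
  · intro i hi
    obtain ⟨l, -, rfl⟩ := Finset.mem_image.1 hi
    beta_reduce
    rw [Equiv.symm_apply_apply]
    have h1 : B (Sum.inl l) = (finBasis F U' l : W) := by simp [hB]
    have h2 : ∀ w ∈ U', (w : A) ∈ U := by rw [hU']; exact fun w hw => hw
    rw [h1]
    exact h2 _ (finBasis F U' l).2

/-- The polynomial with given coefficients. -/
noncomputable def toPoly (m : ℕ) : (Fin m → F) →ₗ[F] F[X] :=
  (degreeLT F m).subtype ∘ₗ (degreeLTEquiv F m).symm.toLinearMap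

theorem toPoly_injective (m : ℕ) : Function.Injective (toPoly (F := F) m) :=
  Subtype.val_injective.comp (degreeLTEquiv F m).symm.injective

theorem toPoly_of_degree_lt {m : ℕ} {P : F[X]} (h : P.degree < m) :
    toPoly m (fun i => P.coeff i) = P := by
  have : (degreeLTEquiv F m).symm (fun i => P.coeff i) = ⟨P, mem_degreeLT.2 h⟩ := by
    rw [LinearEquiv.symm_apply_eq]
    rfl
  rw [toPoly, LinearMap.comp_apply, LinearEquiv.coe_coe, this]
  rfl

theorem natDegree_toPoly_lt {m : ℕ} (hm : 0 < m) (w : Fin m → F) : (toPoly m w).natDegree < m := by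
  have h := mem_degreeLT.1 ((degreeLTEquiv F m).symm w).2
  by_cases h0 : toPoly m w = 0
  · rw [h0]; simpa using hm
  · exact (natDegree_lt_iff_degree_lt h0).2 h

theorem isCoprime_of_monic_irreducible {P Q : F[X]} (hP : P.Monic) (hQ : Q.Monic)
    (hP' : Irreducible P) (hQ' : Irreducible Q) (h : P ≠ Q) : IsCoprime P Q := by
  refine (hP'.coprime_iff_not_dvd).2 fun hd => h ?_
  exact eq_of_monic_of_associated hP hQ (hP'.associated_of_dvd hQ' hd)

/-- Spaces of polynomials of degree less than `m`, the scalings of whose elements are divisible by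
irreducible quadratic polynomials, form a subspace design. -/
theorem sum_finrank_le_of_dvd {δ : F} {m k u : ℕ} (hm : 0 < m)
    (hδ : ∀ i < m, ∀ j < m, δ ^ i = δ ^ j → i = j) (H : Fin k → Submodule F (Fin m → F))
    (Q : Fin k × Fin u → F[X]) (hQ : Function.Injective Q) (hQm : ∀ j, (Q j).Monic)
    (hQi : ∀ j, Irreducible (Q j)) (hQd : ∀ j, (Q j).natDegree = 2)
    (hdvd : ∀ j i, ∀ w ∈ H j, ∀ e < r, Q (j, i) ∣ (toPoly m w).comp (C (δ ^ e) * X))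
    (W : Submodule F (Fin m → F)) (hW : finrank F W = r) :
    2 * u * ∑ j, finrank F (W ⊓ H j : Submodule F (Fin m → F)) ≤ r * (m - 1) := by
  classical
  set f : Fin r → F[X] := fun i => toPoly m (finBasisOfFinrankEq F W hW i) with hf
  have hfW : ∀ w ∈ W, toPoly m w ∈ Submodule.span F (Set.range f) := fun w hw => by
    have h1 : (⟨w, hw⟩ : W) ∈ Submodule.span F (Set.range (finBasisOfFinrankEq F W hW)) := by
      rw [Basis.span_eq]; trivial
    have h2 := Submodule.mem_map_of_mem (f := toPoly m ∘ₗ W.subtype) h1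
    rwa [Submodule.map_span, ← Set.range_comp] at h2
  have hli : LinearIndependent F f :=
    (finBasisOfFinrankEq F W hW).linearIndependent.map' (toPoly m ∘ₗ W.subtype)
      (LinearMap.ker_eq_bot.2 ((toPoly_injective m).comp W.injective_subtype))
  have hD0 := det_foldMat_ne_zero hδ f hli fun i => natDegree_toPoly_lt hm _
  set D := (foldMat δ f).det with hD
  have hDdeg : D.natDegree ≤ r * (m - 1) := by
    have := (natDegree_det_le_and_coeff (foldMat δ f) (fun _ => m - 1) fun i j =>
      (natDegree_scale_le _ _).trans (Nat.le_sub_one_of_lt (natDegree_toPoly_lt hm _))).1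
    simpa using this
  have hpow : ∀ j i, Q (j, i) ^ finrank F (W ⊓ H j : Submodule F (Fin m → F)) ∣ D := fun j i => by
    -- In a basis of `W` extending one of `W ⊓ H j`, the rows of the latter vectors are divisible by
    -- `Q (j, i)`. Changing the basis multiplies the determinant by a constant, nonzero because both
    -- Wronskians are.
    obtain ⟨g, S, g1, g2, g3, g4⟩ := exists_adapted (U := W ⊓ H j) inf_le_left hW
    obtain ⟨c, hc⟩ := det_foldMat_of_mem_span δ (f := f) (g := fun i => toPoly m (g i))
      fun i => hfW _ (g2 i)
    have hg0 := det_foldMat_ne_zero hδ (fun i => toPoly m (g i))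
      (g1.map' _ (LinearMap.ker_eq_bot.2 (toPoly_injective m))) fun i => natDegree_toPoly_lt hm _
    have hc0 : c ≠ 0 := by
      rintro rfl
      rw [C_0, zero_mul] at hc
      exact hg0 hc
    have hd := pow_dvd_det_of_rows (M := foldMat δ fun i => toPoly m (g i)) (Q := Q (j, i)) S
      fun l hl e => hdvd j i _ (g4 l hl).2 e e.2
    rw [hc, g3] at hd
    exact ((isUnit_C.2 hc0.isUnit).dvd_mul_left).1 hd
  -- Distinct monic irreducible polynomials are coprime, so all these powers divide the Wronskian at
  -- once, and degrees can be compared.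
  have hprod : ∏ x : Fin k × Fin u, Q x ^ finrank F (W ⊓ H x.1 : Submodule F (Fin m → F)) ∣ D := by
    refine Finset.prod_dvd_of_coprime (fun x _ y _ hxy => ?_) fun x _ => hpow x.1 x.2
    exact (isCoprime_of_monic_irreducible (hQm x) (hQm y) (hQi x) (hQi y) (hQ.ne hxy)).pow
  have hdeg := (natDegree_le_of_dvd hprod hD0).trans hDdeg
  rw [natDegree_prod _ _ fun x _ => pow_ne_zero _ (hQm x).ne_zero] at hdeg
  refine le_trans (le_of_eq ?_) hdeg
  rw [Fintype.sum_prod_type, Finset.mul_sum]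
  refine Finset.sum_congr rfl fun j _ => ?_
  simp only [natDegree_pow, hQd]
  show _ = ∑ _x : Fin u, finrank F (W ⊓ H j : Submodule F (Fin m → F)) * 2
  rw [Finset.sum_const, Finset.card_fin, smul_eq_mul]
  ring

end

/-! ### Bases of the space of coefficient vectors -/

section

variable {m k ℓ : ℕ} {F K : Type*} [Field F] [Field K] [Algebra F K] (bK : Basis (Fin m) F K)

/-- The basis of the space of coefficient vectors given by bases of the factors. -/
noncomputable def designBasis (g : Fin k → Fin ℓ → Fin m → F) (l : Fin (k * ℓ)) : Fin k → K :=
  Pi.single l.divNat (bK.equivFun.symm (g l.divNat l.modNat))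

/-- The sum of the dimensions of the intersections of `W` with the spaces spanned by the rows. -/
noncomputable abbrev designSum (g : Fin k → Fin ℓ → Fin m → F) (W : Submodule F (Fin m → F)) : ℕ :=
  ∑ j, finrank F (W ⊓ Submodule.span F (Set.range (g j)) : Submodule F (Fin m → F))

theorem linearIndependent_designBasis {g : Fin k → Fin ℓ → Fin m → F}
    (hg : ∀ j, LinearIndependent F (g j)) : LinearIndependent F (designBasis bK g) := by
  have h := Pi.linearIndependent_single (R := F)
    (fun j : Fin k => fun i : Fin ℓ => bK.equivFun.symm (g j i))
    fun j => (hg j).map' bK.equivFun.symm.toLinearMap (LinearEquiv.ker _)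
  refine h.comp (fun l : Fin (k * ℓ) => (⟨l.divNat, l.modNat⟩ : Σ _ : Fin k, Fin ℓ)) fun x y hxy => ?_
  apply finProdFinEquiv.symm.injective
  simp only [Sigma.mk.injEq, heq_eq_eq] at hxy
  exact Prod.ext hxy.1 hxy.2

theorem span_designBasis (g : Fin k → Fin ℓ → Fin m → F) :
    Submodule.span F (Set.range (designBasis bK g)) =
      designSpace bK fun j => Submodule.span F (Set.range (g j)) := by
  apply le_antisymm
  · rw [Submodule.span_le]
    rintro _ ⟨l, rfl⟩
    rw [SetLike.mem_coe, mem_designSpace]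
    intro j
    rw [designBasis]
    by_cases h : j = l.divNat
    · subst h
      rw [Pi.single_eq_same, LinearEquiv.apply_symm_apply]
      exact Submodule.subset_span ⟨_, rfl⟩
    · rw [Pi.single_eq_of_ne h, map_zero]
      exact Submodule.zero_mem _
  · intro f hf
    rw [mem_designSpace] at hf
    rw [← Finset.univ_sum_single f]
    refine Submodule.sum_mem _ fun j _ => ?_
    have h : Pi.single j (f j) ∈ (Submodule.span F (Set.range (g j))).map
        (LinearMap.single F (fun _ : Fin k => K) j ∘ₗ bK.equivFun.symm.toLinearMap) :=
      ⟨_, hf j, by simp⟩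
    rw [Submodule.map_span, ← Set.range_comp] at h
    refine Submodule.span_mono ?_ h
    rintro _ ⟨i, rfl⟩
    refine ⟨finProdFinEquiv (j, i), ?_⟩
    have e := finProdFinEquiv.symm_apply_apply (j, i)
    have e1 : (finProdFinEquiv (j, i)).divNat = j := congrArg Prod.fst e
    have e2 : (finProdFinEquiv (j, i)).modNat = i := congrArg Prod.snd e
    rw [designBasis, e1, e2]
    rfl

theorem finrank_designSpace {g : Fin k → Fin ℓ → Fin m → F}
    (hg : ∀ j, LinearIndependent F (g j)) :
    finrank F (designSpace bK fun j => Submodule.span F (Set.range (g j))) = k * ℓ := by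
  rw [← span_designBasis, finrank_span_eq_card (linearIndependent_designBasis bK hg),
    Fintype.card_fin]

end

/-! ### The explicit design -/

section

open Polynomial

variable {F : Type*} [Field F]

/-- The quadratic polynomials used as places. -/
noncomputable def quad (b c : F) : F[X] := X ^ 2 + C b * X + C (b ^ 2 * c)

theorem natDegree_quad (b c : F) : (quad b c).natDegree = 2 := by
  unfold quad; compute_degree!

theorem monic_quad (b c : F) : (quad b c).Monic := by
  unfold quad; monicity!

theorem eval_quad (b c x : F) : (quad b c).eval x = x ^ 2 + b * x + b ^ 2 * c := by
  simp [quad]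

/-- A root x would give the root x / b of Y² + Y + c, and a quadratic polynomial without roots is
irreducible. -/
theorem irreducible_quad {b c : F} (hb : b ≠ 0) (hc : ∀ y : F, y ^ 2 + y + c ≠ 0) :
    Irreducible (quad b c) := by
  rw [(monic_quad b c).irreducible_iff_roots_eq_zero_of_degree_le_three
    (by rw [natDegree_quad]) (by rw [natDegree_quad]; omega)]
  refine Multiset.eq_zero_of_forall_notMem fun x hx => ?_
  have h : x ^ 2 + b * x + b ^ 2 * c = 0 := (eval_quad b c x).symm.trans (mem_roots'.1 hx).2
  apply hc (x / b)
  field_simp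
  linear_combination h

theorem quad_injective {b c b' c' : F} (hb : b ≠ 0) (h : quad b c = quad b' c') :
    b = b' ∧ c = c' := by
  have e1 : ∀ b c : F, (quad b c).coeff 1 = b := fun b c => by
    simp only [quad, coeff_add, coeff_X_pow, coeff_C_mul, coeff_X_one, coeff_C]
    simp
  have e0 : ∀ b c : F, (quad b c).coeff 0 = b ^ 2 * c := fun b c => by
    simp only [quad, coeff_add, coeff_X_pow, coeff_C_mul, coeff_X_zero, coeff_C]
    simp
  have h1 := congrArg (fun P => P.coeff 1) h
  have h0 := congrArg (fun P => P.coeff 0) h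
  simp only [e1, e0] at h1 h0
  subst h1
  exact ⟨rfl, mul_left_cancel₀ (pow_ne_zero 2 hb) h0⟩

/-- Scaling the variable multiplies `b` and fixes `c`; the constant term b²c is chosen for this
purpose. -/
theorem quad_comp {a : F} (ha : a ≠ 0) (b c : F) :
    (quad b c).comp (C a⁻¹ * X) = C (a⁻¹ ^ 2) * quad (a * b) c := by
  have h : C a⁻¹ * C a = (1 : F[X]) := by rw [← C_mul, inv_mul_cancel₀ ha, C_1]
  simp only [quad, add_comp, mul_comp, pow_comp, X_comp, C_comp, C_mul, C_pow]
  linear_combination (-(C a⁻¹ * C b * X) - C b ^ 2 * C c * (1 + C a⁻¹ * C a)) * h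

/-- The polynomial that defines the `j`-th space of the design. -/
noncomputable def designPoly (γ : F) (c : ℕ → F) (u j : ℕ) : F[X] :=
  ∏ i ∈ Finset.range u, quad (γ ^ (j % 2 * u + i)) (c (j / 2))

theorem monic_designPoly (γ : F) (c : ℕ → F) (u j : ℕ) : (designPoly γ c u j).Monic :=
  monic_prod_of_monic _ _ fun _ _ => monic_quad _ _

theorem natDegree_designPoly (γ : F) (c : ℕ → F) (u j : ℕ) :
    (designPoly γ c u j).natDegree = 2 * u := by
  rw [designPoly, natDegree_prod_of_monic _ _ fun _ _ => monic_quad _ _]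
  simp [natDegree_quad, mul_comm]

/-- The scaling by γ^(-e) shifts exponents of places by e. The place with offset r - 1 + i divides
the scalings for all e < r, because the places with offsets r - 1 + i - e all divide the polynomial
itself; of the u places of a block, u - r + 1 survive. The blocks for even and odd j are disjoint,
since 2u ≤ m and the first m powers of γ are distinct. Quadratic places are used so that there are
enough of them for k up to q - 1. -/
theorem sum_finrank_le_of_designPoly_dvd {γ : F} {m k u N r : ℕ} {c : ℕ → F} (hm : 0 < m)
    (hγ0 : γ ≠ 0) (hγ : ∀ i, 0 < i → i < m → γ ^ i ≠ 1) (hc : ∀ i < N, ∀ y : F, y ^ 2 + y + c i ≠ 0)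
    (hci : ∀ i < N, ∀ j < N, c i = c j → i = j) (hk : k ≤ 2 * N) (hr : 0 < r) (hru : r ≤ u)
    (hum : 2 * u ≤ m) (H : Fin k → Submodule F (Fin m → F))
    (hH : ∀ j, ∀ w ∈ H j, designPoly γ c u j ∣ toPoly m w)
    (W : Submodule F (Fin m → F)) (hW : finrank F W = r) :
    2 * (u - r + 1) * ∑ j, finrank F (W ⊓ H j : Submodule F (Fin m → F)) ≤ r * (m - 1) := by
  have hle : ∀ i < m, ∀ j < m, i ≤ j → γ ^ i = γ ^ j → i = j := fun i hi j hj hij h => by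
    by_contra hne
    apply hγ (j - i) (by omega) (by omega)
    have := pow_add γ i (j - i)
    rw [Nat.add_sub_cancel' hij, ← h] at this
    exact (mul_right_eq_self₀.1 this.symm).resolve_right (pow_ne_zero _ hγ0)
  have hinj : ∀ i < m, ∀ j < m, γ ^ i = γ ^ j → i = j := fun i hi j hj h => by
    rcases le_total i j with hij | hij
    · exact hle i hi j hj hij h
    · exact (hle j hj i hi hij h.symm).symm
  have hidx : ∀ (j : Fin k) (i : ℕ), i < u → (j : ℕ) % 2 * u + i < m := fun j i hi => by
    have : (j : ℕ) % 2 * u ≤ 1 * u := Nat.mul_le_mul_right _ (by omega)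
    omega
  refine sum_finrank_le_of_dvd (δ := γ⁻¹) (u := u - r + 1) hm (fun i hi j hj h => ?_) H
    (fun x => quad (γ ^ ((x.1 : ℕ) % 2 * u + (r - 1 + x.2))) (c ((x.1 : ℕ) / 2)))
    ?_ (fun _ => monic_quad _ _) (fun x => irreducible_quad (pow_ne_zero _ hγ0)
      (hc _ (by have := x.1.2; omega))) (fun _ => natDegree_quad _ _) ?_ W hW
  · rw [inv_pow, inv_pow, inv_inj] at h
    exact hinj i hi j hj h
  · rintro ⟨j, i⟩ ⟨j', i'⟩ h
    obtain ⟨h1, h2⟩ := quad_injective (pow_ne_zero _ hγ0) h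
    have hi := i.2
    have hi' := i'.2
    have h3 := hinj _ (hidx j _ (by dsimp only; omega)) _ (hidx j' _ (by dsimp only; omega)) h1
    have h4 := hci _ (by have := j.2; dsimp only; omega) _ (by have := j'.2; dsimp only; omega) h2
    dsimp only at h3 h4
    have h5 : (j : ℕ) % 2 = (j' : ℕ) % 2 ∧ (i : ℕ) = i' := by
      rcases Nat.mod_two_eq_zero_or_one j with e | e <;>
        rcases Nat.mod_two_eq_zero_or_one j' with e' | e' <;> rw [e, e'] at h3 ⊢ <;> omega
    exact Prod.ext (Fin.ext (show (j : ℕ) = j' by omega)) (Fin.ext h5.2)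
  · intro j i w hw e he
    have hi := i.2
    have h1 : quad (γ ^ ((j : ℕ) % 2 * u + (r - 1 + i - e))) (c ((j : ℕ) / 2)) ∣ toPoly m w :=
      (Finset.dvd_prod_of_mem (fun i => quad (γ ^ ((j : ℕ) % 2 * u + i)) (c ((j : ℕ) / 2)))
        (Finset.mem_range.2 (show r - 1 + i - e < u by omega))).trans (hH j w hw)
    obtain ⟨P, hP⟩ := h1
    rw [hP, mul_comp, inv_pow, quad_comp (pow_ne_zero _ hγ0), ← pow_add,
      show e + ((j : ℕ) % 2 * u + (r - 1 + i - e)) = (j : ℕ) % 2 * u + (r - 1 + i) by omega]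
    exact Dvd.dvd.mul_right (Dvd.intro_left _ rfl) _

/-- The rows of the explicit design. -/
noncomputable def designRow (γ : F) (c : ℕ → F) (u m j i : ℕ) : Fin m → F :=
  fun l => (X ^ i * designPoly γ c u j).coeff l

theorem designRow_apply (γ : F) (c : ℕ → F) (u m j i : ℕ) (l : Fin m) :
    designRow γ c u m j i l = if i ≤ l then (designPoly γ c u j).coeff (l - i) else 0 := by
  rw [designRow, coeff_X_pow_mul']

theorem toPoly_designRow {γ : F} {c : ℕ → F} {u m i : ℕ} (j : ℕ) (h : i + 2 * u < m) :
    toPoly m (designRow γ c u m j i) = X ^ i * designPoly γ c u j := by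
  refine toPoly_of_degree_lt ?_
  have h1 : (X ^ i * designPoly γ c u j).natDegree < m := by
    rw [natDegree_X_pow_mul _ (monic_designPoly γ c u j).ne_zero, natDegree_designPoly]
    omega
  exact degree_le_natDegree.trans_lt (by exact_mod_cast h1)

theorem linearIndependent_designRow (γ : F) (c : ℕ → F) (u m j : ℕ) :
    LinearIndependent F fun i : Fin (m - 2 * u) => designRow γ c u m j i := by
  apply LinearIndependent.of_comp (toPoly m)
  have h1 : LinearIndependent F fun i : Fin (m - 2 * u) => (X ^ (i : ℕ) : F[X]) := by
    have := (basisMonomials F).linearIndependent.comp (fun i : Fin (m - 2 * u) => (i : ℕ))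
      Fin.val_injective
    convert this using 1
    ext1 i
    simp [monomial_one_right_eq_X_pow]
  have h2 := h1.map' (LinearMap.mulRight F (designPoly γ c u j)) (LinearMap.ker_eq_bot.2
    (mul_left_injective₀ (monic_designPoly γ c u j).ne_zero))
  have e : (toPoly m ∘ fun i : Fin (m - 2 * u) => designRow γ c u m j i) =
      LinearMap.mulRight F (designPoly γ c u j) ∘ fun i : Fin (m - 2 * u) => X ^ (i : ℕ) := by
    ext1 i
    simp [toPoly_designRow j (show (i : ℕ) + 2 * u < m by omega)]
  rw [e]
  exact h2

theorem designPoly_dvd_of_mem_span {γ : F} {c : ℕ → F} {u m j : ℕ} {w : Fin m → F}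
    (hw : w ∈ Submodule.span F (Set.range fun i : Fin (m - 2 * u) => designRow γ c u m j i)) :
    designPoly γ c u j ∣ toPoly m w := by
  induction hw using Submodule.span_induction with
  | mem x hx =>
    obtain ⟨i, rfl⟩ := hx
    dsimp only
    rw [toPoly_designRow j (by omega)]
    exact Dvd.intro_left _ rfl
  | zero => rw [map_zero]; exact dvd_zero _
  | add x y _ _ hx hy => rw [map_add]; exact dvd_add hx hy
  | smul a x _ hx => rw [map_smul, smul_eq_C_mul]; exact hx.mul_left _

end

/-! ### Searching -/

section

variable {F : Type*} [Field F] (X : Ctx F)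

/-- Sets `y` to `1` if the values of `f` for `x` less than `e` are nonzero, and to `0` otherwise. -/
def allC (x y : ℕ) (e : Expr) (f : FE) : Cmd :=
  .seq (.set y 0 1) (.loop x e (.seq (.setF 34 0 f) (.ite (V 34) .skip (.set y 0 0))))

theorem Ctx.code_eq_zero {X : Ctx F} {z : F} : X.code z = 0 ↔ z = 0 :=
  ⟨fun h => by rw [← X.el_code z, h, X.el_zero], fun h => by rw [h, X.code_zero]⟩

variable {X} {x y z a : ℕ} {e : Expr} {t : Cmd} {f : FE} {σ ρ : Store}

theorem allC_spec (hρ : (allC x y e f).den X σ = ρ) (N : ℕ) (g : ℕ → F) (hM : 1 < X.M)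
    (hN : ∀ τ : Store, (∀ (b : ℕ) (_ : b ≠ y := by decide), τ b = σ b) → e.eval τ = N)
    (hNL : N < X.L) (hf : ∀ τ i, i < N → (∀ (b : ℕ) (_ : b ≠ x := by decide)
      (_ : b ≠ y := by decide) (_ : b ≠ 34 := by decide), τ b = σ b) → τ x 0 = i →
      f.eval X τ = g i) (hxy : x ≠ y := by decide) (hy : y ≠ 34 := by decide) :
    ρ y 0 ≠ 0 ↔ ∀ i < N, g i ≠ 0 := by
  obtain ⟨σ₁, h₁, h⟩ := Cmd.den_seq_iff.1 hρ
  have e1 : ∀ b, b ≠ y → σ₁ b = σ b := fun b hb => fr h₁ b (by simpa [Cmd.mods])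
  refine Cmd.loop_inv h N (fun n τ => (τ y 0 ≠ 0 ↔ ∀ i < n, g i ≠ 0)) (hN _ e1) hNL (by
    simp [put_of_ne _ _ _ _ hxy.symm, set_val h₁ rfl hM]) ?_
  rintro i hi τ hτ hτx hI _ rfl
  rw [put_of_ne _ _ _ _ hxy.symm, Cmd.den_seq, Cmd.den_setF, hf τ i hi (fun b h1 h2 h3 => by
    rw [hτ b (by simp [Cmd.mods, h1, h2, h3]), e1 b h2]) hτx, Cmd.den_ite X (X.code (g i)) (by simp),
    Nat.forall_lt_succ_right]
  split_ifs with h0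
  · simp [Cmd.den_set, Ctx.code_eq_zero.1 h0]
  · rw [Cmd.den_skip, put_of_ne _ _ _ _ hy, hI]
    exact (and_iff_left fun h => h0 (Ctx.code_eq_zero.2 h)).symm

/-- Sets `y` to a value of `x` less than `e` for which the test `t` makes `z` nonzero. -/
def searchC (x y z : ℕ) (e : Expr) (t : Cmd) : Cmd :=
  .loop x e (.seq t (.ite (V z) (.set y 0 (V x)) .skip))

/-- A later hit overwrites an earlier one and the loop never stops early; as soon as some value
passes the test, the final content of `y` is one that does. -/
theorem searchC_spec (hρ : (searchC x y z e t).den X σ = ρ) (N : ℕ) (P : ℕ → Prop)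
    (hN : e.eval σ = N) (hNL : N < X.L) (hNM : N ≤ X.M)
    (ht : ∀ τ i, i < N → (∀ b, b ≠ x → b ≠ y → b ∉ t.mods → τ b = σ b) → τ x 0 = i →
      ∀ τ', t.den X τ = τ' → (τ' z 0 ≠ 0 ↔ P i)) (hP : ∃ i < N, P i) (hxy : x ≠ y := by decide)
    (hx : x ∉ t.mods := by decide) (hy : y ∉ t.mods := by decide) : ρ y 0 < N ∧ P (ρ y 0) := by
  refine Cmd.loop_inv hρ N (fun n τ => (∃ i < n, P i) → τ y 0 < N ∧ P (τ y 0)) hN hNL (by simp) ?_ hP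
  rintro i hi τ hτ hτx hI _ rfl hex
  obtain ⟨τ', h'⟩ : ∃ τ', t.den X τ = τ' := ⟨_, rfl⟩
  have h1 := ht τ i hi (fun b h1 h2 h3 => hτ b (by simp [Cmd.mods, h1, h2, h3])) hτx _ h'
  rw [put_of_ne _ _ _ _ hxy.symm, Cmd.den_seq, h', Cmd.den_ite X (τ' z 0) (by simp)]
  split_ifs with h0
  · rw [Cmd.den_skip, fr h' y (by simpa)]
    obtain ⟨j, hj, hPj⟩ := hex
    exact hI ⟨j, lt_of_le_of_ne (Nat.lt_succ_iff.1 hj) fun h => h1.2 (h ▸ hPj) h0, hPj⟩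
  · rw [show (Cmd.set y 0 (V x)).den X τ' y 0 = i from
      set_val rfl (by simp [fr h' x (by simpa), hτx]) (by omega)]
    exact ⟨hi, h1.1 h0⟩

/-- Writes the values of `x` less than `e` for which the test `t` makes `z` nonzero to array `a`, and
their number to `y`. -/
def listC (x y z a : ℕ) (e : Expr) (t : Cmd) : Cmd :=
  .seq (.set y 0 0) (.loop x e (.seq t (.ite (V z) (.seq (.set a (V y) (V x))
    (.set y 0 (V y + 1))) .skip)))

open Classical in
theorem listC_spec (hρ : (listC x y z a e t).den X σ = ρ) (N : ℕ) (P : ℕ → Prop)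
    (hN : ∀ τ : Store, (∀ (b : ℕ) (_ : b ≠ y := by decide), τ b = σ b) → e.eval τ = N)
    (hNL : N < X.L) (hNM : N < X.M)
    (ht : ∀ τ i, i < N → (∀ b, b ≠ x → b ≠ y → b ≠ a → b ∉ t.mods → τ b = σ b) → τ x 0 = i →
      ∀ τ', t.den X τ = τ' → (τ' z 0 ≠ 0 ↔ P i)) (hxy : x ≠ y := by decide)
    (hax : a ≠ x := by decide) (hay : a ≠ y := by decide) (hx : x ∉ t.mods := by decide)
    (hy : y ∉ t.mods := by decide) (ha : a ∉ t.mods := by decide) :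
    (∀ i < ((Finset.range N).filter P).card, P (ρ a i) ∧ ρ a i < N) ∧
    ∀ i < ((Finset.range N).filter P).card, ∀ j < ((Finset.range N).filter P).card,
      ρ a i = ρ a j → i = j := by
  obtain ⟨σ₁, h₁, h⟩ := Cmd.den_seq_iff.1 hρ
  have e1 : ∀ b, b ≠ y → σ₁ b = σ b := fun b hb => fr h₁ b (by simpa [Cmd.mods])
  have h := Cmd.loop_inv h N (fun n τ => τ y 0 = ((Finset.range n).filter P).card ∧
      (∀ i < τ y 0, P (τ a i) ∧ τ a i < n) ∧ ∀ i < τ y 0, ∀ j < τ y 0, τ a i = τ a j → i = j)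
    (hN _ e1) hNL (by simp [put_of_ne _ _ _ _ hxy.symm, set_val h₁ rfl (Nat.zero_lt_of_lt hNM)]) (by
    rintro n hn τ hτ hτx ⟨I1, I2, I3⟩ _ rfl
    obtain ⟨τ', h'⟩ : ∃ τ', t.den X τ = τ' := ⟨_, rfl⟩
    have h1 := ht τ n hn (fun b h1 h2 h3 h4 => by
      rw [hτ b (by simp [Cmd.mods, h1, h2, h3, h4]), e1 b h2]) hτx _ h'
    have hyf : τ' y = τ y := fr h' y (by simpa)
    have haf : τ' a = τ a := fr h' a (by simpa)
    rw [Cmd.den_seq, h', Cmd.den_ite X (τ' z 0) (by simp), put_of_ne _ _ _ _ hxy.symm,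
      put_of_ne _ _ _ _ hax, Finset.range_add_one, Finset.filter_insert]
    split_ifs with h0 hP hP
    · exact absurd h0 (h1.2 hP)
    · rw [Cmd.den_skip, hyf, haf]
      exact ⟨I1, fun i hi => ⟨(I2 i hi).1, (I2 i hi).2.trans (Nat.lt_succ_self n)⟩, I3⟩
    · have hcard : τ y 0 ≤ n := I1 ▸ (Finset.card_filter_le _ _).trans (by rw [Finset.card_range])
      simp only [Cmd.den_seq, Cmd.den_set, eval_ofNat, eval_read, eval_const, eval_add]
      rw [put_of_ne _ _ _ _ hay.symm, put_same, put_of_ne _ _ _ _ hay, hyf, fr h' x (by simpa), hτx,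
        Nat.mod_eq_of_lt (show n < X.M by omega), Nat.mod_eq_of_lt (show τ y 0 + 1 < X.M by omega),
        Finset.card_insert_of_notMem (by simp), ← I1]
      have hnew : ∀ i, put τ' a (τ y 0) n a i = if i = τ y 0 then n else τ a i :=
        fun i => by simp [put_apply, haf]
      simp only [hnew]
      refine ⟨trivial, fun i hi => ?_, fun i hi j hj hij => ?_⟩
      · split_ifs with h2
        · exact ⟨hP, Nat.lt_succ_self n⟩
        · have := I2 i (by omega)
          exact ⟨this.1, this.2.trans (Nat.lt_succ_self n)⟩
      · have := fun h => (I2 i h).2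
        have := fun h => (I2 j h).2
        split_ifs at hij with h2 h3 h3
        exacts [by omega, by omega, by omega, I3 i (by omega) j (by omega) hij]
    · exact absurd (h1.1 h0) hP)
  exact h.1 ▸ h.2

end

/-- There are many quadratic polynomials `X ^ 2 + X + c` without roots. -/
theorem card_le_two_mul_card_rootless (F : Type*) [Field F] [Fintype F] [DecidableEq F] :
    Fintype.card F ≤ 2 * Finset.card {c : F | ∀ y, y ^ 2 + y + c ≠ 0} + 1 := by
  set f : F → F := fun y => -(y ^ 2 + y) with hf
  have h1 : (Finset.univ.image f).card + Finset.card {c : F | ∀ y, y ^ 2 + y + c ≠ 0} = Fintype.card F := by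
    rw [← Finset.card_univ, ← Finset.card_filter_add_card_filter_not (s := Finset.univ (α := F))
      (fun c => ∃ y, f y = c)]
    congr 2
    · ext c; simp
    · ext c
      simp only [Finset.mem_filter, Finset.mem_univ, true_and, not_exists, hf]
      refine forall_congr' fun y => not_congr ?_
      rw [neg_eq_iff_add_eq_zero]
  have h2 : Fintype.card F = ∑ b ∈ Finset.univ.image f,
      Finset.card {y | f y = b} := by
    rw [← Finset.card_univ]
    exact Finset.card_eq_sum_card_image f _
  -- The elements y and -1 - y have the same image under `f` and can coincide only for y = -1/2,
  -- which does not happen in characteristic two. So all fibres over the image, with at most one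
  -- exception, have two elements.
  have h3 : ∀ b ∈ Finset.univ.image f, 2 ≤ Finset.card {y | f y = b} +
      if b = f (-2⁻¹) then 1 else 0 := by
    intro b hb
    obtain ⟨y, -, rfl⟩ := Finset.mem_image.1 hb
    by_cases hy : y = -1 - y
    · have h4 : 2 * y = -1 := by linear_combination hy
      have h5 : (2 : F) ≠ 0 := by
        intro h
        rw [h, zero_mul] at h4
        exact one_ne_zero (neg_eq_zero.1 h4.symm)
      have h6 : y = -2⁻¹ := by
        field_simp
        linear_combination h4
      rw [← h6, if_pos rfl]
      have : 0 < Finset.card {z | f z = f y} :=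
        Finset.card_pos.2 ⟨y, by simp⟩
      omega
    · refine le_trans ?_ (Nat.le_add_right _ _)
      rw [← Finset.card_pair hy]
      refine Finset.card_le_card fun z hz => ?_
      simp only [Finset.mem_insert, Finset.mem_singleton] at hz
      rcases hz with rfl | rfl
      · simp
      · simp only [Finset.mem_filter, Finset.mem_univ, true_and, hf]
        ring
  have h4 := Finset.sum_le_sum h3
  rw [Finset.sum_add_distrib, ← h2, Finset.sum_ite_eq', Finset.sum_const, smul_eq_mul] at h4
  split_ifs at h4 <;> omega

/-! ### Construction of the explicit design -/

section

variable {F : Type*} [Field F] {X : Ctx F} {m k u ℓ N : ℕ} {σ ρ : Store}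

variable (X) in
/-- The parameters of the construction. -/
structure BuildIn (m k u ℓ N : ℕ) (σ : Store) : Prop where
  par : σ 21 0 = m ∧ σ 24 0 = k ∧ σ 25 0 = N ∧ σ 26 0 = u ∧ σ 27 0 = ℓ
  one : σ 40 0 = X.code 1
  h2 : σ 2 2 = Nat.card F

theorem BuildIn.congr {τ : Store} (h : BuildIn X m k u ℓ N σ)
    (e : ∀ b ∈ [2, 21, 24, 25, 26, 27, 40], τ b = σ b) : BuildIn X m k u ℓ N τ := by
  cases h
  constructor <;> simp_all

theorem BuildIn.step {c : Cmd} (h : BuildIn X m k u ℓ N σ) (hρ : c.den X σ = ρ)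
    (hc : c.keeps [2, 21, 24, 25, 26, 27, 40] = true := by rfl) : BuildIn X m k u ℓ N ρ :=
  h.congr (frs hρ _ hc)

/-- The powers of the element with number `V z`. -/
def powTabC (b z : ℕ) (e : Expr) : Cmd :=
  .loop 37 e (.setF b (V 37) (.ite (V 37) (.mul (.nat (rd b (V 37 - 1))) (.nat (V z)))
    (.nat (V 40))))

theorem powTabC_spec {b z : ℕ} {e : Expr} (hρ : (powTabC b z e).den X σ = ρ)
    (h40 : σ 40 0 = X.code 1) {w : F} (hw : X.el (σ z 0) = w) (N : ℕ) (hN : e.eval σ = N)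
    (hNL : N < X.L) (hb : 37 ≠ b ∧ 40 ≠ b ∧ z ≠ b ∧ z ≠ 37 := by decide) :
    ∀ i < N, ρ b i = X.code (w ^ i) := by
  refine tab_rec hρ N (fun i => w ^ i) hN hNL (fun τ j hj hτ h37 hrec => ?_) hb.1
  rw [FE.eval_ite X j (by simp [h37])]
  split_ifs with h0
  · simp [h0, hτ 40 hb.2.1, h40, X.el_code]
  · simp [h37, hrec (j - 1) (by omega), hτ z hb.2.2.1 hb.2.2.2, hw, X.el_code, ← pow_succ,
      Nat.sub_add_cancel (Nat.pos_of_ne_zero h0)]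

/-- Decides whether the first `m` powers of the element with number `V 38` are distinct. -/
def genTestC : Cmd :=
  .seq (powTabC 33 38 (V 21))
    (allC 39 15 (V 21) (.ite (V 39) (.sub (.nat (rd 33 (V 39))) (.nat (V 40))) (.nat (V 38))))

theorem genTestC_spec (hρ : genTestC.den X σ = ρ) (h : BuildIn X m k u ℓ N σ) (hm : 0 < m)
    (hmL : m < X.L) (hM : 1 < X.M) {i : ℕ} (hi : σ 38 0 = i) :
    ρ 15 0 ≠ 0 ↔ X.el i ≠ 0 ∧ ∀ j, 0 < j → j < m → X.el i ^ j ≠ 1 := by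
  obtain ⟨σ₁, h₁, h₂⟩ := Cmd.den_seq_iff.1 hρ
  have t1 := powTabC_spec h₁ h.one rfl m (by simp [h.par]) hmL
  have h' := h.step h₁
  rw [hi] at t1
  -- At index 0 the power is always 1; this index is used to test that the element itself is
  -- nonzero.
  rw [allC_spec h₂ m (fun j => if j = 0 then X.el i else X.el i ^ j - 1) hM
    (fun τ hτ => by simp [hτ 21, h'.par]) hmL (by
      intro τ j hj hτ h39
      rw [FE.eval_ite X j (by simp [h39])]
      split_ifs with h0
      · simp [hτ 38, fr h₁ 38, hi]
      · simp [hτ 33, hτ 40, h39, t1 j hj, h'.one, X.el_code])]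
  constructor
  · intro hall
    refine ⟨by simpa using hall 0 hm, fun j hj hjm h1 => ?_⟩
    have := hall j hjm
    rw [if_neg (by omega), h1, sub_self] at this
    exact this rfl
  · rintro ⟨h1, h2⟩ j hj
    split_ifs with h0
    exacts [h1, sub_ne_zero.2 (h2 j (by omega) hj)]

variable [Finite F]

/-- Finds an element whose first `m` powers are distinct. -/
def genC : Cmd := searchC 38 30 15 (rd 2 2) genTestC

/-- A generator of the cyclic group of units has order q - 1 ≥ m. -/
theorem exists_gen (hmq : m < Nat.card F) :
    ∃ z : F, z ≠ 0 ∧ ∀ j, 0 < j → j < m → z ^ j ≠ 1 := by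
  obtain ⟨g, hg⟩ := IsCyclic.exists_generator (α := Fˣ)
  refine ⟨g, g.ne_zero, fun j hj hjm h1 => ?_⟩
  have h3 := Nat.le_of_dvd hj (orderOf_dvd_of_pow_eq_one (Units.ext (by simpa using h1)))
  rw [orderOf_eq_card_of_forall_mem_zpowers hg, Nat.card_units] at h3
  omega

theorem genC_spec (hρ : genC.den X σ = ρ) (h : BuildIn X m k u ℓ N σ) (hq : X.q = Nat.card F)
    (hm : 0 < m) (hmq : m < Nat.card F) (hqL : Nat.card F < X.L) :
    X.el (ρ 30 0) ≠ 0 ∧ ∀ j, 0 < j → j < m → X.el (ρ 30 0) ^ j ≠ 1 := by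
  have hqM := X.q_le
  refine (searchC_spec hρ (Nat.card F)
    (fun i => X.el i ≠ 0 ∧ ∀ j, 0 < j → j < m → X.el i ^ j ≠ 1) (by simp [h.h2]) hqL (by omega)
    (fun τ i hi hτ h38 τ' h' => genTestC_spec h' (h.congr fun b hb => by
      apply hτ <;> revert b <;> decide) hm (by omega) (by omega) h38) ?_).2
  obtain ⟨z, hz⟩ := exists_gen hmq
  exact ⟨X.code z, hq ▸ X.code_lt z, by rwa [X.el_code]⟩

/-- Lists the elements `c` for which `X ^ 2 + X + c` has no root. -/
def rootlessC : Cmd :=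
  listC 38 16 15 31 (rd 2 2) (allC 39 15 (rd 2 2)
    (.add (.add (.mul (.nat (V 39)) (.nat (V 39))) (.nat (V 39))) (.nat (V 38))))

/-- The list has n entries with 2n ≥ q - 1, so two blocks of places per entry are enough for every k
< q. -/
theorem rootlessC_spec (hρ : rootlessC.den X σ = ρ) (h2 : σ 2 2 = Nat.card F)
    (hq : X.q = Nat.card F) (hqL : Nat.card F < X.L) (hqM : Nat.card F < X.M) :
    ∃ n, Nat.card F ≤ 2 * n + 1 ∧ (∀ i < n, ∀ y : F, y ^ 2 + y + X.el (ρ 31 i) ≠ 0) ∧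
    ∀ i < n, ∀ j < n, X.el (ρ 31 i) = X.el (ρ 31 j) → i = j := by
  classical
  have := Fintype.ofFinite F
  have hq1 : 1 < Nat.card F := Finite.one_lt_card
  obtain ⟨l1, l2⟩ := listC_spec hρ (Nat.card F) (fun i => ∀ y : F, y ^ 2 + y + X.el i ≠ 0)
    (fun τ hτ => by simp [hτ 2, h2]) hqL hqM (by
      intro τ i hi hτ h38 τ' h'
      rw [allC_spec h' (Nat.card F) (fun y => X.el y * X.el y + X.el y + X.el i) (by omega)
        (fun ρ hρ => by
          simp [hρ 2, hτ 2 (by decide) (by decide) (by decide) (by decide), h2]) hqL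
        (fun ρ y hy hρ h39 => by simp [h39, hρ 38, h38])]
      refine ⟨fun hy y => ?_, fun hy y _ => by rw [← pow_two]; exact hy _⟩
      have := hy (X.code y) (hq ▸ X.code_lt y)
      rwa [X.el_code, ← pow_two] at this)
  refine ⟨_, ?_, fun i hi => (l1 i hi).1, fun i hi j hj hij => l2 i hi j hj ?_⟩
  · have h5 := card_le_two_mul_card_rootless F
    rw [← Nat.card_eq_fintype_card] at h5
    refine h5.trans (Nat.add_le_add_right (Nat.mul_le_mul_left 2
      (Finset.card_le_card_of_injOn X.code (fun c hc => ?_) ?_)) 1)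
    · simp only [Finset.coe_filter, Finset.mem_univ, true_and, Set.mem_ofPred_eq,
        Finset.mem_range, X.el_code] at hc ⊢
      exact ⟨hq ▸ X.code_lt c, hc⟩
    · exact (Function.LeftInverse.injective X.el_code).injOn
  · have h6 := congrArg X.code hij
    rwa [X.code_el, X.code_el, hq, Nat.mod_eq_of_lt (l1 i hi).2, Nat.mod_eq_of_lt (l1 j hj).2] at h6

end

/-! ### Output of a basis -/

section

variable {p a m : ℕ} {F K : Type*} [Field F] [Field K] [hp : Fact p.Prime]
  [Algebra (ZMod p) F] [Algebra F K] (bF : Basis (Fin a) (ZMod p) F) (bK : Basis (Fin m) F K)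
  {X : Ctx F} {k ℓ N h : ℕ} {σ ρ : Store}

theorem kc_designBasis (g : Fin k → Fin ℓ → Fin m → F) {l : ℕ} (hl : l < k * ℓ) (j : Fin k)
    (c : Fin m) : kc bK (designBasis bK g ⟨l, hl⟩ j) c =
      if l / ℓ = j then g j ⟨l % ℓ, Nat.mod_lt _ (Nat.pos_of_ne_zero (by
        rintro rfl; simp at hl))⟩ c else 0 := by
  rw [designBasis]
  split_ifs with h
  · have e : Fin.divNat ⟨l, hl⟩ = j := Fin.ext h
    subst e
    rw [Pi.single_eq_same, kc, ext_val, ← bK.equivFun_apply, LinearEquiv.apply_symm_apply]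
    rfl
  · rw [Pi.single_eq_of_ne (fun e => h (congrArg Fin.val e).symm), kc_zero]

/-- Writes a header and the basis of the space of coefficient vectors given by the rows `f`. -/
def matOutC (hdr : Expr) (f : FE) : Cmd :=
  .seq (.loop 38 (V 25 * (V 24 * V 21)) (.setF 44 (V 38)
    (.ite ((V 38 / (V 24 * V 21) / V 27 - V 38 % (V 24 * V 21) / V 21) +
      (V 38 % (V 24 * V 21) / V 21 - V 38 / (V 24 * V 21) / V 27)) (.nat 0) f)))
    (.seq (.set 1 1 hdr) (outC 1 (V 25 * (V 24 * V 21))))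

theorem matOutC_spec (hσ : Env bF X σ) {hdr : Expr} {f : FE} (hρ : (matOutC hdr f).den X σ = ρ)
    (h21 : σ 21 0 = m) (h24 : σ 24 0 = k) (h25 : σ 25 0 = N) (h27 : σ 27 0 = ℓ)
    (hh : ∀ τ : Store, (∀ (b : ℕ) (_ : b ≠ 44 := by decide) (_ : b ≠ 38 := by decide),
      τ b = σ b) → hdr.eval τ = h) (hhM : h < X.M) (g : Fin k → Fin ℓ → Fin m → F)
    (hN : N ≤ k * ℓ) (hL' : N * (k * m) * a < X.L) (hM' : 1 + N * (k * m) * a < X.M)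
    (hf : ∀ (τ : Store) (j : Fin k) (i : Fin ℓ) (c : Fin m),
      (∀ (b : ℕ) (_ : b ≠ 44 := by decide) (_ : b ≠ 38 := by decide), τ b = σ b) →
      τ 38 0 / (k * m) / ℓ = j → τ 38 0 / (k * m) % ℓ = i → τ 38 0 % m = c → f.eval X τ = g j i c) :
    ∀ i ≤ (h :: encKMat bF bK fun l : Fin N => designBasis bK g (Fin.castLE hN l)).length,
      ρ 1 i = listArray (h :: encKMat bF bK fun l : Fin N => designBasis bK g (Fin.castLE hN l)) i := by
  simp only [matOutC, Cmd.den_seq_iff] at hρ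
  obtain ⟨σ₁, h₁, σ₂, h₂, h₃⟩ := hρ
  have hNL : N * (k * m) < X.L := (Nat.le_mul_of_pos_right _ (a_pos bF)).trans_lt hL'
  have t1 := tab2_spec h₁ N (k * m)
    (fun l z => kc bK (ext (ext (fun l : Fin N => designBasis bK g (Fin.castLE hN l)) l) (z / m))
      (z % m)) (by simp [h21, h24, h25]) hNL (by
    intro τ l z hl hz hτ h38
    have hm : 0 < m := Nat.pos_of_ne_zero (by rintro rfl; simp at hz)
    have hj : z / m < k := Nat.div_lt_of_lt_mul (by rwa [mul_comm])
    have hc := Nat.mod_lt z hm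
    have e1 : τ 38 0 / (k * m) = l := by rw [h38, mul_add_div_self hz]
    have e2 : τ 38 0 % (k * m) = z := by rw [h38, mul_add_mod_self hz]
    have e3 : τ 38 0 % m = z % m := by rw [← e2, Nat.mod_mod_of_dvd _ (Dvd.intro_left _ rfl)]
    have hℓ : 0 < ℓ := Nat.pos_of_ne_zero (by rintro rfl; simp at hN; omega)
    rw [ext_of_lt _ hl, ext_of_lt _ hj, Fin.castLE_mk,
      kc_designBasis bK g (lt_of_lt_of_le hl hN) ⟨z / m, hj⟩ ⟨z % m, hc⟩,
      FE.eval_ite X ((l / ℓ - z / m) + (z / m - l / ℓ)) (by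
        simp [hτ 24, hτ 21, hτ 27, h24, h21, h27, e1, e2])]
    by_cases hlj : l / ℓ = z / m
    · rw [if_pos hlj, if_pos (by omega)]
      exact hf τ ⟨z / m, hj⟩ ⟨l % ℓ, Nat.mod_lt _ hℓ⟩ ⟨z % m, hc⟩ @hτ (by rw [e1, hlj]) (by rw [e1]) e3
    · rw [if_neg hlj, if_neg (by omega), FE.eval_nat, eval_ofNat, X.el_zero])
  have e1 : σ₂ 44 = σ₁ 44 := fr h₂ 44
  have e2 : ∀ b ∈ [21, 24, 25], σ₂ b = σ b := fun b hb => by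
    rw [frs h₂ [21, 24, 25] rfl b hb, frs h₁ [21, 24, 25] rfl b hb]
  obtain ⟨o1, o2, o3⟩ := outC_spec bF ((hσ.step bF h₁).step bF h₂) h₃ 1 (N * (k * m))
    (fun j => kc bK (ext (ext (fun l : Fin N => designBasis bK g (Fin.castLE hN l))
      (j / (k * m))) (j % (k * m) / m)) (j % (k * m) % m))
    (by intro τ hτ; simp [hτ 25, hτ 24, hτ 21, e2, h25, h24, h21]) (by intro τ _; rfl) hL' hM'
    (by
      intro z hz
      have hkm : 0 < k * m := Nat.pos_of_ne_zero (by rintro h0; rw [h0] at hz; simp at hz)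
      rw [e1, ← t1 (z / (k * m)) (Nat.div_lt_of_lt_mul (by rwa [mul_comm])) _ (Nat.mod_lt z hkm),
        Nat.div_add_mod'])
  refine listArray_of_enc bF (hd := [h]) (enc_encKMat bF bK fun l : Fin N => designBasis bK g
    (Fin.castLE hN l)) (by simpa using o1) (fun i hi0 hi => ?_) fun i hi c hc => by simpa using o2 i hi c hc
  obtain rfl : i = 1 := by simp at hi; omega
  rw [o3 1 (by omega) (by omega)]
  exact set_val h₂ (hh _ fun b h1 h2 => fr h₁ b (by simp [Cmd.mods, h1, h2])) hhM

end

/-! ### Tables of the explicit design -/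

section

open Polynomial in
/-- The coefficients of the partial products of the polynomial of the `j`-th space. -/
noncomputable def designPart {F : Type*} [Field F] (γ : F) (c : ℕ → F) (u j i e : ℕ) : F :=
  (∏ i ∈ Finset.range i, quad (γ ^ (j % 2 * u + i)) (c (j / 2))).coeff e

variable {F : Type*} [Field F] {X : Ctx F} {m k u ℓ N : ℕ} {σ ρ : Store}

theorem designPart_zero (γ : F) (c : ℕ → F) (u j e : ℕ) :
    designPart γ c u j 0 e = if e = 0 then 1 else 0 := by
  rw [designPart, Finset.range_zero, Finset.prod_empty, Polynomial.coeff_one]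

/-- Multiplication by X² + bX + b²c on coefficients, in the shape in which the program looks up
earlier entries. By truncation the test `e - 1 = 0` covers e = 0 and e = 1, where X² does not
contribute. -/
theorem designPart_succ (γ : F) (c : ℕ → F) (u j i e : ℕ) :
    designPart γ c u j (i + 1) e =
      (γ ^ (j % 2 * u + i) * γ ^ (j % 2 * u + i)) * (c (j / 2) * designPart γ c u j i e) +
      (if e = 0 then 0 else γ ^ (j % 2 * u + i) * designPart γ c u j i (e - 1)) +
      (if e - 1 = 0 then 0 else designPart γ c u j i (e - 2)) := by
  simp only [designPart, Finset.prod_range_succ]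
  rw [mul_comm, quad, add_mul, add_mul, Polynomial.coeff_add, Polynomial.coeff_add,
    Polynomial.coeff_C_mul, mul_assoc (Polynomial.C _) Polynomial.X, Polynomial.coeff_C_mul,
    Polynomial.coeff_X_pow_mul']
  rcases e with - | e
  · simp
    ring
  · rcases e with - | e
    · simp [Polynomial.coeff_X_mul]
      ring
    · simp [Polynomial.coeff_X_mul]
      ring

/-- The place with number `i - 1` of the `j`-th space. -/
def placeE : Expr :=
  rd 32 (V 38 / (2 * V 26 + 1) / (V 26 + 1) % 2 * V 26 + (V 38 / (2 * V 26 + 1) % (V 26 + 1) - 1))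

/-- The coefficients of the polynomials of the design. -/
def polyC : Cmd :=
  .loop 38 (V 24 * (V 26 + 1) * (2 * V 26 + 1)) (.setF 35 (V 38)
    (.ite (V 38 / (2 * V 26 + 1) % (V 26 + 1))
      (.add (.add (.mul (.mul (.nat placeE) (.nat placeE))
        (.mul (.nat (rd 31 (V 38 / (2 * V 26 + 1) / (V 26 + 1) / 2)))
          (.nat (rd 35 (V 38 - (2 * V 26 + 1))))))
        (.ite (V 38 % (2 * V 26 + 1))
          (.mul (.nat placeE) (.nat (rd 35 (V 38 - (2 * V 26 + 1) - 1)))) (.nat 0)))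
        (.ite (V 38 % (2 * V 26 + 1) - 1) (.nat (rd 35 (V 38 - (2 * V 26 + 1) - 2))) (.nat 0)))
      (.ite (V 38 % (2 * V 26 + 1)) (.nat 0) (.nat (V 40)))))

theorem polyC_spec (hρ : polyC.den X σ = ρ) (h : BuildIn X m k u ℓ N σ)
    (hL : k * (u + 1) * (2 * u + 1) < X.L) {γ : F} {c : ℕ → F}
    (hγ : ∀ i < 2 * u + 1, σ 32 i = X.code (γ ^ i)) (hc : ∀ j, X.el (σ 31 j) = c j) :
    ∀ j < k, ∀ i ≤ u, ∀ e < 2 * u + 1,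
      ρ 35 ((j * (u + 1) + i) * (2 * u + 1) + e) = X.code (designPart γ c u j i e) := by
  have t1 := tab2_rec hρ (k * (u + 1)) (2 * u + 1)
    (fun y e => designPart γ c u (y / (u + 1)) (y % (u + 1)) e) (by simp [h.par]) hL (by
      intro τ y e _ hlt hτ h38 hrec
      have hy : τ 38 0 / (2 * u + 1) = y := by rw [h38, mul_add_div_self hlt]
      have he : τ 38 0 % (2 * u + 1) = e := by rw [h38, mul_add_mod_self hlt]
      obtain ⟨i, hi⟩ : ∃ i, y % (u + 1) = i := ⟨_, rfl⟩
      obtain ⟨j, hj⟩ : ∃ j, y / (u + 1) = j := ⟨_, rfl⟩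
      have hiu : i < u + 1 := by rw [← hi]; exact Nat.mod_lt _ (by omega)
      have hyi : j * (u + 1) + i = y := by rw [← hi, ← hj, Nat.div_add_mod']
      have v26 : τ 26 0 = u := by simp [hτ 26, h.par]
      have hpl : ∀ i', i = i' + 1 → X.el (placeE.eval τ) = γ ^ (j % 2 * u + i') := fun i' hi' => by
        simp only [placeE, eval_read, eval_add, eval_mul, eval_div, eval_mod, eval_sub, eval_const,
          eval_ofNat, v26, hy, hi, hj]
        have : j % 2 * u ≤ 1 * u := Nat.mul_le_mul_right _ (by omega)
        rw [hτ 32, hγ _ (by omega), X.el_code, hi', Nat.add_sub_cancel]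
      rw [hi, hj, FE.eval_ite X i (by simp [v26, hy, hi])]
      rcases i with - | i
      · rw [if_pos rfl, designPart_zero, FE.eval_ite X e (by simp [v26, he])]
        split_ifs
        · simp [hτ 40, h.one, X.el_code]
        · simp [X.el_zero]
      -- The preceding row of the flattened table holds the product with one factor less, for the
      -- same space.
      · have h1 : (y - 1) * (2 * u + 1) + (2 * u + 1) = y * (2 * u + 1) := by
          rw [← Nat.succ_mul, Nat.succ_eq_add_one, Nat.sub_add_cancel (by omega)]
        have hprev : ∀ e' < 2 * u + 1, X.el (τ 35 ((y - 1) * (2 * u + 1) + e')) =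
            designPart γ c u j i e' := fun e' he' => by
          have h2 : y - 1 = j * (u + 1) + i := by omega
          rw [hrec _ _ (by omega) he', X.el_code, h2, mul_add_div_self (by omega),
            mul_add_mod_self (by omega)]
        have g0 : ∀ d, y * (2 * u + 1) + e - (2 * u + 1) - d = (y - 1) * (2 * u + 1) + e - d := by
          omega
        rw [if_neg (by omega), designPart_succ, FE.eval_add', FE.eval_add', FE.eval_mul',
          FE.eval_mul', FE.eval_mul', FE.eval_nat, FE.eval_nat, FE.eval_nat, hpl i rfl,
          FE.eval_ite X e (by simp [v26, he]), FE.eval_ite X (e - 1) (by simp [v26, he]),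
          FE.eval_mul', FE.eval_nat, FE.eval_nat, FE.eval_nat, FE.eval_nat, hpl i rfl]
        simp only [eval_read, eval_sub, eval_add, eval_div, eval_mul, eval_const, eval_ofNat,
          v26, hy, hj, X.el_zero]
        rw [h38, hτ 31, hc, g0 1, g0 2, show y * (2 * u + 1) + e - (2 * u + 1) =
          (y - 1) * (2 * u + 1) + e from g0 0, hprev e hlt]
        congr 1
        · congr 1
          split_ifs with h0
          · rfl
          · rw [Nat.add_sub_assoc (by omega), hprev _ (by omega)]
        · split_ifs with h0
          · rfl
          · rw [Nat.add_sub_assoc (by omega), hprev _ (by omega)])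
  intro j hj i hi e he
  rw [t1 _ (mul_add_lt hj (by omega)) e he, mul_add_div_self (by omega), mul_add_mod_self (by omega)]

end

/-! ### The command for the explicit design -/

section

variable {p a m : ℕ} {F K : Type*} [Field F] [Finite F] [Field K] [hp : Fact p.Prime]
  [Algebra (ZMod p) F] [Algebra F K] (bF : Basis (Fin a) (ZMod p) F) (bK : Basis (Fin m) F K)
  {X : Ctx F} {k u N h : ℕ} {σ ρ : Store}

/-- The entries of the rows of the design. -/
def rowFE : FE :=
  .ite ((V 38 / (V 24 * V 21) % V 27 - V 38 % V 21) +
    (V 38 % V 21 - V 38 / (V 24 * V 21) % V 27 - 2 * V 26)) (.nat 0)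
    (.nat (rd 35 ((V 38 / (V 24 * V 21) / V 27 * (V 26 + 1) + V 26) * (2 * V 26 + 1) +
      (V 38 % V 21 - V 38 / (V 24 * V 21) % V 27))))

/-- Sets the parameters of a construction; `eu`, `ek` and `eN` are the values of `u`, of the number
of spaces and of the number of basis vectors. -/
def buildInC (ew ek eN : Expr) : Cmd :=
  .seq (.set 21 0 (inp 3)) (.seq (.set 26 0 ew) (.seq (.set 27 0 (V 21 - 2 * V 26))
    (.seq (.set 24 0 ek) (.set 25 0 eN))))

/-- The construction of an explicit design. -/
def designC (ew ek eN hdr : Expr) : Cmd :=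
  .seq (buildInC ew ek eN) (.seq oneC (.seq genC (.seq rootlessC (.seq (powTabC 32 30 (2 * V 26 + 1))
    (.seq polyC
    (matOutC hdr rowFE))))))

/-- The dimension `r` of the tested subspace enters the analysis only, not the program; so one
construction satisfies the bounds for all r ≤ u. Only the first `N` vectors of the product basis are
written, which allows a prescribed dimension. -/
theorem designC_spec (hσ : Env bF X σ) {ew ek eN hdr : Expr}
    (hρ : (designC ew ek eN hdr).den X σ = ρ)
    (hm3 : σ 0 3 = m) (hw : ∀ τ : Store, τ 0 = σ 0 → ew.eval τ = u)
    (hek : ∀ τ : Store, τ 0 = σ 0 → τ 27 0 = m - 2 * u → ek.eval τ = k)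
    (heN : ∀ τ : Store, τ 0 = σ 0 → τ 27 0 = m - 2 * u → τ 24 0 = k → eN.eval τ = N)
    (hhdr : ∀ τ : Store, τ 24 0 = k → τ 25 0 = N → hdr.eval τ = h)
    (hq : Nat.card F = p ^ a) (hm0 : 0 < m) (hmq : m < Nat.card F) (hkq : k < Nat.card F)
    (hu : 2 * u ≤ m) (hN : N ≤ k * (m - 2 * u)) (hLM : 2 * X.L ≤ X.M) (hqL : Nat.card F < X.L)
    (hq2 : 4 * Nat.card F ≤ 2 ^ (X.L - 1)) (hhL : h < X.L)
    (hNL : N < X.L) (hL1 : k * (u + 1) * (2 * u + 1) < X.L) (hL2 : 2 * u + 1 < X.L)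
    (hL3 : N * (k * m) * a < X.L) :
    ∃ g : Fin k → Fin (m - 2 * u) → Fin m → F, (∀ j, LinearIndependent F (g j)) ∧
      (∀ r, 0 < r → r ≤ u → ∀ W : Submodule F (Fin m → F), finrank F W = r →
        2 * (u - r + 1) * designSum g W ≤ r * (m - 1)) ∧
      ∀ i ≤ (h :: encKMat bF bK fun l : Fin N => designBasis bK g (Fin.castLE hN l)).length,
      ρ 1 i = listArray (h :: encKMat bF bK fun l : Fin N => designBasis bK g (Fin.castLE hN l)) i := by
  have hXq : X.q = Nat.card F := hσ.hXq.trans hq.symm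
  have hq1 : 1 < Nat.card F := Finite.one_lt_card
  simp only [designC, buildInC, Cmd.den_seq_iff] at hρ
  obtain ⟨σ₁, ⟨τ₁, u₁, τ₂, u₂, τ₃, u₃, τ₄, u₄, u₅⟩, σ₂, h₂, σ₃, h₃, σ₄, h₄, σ₅, h₅, σ₆, h₆, h₇⟩ := hρ
  have v21 : τ₂ 21 0 = m := by
    rw [fr u₂ 21]; exact set_val u₁ hm3 (by omega)
  have v26 : τ₂ 26 0 = u := set_val u₂ (hw _ (fr u₁ 0)) (by omega)
  have v27 : τ₃ 27 0 = m - 2 * u := set_val u₃ (by simp [v21, v26]) (by omega)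
  have f3 : τ₃ 0 = σ 0 := by rw [fr u₃ 0, fr u₂ 0, fr u₁ 0]
  have v24 : τ₄ 24 0 = k := set_val u₄ (hek _ f3 v27) (by omega)
  have v25 : σ₁ 25 0 = N :=
    set_val u₅ (heN _ ((fr u₄ 0).trans f3) (by rw [fr u₄ 27, v27]) v24) (by omega)
  have env1 := ((((hσ.step bF u₁).step bF u₂).step bF u₃).step bF u₄).step bF u₅
  have b2 : BuildIn X m k u (m - 2 * u) N σ₂ :=
    ⟨by simp [fr h₂ 21, fr h₂ 24, fr h₂ 25, fr h₂ 26, fr h₂ 27, fr u₅ 21, fr u₄ 21, fr u₃ 21, v21,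
      fr u₅ 24, v24, v25, fr u₅ 26, fr u₄ 26, fr u₃ 26, v26, fr u₅ 27, fr u₄ 27, v27],
      oneC_spec h₂ env1.hL (env1.hq.trans hXq) hXq hq2, by rw [fr h₂ 2, env1.hq, hXq]⟩
  have g1 := genC_spec h₃ b2 hXq hm0 hmq hqL
  obtain ⟨γ, hγ⟩ : ∃ γ, X.el (σ₃ 30 0) = γ := ⟨_, rfl⟩
  rw [hγ] at g1
  have b3 := b2.step h₃
  obtain ⟨n, r1, r2, r3⟩ := rootlessC_spec h₄ b3.h2 hXq hqL (by omega)
  have b4 := b3.step h₄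
  have p1 := powTabC_spec h₅ b4.one (by rw [fr h₄ 30, hγ]) (2 * u + 1) (by simp [b4.par]) hL2
  have b5 := b4.step h₅
  have q1 := polyC_spec h₆ b5 hL1 p1 (c := fun i => X.el (σ₄ 31 i)) (fun j => by rw [fr h₅ 31])
  have b6 := b5.step h₆
  have env6 := ((((env1.step bF h₂).step bF h₃).step bF h₄).step bF h₅).step bF h₆
  obtain ⟨w21, w24, w25, w26, w27⟩ := b6.par
  refine ⟨fun j i => designRow γ (fun i => X.el (σ₄ 31 i)) u m j i,
    fun j => linearIndependent_designRow _ _ _ _ _, fun r hr hru W hW => ?_, ?_⟩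
  · exact sum_finrank_le_of_designPoly_dvd hm0 g1.1 g1.2 (N := n) (fun i hi => r2 i hi)
      (fun i hi j hj => r3 i hi j hj) (by omega) hr hru hu _
      (fun j w hw => designPoly_dvd_of_mem_span hw) W hW
  · refine matOutC_spec bF bK env6 h₇ w21 w24 w25 w27
      (fun τ hτ => hhdr τ (by rw [hτ 24, w24]) (by rw [hτ 25, w25])) (by omega) _ hN hL3 (by omega) ?_
    intro τ j i c hτ hj hi hc
    have e : τ 21 0 = m ∧ τ 24 0 = k ∧ τ 26 0 = u ∧ τ 27 0 = m - 2 * u := by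
      rw [hτ 21, hτ 24, hτ 26, hτ 27]; exact ⟨w21, w24, w26, w27⟩
    rw [rowFE, FE.eval_ite X (((i : ℕ) - c) + (c - i - 2 * u)) (by simp [e, hi, hc]), designRow_apply,
      FE.eval_nat, FE.eval_nat]
    simp only [eval_add, eval_sub, eval_mod, eval_div, eval_mul, eval_read, eval_const,
      eval_ofNat, e, hi, hc, hj]
    by_cases hic : (i : ℕ) ≤ c
    · rw [if_pos hic]
      split_ifs with h0
      · rw [hτ 35, q1 j j.2 u le_rfl _ (by omega), X.el_code]
        rfl
      · rw [X.el_zero, Polynomial.coeff_eq_zero_of_natDegree_lt]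
        rw [natDegree_designPoly]
        omega
    · rw [if_neg hic, if_neg (by omega), X.el_zero]

end

/-! ### Programs for the explicit design -/

theorem le_card_of_basis {p a : ℕ} {F : Type*} [Field F] [hp : Fact p.Prime] [Algebra (ZMod p) F]
    (bF : Basis (Fin a) (ZMod p) F) : p ≤ p ^ a ∧ a ≤ p ^ a :=
  ⟨Nat.le_self_pow (a_pos bF).ne' p, (Nat.lt_pow_self hp.out.one_lt).le⟩

/-- The summand 10 in the base lets powers of it absorb numerical constants even for the smallest
fields. -/
theorem design_bounds {Q m k u N a : ℕ} (hm : m < Q) (hk : k < Q) (hu : 2 * u ≤ m)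
    (hN : N ≤ k * m) (ha : a ≤ Q) :
    N ≤ Q * Q ∧ N < (Q + 10) ^ 12 ∧ k * (u + 1) * (2 * u + 1) < (Q + 10) ^ 12 ∧
    2 * u + 1 < (Q + 10) ^ 12 ∧ N * (k * m) * a < (Q + 10) ^ 12 ∧ a * a < (Q + 10) ^ 12 ∧
    a * a * a + 100 < (Q + 10) ^ 12 ∧ 4 * Q ≤ 2 ^ ((Q + 10) ^ 12 - 1) ∧ Q < (Q + 10) ^ 12 := by
  have hN2 : N ≤ Q * Q := hN.trans (Nat.mul_le_mul hk.le hm.le)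
  obtain ⟨B, hB⟩ : ∃ B, Q + 10 = B := ⟨_, rfl⟩
  rw [hB]
  have hlt : ∀ j < 12, B ^ j < B ^ 12 := fun j hj => Nat.pow_lt_pow_right (by omega) hj
  have h1 := hlt 1 (by omega)
  have e3 : k * (u + 1) * (2 * u + 1) ≤ B * B * B := by gcongr <;> omega
  have hNB : N ≤ B * B := hN2.trans (Nat.mul_le_mul (by omega) (by omega))
  have e5 : N * (k * m) * a ≤ B * B * (B * B) * B := by gcongr <;> omega
  have e2 : a * a ≤ B * B := by gcongr <;> omega
  have e4 : a * a * a + 10 * 10 * 10 ≤ B * B * B + B * B * B := by gcongr <;> omega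
  have e6 : 2 * (B * B * B) ≤ B * (B * B * B) := Nat.mul_le_mul_right _ (by omega)
  have e7 : 4 * B ≤ B * B := Nat.mul_le_mul_right _ (by omega)
  have h2 : B * B < B ^ 12 := (by ring : B * B = B ^ 2).trans_lt (hlt 2 (by omega))
  have h3 : B * B * B < B ^ 12 := (by ring : B * B * B = B ^ 3).trans_lt (hlt 3 (by omega))
  have h4 : B * (B * B * B) < B ^ 12 := (by ring : B * (B * B * B) = B ^ 4).trans_lt (hlt 4 (by omega))
  have h5 : B * B * (B * B) * B < B ^ 12 :=
    (by ring : B * B * (B * B) * B = B ^ 5).trans_lt (hlt 5 (by omega))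
  exact ⟨hN2, by omega, by omega, by omega, by omega, by omega, by omega,
    (show 4 * Q ≤ B ^ 12 - 1 by omega).trans Nat.lt_two_pow_self.le, by omega⟩

/-- The construction of an explicit design of subspaces of codimension at most a given number. -/
def explicitProg : Prog :=
  (designC (inp 6 / 2) (inp 4) (V 24 * V 27) (V 25)).toProg 6 (powE (rd 2 2 + 10) 12)

theorem explicitProg_exec : ∃ C, ∀ {p a m k s t : ℕ} {F K : Type*} [Field F] [Field K]
    [Fact p.Prime] [Algebra (ZMod p) F] [Algebra F K] (bF : Basis (Fin a) (ZMod p) F)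
    (bK : Basis (Fin m) F K) (σ : Store), σ 0 = listArray ([p, a, m, k, s, t] ++ tableF bF) →
    Bd (2 * (Nat.card F + 10) ^ 12) σ → 0 < m → m < Nat.card F → k < Nat.card F → t ≤ m →
    ∃ g : Fin k → Fin (m - 2 * (t / 2)) → Fin m → F, (∀ j, LinearIndependent F (g j)) ∧
      (∀ r, 0 < r → r ≤ t / 2 → ∀ W : Submodule F (Fin m → F), finrank F W = r →
        2 * (t / 2 - r + 1) * designSum g W ≤ r * (m - 1)) ∧
      ∃ τ, (∃ T ≤ (Nat.card F + 10) ^ C, Exec explicitProg σ τ T) ∧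
        ∀ i ≤ ((k * (m - 2 * (t / 2))) :: encKMat bF bK (designBasis bK g)).length,
          τ 1 i = listArray ((k * (m - 2 * (t / 2))) :: encKMat bF bK (designBasis bK g)) i := by
  obtain ⟨C, hC⟩ := Cmd.toProg_exec (designC (inp 6 / 2) (inp 4) (V 24 * V 27) (V 25)) (by decide) 6
    (powE (rd 2 2 + 10) 12)
  refine ⟨12 * C, fun {p a m k s t F K} _ _ hp _ _ bF bK σ h0 hB hm0 hm hk ht => ?_⟩
  have := finite_of_basis bF
  have hcard := card_of_basis bF
  have ha := a_pos bF
  obtain ⟨d0, d1, d2, d3, d4, d5, d6, d7, d8⟩ := design_bounds (u := t / 2) (a := a)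
    (N := k * (m - 2 * (t / 2))) hm hk (by omega) (Nat.mul_le_mul_left _ (by omega))
    (by rw [hcard]; exact (le_card_of_basis bF).2)
  have hLM : (Nat.card F + 10) ^ 12 ≤ p ^ a * (Nat.card F + 10) ^ 12 :=
    Nat.le_mul_of_pos_left _ (by rw [← hcard]; omega)
  obtain ⟨X, hM, hL, τ, hE, hτ0, ρ, hρ, hρ1⟩ := hC bF (L := (Nat.card F + 10) ^ 12) (by omega)
    [p, a, m, k, s, t] [] σ (by rw [List.append_nil, h0]) hB rfl (by omega) rfl rfl (by omega)
    (by omega) (by rw [← hcard]; exact d7) (fun τ P => by simp [P.h22, hcard])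
  have hin : ∀ j < 6, τ 0 (j + 1) = ([p, a, m, k, s, t] : List ℕ).getD j 0 := fun j hj => by
    rw [hτ0, List.append_assoc, listArray_append_left _ _ (by simpa using hj)]
  rw [← hL] at d1 d2 d3 d4 d7 d8 hLM hM
  obtain ⟨g, g1, g2, g3⟩ := designC_spec bF bK hE rfl (hin 2 (by omega)) (u := t / 2) (k := k)
    (ew := inp 6 / 2) (ek := inp 4) (eN := V 24 * V 27) (hdr := V 25)
    (fun ρ h => by simpa [h] using congrArg (· / 2) (hin 5 (by omega)))
    (fun ρ h _ => by simpa [h] using hin 3 (by omega))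
    (fun ρ h h1 h2 => by simp [h1, h2]) (fun ρ h1 h2 => by simp [h2]) hcard hm0 hm hk (by omega)
    le_rfl (by omega) d8 d7 d1 d1 d2 d3 d4
  refine ⟨g, g1, g2, ρ, by rwa [pow_mul], fun i hi => ?_⟩
  rw [hρ1]
  exact g3 i hi

/-- The construction of the code of rate `R`. -/
def codeProg : Prog :=
  (designC (24 * inp 6) ((inp 5 + V 27 - 1) / V 27) (inp 5) (V 24)).toProg 6 (powE (rd 2 2 + 10) 12)

/-- The number of spaces is not part of the input: it is the least k with k(m - 48e) ≥ N, found by a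
division with rounding up. -/
theorem codeProg_runs : ∃ C, ∀ {p a m n k N e : ℕ} {F K : Type*} [Field F] [Field K]
    [Fact p.Prime] [Algebra (ZMod p) F] [Algebra F K] (bF : Basis (Fin a) (ZMod p) F)
    (bK : Basis (Fin m) F K) (α : Fin n → F), 48 * e < m → m < Nat.card F → n < Nat.card F →
    k < Nat.card F → (N + (m - 48 * e) - 1) / (m - 48 * e) = k →
    ∃ (g : Fin k → Fin (m - 2 * (24 * e)) → Fin m → F) (hN : N ≤ k * (m - 2 * (24 * e))),
      (∀ j, LinearIndependent F (g j)) ∧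
      (∀ r, 0 < r → r ≤ 24 * e → ∀ W : Submodule F (Fin m → F), finrank F W = r →
        2 * (24 * e - r + 1) * designSum g W ≤ r * (m - 1)) ∧
      RunsIn codeProg ([p, a, m, n, N, e] ++ tableF bF ++ tableK bF bK ++ encFVec bF α)
        (k :: encKMat bF bK fun l : Fin N => designBasis bK g (Fin.castLE hN l))
        ((Nat.card F + 10) ^ C) := by
  obtain ⟨C, hC⟩ := Cmd.toProg_runs (designC (24 * inp 6) ((inp 5 + V 27 - 1) / V 27) (inp 5) (V 24))
    (by decide) 6 (powE (rd 2 2 + 10) 12)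
  refine ⟨12 * C, fun {p a m n k N e F K} _ _ hp _ _ bF bK α he hm hn hk hkN => ?_⟩
  have := finite_of_basis bF
  have hcard := card_of_basis bF
  have ha := a_pos bF
  have hℓ : m - 2 * (24 * e) = m - 48 * e := by omega
  have hN : N ≤ k * (m - 2 * (24 * e)) := by
    rw [hℓ]
    have h1 := Nat.lt_mul_div_succ (N + (m - 48 * e) - 1) (show 0 < m - 48 * e by omega)
    rw [hkN, Nat.mul_succ, Nat.mul_comm (m - 48 * e) k] at h1
    omega
  obtain ⟨d0, d1, d2, d3, d4, d5, d6, d7, d8⟩ := design_bounds (u := 24 * e) (a := a)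
    (N := N) hm hk (by omega) (hN.trans (Nat.mul_le_mul_left _ (by omega)))
    (by rw [hcard]; exact (le_card_of_basis bF).2)
  obtain ⟨L, hLdef⟩ : ∃ L, (Nat.card F + 10) ^ 12 = L := ⟨_, rfl⟩
  have hqL : Nat.card F * L = p ^ a * L := by rw [hcard]
  have hLM : L ≤ Nat.card F * L := Nat.le_mul_of_pos_left _ (by omega)
  have hlen : ([p, a, m, n, N, e] ++ tableF bF ++ (tableK bF bK ++ encFVec bF α)).length ≤ L := by
    simp only [List.length_append, (enc_tableF bF).1, (enc_tableK bF bK).1, (enc_encFVec bF α).1,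
      List.length_cons, List.length_nil, ← hLdef]
    have haq : a ≤ Nat.card F := by rw [hcard]; exact (le_card_of_basis bF).2
    obtain ⟨B, hB⟩ : ∃ B, Nat.card F + 10 = B := ⟨_, rfl⟩
    have e1 : a * (a * 1) * a ≤ B * (B * B) * B := by gcongr <;> omega
    have e2 : m * (m * m) * a ≤ B * (B * B) * B := by gcongr <;> omega
    have e3 : n * (1 * 1) * a ≤ B * (B * B) * B := by gcongr <;> omega
    have e4 : 6 * (1 * 1) * 1 ≤ B * (B * B) * B := by gcongr <;> omega
    have e5 : 4 * (B * (B * B) * B) ≤ B ^ 5 :=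
      (Nat.mul_le_mul_right _ (by omega)).trans_eq (by ring : B * (B * (B * B) * B) = B ^ 5)
    have h6 : B ^ 5 ≤ B ^ 12 := Nat.pow_le_pow_right (by omega) (by omega)
    simp only [hB, mul_one] at e1 e3 e4 ⊢
    omega
  rw [hLdef] at d1 d2 d3 d4 d5 d6 d7 d8
  have hQQ : Nat.card F * Nat.card F ≤ Nat.card F * L := Nat.mul_le_mul_left _ (by omega)
  obtain ⟨X, hXM, hXL, τ, hE, hτ0, hout⟩ := hC bF (L := L) (by omega)
    [p, a, m, n, N, e] (tableK bF bK ++ encFVec bF α) rfl (by omega) rfl rfl (by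
      have := le_card_of_basis bF
      rw [← hcard] at this
      rw [← hqL]
      intro x hx
      simp only [List.mem_cons, List.not_mem_nil, or_false] at hx
      rcases hx with rfl | rfl | rfl | rfl | rfl | rfl <;> omega)
    (fun x hx => by
      rcases List.mem_append.1 hx with hx | hx
      · exact (enc_tableK bF bK).lt bF x hx
      · exact (enc_encFVec bF α).lt bF x hx) hlen (by omega)
    (by omega) (by rw [← hcard]; exact d7) (fun τ P => by simp [P.h22, ← hcard, hLdef])
  have hin : ∀ j < 6, τ 0 (j + 1) = ([p, a, m, n, N, e] : List ℕ).getD j 0 := fun j hj => by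
    rw [hτ0, List.append_assoc, listArray_append_left _ _ (by simpa using hj)]
  subst hXL
  obtain ⟨g, g1, g2, g3⟩ := designC_spec bF bK hE rfl (hin 2 (by omega)) (u := 24 * e) (k := k) (h := k)
    (ew := 24 * inp 6) (ek := (inp 5 + V 27 - 1) / V 27) (eN := inp 5) (hdr := V 24)
    (fun ρ h => by simpa [h] using hin 5 (by omega))
    (fun ρ h h1 => by
      simp only [eval_div, eval_add, eval_sub, eval_read, eval_const, eval_ofNat, h, h1]
      rw [hin 4 (by omega), hℓ]
      exact hkN)
    (fun ρ h h1 h2 => by simpa [h] using hin 4 (by omega)) (fun ρ h1 h2 => by simp [h1]) hcard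
    (by omega) hm hk (by omega) hN (by omega) d8 d7 (by omega) d1 d2 d3 d4
  refine ⟨g, hN, g1, g2, ?_⟩
  rw [pow_mul, hLdef, List.append_assoc _ (tableK bF bK)]
  exact hout _ g3

/-! ### The encoder -/

section

variable {F : Type*} [Field F] {X : Ctx F} {m n k κ : ℕ} {σ ρ : Store}

/-- The input of the encoder, read to array `10`. -/
structure EncIn (X : Ctx F) (m n k κ : ℕ) (α : ℕ → F) (v : ℕ → ℕ → F) (x : ℕ → F) (σ : Store) :
    Prop where
  par : σ 21 0 = m ∧ σ 23 0 = n ∧ σ 24 0 = k ∧ σ 25 0 = κ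
  hα : ∀ i < n, σ 10 (m * m * m + i) = X.code (α i)
  hv : ∀ l < κ, ∀ z < k * m, σ 10 (m * m * m + n + (l * (k * m) + z)) = X.code (v l z)
  hx : ∀ l < κ, σ 10 (m * m * m + n + κ * (k * m) + l) = X.code (x l)

variable {α x : ℕ → F} {v : ℕ → ℕ → F}

theorem EncIn.congr {τ : Store} (h : EncIn X m n k κ α v x σ)
    (e : ∀ b ∈ [10, 21, 23, 24, 25], τ b = σ b) : EncIn X m n k κ α v x τ := by
  cases h
  constructor <;> simp_all

/-- The number of elements of the table of the extension field and of the evaluation points. -/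
def offE : Expr := V 21 * V 21 * V 21 + V 23

/-- Computes the message and its values. -/
def encC : Cmd :=
  .seq (.loop 38 (V 24 * V 21) (.setF 31 (V 38) (.sum 50 (V 25)
    (.mul (.nat (rd 10 (offE + V 25 * (V 24 * V 21) + V 50)))
      (.nat (rd 10 (offE + (V 50 * (V 24 * V 21) + V 38))))))))
  (.seq (.loop 38 (V 23 * V 21 * V 24) (.setF 32 (V 38) (.ite (V 38 % V 24)
    (.add (.mul (.nat (rd 32 (V 38 - 1))) (.nat (rd 10 (V 21 * V 21 * V 21 + V 38 / V 24 / V 21))))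
      (.nat (rd 31 ((V 24 - 1 - V 38 % V 24) * V 21 + V 38 / V 24 % V 21))))
    (.nat (rd 31 ((V 24 - 1 - V 38 % V 24) * V 21 + V 38 / V 24 % V 21))))))
  (.loop 38 (V 23 * V 21) (.setF 44 (V 38) (.nat (rd 32 (V 38 * V 24 + (V 24 - 1)))))))

/-- Horner's rule with all intermediate values kept in a table: entry r of a row is the value of the
polynomial formed by the r + 1 highest coefficients. Since the evaluation points lie in F, each
coordinate is treated separately, and row i * m + c belongs to coordinate c at the i-th point. -/
theorem encC_spec (hρ : encC.den X σ = ρ) (h : EncIn X m n k κ α v x σ) (hk : 0 < k)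
    (hL : n * m * k < X.L) (hkm : k * m < X.L) (hnm : n * m < X.L) (hκ : κ < X.L) :
    ∀ z < n * m, ρ 44 z = X.code (∑ j ∈ Finset.range k,
      α (z / m) ^ j * ∑ l ∈ Finset.range κ, x l * v l (j * m + z % m)) := by
  obtain ⟨f, hf⟩ : ∃ f : ℕ → F, ∀ z, f z = ∑ l ∈ Finset.range κ, x l * v l z := ⟨_, fun _ => rfl⟩
  simp only [← hf]
  simp only [encC, Cmd.den_seq_iff] at hρ
  obtain ⟨σ₁, e₁, σ₂, e₂, e₃⟩ := hρ
  have h1 := h.congr (frs e₁ _)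
  have h2 := h1.congr (frs e₂ _)
  have t1 := tab_spec e₁ (k * m) f (by simp [h.par]) hkm (by
    intro τ z hz hτ h38
    have h' : EncIn X m n k κ α v x τ := h.congr fun b hb => by apply hτ <;> revert b <;> decide
    rw [hf]
    refine FE.eval_sum X _ (by simp [h'.par]) hκ fun l hl => ?_
    simp [offE, h'.par, h38, h'.hx l hl, h'.hv l hl z hz, X.el_code])
  have u1 := tab2_rec e₂ (n * m) k
    (fun y r => ∑ w ∈ Finset.range (r + 1), α (y / m) ^ w * f ((k - 1 - r + w) * m + y % m))
    (by simp [h1.par]) hL (by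
      intro τ y r hy hr hτ h38 hrec
      have h' : EncIn X m n k κ α v x τ := h1.congr fun b hb => by apply hτ <;> revert b <;> decide
      have hm : 0 < m := Nat.pos_of_ne_zero (by rintro rfl; simp at hy)
      have hd : τ 38 0 / k = y := by rw [h38, mul_add_div_self hr]
      have hr' : τ 38 0 % k = r := by rw [h38, mul_add_mod_self hr]
      have e1 : X.el ((rd 31 ((V 24 - 1 - V 38 % V 24) * V 21 + V 38 / V 24 % V 21)).eval τ) =
          f ((k - 1 - r) * m + y % m) := by
        simp [h'.par, hd, hr', hτ 31, t1 _ (mul_add_lt (show k - 1 - r < k by omega) (Nat.mod_lt y hm)),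
          X.el_code]
      rw [FE.eval_ite X r (by simp [hr', h'.par])]
      split_ifs with h0
      · rw [FE.eval_nat, e1, h0]
        simp
      · obtain ⟨r, rfl⟩ : ∃ s, r = s + 1 := ⟨r - 1, by omega⟩
        rw [FE.eval_add', FE.eval_mul', FE.eval_nat, FE.eval_nat, FE.eval_nat, e1,
          Finset.sum_range_succ' _ (r + 1), pow_zero, one_mul, add_zero, add_left_inj]
        simp only [eval_read, eval_add, eval_mul, eval_sub, eval_div, eval_const, eval_ofNat, h'.par, hd]
        rw [h38, show y * k + (r + 1) - 1 = y * k + r from rfl, hrec y r (by omega) (by omega),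
          X.el_code, h'.hα _ (Nat.div_lt_of_lt_mul (by rwa [mul_comm])), X.el_code, Finset.sum_mul]
        refine Finset.sum_congr rfl fun w _ => ?_
        rw [show k - 1 - r + w = k - 1 - (r + 1) + (w + 1) by omega]
        ring)
  refine tab_spec e₃ (n * m) _ (by simp [h2.par]) hnm fun τ z hz hτ h38 => ?_
  have h' : EncIn X m n k κ α v x τ := h2.congr fun b hb => by apply hτ <;> revert b <;> decide
  simp [h'.par, h38, hτ 32, u1 z hz (k - 1) (by omega), X.el_code, Nat.sub_add_cancel hk]

end

section

variable {p a m : ℕ} {F K : Type*} [Field F] [Field K] [hp : Fact p.Prime]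
  [Algebra (ZMod p) F] [Algebra F K] (bF : Basis (Fin a) (ZMod p) F) (bK : Basis (Fin m) F K)
  {X : Ctx F} {n k κ : ℕ} {σ ρ : Store}

/-- Reads the input of the encoder. -/
def encInC : Cmd :=
  .seq (.set 21 0 (inp 3)) (.seq (.set 23 0 (inp 4)) (.seq (.set 24 0 (inp 5))
    (.seq (.set 25 0 (inp 6)) (inRest 7 (offE + V 25 * (V 24 * V 21) + V 25)))))

theorem encInC_spec (hσ : Env bF X σ) (hρ : encInC.den X σ = ρ) (α : Fin n → F)
    (v : Fin κ → Fin k → K) (x : Fin κ → F) (h0 : σ 0 = listArray ([p, a, m, n, k, κ] ++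
      tableF bF ++ (tableK bF bK ++ (encFVec bF α ++ (encKMat bF bK v ++ encFVec bF x)))))
    (hNL : m * m * m + n + κ * (k * m) + κ < X.L) (hmM : m < X.M) (hnM : n < X.M) (hkM : k < X.M)
    (hκM : κ < X.M) :
    EncIn X m n k κ (ext α) (fun l z => kc bK (ext (ext v l) (z / m)) (z % m)) (ext x) ρ := by
  have hin : ∀ j < 6, σ 0 (j + 1) = ([p, a, m, n, k, κ] : List ℕ).getD j 0 := fun j hj => by
    rw [h0, List.append_assoc, listArray_append_left _ _ (by simpa using hj)]
  simp only [encInC, Cmd.den_seq_iff] at hρ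
  obtain ⟨σ₁, h₁, σ₂, h₂, σ₃, h₃, σ₄, h₄, h₅⟩ := hρ
  have f2 : σ₂ 0 = σ 0 := by rw [fr h₂ 0, fr h₁ 0]
  have v4 : σ₄ 21 0 = m ∧ σ₄ 23 0 = n ∧ σ₄ 24 0 = k ∧ σ₄ 25 0 = κ := by
    rw [fr h₄ 21, fr h₃ 21, fr h₂ 21, fr h₄ 23, fr h₃ 23, fr h₄ 24]
    exact ⟨set_val h₁ (hin 2 (by omega)) hmM,
      set_val h₂ ((congrFun (fr h₁ 0) 4).trans (hin 3 (by omega))) hnM,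
      set_val h₃ ((congrFun f2 5).trans (hin 4 (by omega))) hkM,
      set_val h₄ ((congrFun ((fr h₃ 0).trans f2) 6).trans (hin 5 (by omega))) hκM⟩
  obtain ⟨z, hz, -, z2, z3, z4⟩ := enc_rest bF bK α v (enc_encFVec bF x)
  have r1 := inRest_spec bF ((((hσ.step bF h₁).step bF h₂).step bF h₃).step bF h₄)
    (hd := [p, a, m, n, k, κ]) h₅ (by rw [fr h₄ 0, fr h₃ 0, f2, h0]) (by simp [offE, v4]) hNL hz
  refine ⟨by rwa [fr h₅ 21, fr h₅ 23, fr h₅ 24, fr h₅ 25], fun i hi => ?_, fun l hl w hw => ?_,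
    fun l hl => ?_⟩
  · rw [r1 _ (by omega), z2 i hi]
  · have hm : 0 < m := Nat.pos_of_ne_zero (by rintro rfl; simp at hw)
    have h1 := mul_add_lt hl hw
    have h2 := z3 l hl (w / m) (Nat.div_lt_of_lt_mul (by rwa [mul_comm])) (w % m) (Nat.mod_lt _ hm)
    rw [Nat.div_add_mod'] at h2
    rw [r1 _ (by omega), h2]
  · rw [r1 _ (by omega), z4 l hl]

/-- The encoder. -/
def encProg : Prog :=
  (Cmd.seq encInC (.seq encC (outC 0 (V 23 * V 21)))).toProg 6 (powE (inp 0 + V 7 + 10) 12)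

theorem encProg_runs : ∃ C, ∀ {p a m n k κ : ℕ} {F K : Type*} [Field F] [Field K] [Fact p.Prime]
    [Algebra (ZMod p) F] [Algebra F K] (bF : Basis (Fin a) (ZMod p) F) (bK : Basis (Fin m) F K)
    (α : Fin n → F) (v : Fin κ → Fin k → K) (x : Fin κ → F), 0 < m → 1 ≤ k → k < n → κ ≤ k * m →
    RunsIn encProg ([p, a, m, n, k, κ] ++ tableF bF ++ tableK bF bK ++ encFVec bF α ++
      encKMat bF bK v ++ encFVec bF x) (encKVec bF bK (rsEncode α k (∑ l, x l • v l)))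
      ((n + m + (Nat.card F).size) ^ C) := by
  obtain ⟨K₀, hK₀⟩ := (Cmd.seq encInC (.seq encC (outC 0 (V 23 * V 21)))).toProg_runs (by decide) 6
    (powE (inp 0 + V 7 + 10) 12)
  refine ⟨7 * 12 * K₀, fun {p a m n k κ F K} _ _ hp _ _ bF bK α v x hm hk hkn hκ => ?_⟩
  have hq := card_of_basis bF
  have ha := a_pos bF
  obtain ⟨input, hinput⟩ : ∃ input, [p, a, m, n, k, κ] ++ tableF bF ++
    (tableK bF bK ++ (encFVec bF α ++ (encKMat bF bK v ++ encFVec bF x))) = input := ⟨_, rfl⟩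
  have hlen : input.length = 6 + a * a * a + (m * m * m + n + κ * (k * m) + κ) * a := by
    rw [← hinput]
    simp only [List.length_append, (enc_tableF bF).1, (enc_tableK bF bK).1,
      (enc_encFVec bF α).1, (enc_encKMat bF bK v).1, (enc_encFVec bF x).1, List.length_cons,
      List.length_nil]
    ring
  have hκnm : κ ≤ n * m := hκ.trans (Nat.mul_le_mul_right _ hkn.le)
  obtain ⟨B, hB⟩ : ∃ B, input.length + p.size + 10 = B := ⟨_, rfl⟩
  have hN := Nat.le_mul_of_pos_right (m * m * m + n + κ * (k * m) + κ) ha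
  have haaa : a ≤ a * a * a := by
    rw [mul_assoc]; exact Nat.le_mul_of_pos_right _ (Nat.mul_pos ha ha)
  have hmmm : m ≤ m * m * m := by
    rw [mul_assoc]; exact Nat.le_mul_of_pos_right _ (Nat.mul_pos hm hm)
  have hin : InBd B p a m n k κ 0 := by constructor <;> omega
  have hBW : B ≤ (n + m + (Nat.card F).size) ^ 7 := by
    refine le_trans ?_ (length_le_pow hp.out ha hm (by omega) hkn hκ (le_of_eq
      (by rw [hq] : n + m + (p ^ a).size = n + m + (Nat.card F).size)))
    rw [← hB, hlen]
    have : (m * m * m + n + κ * (k * m) + κ) * a ≤ (m * m * m + n + κ * (k * m) + n * m) * a :=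
      Nat.mul_le_mul_right _ (by omega)
    omega
  have hBL : ∀ e, e < 10 → B ^ e < B ^ 12 := fun e he => by
    simpa using hin.mul_pow_le (c := 1) (by omega) he
  have hB1 := hBL 1 (by omega)
  rw [pow_one] at hB1
  have hnm : n * m ≤ B ^ 2 := by rw [pow_two]; exact Nat.mul_le_mul hin.hn hin.hm
  have hkm : k * m ≤ B ^ 2 := by rw [pow_two]; exact Nat.mul_le_mul hin.hk hin.hm
  have hnmk : n * m * k ≤ B ^ 3 := Nat.mul_le_mul hnm hin.hk
  have hnma : n * m * a ≤ B ^ 3 := Nat.mul_le_mul hnm hin.ha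
  have haa : a * a ≤ B ^ 2 := by rw [pow_two]; exact Nat.mul_le_mul hin.ha hin.ha
  have hB2 := hBL 2 (by omega)
  have hB3 := hBL 3 (by omega)
  have hfour : 4 * p ^ a ≤ 2 ^ (B ^ 12 - 1) := hin.four_mul_le
  have hB10 := hin.hB
  generalize hLB : B ^ 12 = L at *
  have hL : 0 < L := by omega
  have hqL : L ≤ p ^ a * L := Nat.le_mul_of_pos_left _ (pow_pos hp.out.pos a)
  have hpqL : p ^ a ≤ p ^ a * L := Nat.le_mul_of_pos_right _ hL
  obtain ⟨X, hXM, hXL, τ, hE, h0, hrun⟩ := hK₀ bF hL [p, a, m, n, k, κ]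
    (tableK bF bK ++ (encFVec bF α ++ (encKMat bF bK v ++ encFVec bF x))) rfl (by omega) rfl rfl
    (by
      have := (le_card_of_basis bF).1
      have := hin.ha
      have := hin.hm
      have := hin.hn
      have := hin.hk
      have := hin.hκ
      simp only [List.forall_mem_cons, List.not_mem_nil, false_imp_iff, implies_true, and_true]
      refine ⟨?_, ?_, ?_, ?_, ?_, ?_⟩ <;> omega)
    (by
      obtain ⟨z, hz, -⟩ := enc_rest bF bK α v (enc_encFVec bF x)
      exact hz.lt bF)
    (by rw [hinput]; omega) (by omega) (by omega) hfour
    (fun τ P => by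
      have : τ 0 0 = input.length := by rw [P.h0, hinput, listArray_zero]
      simp [P.h7, this, hB, hLB])
  rw [hinput] at h0 hrun
  have hBM : B < 4 * (p ^ a * L) := by omega
  subst hXL
  simp only [Cmd.den_seq] at hrun
  obtain ⟨σ₁, h₁⟩ : ∃ ρ, encInC.den X τ = ρ := ⟨_, rfl⟩
  obtain ⟨σ₂, h₂⟩ : ∃ ρ, encC.den X σ₁ = ρ := ⟨_, rfl⟩
  rw [h₁, h₂] at hrun
  have i1 := encInC_spec bF bK hE h₁ α v x (by rw [h0, hinput]) (by omega)
    (by rw [hXM]; exact hin.hm.trans_lt hBM) (by rw [hXM]; exact hin.hn.trans_lt hBM)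
    (by rw [hXM]; exact hin.hk.trans_lt hBM) (by rw [hXM]; exact hin.hκ.trans_lt hBM)
  have c1 := encC_spec h₂ i1 hk (hnmk.trans_lt hB3) (hkm.trans_lt hB2) (hnm.trans_lt hB2)
    (hin.hκ.trans_lt hB1)
  obtain ⟨o1, o2, o3⟩ := outC_spec bF ((hE.step bF h₁).step bF h₂) (he := 0) (Ne := V 23 * V 21) rfl
    0 (n * m)
    (fun z => kc bK (ext (rsEncode α k (∑ l, x l • v l)) (z / m)) (z % m))
    (by intro ρ hρ; simp [hρ 23, hρ 21, fr h₂ 23, fr h₂ 21, i1.par]) (fun _ _ => rfl)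
    (lt_of_le_of_lt hnma hB3) (by omega) (fun z hz => by
      have hi : z / m < n := Nat.div_lt_of_lt_mul (by rwa [mul_comm])
      have hc := Nat.mod_lt z hm
      rw [c1 z hz, ext_of_lt α hi, ext_of_lt _ hi, kc_rsEncode]
      congr 1
      refine Finset.sum_congr rfl fun j hj => ?_
      congr 1
      rw [ext_of_lt _ (Finset.mem_range.1 hj), Finset.sum_apply, kc_sum, Finset.sum_range]
      refine Finset.sum_congr rfl fun l _ => ?_
      rw [mul_add_div_self hc, mul_add_mod_self hc, ext_val, ext_val, Pi.smul_apply, kc_smul,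
        ext_of_lt _ (Finset.mem_range.1 hj)])
  have hfin := hrun (encKVec bF bK (rsEncode α k (∑ l, x l • v l))) (by
    refine listArray_of_enc bF (hd := []) (enc_encKVec bF bK _) (by simpa using o1) ?_ ?_
    · intro i h1 h2
      simp at h2
      omega
    · intro i hi d hd
      simpa using o2 i hi d hd)
  obtain ⟨ρ, t, r1, r2, r3⟩ := hfin
  rw [← hinput] at r1
  simp only [← List.append_assoc] at r1
  refine ⟨ρ, t, r1, r2.trans ?_, r3⟩
  rw [← hLB, ← pow_mul, mul_assoc 7, pow_mul (n + m + _)]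
  exact Nat.pow_le_pow_left hBW _

end

/-! ### Averages over graphs of linear maps -/

section

open Matrix

theorem card_matrix {F : Type*} [Fintype F] [DecidableEq F] (m n : ℕ) :
    Fintype.card (Matrix (Fin m) (Fin n) F) = Fintype.card F ^ (m * n) :=
  (Fintype.card_fun (α := Fin m) (β := Fin n → F)).trans (by simp [pow_mul, pow_right_comm])

variable {F E : Type*} [Field F] [AddCommGroup E] [Module F E] {ℓ t : ℕ}
  (P : E →ₗ[F] Fin ℓ → F) (Q : E →ₗ[F] Fin t → F)

/-- The subspace on which `Q` is the composition of `P` and the map given by `M`. -/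
def graphSpace (M : Matrix (Fin ℓ) (Fin t) F) : Submodule F E :=
  LinearMap.ker (Q - M.vecMulLinear ∘ₗ P)

variable {P Q}

theorem mem_graphSpace {M : Matrix (Fin ℓ) (Fin t) F} {e : E} :
    e ∈ graphSpace P Q M ↔ Q e = P e ᵥ* M := by
  simp [graphSpace, sub_eq_zero]

variable [Fintype F]

-- If some M₀ works, `P` is injective on its graph, so the vectors P uᵢ are independent and the
-- matrix U formed by them has a right inverse R. All admissible M have the same product U M, so
-- from M + R Y one recovers Y and then M. Thus pairs of an admissible M and an arbitrary Y inject
-- into the set of all matrices.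
open Classical in
theorem card_graphSpace_mul_le (hPQ : ∀ e, P e = 0 → Q e = 0 → e = 0) {d : ℕ} {u : Fin d → E}
    (hu : LinearIndependent F u) :
    (Finset.univ.filter fun M => ∀ i, u i ∈ graphSpace P Q M).card * Fintype.card F ^ (d * t) ≤
      Fintype.card F ^ (ℓ * t) := by
  rcases Finset.eq_empty_or_nonempty (Finset.univ.filter fun M => ∀ i, u i ∈ graphSpace P Q M)
    with h | ⟨M₀, h⟩
  · simp [h]
  have h0 := (Finset.mem_filter.1 h).2
  simp only [mem_graphSpace] at h0
  have hP : LinearIndependent F (P ∘ u) := by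
    rw [Fintype.linearIndependent_iff] at hu ⊢
    intro c hc
    simp only [Function.comp_apply, ← map_smul, ← map_sum] at hc
    refine hu c (hPQ _ hc ?_)
    rw [map_sum] at hc ⊢
    simp only [map_smul, h0, ← smul_vecMul, ← sum_vecMul] at hc ⊢
    rw [hc, zero_vecMul]
  obtain ⟨R, hR⟩ : ∃ R : Matrix (Fin ℓ) (Fin d) F, Matrix.of (P ∘ u) * R = 1 := by
    obtain ⟨g, hg⟩ := (Fintype.linearCombination F (P ∘ u)).exists_leftInverse_of_injective
      (LinearMap.ker_eq_bot.2 (linearIndependent_iff_injective_fintypeLinearCombination.1 hP))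
    refine ⟨LinearMap.toMatrixRight' g, ?_⟩
    ext i j
    have := congrArg (fun f => f (Pi.single i 1) j) hg
    simp only [LinearMap.comp_apply, Fintype.linearCombination_apply_single, one_smul,
      LinearMap.id_apply] at this
    rw [mul_apply_eq_vecMul]
    change LinearMap.toMatrixRight'.symm (LinearMap.toMatrixRight' g) (P (u i)) j = _
    rw [LinearEquiv.symm_apply_apply]
    simpa [Matrix.one_apply, Pi.single_apply, eq_comm] using this
  have hA : ∀ M ∈ Finset.univ.filter (fun M => ∀ i, u i ∈ graphSpace P Q M),
      Matrix.of (P ∘ u) * M = Matrix.of (Q ∘ u) := fun M hM => by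
    have := (Finset.mem_filter.1 hM).2
    simp only [mem_graphSpace] at this
    ext i j
    rw [mul_apply_eq_vecMul]
    exact (congrFun (this i) j).symm
  have := Finset.card_le_card_of_injOn (s := (Finset.univ.filter fun M => ∀ i,
      u i ∈ graphSpace P Q M) ×ˢ (Finset.univ : Finset (Matrix (Fin d) (Fin t) F)))
    (t := (Finset.univ : Finset (Matrix (Fin ℓ) (Fin t) F))) (fun x => x.1 + R * x.2)
    (fun _ _ => Finset.mem_coe.2 (Finset.mem_univ _)) (by
      rintro ⟨M, Y⟩ h1 ⟨M', Y'⟩ h2 h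
      have h1 := hA M (Finset.mem_product.1 h1).1
      have h2 := hA M' (Finset.mem_product.1 h2).1
      have h3 := congrArg (fun x => Matrix.of (P ∘ u) * x) h
      simp only [Matrix.mul_add, ← Matrix.mul_assoc, hR, Matrix.one_mul, h1, h2, add_right_inj] at h3
      subst h3
      exact Prod.ext (add_right_cancel h) rfl)
  rwa [Finset.card_product, Finset.card_univ, Finset.card_univ, card_matrix, card_matrix] at this

variable [Finite E]

-- A union bound: an intersection of dimension d contains d independent vectors of `W`, and there
-- are at most q^(d·dim W) families of d vectors in `W`.
open Classical in
theorem card_finrank_graphSpace (hPQ : ∀ e, P e = 0 → Q e = 0 → e = 0) (W : Submodule F E) (d : ℕ) :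
    (Finset.univ.filter fun M => finrank F (W ⊓ graphSpace P Q M : Submodule F E) = d).card *
      Fintype.card F ^ (d * t) ≤ Fintype.card F ^ (finrank F W * d) * Fintype.card F ^ (ℓ * t) := by
  have := Fintype.ofFinite W
  have hcard : Fintype.card (Fin d → W) = Fintype.card F ^ (finrank F W * d) := by
    rw [Fintype.card_fun, Fintype.card_fin, Module.card_eq_pow_finrank (K := F), pow_mul]
  have hle := Finset.card_le_card (s := Finset.univ.filter fun M =>
      finrank F (W ⊓ graphSpace P Q M : Submodule F E) = d)
    (t := (Finset.univ.filter fun u : Fin d → W => LinearIndependent F fun i => (u i : E)).biUnion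
      fun u => Finset.univ.filter fun M => ∀ i, (u i : E) ∈ graphSpace P Q M) (fun M hM => by
      have b := finBasisOfFinrankEq F _ (Finset.mem_filter.1 hM).2
      simp only [Finset.mem_biUnion, Finset.mem_filter, Finset.mem_univ, true_and]
      exact ⟨fun i => ⟨b i, (Submodule.mem_inf.1 (b i).2).1⟩,
        b.linearIndependent.map' (Submodule.subtype _) (Submodule.ker_subtype _),
        fun i => (Submodule.mem_inf.1 (b i).2).2⟩)
  refine (Nat.mul_le_mul_right _ (hle.trans Finset.card_biUnion_le)).trans ?_
  rw [Finset.sum_mul, ← hcard, ← smul_eq_mul]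
  refine (Finset.sum_le_card_nsmul _ _ _ fun u hu =>
    card_graphSpace_mul_le hPQ (Finset.mem_filter.1 hu).2).trans ?_
  exact Nat.mul_le_mul_right _ (Finset.card_le_univ _)

/-- Matrices with an intersection of dimension d make up at most the fraction q^(d·dim W - dt) of
all. Weighted with q^(de) they contribute at most q^(-d) ≤ 2^(-d) because e + dim W + 1 ≤ t, and the
geometric series is at most 2. -/
theorem sum_card_graphSpace_le (hPQ : ∀ e, P e = 0 → Q e = 0 → e = 0) (W : Submodule F E) {e : ℕ}
    (he : e + finrank F W + 1 ≤ t) :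
    ∑ M, Nat.card (W ⊓ graphSpace P Q M : Submodule F E) ^ e ≤ 2 * Fintype.card F ^ (ℓ * t) := by
  classical
  set q := Fintype.card F with hq
  have hq2 : 2 ≤ q := Fintype.one_lt_card
  have h1 : ∑ M, Nat.card (W ⊓ graphSpace P Q M : Submodule F E) ^ e =
      ∑ d ∈ Finset.range (finrank F W + 1), (Finset.univ.filter fun M =>
        finrank F (W ⊓ graphSpace P Q M : Submodule F E) = d).card * q ^ (d * e) := by
    rw [← Finset.sum_fiberwise_of_maps_to (s := Finset.univ)
      (g := fun M => finrank F (W ⊓ graphSpace P Q M : Submodule F E))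
      (t := Finset.range (finrank F W + 1)) fun M _ => Finset.mem_range.2
        (Nat.lt_succ_of_le (Submodule.finrank_mono inf_le_left))]
    refine Finset.sum_congr rfl fun d _ => ?_
    rw [← smul_eq_mul, ← Finset.sum_const]
    refine Finset.sum_congr rfl fun M hM => ?_
    rw [Module.natCard_eq_pow_finrank (K := F), (Finset.mem_filter.1 hM).2,
      Nat.card_eq_fintype_card, ← pow_mul]
  have h2 : ∀ d, (Finset.univ.filter fun M => finrank F (W ⊓ graphSpace P Q M : Submodule F E)
      = d).card * q ^ (d * e) * 2 ^ d ≤ q ^ (ℓ * t) := fun d => by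
    have h := card_finrank_graphSpace hPQ W d
    obtain ⟨n, hn⟩ : ∃ n, (Finset.univ.filter fun M =>
      finrank F (W ⊓ graphSpace P Q M : Submodule F E) = d).card = n := ⟨_, rfl⟩
    rw [hn] at h ⊢
    refine le_of_mul_le_mul_left (a := q ^ (finrank F W * d)) (le_trans ?_ h)
      (pow_pos (by omega) _)
    calc q ^ (finrank F W * d) * (n * q ^ (d * e) * 2 ^ d)
        ≤ q ^ (finrank F W * d) * (n * q ^ (d * e) * q ^ d) := by gcongr
      _ = n * q ^ (d * (e + finrank F W + 1)) := by ring
      _ ≤ _ := by gcongr; omega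
  rw [h1]
  have h3 : ∀ d, (((Finset.univ.filter fun M => finrank F (W ⊓ graphSpace P Q M : Submodule F E)
      = d).card * q ^ (d * e) : ℕ) : ℝ) ≤ (q ^ (ℓ * t) : ℕ) * (1 / 2) ^ d := fun d => by
    have := Nat.cast_le (α := ℝ).2 (h2 d)
    rw [one_div, inv_pow, ← div_eq_mul_inv, le_div_iff₀ (by positivity)]
    exact_mod_cast this
  have h4 := (Finset.sum_le_sum fun d (_ : d ∈ Finset.range (finrank F W + 1)) => h3 d).trans (le_of_eq_of_le (Finset.mul_sum ..).symm (mul_le_mul_of_nonneg_left (sum_geometric_two_le _) (Nat.cast_nonneg _)))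
  rw [mul_comm 2]
  exact_mod_cast h4

/-- A step of the greedy construction. -/
theorem exists_graphSpace_le (hPQ : ∀ e, P e = 0 → Q e = 0 → e = 0) {ι : Type*} (s : Finset ι)
    (a : ι → ℕ) (W : ι → Submodule F E) {e r : ℕ} (hW : ∀ i ∈ s, a i ≠ 0 → finrank F (W i) = r)
    (he : e + r + 1 ≤ t) :
    ∃ M, ∑ i ∈ s, a i * Nat.card (W i ⊓ graphSpace P Q M : Submodule F E) ^ e ≤
      2 * ∑ i ∈ s, a i := by
  classical
  -- Otherwise summing over all matrices would contradict the average bound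
  -- `sum_card_graphSpace_le`. Terms with weight zero need no assumption on the dimension.
  by_contra! h
  have h1 := Finset.sum_lt_sum_of_nonempty (Finset.univ_nonempty) fun M _ => h M
  rw [Finset.sum_comm, Finset.sum_const, Finset.card_univ, card_matrix, smul_eq_mul] at h1
  refine absurd h1 (not_lt.2 ?_)
  rw [← mul_assoc, mul_comm _ 2, Finset.mul_sum]
  refine Finset.sum_le_sum fun i hi => ?_
  rw [← Finset.mul_sum, mul_comm _ (a i)]
  by_cases h0 : a i = 0
  · simp [h0]
  · exact Nat.mul_le_mul_left _ (sum_card_graphSpace_le hPQ _ (by rw [hW i hi h0]; exact he))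

end

/-! ### The greedy choice of a design -/

section

variable {F : Type*} [Field F] (X : Ctx F)

/-- The digits of a number as elements of the field. -/
def Ctx.dg (n i : ℕ) : F := X.el (n / X.q ^ i)

variable {X}

theorem Ctx.exists_dg (n : ℕ) (v : ℕ → F) : ∃ y < X.q ^ n, ∀ i < n, X.dg y i = v i := by
  have h := fun i => X.code_lt (v i)
  refine ⟨_, sum_digits_lt (fun i => X.code (v i)) h n, fun i hi => ?_⟩
  rw [Ctx.dg, ← X.el_code (X.el _), X.code_el, sum_digits_div_mod (by have := h 0; omega) _ h _ _ hi,
    X.el_code]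

variable [Fintype F] (hq : X.q = Fintype.card F)
include hq

theorem Ctx.dg_bijective (n : ℕ) :
    Function.Bijective fun (y : Fin (X.q ^ n)) (i : Fin n) => X.dg y i := by
  classical
  rw [Fintype.bijective_iff_surjective_and_card]
  refine ⟨fun v => ?_, by simp [hq]⟩
  obtain ⟨y, hy, h⟩ := X.exists_dg n fun i => if h : i < n then v ⟨i, h⟩ else 0
  exact ⟨⟨y, hy⟩, funext fun i => (h i i.2).trans (by simp)⟩

theorem sum_dg_eq_card {E : Type*} [AddCommGroup E] [Module F E] {r : ℕ} (w : Fin r → E)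
    (U : Submodule F E) (P : ℕ → Prop) [DecidablePred P]
    (hP : ∀ c, P c ↔ ∑ l : Fin r, X.dg c l • w l ∈ U) :
    ∑ c ∈ Finset.range (X.q ^ r), (if P c then 1 else 0) =
      Nat.card (U.comap (Fintype.linearCombination F w)) := by
  classical
  rw [← Fin.sum_univ_eq_sum_range (fun c => if P c then 1 else 0),
    Fintype.sum_bijective _ (Ctx.dg_bijective hq r) _
      (fun v : Fin r → F => if ∑ l, v l • w l ∈ U then 1 else 0) fun c => by simp [hP],
    Finset.sum_boole, Nat.cast_id, Nat.card_eq_fintype_card, Fintype.card_subtype]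
  rfl

end

/-! ### The potential of the greedy choice -/

section

open Matrix

variable {F : Type*} [Field F] (X : Ctx F) (m r ℓ t e : ℕ)

/-- The vectors described by a number. -/
def dgVec (y : ℕ) (l : Fin r) (i : Fin m) : F := X.dg y (l * m + i)

/-- The matrix described by a number. -/
def dgMat (x : ℕ) : Matrix (Fin ℓ) (Fin t) F := fun i j => X.dg x (i * t + j)

/-- The defects of a vector with respect to the graph of a matrix. -/
def defect (x y l j : ℕ) : F :=
  X.dg y (l * m + (ℓ + j)) - ∑ i ∈ Finset.range ℓ, X.dg y (l * m + i) * X.dg x (i * t + j)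

open Classical in
/-- The number of combinations of the vectors described by `y` for which `n` linear forms vanish. -/
noncomputable def cnt (n : ℕ) (f : ℕ → ℕ → F) : ℕ :=
  ∑ c ∈ Finset.range (X.q ^ r),
    if ∀ j < n, ∑ l ∈ Finset.range r, X.dg c l * f l j = 0 then 1 else 0

/-- The potential of a choice of matrices. -/
noncomputable def pot (x : ℕ → ℕ) (J : ℕ) : ℕ :=
  ∑ y ∈ Finset.range (X.q ^ (r * m)), (1 - (cnt X r m (fun l i => X.dg y (l * m + i)) - 1)) *
    ∏ i ∈ Finset.range (J * e), cnt X r t (defect X m ℓ t (x (i / e)) y)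

/-- The rows of the basis of the graph of a matrix. -/
def graphRow (x i : ℕ) (c : Fin m) : F :=
  if (c : ℕ) < ℓ then (if c - i + (i - c) = 0 then X.el 1 else X.el 0)
  else X.el 1 * X.dg x (i * t + (c - ℓ))

theorem prod_range_mul_div (f : ℕ → ℕ) (J : ℕ) :
    ∏ i ∈ Finset.range (J * e), f (i / e) = ∏ j ∈ Finset.range J, f j ^ e := by
  induction J with
  | zero => simp
  | succ J ih =>
    rw [Nat.succ_mul, Finset.prod_range_add, ih, Finset.prod_range_succ]
    congr 1
    rw [Finset.prod_congr rfl fun i hi => by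
      rw [Nat.mul_comm, Nat.mul_add_div (by have := Finset.mem_range.1 hi; omega),
        Nat.div_eq_of_lt (Finset.mem_range.1 hi), add_zero]]
    simp

variable {X m r ℓ t e}

variable (hm : ℓ + t = m)

/-- The first coordinates. -/
def headMap : (Fin m → F) →ₗ[F] Fin ℓ → F :=
  LinearMap.funLeft F F fun i => ⟨i, by omega⟩

/-- The last coordinates. -/
def tailMap : (Fin m → F) →ₗ[F] Fin t → F :=
  LinearMap.funLeft F F fun j => ⟨ℓ + j, by omega⟩

theorem head_tail_zero (v : Fin m → F) (h : headMap hm v = 0) (h' : tailMap hm v = 0) : v = 0 := by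
  funext i
  by_cases hi : (i : ℕ) < ℓ
  · exact congrFun h ⟨i, hi⟩
  · have := congrFun h' ⟨i - ℓ, by omega⟩
    simp only [tailMap, LinearMap.funLeft_apply, Pi.zero_apply] at this
    rw [Pi.zero_apply, ← this]
    exact congrArg v (Fin.ext (by simp only; omega))

theorem el_one_ne (hq : 1 < X.q) : X.el 1 ≠ 0 := fun h => by
  have := X.code_el 1
  rw [h, X.code_zero, Nat.mod_eq_of_lt hq] at this
  omega

/-- The row is `X.el 1` times the vector consisting of the i-th unit vector and the i-th row of the
matrix. The nonzero element with number 1 serves as a scalar, so the unit of F need not be computed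
here. -/
theorem graphRow_mem (x : ℕ) (i : Fin ℓ) :
    graphRow X m ℓ t x i ∈ graphSpace (headMap hm) (tailMap hm) (dgMat X ℓ t x) := by
  rw [mem_graphSpace]
  have h1 : headMap hm (graphRow X m ℓ t x i) = Pi.single i (X.el 1) := by
    funext c
    simp only [headMap, LinearMap.funLeft_apply, graphRow, c.2, if_true, Pi.single_apply, X.el_zero,
      Fin.ext_iff]
    exact if_congr (by omega) rfl rfl
  rw [h1, single_vecMul]
  funext j
  simp [tailMap, graphRow, dgMat]

theorem linearIndependent_graphRow (hq : 1 < X.q) (hm : ℓ + t = m) (x : ℕ) :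
    LinearIndependent F fun i : Fin ℓ => graphRow X m ℓ t x i := by
  have h1 : headMap hm ∘ (fun i : Fin ℓ => graphRow X m ℓ t x i) =
      fun i => (Units.mk0 _ (el_one_ne hq)) • (Pi.basisFun F (Fin ℓ) i) := by
    funext i c
    simp only [Function.comp_apply, headMap, LinearMap.funLeft_apply, graphRow, c.2, if_true,
      X.el_zero, Pi.smul_apply, Units.smul_mk0, Pi.basisFun_apply, Pi.single_apply, smul_eq_mul,
      mul_ite, mul_one, mul_zero, Fin.ext_iff]
    exact if_congr (by omega) rfl rfl
  refine LinearIndependent.of_comp (headMap hm) ?_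
  rw [h1]
  exact (Pi.basisFun F (Fin ℓ)).linearIndependent.units_smul fun _ => _

variable [Fintype F] (hq : X.q = Fintype.card F)
include hq

theorem cnt_forms (y : ℕ) : cnt X r m (fun l i => X.dg y (l * m + i)) =
    Nat.card (LinearMap.ker (Fintype.linearCombination F (dgVec X m r y))) := by
  classical
  rw [cnt, sum_dg_eq_card hq (dgVec X m r y) ⊥ _ fun c => ?_]
  · rfl
  rw [Submodule.mem_bot, funext_iff, Fin.forall_iff]
  refine forall₂_congr fun i hi => ?_
  rw [← Fin.sum_univ_eq_sum_range (fun l => X.dg c l * X.dg y (l * m + i)), Finset.sum_apply]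
  rfl

theorem cnt_defect (x y : ℕ) : cnt X r t (defect X m ℓ t x y) =
    Nat.card ((graphSpace (headMap hm) (tailMap hm) (dgMat X ℓ t x)).comap
      (Fintype.linearCombination F (dgVec X m r y))) := by
  classical
  rw [cnt, sum_dg_eq_card hq (dgVec X m r y) _ _ fun c => ?_]
  rw [graphSpace, LinearMap.mem_ker, map_sum, funext_iff, Fin.forall_iff]
  refine forall₂_congr fun j hj => ?_
  rw [← Fin.sum_univ_eq_sum_range (fun l => X.dg c l * defect X m ℓ t x y l j), Finset.sum_apply]
  have : ∀ l : Fin r, defect X m ℓ t x y l j =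
      (tailMap hm - (dgMat X ℓ t x).vecMulLinear ∘ₗ headMap hm : (Fin m → F) →ₗ[F] Fin t → F)
        (dgVec X m r y l) ⟨j, hj⟩ := by
    intro l
    rw [defect, ← Fin.sum_univ_eq_sum_range
      (fun i => X.dg y (l * m + i) * X.dg x (i * t + j))]
    rfl
  simp only [this, map_smul, Pi.smul_apply, smul_eq_mul, Pi.zero_apply]

/-- Independent vectors have exactly one vanishing combination, dependent ones at least two;
truncated subtraction turns this count into an indicator. The potential thus sums over the
independent families, and each subspace occurs through its bases. -/
theorem ind_eq (y : ℕ) [Decidable (LinearIndependent F (dgVec X m r y))] :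
    1 - (cnt X r m (fun l i => X.dg y (l * m + i)) - 1) =
      if LinearIndependent F (dgVec X m r y) then 1 else 0 := by
  rw [cnt_forms hq]
  split_ifs with h
  · rw [linearIndependent_iff_injective_fintypeLinearCombination, ← LinearMap.ker_eq_bot] at h
    rw [h]
    simp
  · have : Nontrivial (LinearMap.ker (Fintype.linearCombination F (dgVec X m r y))) := by
      rwa [Submodule.nontrivial_iff_ne_bot, Ne, LinearMap.ker_eq_bot,
        ← linearIndependent_iff_injective_fintypeLinearCombination]
    have := Finite.one_lt_card (α := LinearMap.ker (Fintype.linearCombination F (dgVec X m r y)))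
    omega

theorem cnt_defect_of_linearIndependent {y : ℕ} (hy : LinearIndependent F (dgVec X m r y)) (x : ℕ) :
    cnt X r t (defect X m ℓ t x y) = Nat.card (Submodule.span F (Set.range (dgVec X m r y)) ⊓
      graphSpace (headMap hm) (tailMap hm) (dgMat X ℓ t x) : Submodule F (Fin m → F)) := by
  rw [cnt_defect hm hq, ← Fintype.range_linearCombination F, ← Submodule.map_comap_eq]
  exact Nat.card_congr (Submodule.equivMapOfInjective _
    (linearIndependent_iff_injective_fintypeLinearCombination.1 hy) _).toEquiv

include hm

/-- The method of conditional expectations: `exists_graphSpace_le` is applied with the summands of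
the current potential as weights, which vanish on dependent families. -/
theorem exists_pot_le (he : e + r + 1 ≤ t) (x : ℕ → ℕ) (J : ℕ) :
    ∃ z < X.q ^ (ℓ * t), ∀ x' : ℕ → ℕ, (∀ j < J, x' j = x j) → x' J = z →
      pot X m r ℓ t e x' (J + 1) ≤ 2 * pot X m r ℓ t e x J := by
  classical
  obtain ⟨M, hM⟩ := exists_graphSpace_le (head_tail_zero (F := F) hm) (Finset.range (X.q ^ (r * m)))
    (fun y => (1 - (cnt X r m (fun l i => X.dg y (l * m + i)) - 1)) *
      ∏ i ∈ Finset.range (J * e), cnt X r t (defect X m ℓ t (x (i / e)) y))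
    (fun y => Submodule.span F (Set.range (dgVec X m r y))) (e := e) (r := r) (fun y _ h => by
      rw [ind_eq hq] at h
      split_ifs at h with h'
      · rw [finrank_span_eq_card h', Fintype.card_fin]
      · simp at h) he
  obtain ⟨z, hz, h⟩ := X.exists_dg (ℓ * t) fun i =>
    if h : i < ℓ * t then M (Fin.divNat ⟨i, h⟩) (Fin.modNat ⟨i, h⟩) else 0
  have hMz : dgMat X ℓ t z = M := by
    ext i j
    have hij : (i : ℕ) * t + j < ℓ * t := mul_add_lt i.2 j.2
    rw [dgMat, h _ hij, dif_pos hij]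
    congr 1 <;> ext
    · exact mul_add_div_self j.2
    · exact mul_add_mod_self j.2
  refine ⟨z, hz, fun x' h1 h2 => le_trans (Finset.sum_le_sum fun y _ => ?_) hM⟩
  rw [prod_range_mul_div e (fun j => cnt X r t (defect X m ℓ t (x' j) y)), Finset.prod_range_succ,
    prod_range_mul_div e (fun j => cnt X r t (defect X m ℓ t (x j) y)), h2, ← mul_assoc,
    Finset.prod_congr rfl fun j hj => by rw [h1 j (Finset.mem_range.1 hj)], ind_eq hq]
  split_ifs with h'
  · rw [cnt_defect_of_linearIndependent hm hq h', hMz]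
  · simp

/-- A basis of `W` is among the enumerated families, and its summand Πⱼ |W ∩ Hⱼ|^e alone is at most
the whole potential. -/
theorem pow_sum_finrank_le {k B : ℕ} {x : ℕ → ℕ} (h : pot X m r ℓ t e x k ≤ B)
    (W : Submodule F (Fin m → F)) (hW : finrank F W = r) :
    X.q ^ (e * ∑ j : Fin k, finrank F (W ⊓ Submodule.span F (Set.range fun i : Fin ℓ =>
      graphRow X m ℓ t (x j) i) : Submodule F (Fin m → F))) ≤ B := by
  classical
  have b := finBasisOfFinrankEq F W hW
  obtain ⟨y, hy, hy'⟩ := X.exists_dg (r * m) fun i =>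
    if h : i < r * m then (b (Fin.divNat ⟨i, h⟩) : Fin m → F) (Fin.modNat ⟨i, h⟩) else 0
  have hyb : dgVec X m r y = fun l => (b l : Fin m → F) := by
    funext i j
    have hij : (i : ℕ) * m + j < r * m := mul_add_lt i.2 j.2
    rw [dgVec, hy' _ hij, dif_pos hij]
    rw [show Fin.divNat ⟨i * m + j, hij⟩ = i from Fin.ext (mul_add_div_self j.2),
      show Fin.modNat ⟨i * m + j, hij⟩ = j from Fin.ext (mul_add_mod_self j.2)]
  have hLI : LinearIndependent F (dgVec X m r y) := by
    rw [hyb]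
    exact b.linearIndependent.map' W.subtype (Submodule.ker_subtype _)
  have hsp : Submodule.span F (Set.range (dgVec X m r y)) = W := by
    have := congrArg (Submodule.map W.subtype) b.span_eq
    rw [Submodule.map_span, ← Set.range_comp, Submodule.map_top, Submodule.range_subtype] at this
    rw [hyb]
    exact this
  refine le_trans ?_ (le_trans (Finset.single_le_sum (f := fun y =>
    (1 - (cnt X r m (fun l i => X.dg y (l * m + i)) - 1)) *
    ∏ i ∈ Finset.range (k * e), cnt X r t (defect X m ℓ t (x (i / e)) y))
    (fun _ _ => Nat.zero_le _) (Finset.mem_range.2 hy)) h)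
  rw [ind_eq hq, if_pos hLI, one_mul,
    prod_range_mul_div e (fun j => cnt X r t (defect X m ℓ t (x j) y)), Finset.mul_sum,
    ← Finset.prod_pow_eq_pow_sum, ← Fin.prod_univ_eq_prod_range (fun j =>
      cnt X r t (defect X m ℓ t (x j) y) ^ e)]
  refine Finset.prod_le_prod' fun j _ => ?_
  rw [cnt_defect_of_linearIndependent hm hq hLI, hsp, mul_comm, pow_mul, hq,
    ← Nat.card_eq_fintype_card, ← Module.natCard_eq_pow_finrank (K := F)]
  refine Nat.pow_le_pow_left (Nat.card_le_card_of_injective _ (Submodule.inclusion_injective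
    (inf_le_inf_left W (Submodule.span_le.2 ?_)))) e
  rintro _ ⟨i, rfl⟩
  exact graphRow_mem hm (x j) i

end

/-! ### The command for the greedy design -/

section

variable {F : Type*} [Field F] {X : Ctx F} {σ ρ : Store}

theorem fold_spec {x z : ℕ} {e : Expr} {c : Cmd} (hρ : (Cmd.loop x e c).den X σ = ρ) (N : ℕ)
    (g : ℕ → ℕ) (hN : e.eval σ = N) (hNL : N < X.L) (h0 : σ z 0 = g 0)
    (hs : ∀ i < N, ∀ τ, (∀ (b : ℕ) (_ : b ∉ (Cmd.loop x e c).mods := by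
      exact of_decide_eq_true rfl), τ b = σ b) → τ x 0 = i → τ z 0 = g i →
      ∀ τ', c.den X τ = τ' → τ' z 0 = g (i + 1)) (hxz : z ≠ x := by decide) : ρ z 0 = g N :=
  Cmd.loop_inv hρ N (fun n τ => τ z 0 = g n) hN hNL
    (by rw [put_of_ne _ _ _ _ hxz, put_of_ne _ _ _ _ hxz, h0]) fun i hi τ hτ hx hI τ' h => by
      rw [put_of_ne _ _ _ _ hxz, hs i hi τ @hτ hx hI τ' h]

/-- Sets array `33` to `1` if `n` linear forms vanish at the combination described by array `39`. -/
def zeroC (n : Expr) (f : FE) : Cmd :=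
  .seq (.set 33 0 1) (.loop 30 n (.seq
    (.setF 34 0 (.sum 50 (V 12) (.mul (.nat (V 39 / rd 4 (V 50))) f)))
    (.ite (V 34) (.set 33 0 0) .skip)))

/-- Counts the combinations for which `n` linear forms vanish. -/
def cntC (n : Expr) (f : FE) : Cmd :=
  .seq (.set 31 0 0) (.loop 39 (rd 4 (V 12)) (.seq (zeroC n f) (.set 31 0 (V 31 + V 33))))

variable {m k r ℓ t e : ℕ}

open Classical in
theorem zeroC_spec {n : Expr} {f : FE} {c : ℕ} (hρ : (zeroC n f).den X σ = ρ) (N : ℕ)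
    (g : ℕ → ℕ → F) (h12 : σ 12 0 = r) (hpow : ∀ i ≤ r, σ 4 i = X.q ^ i) (hM : 1 < X.M)
    (h39 : σ 39 0 = c) (hn : ∀ τ : Store, (∀ b, b ∉ [30, 33, 34] → τ b = σ b) → n.eval τ = N)
    (hNL : N < X.L) (hrL : r < X.L) (hf : ∀ τ j l, j < N → l < r →
      (∀ b, b ∉ [30, 33, 34, 50] → τ b = σ b) → τ 30 0 = j → τ 50 0 = l → f.eval X τ = g l j) :
    ρ 33 0 = if ∀ j < N, ∑ l ∈ Finset.range r, X.dg c l * g l j = 0 then 1 else 0 := by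
  obtain ⟨σ₁, h₁, h₂⟩ := Cmd.den_seq_iff.1 hρ
  have e1 : ∀ b, b ≠ 33 → σ₁ b = σ b := fun b hb => fr h₁ b (by simpa [Cmd.mods])
  refine fold_spec h₂ N (fun N => if ∀ j < N, ∑ l ∈ Finset.range r, X.dg c l * g l j = 0
    then 1 else 0) (hn _ fun b hb => e1 b (by grind)) hNL (by simp [set_val h₁ rfl hM]) ?_
  rintro j hj τ hτ hx hz _ rfl
  have hτ' : ∀ b, b ∉ [30, 33, 34] → τ b = σ b := fun b hb => by
    rw [hτ b (by simp only [Cmd.mods]; grind), e1 b (by grind)]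
  rw [Cmd.den_seq, Cmd.den_setF, FE.eval_sum X (fun l => X.dg c l * g l j)
    (show (V 12).eval τ = r by simp [hτ' 12, h12]) hrL fun l hl => ?_]
  · obtain ⟨s, hs⟩ : ∃ s, ∑ l ∈ Finset.range r, X.dg c l * g l j = s := ⟨_, rfl⟩
    rw [hs, Cmd.den_ite X (X.code s) (by simp)]
    simp only [Nat.forall_lt_succ_right, hs, Ctx.code_eq_zero]
    split_ifs with h0 h1 h1
    · rw [Cmd.den_skip, put_of_ne _ _ _ _ (by omega), hz, if_pos h1.1]
    · rw [Cmd.den_skip, put_of_ne _ _ _ _ (by omega), hz, if_neg fun h => h1 ⟨h, h0⟩]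
    · exact absurd h1.2 h0
    · simp [Cmd.den_set]
  · rw [FE.eval_mul', FE.eval_nat, hf _ j l hj hl (fun b hb => by
      rw [put_of_ne _ _ _ _ (by grind), hτ' b (by grind)]) (by simp [hx]) (by simp)]
    simp [Ctx.dg, hτ' 39, hτ' 4, hpow l hl.le, h39]

theorem cntC_spec {n : Expr} {f : FE} (hρ : (cntC n f).den X σ = ρ) (N : ℕ) (g : ℕ → ℕ → F)
    (h12 : σ 12 0 = r) (hpow : ∀ i ≤ r, σ 4 i = X.q ^ i)
    (hn : ∀ τ : Store, (∀ b, b ∉ [30, 31, 33, 34, 39] → τ b = σ b) → n.eval τ = N) (hNL : N < X.L)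
    (hrL : r < X.L) (hqL : X.q ^ r < X.L) (hqM : X.q ^ r < X.M) (hM : 1 < X.M)
    (hf : ∀ τ j l, j < N → l < r → (∀ b, b ∉ [30, 31, 33, 34, 39, 50] → τ b = σ b) → τ 30 0 = j →
      τ 50 0 = l → f.eval X τ = g l j) : ρ 31 0 = cnt X r N g := by
  classical
  obtain ⟨σ₁, h₁, h₂⟩ := Cmd.den_seq_iff.1 hρ
  have e1 : ∀ b, b ≠ 31 → σ₁ b = σ b := fun b hb => fr h₁ b (by simpa [Cmd.mods])
  refine fold_spec h₂ (X.q ^ r) (fun n => ∑ c ∈ Finset.range n,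
    if ∀ j < N, ∑ l ∈ Finset.range r, X.dg c l * g l j = 0 then 1 else 0)
    (by simp [e1 12, e1 4, h12, hpow r le_rfl]) hqL (by simpa using set_val h₁ (v := 0) rfl (by omega)) ?_
  rintro c hc τ hτ hx hz τ' h'
  obtain ⟨τ₁, u₁, u₂⟩ := Cmd.den_seq_iff.1 h'
  have hτ' : ∀ b, b ∉ [30, 31, 33, 34, 39] → τ b = σ b := fun b hb => by
    rw [hτ b (by simp only [Cmd.mods, zeroC]; grind), e1 b (by grind)]
  have h := zeroC_spec (c := c) u₁ N g (by rw [hτ' 12 (by simp), h12])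
    (fun i hi => by rw [hτ' 4 (by simp), hpow i hi]) hM hx
    (fun ρ hρ => hn ρ fun b hb => by rw [hρ b (by grind), hτ' b (by grind)]) hNL hrL
    (fun ρ j l hj hl hρ => hf ρ j l hj hl fun b hb => by rw [hρ b (by grind), hτ' b (by grind)])
  refine set_val u₂ (by
    simp only [eval_add, eval_read, eval_const, fr u₁ 31, hz, h, Finset.sum_range_succ])
    (((Finset.sum_le_card_nsmul _ _ 1 fun c _ => ?_).trans ?_).trans_lt hqM)
  · split_ifs <;> omega
  · simpa using hc

theorem cnt_le (n : ℕ) (f : ℕ → ℕ → F) : cnt X r n f ≤ X.q ^ r := by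
  classical
  exact (Finset.sum_le_card_nsmul _ _ 1 fun c _ => by split_ifs <;> omega).trans (by simp)

variable (X m k r ℓ t e) in
/-- The parameters of the greedy construction. -/
structure Greedy (σ : Store) : Prop where
  par : σ 12 0 = r ∧ σ 21 0 = m ∧ σ 24 0 = k ∧ σ 25 0 = k * ℓ ∧ σ 26 0 = t ∧ σ 27 0 = ℓ ∧ σ 48 0 = e
  h4 : ∀ i ≤ m * m, σ 4 i = X.q ^ i
  hr : r ≤ m
  hm : ℓ + t = m
  he : k * e ≤ m * m
  hk : k ≤ m * m
  hm0 : 0 < m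
  hqL : X.q ^ (m * m) < X.L
  hL : m * m < X.L
  hM : X.q ^ (r * m) * (X.q ^ r) ^ (k * e) < X.M
  hT : X.q ^ (r * m + k) + 1 < X.M
  hq : 1 < X.q

theorem Greedy.congr {τ : Store} (h : Greedy X m k r ℓ t e σ)
    (hτ : ∀ b ∈ [4, 12, 21, 24, 25, 26, 27, 48], τ b = σ b) : Greedy X m k r ℓ t e τ :=
  { h with
    par := by simp [hτ, h.par]
    h4 := by simpa [hτ] using h.h4 }

theorem Greedy.step {c : Cmd} (h : Greedy X m k r ℓ t e σ) (hρ : c.den X σ = ρ)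
    (hc : c.keeps [4, 12, 21, 24, 25, 26, 27, 48] = true := by rfl) : Greedy X m k r ℓ t e ρ :=
  h.congr (frs hρ _ hc)

theorem Greedy.pow (h : Greedy X m k r ℓ t e σ) {i : ℕ} (hi : i ≤ m * m) :
    X.q ^ i < X.L ∧ i < X.L :=
  ⟨(Nat.pow_le_pow_right h.hq.le hi).trans_lt h.hqL, hi.trans_lt h.hL⟩

theorem Greedy.rm (h : Greedy X m k r ℓ t e σ) : r ≤ m * m ∧ m ≤ m * m ∧ ℓ * t ≤ m * m ∧
    r * m ≤ m * m :=
  ⟨h.hr.trans (Nat.le_mul_self m), Nat.le_mul_self m,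
    Nat.mul_le_mul (by have := h.hm; omega) (by have := h.hm; omega), Nat.mul_le_mul_right _ h.hr⟩

/-- Counts the linear relations of the vectors described by array `18`. -/
def relC : Cmd := cntC (V 21) (.nat (V 18 / rd 4 (V 50 * V 21 + V 30)))

/-- Counts the combinations in the graph of the matrix described by array `29`. -/
def graphC : Cmd :=
  cntC (V 26) (.sub (.nat (V 18 / rd 4 (V 50 * V 21 + (V 27 + V 30)))) (.sum 51 (V 27)
    (.mul (.nat (V 18 / rd 4 (V 50 * V 21 + V 51))) (.nat (V 29 / rd 4 (V 51 * V 26 + V 30))))))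

/-- A factor of the potential. -/
def factorC : Cmd :=
  .seq (.ite (V 15 - V 37 / V 48) (.set 29 0 (rd 16 (V 37 / V 48))) (.set 29 0 (V 38)))
    (.seq graphC (.set 19 0 (V 19 * V 31)))

/-- A summand of the potential. -/
def termC : Cmd :=
  .seq relC (.seq (.set 46 0 (1 - (V 31 - 1))) (.seq (.set 19 0 1)
    (.seq (.loop 37 ((V 15 + 1) * V 48) factorC) (.set 20 0 (V 20 + V 46 * V 19)))))

/-- The potential of the choice of array `38` after the choices in array `16`. -/
def potC : Cmd := .seq (.set 20 0 0) (.loop 18 (rd 4 (V 12 * V 21)) termC)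

theorem Greedy.relC_spec (h : Greedy X m k r ℓ t e σ) (hρ : relC.den X σ = ρ) (hM : X.q ^ r < X.M)
    {y : ℕ} (hy : σ 18 0 = y) : ρ 31 0 = cnt X r m (fun l i => X.dg y (l * m + i)) := by
  obtain ⟨b1, b2, b3, b4⟩ := h.rm
  refine cntC_spec hρ m _ h.par.1 (fun i hi => h.h4 i (by omega))
    (fun τ hτ => by simp [hτ 21, h.par]) (h.pow b2).2 (h.pow b1).2 (h.pow b1).1 hM
    ((Nat.one_le_pow _ _ h.hq.le).trans_lt hM) fun τ j l hj hl hτ h30 h50 => ?_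
  have : l * m + j ≤ m * m := (mul_add_lt hl hj).le.trans b4
  simp [Ctx.dg, hτ 18, hτ 4, hτ 21, h30, h50, hy, h.par, h.h4 _ this]

theorem Greedy.graphC_spec (h : Greedy X m k r ℓ t e σ) (hρ : graphC.den X σ = ρ)
    (hM : X.q ^ r < X.M) {x y : ℕ} (hy : σ 18 0 = y) (hx : σ 29 0 = x) :
    ρ 31 0 = cnt X r t (defect X m ℓ t x y) := by
  obtain ⟨b1, b2, b3, b4⟩ := h.rm
  have hm := h.hm
  refine cntC_spec hρ t _ h.par.1 (fun i hi => h.h4 i (by omega))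
    (fun τ hτ => by simp [hτ 26, h.par]) (h.pow (by omega)).2 (h.pow b1).2 (h.pow b1).1 hM
    ((Nat.one_le_pow _ _ h.hq.le).trans_lt hM) fun τ j l hj hl hτ h30 h50 => ?_
  have h1 : l * m + (ℓ + j) ≤ m * m := (mul_add_lt hl (by omega)).le.trans b4
  rw [FE.eval_sub', FE.eval_sum X (N := ℓ) (fun i => X.dg y (l * m + i) * X.dg x (i * t + j))
    (by simp [hτ 27, h.par]) (h.pow (by omega)).2 fun i hi => ?_]
  · simp [defect, Ctx.dg, hτ 18, hτ 4, hτ 21, hτ 27, h30, h50, hy, h.par, h.h4 _ h1]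
  · have h2 : l * m + i ≤ m * m := (mul_add_lt hl (by omega)).le.trans b4
    have h3 : i * t + j ≤ m * m := (mul_add_lt hi hj).le.trans b3
    simp [Ctx.dg, hτ 18, hτ 4, hτ 21, hτ 26, hτ 29, h30, h50, hy, hx, h.par, h.h4 _ h2, h.h4 _ h3]

theorem Greedy.factorC_spec (h : Greedy X m k r ℓ t e σ) (hρ : factorC.den X σ = ρ)
    (hM : X.q ^ r < X.M) {J y i n : ℕ} {x : ℕ → ℕ}
    (hx : ∀ i ≤ J, x i = if i < J then σ 16 i else σ 38 0) (hJ : σ 15 0 = J) (hy : σ 18 0 = y)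
    (hi : σ 37 0 = i) (hiJ : i / e ≤ J) (hn : σ 19 0 = n) (hnM : n * X.q ^ r < X.M)
    (hxM : ∀ i ≤ J, x i < X.M) : ρ 19 0 = n * cnt X r t (defect X m ℓ t (x (i / e)) y) := by
  simp only [factorC, Cmd.den_seq_iff] at hρ
  obtain ⟨σ₁, h₁, σ₂, h₂, h₃⟩ := hρ
  have g := (h.step h₁).graphC_spec h₂ hM (by rw [fr h₁ 18, hy]) (show σ₁ 29 0 = x (i / e) by
    rw [Cmd.den_ite X (J - i / e) (by simp [hJ, hi, h.par])] at h₁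
    have h1 := hx _ hiJ
    split_ifs at h₁ h1
    · omega
    · exact set_val h₁ (by simp [h1]) (hxM _ hiJ)
    · exact set_val h₁ (by simp [hi, h.par, h1]) (hxM _ hiJ)
    · omega)
  exact set_val h₃ (by simp [fr h₂ 19, fr h₁ 19, hn, g])
    ((Nat.mul_le_mul_left _ (cnt_le _ _)).trans_lt hnM)

theorem Greedy.termC_spec (h : Greedy X m k r ℓ t e σ) (hρ : termC.den X σ = ρ)
    (hM : X.q ^ r < X.M) {J y n : ℕ} {x : ℕ → ℕ}
    (hx : ∀ i ≤ J, x i = if i < J then σ 16 i else σ 38 0) (hJ : σ 15 0 = J) (hy : σ 18 0 = y)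
    (hn : σ 20 0 = n) (hJk : J < k) (hnM : n + (X.q ^ r) ^ (k * e) < X.M)
    (hxM : ∀ i ≤ J, x i < X.M) :
    ρ 20 0 = n + (1 - (cnt X r m (fun l i => X.dg y (l * m + i)) - 1)) *
      ∏ i ∈ Finset.range ((J + 1) * e), cnt X r t (defect X m ℓ t (x (i / e)) y) := by
  have hq : 0 < X.q ^ r := pow_pos h.hq.le _
  have hJe : (J + 1) * e ≤ k * e := Nat.mul_le_mul_right _ hJk
  have hprod : ∀ n ≤ k * e, ∏ i ∈ Finset.range n, cnt X r t (defect X m ℓ t (x (i / e)) y) ≤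
      (X.q ^ r) ^ n := fun n _ =>
    (Finset.prod_le_pow_card _ _ (X.q ^ r) fun i _ => cnt_le _ _).trans_eq (by rw [Finset.card_range])
  have hle : ∀ n ≤ k * e, (X.q ^ r) ^ n < X.M := fun n hn =>
    ((Nat.pow_le_pow_right hq hn).trans (Nat.le_add_left _ _)).trans_lt hnM
  simp only [termC, Cmd.den_seq_iff] at hρ
  obtain ⟨σ₁, h₁, σ₂, h₂, σ₃, h₃, σ₄, h₄, h₅⟩ := hρ
  have v46 := set_val h₂ (by simp [h.relC_spec h₁ hM hy]) (show
    1 - (cnt X r m (fun l i => X.dg y (l * m + i)) - 1) < X.M by omega)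
  have e3 : ∀ b ∈ [15, 16, 18, 20, 38], σ₃ b = σ b := fun b hb => by
    rw [frs h₃ _ rfl b hb, frs h₂ _ rfl b hb, frs h₁ _ rfl b hb]
  have g3 := ((h.step h₁).step h₂).step h₃
  have h2 := fold_spec h₄ ((J + 1) * e)
    (fun n => ∏ i ∈ Finset.range n, cnt X r t (defect X m ℓ t (x (i / e)) y))
    (by simp [e3, g3.par, hJ]) (h.pow (hJe.trans h.he)).2
    (by simpa using set_val h₃ (v := 1) rfl (by omega)) (by
      intro i hi τ hτ hτx hz τ' h'
      rw [Finset.prod_range_succ]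
      refine Greedy.factorC_spec (g3.congr fun b hb => hτ b (by revert b; decide)) h' hM
        (by rwa [hτ 16, hτ 38, e3 16 (by simp), e3 38 (by simp)])
        (by rw [hτ 15, e3 15 (by simp), hJ]) (by rw [hτ 18, e3 18 (by simp), hy]) hτx
        (Nat.lt_succ_iff.1 (Nat.div_lt_of_lt_mul (by rwa [mul_comm]))) hz
        (((Nat.mul_le_mul_right _ (hprod i (by omega))).trans_eq (pow_succ _ _).symm).trans_lt
          (hle _ (by omega))) hxM)
  refine set_val h₅ (by simp [fr h₄ 20, e3, hn, fr h₄ 46, fr h₃ 46, v46, h2])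
    ((Nat.add_le_add_left ?_ _).trans_lt hnM)
  exact (Nat.mul_le_mul (Nat.sub_le _ _) (hprod _ hJe)).trans
    (by rw [one_mul]; exact Nat.pow_le_pow_right hq hJe)

theorem Greedy.potC_spec (h : Greedy X m k r ℓ t e σ) (hρ : potC.den X σ = ρ) (hM : X.q ^ r < X.M)
    {J : ℕ} {x : ℕ → ℕ} (hx : ∀ i ≤ J, x i = if i < J then σ 16 i else σ 38 0)
    (hJ : σ 15 0 = J) (hJk : J < k) (hxM : ∀ i ≤ J, x i < X.M) :
    ρ 20 0 = pot X m r ℓ t e x (J + 1) := by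
  have hq : 0 < X.q ^ r := pow_pos h.hq.le _
  have hJe : (J + 1) * e ≤ k * e := Nat.mul_le_mul_right _ hJk
  obtain ⟨b1, b2, b3, b4⟩ := h.rm
  obtain ⟨σ₁, h₁, h₂⟩ := Cmd.den_seq_iff.1 hρ
  have g1 := h.step h₁
  refine fold_spec h₂ (X.q ^ (r * m))
    (fun n => ∑ y ∈ Finset.range n, (1 - (cnt X r m (fun l i => X.dg y (l * m + i)) - 1)) *
      ∏ i ∈ Finset.range ((J + 1) * e), cnt X r t (defect X m ℓ t (x (i / e)) y))
    (by simp [g1.par, g1.h4 _ b4]) (h.pow b4).1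
    (by simpa using set_val h₁ (v := 0) rfl (by omega)) ?_
  intro y hy τ hτ hτx hz τ' h'
  rw [Finset.sum_range_succ]
  refine Greedy.termC_spec (g1.congr fun b hb => hτ b (by revert b; decide)) h' hM
    (by rwa [hτ 16, hτ 38, fr h₁ 16, fr h₁ 38]) (by rw [hτ 15, fr h₁ 15, hJ]) hτx hz hJk ?_ hxM
  refine (Nat.add_le_add_right (Finset.sum_le_card_nsmul _ _ ((X.q ^ r) ^ (k * e))
    fun y _ => ?_) _).trans_lt (lt_of_le_of_lt ?_ h.hM)
  · refine (Nat.mul_le_mul (Nat.sub_le _ _) (Finset.prod_le_pow_card _ _ (X.q ^ r)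
      fun i _ => cnt_le _ _)).trans ?_
    rw [Finset.card_range, one_mul]
    exact Nat.pow_le_pow_right hq hJe
  · rw [Finset.card_range, smul_eq_mul, ← Nat.succ_mul]
    exact Nat.mul_le_mul_right _ hy

/-- The greedy choice of the matrices of the design. -/
def greedyC : Cmd :=
  .seq (.set 28 0 (rd 4 (V 12 * V 21))) (.loop 15 (V 24) (.seq (.set 28 0 (2 * V 28))
    (.seq (searchC 38 13 14 (rd 4 (V 27 * V 26)) (.seq potC (.set 14 0 (V 28 + 1 - V 20))))
      (.set 16 (V 15) (V 13)))))

theorem pot_congr {x x' : ℕ → ℕ} {J : ℕ} (h : ∀ j < J, x j = x' j) :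
    pot X m r ℓ t e x J = pot X m r ℓ t e x' J := by
  refine Finset.sum_congr rfl fun y _ => ?_
  rw [prod_range_mul_div e fun j => cnt X r t (defect X m ℓ t (x j) y),
    prod_range_mul_div e fun j => cnt X r t (defect X m ℓ t (x' j) y),
    Finset.prod_congr rfl fun j hj => by rw [h j (Finset.mem_range.1 hj)]]

/-- Cell `28` holds the threshold 2^J q^(rm), doubled in each round. By `exists_pot_le` a candidate
under the new threshold always exists, so the search succeeds. -/
theorem Greedy.greedyC_spec [Fintype F] (h : Greedy X m k r ℓ t e σ) (hρ : greedyC.den X σ = ρ)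
    (hcard : X.q = Fintype.card F) (he : e + r + 1 ≤ t) (hM : X.q ^ (m * m) < X.M) :
    pot X m r ℓ t e (ρ 16) k ≤ 2 ^ k * X.q ^ (r * m) := by
  have hq := h.hq
  obtain ⟨b1, b2, b3, b4⟩ := h.rm
  have hle : ∀ i ≤ m * m, X.q ^ i < X.M := fun i hi => (Nat.pow_le_pow_right hq.le hi).trans_lt hM
  have hT : ∀ J ≤ k, 2 ^ J * X.q ^ (r * m) + 1 < X.M := fun J hJ => by
    refine lt_of_le_of_lt (Nat.add_le_add_right ?_ 1) h.hT
    rw [pow_add, mul_comm]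
    exact Nat.mul_le_mul_left _ ((Nat.pow_le_pow_right (by omega) hJ).trans
      (Nat.pow_le_pow_left hq k))
  obtain ⟨σ₀, h₀, h₁⟩ := Cmd.den_seq_iff.1 hρ
  have v28 := set_val h₀ (by simp [h.par, h.h4 _ b4]) (hle _ b4)
  refine (Cmd.loop_inv h₁ k (fun J τ => (∀ j < J, τ 16 j < X.M) ∧ τ 28 0 = 2 ^ J * X.q ^ (r * m) ∧
    pot X m r ℓ t e (τ 16) J ≤ 2 ^ J * X.q ^ (r * m)) (by simp [fr h₀ 24, h.par])
    (h.pow h.hk).2 ⟨by simp, by simp [v28], ?_⟩ ?_).2.2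
  -- Before any choice the product is empty and each of the q^(rm) families contributes at most 1.
  · rw [pow_zero, one_mul, pot]
    refine (Finset.sum_le_card_nsmul _ _ 1 fun y _ => ?_).trans (by simp)
    simp only [zero_mul, Finset.range_zero, Finset.prod_empty]
    omega
  rintro J hJ τ hτ hτx ⟨I1, I2, I3⟩ τ' h'
  simp only [Cmd.den_seq_iff] at h'
  obtain ⟨σ₁, u₁, σ₂, u₂, u₃⟩ := h'
  have hTJ := hT (J + 1) hJ
  have h28 : σ₁ 28 0 = 2 ^ (J + 1) * X.q ^ (r * m) :=
    set_val u₁ (by simp [I2, pow_succ', mul_assoc]) (by omega)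
  have g1 : Greedy X m k r ℓ t e σ₁ :=
    ((h.step h₀).congr fun b hb => hτ b (by revert b; decide)).step u₁
  obtain ⟨z, hz, hpot⟩ := exists_pot_le h.hm hcard he (τ 16) J
  have hzM : ∀ z < X.q ^ (ℓ * t), z < X.M := fun z hz => hz.trans (hle _ b3)
  obtain ⟨s1, s2⟩ := searchC_spec u₂ (X.q ^ (ℓ * t))
    (fun z => pot X m r ℓ t e (fun i => if i < J then τ 16 i else z) (J + 1) ≤
      2 ^ (J + 1) * X.q ^ (r * m)) (by simp [g1.par, g1.h4 _ b3]) (h.pow b3).1 (hle _ b3).le (by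
      intro ρ i hi hρ hρx ρ' h'
      obtain ⟨ρ₁, w₁, w₂⟩ := Cmd.den_seq_iff.1 h'
      have hρ' : ∀ b ∈ [4, 12, 15, 16, 21, 24, 25, 26, 27, 28, 48], ρ b = σ₁ b := fun b hb => by
        apply hρ <;> revert b <;> decide
      have hp := Greedy.potC_spec (g1.congr fun b hb => hρ' b (by revert b; decide)) w₁
        (hle _ b1) (J := J) (x := fun j => if j < J then τ 16 j else i) (fun j _ => by
          rw [hρ' 16 (by decide), fr u₁ 16, hρx])
        (by rw [hρ' 15 (by decide), fr u₁ 15, hτx]) hJ (fun j _ => by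
          split_ifs with hj
          exacts [I1 j hj, hzM i hi])
      -- The test value, threshold plus 1 minus potential, is nonzero exactly if the potential does
      -- not exceed the threshold.
      rw [set_val w₂ (by simp [hp, fr w₁ 28, hρ' 28, h28]; rfl) (by omega)]
      omega) ⟨z, hz, (hpot _ (fun j hj => if_pos hj) (if_neg (lt_irrefl _))).trans (by
        rw [pow_succ', mul_assoc]; omega)⟩
  have h16 : ∀ j, τ' 16 j = if j = J then σ₂ 13 0 else τ 16 j := fun j => by
    rw [← u₃, Cmd.den_set]
    simp only [eval_read, eval_const, fr u₂ 15, fr u₁ 15, hτx, Nat.mod_eq_of_lt (hzM _ s1)]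
    split_ifs with hj
    · rw [hj, put_same]
    · rw [put_cell_ne _ _ _ _ _ hj, fr u₂ 16, fr u₁ 16]
  rw [put_of_ne _ 15 _ _ (show 28 ≠ 15 by omega), put_of_ne _ 15 _ _ (show 16 ≠ 15 by omega)]
  refine ⟨fun j hj => ?_, by rw [fr u₃ 28, fr u₂ 28, h28], ?_⟩
  · rw [h16]
    split_ifs
    exacts [hzM _ s1, I1 j (by omega)]
  · rw [pot_congr (x' := fun i => if i < J then τ 16 i else σ₂ 13 0) fun j hj => ?_]
    · exact s2
    · rw [h16]
      split_ifs <;> first | rfl | omega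

end

/-! ### The greedy design as a program -/

section

variable {p a m : ℕ} {F K : Type*} [Field F] [Field K] [hp : Fact p.Prime]
  [Algebra (ZMod p) F] [Algebra F K] (bF : Basis (Fin a) (ZMod p) F) (bK : Basis (Fin m) F K)

/-- The entries of the rows of the greedy design. -/
def graphFE : FE :=
  .ite (V 27 - V 38 % V 21) (.ite ((V 38 % V 21 - V 38 / (V 24 * V 21) % V 27) +
    (V 38 / (V 24 * V 21) % V 27 - V 38 % V 21)) (.nat 0) (.nat 1))
    (.mul (.nat 1) (.nat (rd 16 (V 38 / (V 24 * V 21) / V 27) /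
      rd 4 (V 38 / (V 24 * V 21) % V 27 * V 26 + (V 38 % V 21 - V 27)))))

/-- The construction of a greedy design. -/
def greedyDesignC : Cmd :=
  .seq (.seq (.set 12 0 (inp 5 - 1)) (.seq (.set 21 0 (inp 3)) (.seq (.set 24 0 (inp 4))
    (.seq (.set 26 0 (inp 6)) (.seq (.set 27 0 (inp 3 - inp 6)) (.seq (.set 48 0 (inp 6 - inp 5))
      (.set 25 0 (inp 4 * (inp 3 - inp 6))))))))) (.seq greedyC (matOutC (V 25) graphFE))

/-- The construction of a design over a small field. -/
def greedyProg : Prog :=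
  greedyDesignC.full 6 (8 * (inp 3 * inp 3 * inp 3)) (rd 4 (8 * (inp 3 * inp 3)))
    (rd 4 (8 * (inp 3 * inp 3 * inp 3)))

/-- Here r = s - 1 and e = t - s, so that e + r + 1 = t: the largest exponent the averaging argument
allows. -/
theorem greedyDesignC_spec [Fintype F] {X : Ctx F} {k s t : ℕ} {σ ρ : Store} (hσ : Env bF X σ)
    (hρ : greedyDesignC.den X σ = ρ)
    (h0 : ∀ j < 6, σ 0 (j + 1) = ([p, a, m, k, s, t] : List ℕ).getD j 0)
    (h4 : ∀ i ≤ m * m, σ 4 i = (p ^ a) ^ i) (hq : Fintype.card F = p ^ a) (hs : 1 ≤ s) (hst : s ≤ t)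
    (htm : t ≤ m) (hkm : k ≤ m) (hqL : (p ^ a) ^ (m * m) < X.L)
    (hLm : m * m < X.L) (hLM : X.L < X.M) (hM1 : (p ^ a) ^ (m * m * m + m * m + 1) < X.M)
    (hout : k * (m - t) * (k * m) * a < X.L) :
    ∃ g : Fin k → Fin (m - t) → Fin m → F, (∀ j, LinearIndependent F (g j)) ∧
      (∀ W : Submodule F (Fin m → F), finrank F W = s - 1 →
        (p ^ a) ^ ((t - s) * designSum g W) ≤ 2 ^ k * (p ^ a) ^ ((s - 1) * m)) ∧
      ∀ i ≤ ((k * (m - t)) :: encKMat bF bK (designBasis bK g)).length,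
        ρ 1 i = listArray ((k * (m - t)) :: encKMat bF bK (designBasis bK g)) i := by
  have hXq := hσ.hXq
  rw [← hXq] at h4 hq hqL hM1 ⊢
  have hq1 : 1 < X.q := hq ▸ Fintype.one_lt_card
  have hkt : k * (m - t) ≤ m * m := Nat.mul_le_mul hkm (Nat.sub_le _ _)
  have hmm := Nat.le_mul_self m
  simp only [greedyDesignC, Cmd.den_seq_iff] at hρ
  obtain ⟨σ₁, ⟨τ₁, u₁, τ₂, u₂, τ₃, u₃, τ₄, u₄, τ₅, u₅, τ₆, u₆, u₇⟩, σ₂, h₂, h₃⟩ := hρ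
  have f : τ₁ 0 = σ 0 ∧ τ₂ 0 = σ 0 ∧ τ₃ 0 = σ 0 ∧ τ₄ 0 = σ 0 ∧ τ₅ 0 = σ 0 ∧ τ₆ 0 = σ 0 := by
    simp [fr u₆ 0, fr u₅ 0, fr u₄ 0, fr u₃ 0, fr u₂ 0, fr u₁ 0]
  have g1 : Greedy X m k (s - 1) (m - t) t (t - s) σ₁ := by
    have hp0 : ∀ {i}, i ≤ m * m * m + m * m + 1 → X.q ^ i < X.M := fun hi =>
      (Nat.pow_le_pow_right hq1.le hi).trans_lt hM1
    have i2 := h0 2 (by omega)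
    have i3 := h0 3 (by omega)
    have i4 := h0 4 (by omega)
    have i5 := h0 5 (by omega)
    norm_num at i2 i3 i4 i5
    have v12 := set_val u₁ (by simp [i4]) (show s - 1 < X.M by omega)
    have v21 := set_val u₂ (by simp [f, i2]) (show m < X.M by omega)
    have v24 := set_val u₃ (by simp [f, i3]) (show k < X.M by omega)
    have v26 := set_val u₄ (by simp [f, i5]) (show t < X.M by omega)
    have v27 := set_val u₅ (by simp [f, i2, i5]) (show m - t < X.M by omega)
    have v48 := set_val u₆ (by simp [f, i4, i5]) (show t - s < X.M by omega)
    have v25 := set_val u₇ (by simp [f, i2, i3, i5]) (show k * (m - t) < X.M by omega)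
    refine ⟨by simp [fr u₇ 12, fr u₆ 12, fr u₅ 12, fr u₄ 12, fr u₃ 12, fr u₂ 12, fr u₇ 21, fr u₆ 21,
      fr u₅ 21, fr u₄ 21, fr u₃ 21, fr u₇ 24, fr u₆ 24, fr u₅ 24, fr u₄ 24, fr u₇ 26, fr u₆ 26,
      fr u₅ 26, fr u₇ 27, fr u₆ 27, fr u₇ 48, v12, v21, v24, v25, v26, v27, v48],
      by rwa [fr u₇ 4, fr u₆ 4, fr u₅ 4, fr u₄ 4, fr u₃ 4, fr u₂ 4, fr u₁ 4], by omega, by omega,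
      Nat.mul_le_mul hkm (by omega), by omega, by omega, hqL, hLm, ?_, ?_, hq1⟩
    · rw [← pow_mul, ← pow_add]
      refine hp0 ?_
      have : (s - 1) * (k * (t - s)) ≤ m * m * m := (Nat.mul_le_mul (by omega)
        (Nat.mul_le_mul hkm (by omega))).trans (mul_assoc m m m).ge
      have : (s - 1) * m ≤ m * m := Nat.mul_le_mul_right _ (by omega)
      omega
    · have : (s - 1) * m ≤ m * m * m := by
        rw [mul_assoc]; exact Nat.mul_le_mul (by omega) hmm
      have h1 : X.q ^ ((s - 1) * m + k) ≤ X.q ^ (m * m * m + m * m) :=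
        Nat.pow_le_pow_right hq1.le (by omega)
      have h2 := Nat.mul_le_mul_left (X.q ^ (m * m * m + m * m)) hq1
      have := Nat.one_le_pow (m * m * m + m * m) X.q (by omega)
      rw [pow_succ] at hM1
      omega
  have hpot := g1.greedyC_spec h₂ hq.symm (by omega)
    ((Nat.pow_le_pow_right hq1.le (by omega)).trans_lt hM1)
  have g2 := g1.step h₂
  obtain ⟨w12, w21, w24, w25, w26, w27, w48⟩ := g2.par
  refine ⟨fun j i => graphRow X m (m - t) t (σ₂ 16 j) i,
    fun j => linearIndependent_graphRow hq1 (by omega) _,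
    fun W hW => pow_sum_finrank_le (by omega) hq.symm hpot W hW, ?_⟩
  refine matOutC_spec bF bK ((((((((hσ.step bF u₁).step bF u₂).step bF u₃).step bF u₄).step bF u₅).step
    bF u₆).step bF u₇).step bF h₂) h₃ w21 w24 w25 w27 (fun τ hτ => by simp [hτ 25, w25]) (by omega) _
    le_rfl hout (by omega) ?_
  intro τ j i c hτ hj hi hc
  have h1 : (i : ℕ) * t + (c - (m - t)) ≤ m * m := by
    refine (mul_add_lt i.2 (show (c : ℕ) - (m - t) < t by omega)).le.trans
      (Nat.mul_le_mul (by omega) htm)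
  rw [graphFE, FE.eval_ite X (m - t - c) (by simp [hτ 27, hτ 21, w27, w21, hc]), graphRow]
  by_cases h3 : (c : ℕ) < m - t
  · rw [if_neg (by omega), if_pos h3, FE.eval_ite X (c - i + (i - c))
      (by simp [hτ 27, hτ 21, hτ 24, w27, w21, w24, hi, hc])]
    split_ifs <;> simp
  · rw [if_pos (by omega), if_neg h3]
    simp [hτ 4, hτ 16, hτ 21, hτ 24, hτ 26, hτ 27, g2.par, hj, hi, hc, Ctx.dg, g2.h4 _ h1]

/-- Candidates and families are enumerated by numbers below powers of q with exponent at most m², so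
L = q^(8m²) covers each single loop, and nesting only affects the absolute exponent. Potentials can
be as large as q to the power of order m³, but only their length enters the cost, and it is
polynomial in m because q ≤ m. -/
theorem greedyProg_exec : ∃ C, ∀ {p a m k s t : ℕ} {F K : Type*} [Field F] [Field K]
    [Fact p.Prime] [Algebra (ZMod p) F] [Algebra F K] (bF : Basis (Fin a) (ZMod p) F)
    (bK : Basis (Fin m) F K) (σ : Store), σ 0 = listArray ([p, a, m, k, s, t] ++ tableF bF) →
    Bd (2 * (4 * m) ^ 12) σ → 13 ≤ m → Nat.card F ≤ m → k ≤ m → 1 ≤ s → s ≤ t → t ≤ m →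
    ∃ g : Fin k → Fin (m - t) → Fin m → F, (∀ j, LinearIndependent F (g j)) ∧
      (∀ W : Submodule F (Fin m → F), finrank F W = s - 1 →
        Nat.card F ^ ((t - s) * designSum g W) ≤ 2 ^ k * Nat.card F ^ ((s - 1) * m)) ∧
      ∃ τ, (∃ T ≤ Nat.card F ^ (C * m ^ 2), Exec greedyProg σ τ T) ∧
        ∀ i ≤ ((k * (m - t)) :: encKMat bF bK (designBasis bK g)).length,
          τ 1 i = listArray ((k * (m - t)) :: encKMat bF bK (designBasis bK g)) i := by
  obtain ⟨K₀, hK⟩ := Cmd.full_runs greedyDesignC (by decide) 6 (8 * (inp 3 * inp 3 * inp 3))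
    (rd 4 (8 * (inp 3 * inp 3))) (rd 4 (8 * (inp 3 * inp 3 * inp 3))) (by decide)
  refine ⟨9 * K₀, fun {p a m k s t F K} _ _ hp _ _ bF bK σ h0 hB hm hqm hkm hs hst htm => ?_⟩
  have := finite_of_basis bF
  have := Fintype.ofFinite F
  have hcard := card_of_basis bF
  have ha := le_card_of_basis bF
  have hq1 : 1 < p ^ a := hcard ▸ Finite.one_lt_card
  have htF := enc_tableF bF
  rw [hcard] at hqm ⊢
  have hin : ∀ j < 6, listArray ([p, a, m, k, s, t] ++ tableF bF) (j + 1) =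
      ([p, a, m, k, s, t] : List ℕ).getD j 0 :=
    fun j hj => listArray_append_left _ _ (by simpa using hj)
  have hlt : ∀ {i j}, i < j → (p ^ a) ^ i < (p ^ a) ^ j := fun h => Nat.pow_lt_pow_right hq1 h
  have hm2 : 13 * m ≤ m * m := Nat.mul_le_mul_right _ hm
  have hm3 : 13 * (m * m) ≤ m * m * m := by rw [mul_assoc]; exact Nat.mul_le_mul_right _ hm
  have hm1 : m ≤ (p ^ a) ^ m := (Nat.lt_pow_self hq1).le
  have h2 : ∀ {i j b c}, b ≤ (p ^ a) ^ i → c ≤ (p ^ a) ^ j → b * c ≤ (p ^ a) ^ (i + j) :=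
    fun hb hc => by rw [pow_add]; exact Nat.mul_le_mul hb hc
  have hmm : m * m ≤ (p ^ a) ^ (m + m) := h2 hm1 hm1
  have h1 : p ^ a ≤ (p ^ a) ^ 1 := (pow_one _).ge
  have h8 : 8 ≤ (p ^ a) ^ 3 := Nat.pow_le_pow_left (n := 2) hq1 3
  have hE : 8 * (m * m * m) ≤ (p ^ a) ^ (8 * (m * m)) :=
    (h2 h8 (h2 hmm hm1)).trans (hlt (by omega)).le
  have hβ : 2 * (4 * m) ^ 12 ≤ (p ^ a) ^ (8 * (m * m)) := by
    have h4 : 4 * m ≤ (p ^ a) ^ (2 + m) := h2 (Nat.pow_le_pow_left (n := 2) hq1 2) hm1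
    have h5 := h2 (i := 1) (b := 2) (by omega)
      ((Nat.pow_le_pow_left h4 12).trans (pow_mul _ _ 12).ge)
    exact h5.trans (hlt (by omega)).le
  -- Since q ≤ m < 2^m, the length of q^(8m³) is at most 8m⁴.
  have hMβ : ((p ^ a) ^ (8 * (m * m * m))).size ≤ 2 * (4 * m) ^ 12 := by
    rw [Nat.size_le]
    refine (Nat.pow_lt_pow_left (hqm.trans_lt Nat.lt_two_pow_self) (by omega)).trans_le ?_
    rw [← pow_mul]
    refine Nat.pow_le_pow_right (by omega) ?_
    calc m * (8 * (m * m * m)) ≤ 2 * (4 * m) ^ 4 := by ring_nf; omega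
      _ ≤ _ := Nat.mul_le_mul_left _ (Nat.pow_le_pow_right (by omega) (by omega))
  obtain ⟨X, hM, hL, τ₀, hτ, P, ρ, ⟨T, hT, hρ⟩, hρ1⟩ := hK bF (M := (p ^ a) ^ (8 * (m * m * m)))
    (L := (p ^ a) ^ (8 * (m * m))) (h1.trans (hlt (by omega)).le) (pow_pos (by omega) _)
    (8 * (m * m * m)) _ (2 * (4 * m) ^ 12) ((p ^ a) ^ (9 * m ^ 2)) σ h0 hB (hin 0 (by omega))
    (hin 1 (by omega)) (fun i hi d hd => by
      rw [show 6 = [p, a, m, k, s, t].length from rfl, listArray_append]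
      exact htF.2 i hi d hd) hMβ
    ((Nat.size_le_size (hlt (by omega)).le).trans hMβ) hMβ
    ((h2 (ha.2.trans h1) (ha.2.trans h1)).trans_lt (hlt (by omega))) hE
    (by have := (hE.trans (hlt (show 8 * (m * m) < 8 * (m * m * m) by omega)).le); omega) (by
      have h3 := h2 (i := 2) (b := 4) (Nat.pow_le_pow_left (n := 2) hq1 2)
        (le_refl ((p ^ a) ^ (8 * (m * m))))
      have h4 := h3.trans (Nat.pow_le_pow_right (by omega)
        (show 2 + 8 * (m * m) ≤ 9 * m ^ 2 by rw [pow_two]; omega))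
      omega)
    (fun τ hτ _ => by simp [hτ])
    (fun τ P => by simp [P.h0, P.h4 (8 * (m * m)) (by omega)])
    (fun τ P _ => by simp [P.h0, P.h4 (8 * (m * m * m)) le_rfl])
  obtain ⟨g, g1, g2, g3⟩ := greedyDesignC_spec bF bK hτ rfl (k := k) (s := s) (t := t)
    (fun j hj => by rw [P.h0, hin j hj]) (fun i hi => P.h4 i (by omega))
    (by rw [← hcard, Nat.card_eq_fintype_card]) hs hst htm hkm (by rw [hL]; exact hlt (by omega))
    (by rw [hL]; exact hmm.trans_lt (hlt (by omega))) (by rw [hL, hM]; exact hlt (by omega))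
    (by rw [hM]; exact hlt (by omega)) (by
      rw [hL]
      refine (h2 ((Nat.mul_le_mul (Nat.mul_le_mul hkm (Nat.sub_le _ _)) (Nat.mul_le_mul_right _
        hkm)).trans (h2 hmm hmm)) (ha.2.trans h1)).trans_lt (hlt (by omega)))
  refine ⟨g, g1, g2, ρ, ⟨T, hT.trans ?_, hρ⟩, fun i hi => by rw [hρ1]; exact g3 i hi⟩
  rw [← pow_mul, mul_right_comm]

end

/-- The construction of a subspace design. -/
def designProg : Prog :=
  .seq (powProg 3 6 (inp 1) (inp 2)) (.ite (rd 3 (inp 2) - inp 3) explicitProg greedyProg)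

/-- Comparing m with q requires q, so the powers of `p` are computed first. The selected program
then starts on a memory with leftovers, which its execution theorem permits. -/
theorem designProg_runs : ∃ C, ∀ {p a m : ℕ} {F : Type*} [Field F] [Fact p.Prime]
    [Algebra (ZMod p) F] (bF : Basis (Fin a) (ZMod p) F) (k s t B Z : ℕ),
    10 ≤ B → Nat.card F ≤ B → m ≤ B → k ≤ B → s ≤ B → t ≤ B → B + 2 * B ^ 12 + 2 ≤ Z →
    ∃ σ, σ 0 = listArray ([p, a, m, k, s, t] ++ tableF bF) ∧ Bd (2 * B ^ 12) σ ∧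
      ∀ (out : List ℕ) (τ : Store) (T : ℕ),
        (∃ T' ≤ T, Exec (if m < Nat.card F then explicitProg else greedyProg) σ τ T') →
        (∀ i ≤ out.length, τ 1 i = listArray out i) →
        RunsIn designProg ([p, a, m, k, s, t] ++ tableF bF) out (Z ^ C + T) := by
  obtain ⟨K₁, h₁⟩ := powProg_runs 3 6 (inp 1) (inp 2) (by omega) (by decide) (by decide)
  obtain ⟨K₂, h₂⟩ := (rd 3 (inp 2) - inp 3).cost_le
  refine ⟨K₁ + K₂ + 1, fun {p a m F} _ hp _ bF k s t B Z hB hqB hm hk hs ht hZ => ?_⟩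
  have hcard := card_of_basis bF
  have ha := le_card_of_basis bF
  have hBB : B ^ 4 ≤ 2 * B ^ 12 :=
    (Nat.pow_le_pow_right (by omega) (by omega)).trans (Nat.le_mul_of_pos_left _ (by omega))
  have hB1 : B ≤ B ^ 4 := Nat.le_self_pow (by omega) B
  have hsz : ∀ {x}, x ≤ B ^ 4 → x.size ≤ 2 * B ^ 12 := fun hx =>
    (Nat.size_le.2 Nat.lt_two_pow_self).trans (hx.trans hBB)
  have htF := enc_tableF bF
  obtain ⟨l, hl⟩ : ∃ l, [p, a, m, k, s, t] ++ tableF bF = l := ⟨_, rfl⟩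
  have h0 : load l 0 = listArray l := rfl
  have hin : ∀ j < 3, listArray l (j + 1) = ([p, a, m] : List ℕ).getD j 0 := fun j hj => by
    rw [← hl, show [p, a, m, k, s, t] ++ tableF bF = [p, a, m] ++ ([k, s, t] ++ tableF bF) from rfl]
    exact listArray_append_left _ _ hj
  have hb : Bd (2 * B ^ 12) (load l) := by
    refine bd_load (hsz ?_) fun x hx => hsz ?_
    · rw [← hl, List.length_append, htF.1]
      have : a * (a * 1) * a ≤ B * (B * 1) * B := by gcongr <;> omega
      have := Nat.mul_le_mul_left (B * (B * 1) * B) hB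
      rw [show B ^ 4 = B * (B * 1) * B * B by ring]
      simp only [List.length_cons, List.length_nil]
      have := Nat.one_le_pow 3 B (by omega)
      rw [show B ^ 3 = B * (B * 1) * B by ring] at this
      omega
    · rw [← hl, List.mem_append] at hx
      rcases hx with hx | hx
      · simp only [List.mem_cons, List.not_mem_nil, or_false] at hx
        omega
      · have := htF.lt bF x hx
        omega
  rw [hl]
  have eb : (inp 1).eval (load l) = p := hin 0 (by omega)
  have ee : (inp 2).eval (load l) = a := hin 1 (by omega)
  obtain ⟨τ, ⟨t₁, ht₁, x₁⟩, b₁, e₁, e₂⟩ := h₁ (load l) (2 * B ^ 12) Z hb (by omega)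
    (by rw [eb]; exact hp.out.pos) (by rw [eb, ee]; exact hsz (by omega)) (by rw [ee]; exact hsz (by omega))
  have h0' : τ 0 = listArray l := e₂ 0 (by omega) (by omega)
  obtain ⟨c₂, -⟩ := h₂ τ (2 * B ^ 12) Z b₁ (by omega)
  have hev : (rd 3 (inp 2) - inp 3).eval τ = Nat.card F - m := by
    have := e₁ a (by rw [ee])
    rw [eb] at this
    change τ 3 (τ 0 2) - τ 0 3 = _
    rw [h0', show listArray l 2 = a from ee, this, hcard]
    exact congrArg _ (hin 2 (by omega))
  refine ⟨τ, h0', b₁, fun out ρ T ⟨t₂, ht₂, x₂⟩ hρ => ⟨ρ, t₁ + ((rd 3 (inp 2) - inp 3).cost τ + t₂), x₁.seq ?_, ?_, hρ⟩⟩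
  · split_ifs at x₂ with hmq
    · exact .ite_true (by omega) x₂
    · exact .ite_false (by omega) x₂
  · have := le_pow_add (by omega) ht₁ c₂
    omega

/-- This absorbs the factor 2^k lost in the greedy doubling. For q ≥ 4 compare bases and exponents;
for q ≤ 3 one has k ≤ 2, and 4² = 2⁴ ≤ q^m. -/
theorem pow_four_le {q m k : ℕ} (hq : 1 < q) (hk : k < q) (hm : q ≤ m) (h4 : 4 ≤ m) :
    4 ^ k ≤ q ^ m := by
  by_cases h : 4 ≤ q
  · exact (Nat.pow_le_pow_left h k).trans (Nat.pow_le_pow_right (by omega) (by omega))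
  · exact (Nat.pow_le_pow_right (by omega) (show k ≤ 2 by omega)).trans
      ((Nat.pow_le_pow_left (n := 2) hq 4).trans (Nat.pow_le_pow_right (by omega) h4))

/-- Covers s = 1, where the tested subspaces are zero and the required bound is 0. -/
theorem finrank_inf_eq_zero {F : Type*} [Field F] {k ℓ m : ℕ} (g : Fin k → Fin ℓ → Fin m → F)
    {W : Submodule F (Fin m → F)} (hW : finrank F W = 0) :
    designSum g W = 0 := by
  rw [Submodule.finrank_eq_zero] at hW
  simp [hW]

/-- Both constructions are brought to the same integer inequality. The hypothesis 12s ≤ t leaves the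
room needed: t + 1 ≤ 4(⌊t/2⌋ - s + 2) in the explicit case and 3(t + 1) ≤ 4(t - s) in the greedy
case. -/
theorem designProg_design : ∃ C, ∀ {p a m k s t : ℕ} {F K : Type*} [Field F] [Field K]
    [Fact p.Prime] [Algebra (ZMod p) F] [Algebra F K] (bF : Basis (Fin a) (ZMod p) F)
    (bK : Basis (Fin m) F K), k < Nat.card F → 1 ≤ s → 12 * s ≤ t → t < m →
    ∃ (ℓ : ℕ) (g : Fin k → Fin ℓ → Fin m → F) (T : ℕ), m ≤ ℓ + t ∧
      (∀ j, LinearIndependent F (g j)) ∧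
      (∀ W : Submodule F (Fin m → F), finrank F W = s - 1 →
        (t + 1) * designSum g W ≤ 2 * (s - 1) * m) ∧
      RunsIn designProg ([p, a, m, k, s, t] ++ tableF bF)
        ((k * ℓ) :: encKMat bF bK (designBasis bK g)) T ∧
      T ≤ Nat.card F ^ (C * m ^ 2) ∧ (m < Nat.card F → T ≤ Nat.card F ^ C) := by
  obtain ⟨C₀, h₀⟩ := designProg_runs
  obtain ⟨C₁, h₁⟩ := explicitProg_exec
  obtain ⟨C₂, h₂⟩ := greedyProg_exec
  refine ⟨51 * C₀ + 4 * C₁ + C₂ + 1, fun {p a m k s t F K} _ _ hp _ _ bF bK hk hs hst htm => ?_⟩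
  have := finite_of_basis bF
  have hq1 : 1 < Nat.card F := Finite.one_lt_card
  obtain ⟨q, hq⟩ : ∃ q, Nat.card F = q := ⟨_, rfl⟩
  have hle : ∀ {i j}, i ≤ j → q ^ i ≤ q ^ j := fun h => Nat.pow_le_pow_right (by omega) h
  have hm2 : 13 * m ≤ m ^ 2 := by rw [pow_two]; exact Nat.mul_le_mul_right _ (by omega)
  have hrW : ∀ {ℓ} (g : Fin k → Fin ℓ → Fin m → F), (∀ r, s - 1 = r + 1 →
      ∀ W : Submodule F (Fin m → F), finrank F W = r + 1 →
        (t + 1) * designSum g W ≤ 2 * (r + 1) * m) →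
      ∀ W : Submodule F (Fin m → F), finrank F W = s - 1 →
        (t + 1) * designSum g W ≤ 2 * (s - 1) * m := fun g h W hW => by
    rcases hr : s - 1 with - | r
    · rw [hr] at hW
      simp [finrank_inf_eq_zero g hW]
    · exact h r hr W (hW.trans hr)
  rw [hq] at hk hq1
  by_cases hmq : m < q
  · have hB : q + 10 ≤ q ^ 4 := by
      have := Nat.pow_le_pow_left (n := 2) hq1 3
      rw [pow_succ]
      nlinarith
    obtain ⟨σ, h0, hb, hrun⟩ := h₀ bF (m := m) k s t (q + 10) (q ^ 51) (by omega) (by omega)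
      (by omega) (by omega) (by omega) (by omega) (by
        have h4 := Nat.pow_le_pow_left hB 12
        have h5 : q ^ 51 = q ^ (4 * 12) * (q * q * q) := by ring
        have h6 := Nat.mul_le_mul_left (q ^ (4 * 12)) (show 4 ≤ q * q * q by nlinarith)
        have h7 : q + 10 + 2 ≤ (q + 10) ^ 12 := by
          have := Nat.pow_le_pow_right (show 0 < q + 10 by omega) (show 2 ≤ 12 by omega)
          nlinarith
        rw [← pow_mul] at h4
        omega)
    obtain ⟨g, g1, g2, τ, hτ, hout⟩ := h₁ (k := k) (s := s) (t := t) bF bK σ h0 (by rwa [hq])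
      (by omega) (by omega) (by omega) htm.le
    rw [hq] at hτ hrun ⊢
    have hT : (q ^ 51) ^ C₀ + (q + 10) ^ C₁ ≤ q ^ (51 * C₀ + 4 * C₁ + C₂ + 1) := by
      have h4 := Nat.pow_le_pow_left hB C₁
      rw [← pow_mul] at h4 ⊢
      exact le_pow_mono hq1 (le_pow_add hq1 le_rfl h4) (by omega)
    refine ⟨m - 2 * (t / 2), g, _, by omega, g1, hrW g fun r hr W hW => ?_,
      hrun _ τ _ (by rwa [if_pos hmq]) hout, hT.trans (hle (Nat.le_mul_of_pos_right _
        (by omega))), fun _ => hT⟩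
    have h3 := g2 (r + 1) (by omega) (by omega) W hW
    obtain ⟨S, hS⟩ : ∃ S, designSum g W = S := ⟨_, rfl⟩
    rw [hS] at h3 ⊢
    have h4 : (t + 1) * S ≤ 2 * (2 * (t / 2 - (r + 1) + 1)) * S := Nat.mul_le_mul_right _ (by omega)
    have h5 := Nat.mul_le_mul_left (r + 1) (Nat.sub_le m 1)
    nlinarith
  · have hB : 4 * m ≤ q ^ (2 + m) := by
      rw [pow_add]
      exact Nat.mul_le_mul (Nat.pow_le_pow_left (n := 2) hq1 2) (Nat.lt_pow_self hq1).le
    obtain ⟨σ, h0, hb, hrun⟩ := h₀ bF (m := m) k s t (4 * m) (q ^ (15 * m ^ 2)) (by omega) (by omega)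
      (by omega) (by omega) (by omega) (by omega) (by
        have h4 := Nat.pow_le_pow_left hB 12
        have h5 : q ^ ((2 + m) * 12 + 3) = q ^ ((2 + m) * 12) * (q * q * q) := by ring
        have h6 := Nat.mul_le_mul_left (q ^ ((2 + m) * 12)) (show 4 ≤ q * q * q by nlinarith)
        have h7 : 4 * m + 2 ≤ (4 * m) ^ 12 := by
          have := Nat.pow_le_pow_right (show 0 < 4 * m by omega) (show 2 ≤ 12 by omega)
          nlinarith
        have h8 : q ^ ((2 + m) * 12 + 3) ≤ q ^ (15 * m ^ 2) := hle (by omega)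
        rw [← pow_mul] at h4
        omega)
    obtain ⟨g, g1, g2, τ, hτ, hout⟩ := h₂ (k := k) (s := s) (t := t) bF bK σ h0 hb (by omega)
      (by omega) (by omega) hs (by omega) htm.le
    rw [hq] at hτ hrun g2 ⊢
    have hT : (q ^ (15 * m ^ 2)) ^ C₀ + q ^ (C₂ * m ^ 2) ≤
        q ^ ((51 * C₀ + 4 * C₁ + C₂ + 1) * m ^ 2) := by
      rw [← pow_mul]
      refine le_pow_mono hq1 (le_pow_add hq1 le_rfl le_rfl) ?_
      have := Nat.zero_le (C₀ * m ^ 2)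
      have := Nat.zero_le (C₁ * m ^ 2)
      nlinarith
    refine ⟨m - t, g, _, by omega, g1, hrW g fun r hr W hW => ?_,
      hrun _ τ _ (by rwa [if_neg hmq]) hout, hT, fun h => absurd h hmq⟩
    have h3 := g2 W (hW.trans hr.symm)
    obtain ⟨S, hS⟩ : ∃ S, designSum g W = S := ⟨_, rfl⟩
    rw [hr] at h3
    rw [hS] at h3 ⊢
    -- The greedy bound is squared, so that its factor becomes 4^k, which is at most q^m.
    have h4 : q ^ (2 * ((t - s) * S)) ≤ q ^ (m + 2 * ((r + 1) * m)) := by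
      have h5 := Nat.pow_le_pow_left h3 2
      rw [mul_pow, ← pow_mul, ← pow_mul, ← pow_mul, mul_comm k, pow_mul 2] at h5
      rw [mul_comm 2, pow_add, mul_comm 2]
      exact h5.trans (Nat.mul_le_mul_right _ (pow_four_le hq1 hk (by omega) (by omega)))
    have h5 := (Nat.pow_le_pow_iff_right hq1).1 h4
    have h6 : 3 * ((t + 1) * S) ≤ 4 * (t - s) * S := by
      rw [← mul_assoc]
      exact Nat.mul_le_mul_right _ (by omega)
    -- Altogether 3(t + 1)S ≤ 2m + 4(r + 1)m ≤ 6(r + 1)m.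
    nlinarith

/-! ### Parameters -/

-- With s = 4e the factor s/(s + 1) is at least 1 - ε/4. The spaces have relative codimension 1/u,
-- so k is about Rn·u/(u - 1), and the choice of u gives k - Rn ≤ 1 + n(1 - R)ε/3; for n ≥ 6/((1 -
-- R)ε) the 1 costs at most another n(1 - R)ε/6. Thus n - k ≥ n(1 - R)(1 - ε/2), and (1 - ε/4)(1 -
-- ε/2) ≥ 1 - ε. The constant is 864 = 48·2·9, from eε ≤ 2, u(1 - R) ≤ 4e + 1 and (4e + 1)ε ≤ 9.
set_option maxHeartbeats 800000 in
theorem rate_bounds {R ε : ℝ} (hR0 : 0 < R) (hR1 : R < 1) (hε0 : 0 < ε) (hε1 : ε < 1) {e u : ℕ}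
    (he : e = ⌈1 / ε⌉₊) (hu : u = ⌈4 * e / (1 - R)⌉₊) :
    2 ≤ e ∧ 8 ≤ u ∧ ((48 * e * u : ℕ) : ℝ) ≤ 864 / ((1 - R) * ε ^ 2) ∧
    ∀ n k : ℕ, 6 / ((1 - R) * ε) ≤ n →
      (⌈R * ((48 * e * u : ℕ) * n)⌉₊ + (48 * e * u - 48 * e) - 1) / (48 * e * u - 48 * e) = k →
      (1 - ε) * (1 - R) * n ≤ ((4 * e : ℕ) : ℝ) / ((4 * e : ℕ) + 1) * (n - k) := by
  have hR : 0 < 1 - R := by linarith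
  have e1 : 1 / ε ≤ e := he ▸ Nat.le_ceil _
  have e2 : (e : ℝ) < 1 / ε + 1 := he ▸ Nat.ceil_lt_add_one (by positivity)
  have u1 : 4 * e / (1 - R) ≤ u := hu ▸ Nat.le_ceil _
  have u2 : (u : ℝ) < 4 * e / (1 - R) + 1 := hu ▸ Nat.ceil_lt_add_one (by positivity)
  have h1ε : 1 < 1 / ε := by rw [lt_div_iff₀ hε0]; linarith
  have he2 : 2 ≤ e := by
    have : 1 < (e : ℝ) := h1ε.trans_le e1
    exact_mod_cast this
  have he0 : (2 : ℝ) ≤ e := by exact_mod_cast he2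
  rw [div_le_iff₀ hR] at u1
  rw [div_le_iff₀ hε0] at e1
  have hu4 : 4 * (e : ℝ) ≤ u := by nlinarith [Nat.cast_nonneg (α := ℝ) u]
  have hu8 : 8 ≤ u := by
    have : (8 : ℝ) ≤ u := by linarith
    exact_mod_cast this
  have hu8' : (8 : ℝ) ≤ u := by exact_mod_cast hu8
  refine ⟨he2, hu8, ?_, fun n k hn hk => ?_⟩
  · have e3 : (e : ℝ) * ε ≤ 2 := by
      have := mul_lt_mul_of_pos_right e2 hε0
      rw [add_mul, div_mul_cancel₀ _ hε0.ne'] at this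
      linarith
    have u3 : (u : ℝ) * (1 - R) ≤ 4 * e + 1 := by
      have := mul_lt_mul_of_pos_right u2 hR
      rw [add_mul, div_mul_cancel₀ _ hR.ne'] at this
      linarith
    rw [le_div_iff₀ (by positivity)]
    push_cast
    calc 48 * (e : ℝ) * u * ((1 - R) * ε ^ 2) = 48 * (e * ε) * (u * (1 - R) * ε) := by ring
      _ ≤ 48 * 2 * ((4 * e + 1) * ε) := by gcongr
      _ ≤ _ := by nlinarith
  · have hn0 : (0 : ℝ) ≤ n := Nat.cast_nonneg n
    rw [div_le_iff₀ (by positivity)] at hn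
    have hN := Nat.ceil_lt_add_one (show 0 ≤ R * ((48 * e * u : ℕ) * n) by positivity)
    obtain ⟨N, hN'⟩ : ∃ N, ⌈R * ((48 * e * u : ℕ) * n)⌉₊ = N := ⟨_, rfl⟩
    -- With w = u - 1 each space has dimension 48ew, and division by 48e removes the common factor
    -- from the estimate of k.
    obtain ⟨w, rfl⟩ : ∃ w, u = w + 1 := ⟨u - 1, by omega⟩
    rw [hN'] at hN hk
    have hℓ : 48 * e * (w + 1) - 48 * e = 48 * e * w := by rw [Nat.mul_succ]; omega
    rw [hℓ] at hk
    have h0 : 1 ≤ N + 48 * e * w := by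
      have := Nat.mul_pos (show 0 < 48 * e by omega) (show 0 < w by omega)
      omega
    have hk1 : k * (48 * e * w) + 1 ≤ N + 48 * e * w := by
      have := Nat.div_mul_le_self (N + 48 * e * w - 1) (48 * e * w)
      rw [hk] at this
      omega
    have hk2 : (k : ℝ) * (48 * e * w) + 1 ≤ N + 48 * e * w := by exact_mod_cast hk1
    push_cast at hN u1 hu8' ⊢
    have hk3 : (k : ℝ) * w ≤ R * (w + 1) * n + w := by
      have : (48 * (e : ℝ)) * (k * w) ≤ 48 * e * (R * (w + 1) * n + w) := by nlinarith
      exact le_of_mul_le_mul_left this (by positivity)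
    -- From u(1 - R) ≥ 4e ≥ 4/ε, subtracting 1 - R < 1/ε.
    have hw : 3 / ε ≤ w * (1 - R) := by
      rw [div_le_iff₀ hε0]
      nlinarith
    -- The preceding estimate says w(k - Rn - 1) ≤ Rn; it is multiplied by 1 - R and compared with
    -- w(1 - R) ≥ 3/ε.
    have hk4 : k - R * n - 1 ≤ n * (1 - R) * ε / 3 := by
      by_contra! h
      have h1 : (w * (1 - R)) * (k - R * n - 1) ≤ R * n * (1 - R) := by nlinarith
      have h2 : 3 / ε * (n * (1 - R) * ε / 3) < (w * (1 - R)) * (k - R * n - 1) :=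
        mul_lt_mul' hw h (by positivity) (by nlinarith)
      have h3 : 3 / ε * (n * (1 - R) * ε / 3) = n * (1 - R) := by field_simp
      rw [h3] at h2
      nlinarith
    have hG : 0 ≤ n * (1 - R) := by positivity
    have h5 : n * (1 - R) * (1 - ε / 2) ≤ n - k := by nlinarith
    have h6 : 1 - ε / 4 ≤ 4 * (e : ℝ) / (4 * e + 1) := by
      rw [le_div_iff₀ (by positivity)]
      nlinarith
    have h7 : n * (1 - R) * (1 - ε) ≤ n * (1 - R) * ((1 - ε / 4) * (1 - ε / 2)) :=
      mul_le_mul_of_nonneg_left (by have := mul_pos hε0 hε0; linarith) hG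
    have h8 := mul_le_mul h6 h5 (mul_nonneg hG (by linarith)) (by positivity)
    calc (1 - ε) * (1 - R) * n = n * (1 - R) * (1 - ε) := by ring
      _ ≤ _ := h7.trans (le_of_eq_of_le (by ring) h8)

theorem RunsIn.mono {c : Prog} {i o : List ℕ} {T T' : ℕ} (h : RunsIn c i o T) (hT : T ≤ T') :
    RunsIn c i o T' := by
  obtain ⟨τ, t, h1, h2, h3⟩ := h
  exact ⟨τ, t, h1, h2.trans hT, h3⟩

theorem RunsIn.pow_mono {c : Prog} {i o : List ℕ} {z C C' : ℕ} (h : RunsIn c i o (z ^ C)) (hz : 0 < z)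
    (hC : C ≤ C') : RunsIn c i o (z ^ C') :=
  h.mono (Nat.pow_le_pow_right hz hC)

theorem finrank_rsSubcode {n k : ℕ} {F K : Type*} [Field F] [Finite F] [Field K] [Algebra F K] {α : Fin n → F}
    (hα : Function.Injective α) (hk : k ≤ n) (V : Submodule F (Fin k → K)) :
    finrank F (rsSubcode α V) = finrank F V :=
  (Submodule.equivMapOfInjective _ (rsEncode_injective hα hk) V).finrank_eq.symm

end BitRAM

/-! ### The main theorem -/

open BitRAM

theorem mainTheorem8 :
    -- the subcodes given by subspace designs: construction and decoding
    (∃ (build dec : BitRAM.Prog) (C : ℕ),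
      ∀ (p a m n k s : ℕ) (ε : ℝ) (F K : Type*) [Field F] [Field K] [DecidableEq K]
        [Fact p.Prime] [Algebra (ZMod p) F] [Algebra F K]
        (bF : Module.Basis (Fin a) (ZMod p) F) (bK : Module.Basis (Fin m) F K)
        (α : Fin n → F),
        0 < ε → ε < 1 → 1 ≤ k → k < n → n ≤ Nat.card F → 1 ≤ s → (s : ℝ) ≤ ε * m / 12 →
        Function.Injective α →
        -- an explicit design, and the subspace built from it
        (∃ (H : Fin k → Submodule F (Fin m → F)) (κ : ℕ) (v : Fin κ → Fin k → K) (T : ℕ),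
          IsSubspaceDesign (s - 1) (2 * ((s : ℝ) - 1) / ε) H ∧
          (∀ j, (1 - ε) * m ≤ (Module.finrank F (H j) : ℝ)) ∧
          LinearIndependent F v ∧ Submodule.span F (Set.range v) = designSpace bK H ∧
          (1 - ε) * (m * k) ≤ (Module.finrank F (rsSubcode α (designSpace bK H)) : ℝ) ∧
          BitRAM.RunsIn build ([p, a, m, k, s, ⌊ε * m⌋₊] ++ tableF bF)
            (κ :: encKMat bF bK v) T ∧
          T ≤ Nat.card F ^ (C * m ^ 2) ∧ (m < Nat.card F → T ≤ Nat.card F ^ C)) ∧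
        -- list decoding of every subcode given by such a design
        (∀ (H : Fin k → Submodule F (Fin m → F)) (κ : ℕ) (v : Fin κ → Fin k → K),
          IsSubspaceDesign (s - 1) (2 * ((s : ℝ) - 1) / ε) H →
          LinearIndependent F v → Submodule.span F (Set.range v) = designSpace bK H →
          ∀ y : Fin n → K,
            ListDecodesIn bF bK dec
              ([p, a, m, n, k, s, κ] ++ tableF bF ++ tableK bF bK ++ encFVec bF α ++
                encKMat bF bK v ++ encKVec bF bK y)
              (rsSubcode α (designSpace bK H)) y
              ((s : ℝ) / (s + 1) * (n - k)) (2 * ((s : ℝ) - 1) / ε)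
              ((n + m + (Nat.card F).size) ^ C))) ∧
    -- rate `R` codes decodable from a fraction `(1 - ε) (1 - R)` of errors
    (∃ (build enc dec : BitRAM.Prog) (C : ℕ),
      ∀ R ε : ℝ, 0 < R → R < 1 → 0 < ε → ε < 1 →
      ∃ m n₀ : ℕ, 1 ≤ m ∧ (m : ℝ) ≤ C / ((1 - R) * ε ^ 2) ∧
      ∀ (p a n : ℕ) (F K : Type*) [Field F] [Field K] [DecidableEq K]
        [Fact p.Prime] [Algebra (ZMod p) F] [Algebra F K]
        (bF : Module.Basis (Fin a) (ZMod p) F) (bK : Module.Basis (Fin m) F K)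
        (α : Fin n → F),
        n₀ ≤ n → n < Nat.card F → Function.Injective α →
        ∃ (k : ℕ) (v : Fin ⌈R * (m * n)⌉₊ → Fin k → K),
          1 ≤ k ∧ k < n ∧
          Module.finrank F (rsSubcode α (Submodule.span F (Set.range v))) = ⌈R * (m * n)⌉₊ ∧
          -- construction
          BitRAM.RunsIn build
            ([p, a, m, n, ⌈R * (m * n)⌉₊, ⌈1 / ε⌉₊] ++ tableF bF ++ tableK bF bK ++
              encFVec bF α)
            (k :: encKMat bF bK v) (Nat.card F ^ C) ∧
          -- encoding and decoding
          ∃ T : ℕ, (T : ℝ) ≤ ((n : ℝ) * (Nat.card F).size / ε) ^ C ∧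
            (∀ x : Fin ⌈R * (m * n)⌉₊ → F,
              BitRAM.RunsIn enc
                ([p, a, m, n, k, ⌈R * (m * n)⌉₊] ++ tableF bF ++ tableK bF bK ++
                  encFVec bF α ++ encKMat bF bK v ++ encFVec bF x)
                (encKVec bF bK (rsEncode α k (∑ l, x l • v l))) T) ∧
            (∀ y : Fin n → K,
              ListDecodesIn bF bK dec
                ([p, a, m, n, k, ⌈R * (m * n)⌉₊, ⌈1 / ε⌉₊] ++ tableF bF ++ tableK bF bK ++
                  encFVec bF α ++ encKMat bF bK v ++ encKVec bF bK y)
                (rsSubcode α (Submodule.span F (Set.range v))) y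
                ((1 - ε) * (1 - R) * n) (C / ((1 - R) * ε ^ 2)) T)) := by
  constructor
  · obtain ⟨C₁, h₁⟩ := designProg_design
    obtain ⟨C₂, h₂⟩ := decProg_runs (inp 6) (inp 7) decInC_ok₁
    refine ⟨designProg, decProg (inp 6) (inp 7), C₁ + C₂, fun p a m n k s ε F K _ _ _ _ _ _ bF bK α hε0
      hε1 hk hkn hnq hs hsm hα => ?_⟩
    have := finite_of_basis bF
    have hq1 : 1 < Nat.card F := Finite.one_lt_card
    have hle : ∀ {i j}, i ≤ j → Nat.card F ^ i ≤ Nat.card F ^ j :=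
      fun h => Nat.pow_le_pow_right (by omega) h
    have hst : 12 * s ≤ ⌊ε * m⌋₊ := Nat.le_floor (by push_cast; linarith)
    have hs1 : (1 : ℝ) ≤ s := by exact_mod_cast hs
    have hm0 : (0 : ℝ) < m := by nlinarith
    have htm : ⌊ε * m⌋₊ < m := (Nat.floor_lt (by positivity)).2 (by nlinarith)
    have hft := Nat.floor_le (show 0 ≤ ε * m by positivity)
    refine ⟨?_, fun H κ v hH hv hV y => ?_⟩
    · obtain ⟨ℓ, g, T, hℓ, hg, hW, hrun, hT, hT'⟩ := h₁ bF bK (hkn.trans_le hnq) hs hst htm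
      have hdim : (1 - ε) * m ≤ ℓ := by
        have : (m : ℝ) ≤ ℓ + ⌊ε * m⌋₊ := by exact_mod_cast hℓ
        linarith
      refine ⟨fun j => Submodule.span F (Set.range (g j)), k * ℓ, designBasis bK g, T, fun W hWs => ?_,
        fun j => ?_, linearIndependent_designBasis bK hg, span_designBasis bK g, ?_, hrun,
        hT.trans (hle (Nat.mul_le_mul_right _ (by omega))),
        fun h => (hT' h).trans (hle (by omega))⟩
      · have h1 : ((⌊ε * m⌋₊ : ℝ) + 1) * ((designSum g W : ℕ) : ℝ) ≤ 2 * ((s : ℝ) - 1) * m := by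
          have := Nat.cast_le (α := ℝ).2 (hW W hWs)
          rw [Nat.cast_mul, Nat.cast_mul, Nat.cast_mul, Nat.cast_sub hs] at this
          exact_mod_cast this
        change (designSum g W : ℝ) ≤ _
        rw [le_div_iff₀ hε0]
        -- The inequality εm ≤ ⌊εm⌋ + 1 passes from the integer parameter back to ε.
        have h2 := mul_le_mul_of_nonneg_right (Nat.lt_floor_add_one (ε * m)).le (Nat.cast_nonneg
          (α := ℝ) (designSum g W))
        refine le_of_mul_le_mul_right (le_trans ?_ (h2.trans h1)) hm0
        linarith
      · rw [finrank_span_eq_card (hg j), Fintype.card_fin]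
        exact hdim
      · rw [finrank_rsSubcode hα hkn.le, finrank_designSpace bK hg]
        push_cast
        nlinarith [Nat.cast_nonneg (α := ℝ) k]
    · have hsm' : s ≤ m := by omega
      have hκ := le_card_of_linearIndependent bK hv
      obtain ⟨d, c, u, h3, h4, h5, h6⟩ := h₂ bF bK α v y s κ H _
        (fun τ hτ => ⟨congrFun hτ 6, congrFun hτ 7⟩) (by omega) (by omega) hs hsm' hk hkn hα hv hH hV.le
      rw [hV] at h6
      simp only [decInput, ← List.append_assoc] at h5
      exact ⟨d, c, u, h3, h4, h5.pow_mono (by omega) (by omega), h6⟩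
  · obtain ⟨C₁, h₁⟩ := codeProg_runs
    obtain ⟨C₂, h₂⟩ := decProg_runs (4 * inp 7) (inp 6) decInC_ok₂
    obtain ⟨C₃, h₃⟩ := encProg_runs
    -- 864 is for the bound on m and on the list dimension, the factor 4 comes from q + 10 ≤ q⁴, and
    -- the factor 2 from n + m + size q ≤ (n · size q / ε)².
    obtain ⟨C, hC⟩ : ∃ C, 864 + 4 * C₁ + 2 * (C₂ + C₃) = C := ⟨_, rfl⟩
    refine ⟨codeProg, encProg, decProg (4 * inp 7) (inp 6), C, fun R ε hR0 hR1 hε0 hε1 => ?_⟩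
    obtain ⟨e, he⟩ : ∃ e, e = ⌈1 / ε⌉₊ := ⟨_, rfl⟩
    obtain ⟨u, hu⟩ : ∃ u, u = ⌈4 * e / (1 - R)⌉₊ := ⟨_, rfl⟩
    obtain ⟨he2, hu8, hmC, hrate⟩ := rate_bounds hR0 hR1 hε0 hε1 he hu
    have hR : 0 < 1 - R := by linarith
    obtain ⟨m, hm⟩ : ∃ m, 48 * e * u = m := ⟨_, rfl⟩
    have hem : 8 * (48 * e) ≤ m := by rw [← hm, mul_comm]; exact Nat.mul_le_mul_left _ hu8
    rw [hm] at hmC hrate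
    have hmC' : (m : ℝ) ≤ C / ((1 - R) * ε ^ 2) := by
      refine hmC.trans (div_le_div_of_nonneg_right ?_ (by positivity))
      exact_mod_cast (by omega : 864 ≤ C)
    -- The condition n > m forces m < q, so that the explicit design applies; the second term is the
    -- one needed for the decoding radius.
    refine ⟨m, max (m + 1) ⌈6 / ((1 - R) * ε)⌉₊, by omega, hmC', ?_⟩
    intro p a n F K _ _ _ _ _ _ bF bK α hn hnq hα
    have := finite_of_basis bF
    rw [← he]
    obtain ⟨N, hN⟩ : ∃ N, ⌈R * (m * n)⌉₊ = N := ⟨_, rfl⟩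
    obtain ⟨k, hk⟩ : ∃ k, (N + (m - 48 * e) - 1) / (m - 48 * e) = k := ⟨_, rfl⟩
    have hn1 : 6 / ((1 - R) * ε) ≤ n := (Nat.le_ceil _).trans (by exact_mod_cast (le_max_right _ _).trans hn)
    have hmn : m < n := (le_max_left _ _).trans hn
    have hr := hrate n k hn1 (by rw [hN]; exact hk)
    rw [hN]
    have hm0 : (0 : ℝ) < m := by exact_mod_cast (by omega : 0 < m)
    have hn0 : (0 : ℝ) < n := by exact_mod_cast (by omega : 0 < n)
    have hN0 : 0 < N := hN ▸ Nat.ceil_pos.2 (by positivity)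
    have hkn : k < n := by
      have h : 0 < ((4 * e : ℕ) : ℝ) / ((4 * e : ℕ) + 1) * (n - k) := lt_of_lt_of_le
        (mul_pos (mul_pos (by linarith) hR) hn0) hr
      have := (pos_iff_pos_of_mul_pos h).1 (by positivity)
      exact_mod_cast sub_pos.1 this
    have hk1 : 1 ≤ k := by
      rw [← hk]
      exact Nat.div_pos (by omega) (by omega)
    obtain ⟨g, hNk, hg, hW, hrun⟩ := h₁ bF bK α (k := k) (N := N) (e := e) (by omega) (by omega) hnq
      (by omega) hk
    have hv : LinearIndependent F fun l : Fin N => designBasis bK g (Fin.castLE hNk l) :=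
      (linearIndependent_designBasis bK hg).comp _ (Fin.castLE_injective hNk)
    have hNm := le_card_of_linearIndependent bK hv
    have hspan : Submodule.span F (Set.range fun l : Fin N => designBasis bK g (Fin.castLE hNk l)) ≤
        designSpace bK fun j => Submodule.span F (Set.range (g j)) := by
      rw [← span_designBasis]
      refine Submodule.span_mono ?_
      rintro _ ⟨l, rfl⟩
      exact ⟨_, rfl⟩
    -- With r = 4e - 1 and blocks of 24e places, the factor 2(24e - r + 1) is at least 4e > r. So
    -- the dimension sum is at most m, and m is already of the desired order.
    have hD : IsSubspaceDesign (4 * e - 1) (C / ((1 - R) * ε ^ 2))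
        fun j => Submodule.span F (Set.range (g j)) := fun W hWr => by
      refine le_trans ?_ hmC'
      have := hW (4 * e - 1) (by omega) (by omega) W hWr
      norm_cast
      have h8 : 4 * e * _ ≤ 4 * e * m := (Nat.mul_le_mul_right _ (by omega)).trans (this.trans
        (Nat.mul_le_mul (Nat.sub_le (4 * e) 1) (Nat.sub_le m 1)))
      exact Nat.le_of_mul_le_mul_left h8 (by omega)
    obtain ⟨z, hz⟩ : ∃ z, n + m + (Nat.card F).size = z := ⟨_, rfl⟩
    have hsz : 2 ≤ (Nat.card F).size := Nat.lt_size.2 (by omega)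
    have hz2 : (z : ℝ) ≤ ((n : ℝ) * (Nat.card F).size / ε) ^ 2 := by
      obtain ⟨w, hw⟩ : ∃ w, n * (Nat.card F).size = w := ⟨_, rfl⟩
      have h1 : 2 * n ≤ w := by rw [← hw, mul_comm]; exact Nat.mul_le_mul_left _ hsz
      have h2 : 2 * (Nat.card F).size ≤ w := hw ▸ Nat.mul_le_mul_right _ (by omega)
      have h3 : z ≤ w ^ 2 := by nlinarith
      have h4 : (w : ℝ) ≤ (n : ℝ) * (Nat.card F).size / ε := by
        rw [← hw, Nat.cast_mul, le_div_iff₀ hε0]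
        exact mul_le_of_le_one_right (by positivity) hε1.le
      exact (Nat.cast_le.2 h3).trans (by push_cast; gcongr)
    have hz1 : 1 ≤ (n : ℝ) * (Nat.card F).size / ε := by
      by_contra! h
      have h1 := hz2.trans (pow_le_one₀ (by positivity) h.le)
      have : z ≤ 1 := by exact_mod_cast h1
      omega
    refine ⟨k, _, hk1, hkn, ?_, hrun.mono ?_, z ^ (C₂ + C₃), ?_, fun x => ?_, fun y => ?_⟩
    · rw [finrank_rsSubcode hα hkn.le, finrank_span_eq_card hv, Fintype.card_fin]
    · have h4 : Nat.card F + 10 ≤ Nat.card F ^ 4 :=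
        (show _ ≤ Nat.card F ^ 2 by nlinarith).trans (Nat.pow_le_pow_right (by omega) (by omega))
      refine (Nat.pow_le_pow_left h4 C₁).trans ?_
      rw [← pow_mul]
      exact Nat.pow_le_pow_right (by omega) (by omega)
    · push_cast
      refine (pow_le_pow_left₀ (by positivity) hz2 _).trans ?_
      rw [← pow_mul]
      exact pow_le_pow_right₀ hz1 (by omega)
    · have := h₃ bF bK α (fun l : Fin N => designBasis bK g (Fin.castLE hNk l)) x (by omega) hk1 hkn hNm
      rw [hz] at this
      exact this.pow_mono (by omega) (by omega)
    · obtain ⟨d, c, u, h4, h5, h6, h7⟩ := h₂ (s := 4 * e) bF bK α _ y N e _ _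
        (fun τ hτ => ⟨congrArg (4 * ·) (congrFun hτ 7), congrFun hτ 6⟩) (by omega) (by omega)
        (by omega) (by omega) hk1 hkn hα hv hD hspan
      rw [hz] at h6
      simp only [decInput, ← List.append_assoc] at h6
      exact ⟨d, c, u, h4, h5, h6.pow_mono (by omega) (by omega),
        fun w hw hd => h7 w hw (hd.trans hr)⟩
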